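/- **Setting.** Let $A=(a_{ij})$ be a symmetrizable generalized Cartan matrix of size $n$ with realization $(\mathfrak h,\{\alpha_i\},\{h_i\})$ over $\mathbb C$, $\dim\mathfrak h=2n-\operatorname{rank}A$, and let $\mathfrak g=\mathfrak n_-\oplus\mathfrak h\oplus\mathfrak n_+$ be the Kac–Moody algebra with generators $\mathfrak h,e_i,f_i$ subject to the Chevalley and Serre relations. Fix a nondegenerate invariant symmetric bilinear form $(\,,)$ on $\mathfrak g$; it is nondegenerate on $\mathfrak h$ and so induces a form on $\mathfrak h^*$ and an identification $\mathfrak h\cong\mathfrak h^*$. Let $\rho\in\mathfrak h^*$ satisfy $\rho(h_i)=1$ for all $i$. For every positive root $\alpha$ let $e_\alpha^{(t)}$ and $f_\alpha^{(t)}$ be bases of $\mathfrak g_\alpha$ and $\mathfrak g_{-\alpha}$ with $(e_\alpha^{(t)},f_\alpha^{(t')})=\delta_{tt'}$. Let $\Gamma_1,\Gamma_2$ be sets of simple roots and $T:\Gamma_1\to\Gamma_2$ a bijection preserving inner products. Put $\mathfrak l=\{x\in\mathfrak h:\ \langle\alpha-T\alpha,x\rangle=0\ \forall\alpha\in\Gamma_1\}$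 and $\mathfrak h_0=\mathfrak l^\perp\subset\mathfrak h$, and assume that $(\,,)$ is nondegenerate on $\mathfrak l$, so that $\mathfrak h=\mathfrak l\oplus\mathfrak h_0$. Let $(x_j)_{j\in I_1}$ and $(x_j)_{j\in I_2}$ be orthonormal bases of $\mathfrak l$ and $\mathfrak h_0$. Let $B:\mathfrak n_-\to\mathfrak n_-$ and $B^{-1}:\mathfrak n_+\to\mathfrak n_+$ be the Lie algebra homomorphisms with $B(f_\alpha)=f_{T\alpha}$ for $\alpha\in\Gamma_1$, $B(f_\alpha)=0$ for simple $\alpha\notin\Gamma_1$, $B^{-1}(e_\alpha)=e_{T^{-1}\alpha}$ for $\alpha\in\Gamma_2$, $B^{-1}(e_\alpha)=0$ for simple $\alpha\notin\Gamma_2$ (here $f_{\alpha_i}=f_i$, $e_{\alpha_i}=e_i$); write $B^{-v}=(B^{-1})^v$, and extend $B$ to $U(\mathfrak n_-)$. Let $C_T:\mathfrak h_0\to\mathfrak h_0$ be the Cayley transform of $T$: the linear map such that $\langle\alpha-T\alpha,C_Tx\rangle=\langle\alpha+T\alpha,x\rangle$ for all $\alpha\in\Gamma_1$, $x\in\mathfrak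 h_0$. Let $M_\chi$ be the Verma module with highest weight vector $v_\chi$ of weight $\chi$. For $\chi',\chi\in\mathfrak h^*$ let $B:M_{\chi'}\to M_{\chi}$ be the linear map $xv_{\chi'}\mapsto B(x)v_{\chi}$, $x\in U(\mathfrak n_-)$. Let $V_1,\dots,V_r$ be $\mathfrak g$-modules in category $\mathcal O$, $v_i\in V_i$ a vector of weight $\nu_i$, and suppose that $\nu=\sum_i\nu_i$ vanishes on $\mathfrak l$. Let $\mu\in\mathfrak h^*$ be such that $\mu'=\mu-\nu$ satisfies $(\mu',\alpha)=(\mu,T\alpha)$ for all $\alpha\in\Gamma_1$. Put $\mu_i=\mu-\nu_{i+1}-\dots-\nu_r$, so that $\mu_r=\mu$ and $\mu_0=\mu'$. Let $\Phi_i:M_{\mu_i}\to M_{\mu_{i-1}}\otimes V_i$ $(1\le i\le r)$ be $\mathfrak g$-homomorphisms with $\langle v^*_{\mu_{i-1}},\Phi_iv_{\mu_i}\rangle=v_i$, that is, the component of $\Phi_iv_{\mu_i}$ in $M_{\mu_{i-1}}[\mu_{i-1}]\otimes V_i$ is $v_{\mu_{i-1}}\otimes v_i$. (For generic $\mu$ as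 above there is exactly one such $\Phi_i$, denoted $\Phi^{v_i}_{\mu_i}$.) For $\lambda\in\mathfrak l^*\subset\mathfrak h^*$ let $e^\lambda$ act on a weight space of weight $\chi$ by $e^{(\lambda,\chi)}$. Define $$F^{v_1,\dots,v_r}(\lambda,\mu)=\operatorname{Tr}\big(\Phi_1\cdots\Phi_r\,B\,e^\lambda\big),\qquad \delta_B(\lambda)=\big(\operatorname{Tr}_{M_{-\rho}}(Be^\lambda)\big)^{-1},\qquad \mathbb F^{v_1,\dots,v_r}(\lambda,\mu)=\delta_B(\lambda)\,F^{v_1,\dots,v_r}(\lambda,\mu),$$ where in the first trace $Be^\lambda:M_{\mu'}\to M_\mu$ and the composition is an operator $M_{\mu'}\to M_{\mu'}\otimes V_1\otimes\dots\otimes V_r$. All of these are formal series in the exponentials $e^{(\lambda,\xi)}$, $\xi\in\mathfrak l^*$; $F$ and $\mathbb F$ have coefficients in $V_1\otimes\dots\otimes V_r$. **Theorem.** As an identity of formal series in $\lambda\in\mathfrak l^*$, $$\Big(\sum_{j\in I_1}\frac{\partial^2}{\partial x_j^2}-\sum_{l,m=1}^r S_T(\lambda)|_{V_l\otimes V_m}\Big)\mathbb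 F^{v_1,\dots,v_r}(\lambda,\mu)=(\mu+\rho,\mu+\rho)\,\mathbb F^{v_1,\dots,v_r}(\lambda,\mu),$$ where $\partial_x e^{(\lambda,\xi)}=\langle\xi,x\rangle e^{(\lambda,\xi)}$ for $x\in\mathfrak l$, where $(a\otimes b)|_{V_l\otimes V_m}$ is the operator $a|_{V_l}\,b|_{V_m}$ (for $l=m$, the action of $ab$ on $V_l$), and $$S_T(\lambda)=\sum_{\alpha\in\Delta^+,\,t}\ \sum_{s=0}^\infty\sum_{v=1}^\infty e^{-(s+v)(\alpha,\lambda)}\big(B^sf_\alpha^{(t)}\otimes B^{-v}e_\alpha^{(t)}+B^{-v}e_\alpha^{(t)}\otimes B^sf_\alpha^{(t)}\big)-\sum_{j\in I_2}\tfrac{1-C_T}{2}x_j\otimes\tfrac{1-C_T}{2}x_j .$$ -/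

import Mathlib

open scoped TensorProduct
open Module

noncomputable section

namespace TwistedTrace

/-! ### Kac-Moody algebras -/

/-- Symmetrizable generalized Cartan matrices. -/
structure IsSymmetrizableGCM {n : ℕ} (A : Matrix (Fin n) (Fin n) ℤ) : Prop where
  diag : ∀ i, A i i = 2
  offDiag : ∀ i j, i ≠ j → A i j ≤ 0
  zero_iff : ∀ i j, A i j = 0 ↔ A j i = 0
  symmetrizable : ∃ d : Fin n → ℂ, (∀ i, d i ≠ 0) ∧
    ∀ i j, d i * (A i j : ℂ) = d j * (A j i : ℂ)

/-- A realization `(𝔥, Γ, Γ^∨)` of the matrix `A`: `dim 𝔥 = 2 n - rank A`, and the simple roots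
`α_j ∈ 𝔥^*` and simple coroots `h_i ∈ 𝔥` are linearly independent with `⟨α_j, h_i⟩ = a_ij`. -/
structure Realization {n : ℕ} (A : Matrix (Fin n) (Fin n) ℤ) (H : Type*)
    [AddCommGroup H] [Module ℂ H] where
  root : Fin n → Dual ℂ H
  coroot : Fin n → H
  finiteDimensional : FiniteDimensional ℂ H
  finrank_eq : finrank ℂ H = 2 * n - (A.map (Int.cast : ℤ → ℂ)).rank
  root_linearIndependent : LinearIndependent ℂ root
  coroot_linearIndependent : LinearIndependent ℂ coroot
  pairing : ∀ i j, root j (coroot i) = (A i j : ℂ)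

/-- Generators of the Kac-Moody algebra: the elements of `𝔥` and the Chevalley generators. -/
inductive Gen (n : ℕ) (H : Type*)
  | h : H → Gen n H
  | e : Fin n → Gen n H
  | f : Fin n → Gen n H

section KacMoody

attribute [local instance 100] LieRing.ofAssociativeRing

variable {n : ℕ} {A : Matrix (Fin n) (Fin n) ℤ} {H : Type*} [AddCommGroup H] [Module ℂ H]

local notation "gh" => fun x => FreeLieAlgebra.of ℂ (Gen.h (n := n) (H := H) x)
local notation "ge" => fun i => FreeLieAlgebra.of ℂ (Gen.e (n := n) (H := H) i)
local notation "gf" => fun i => FreeLieAlgebra.of ℂ (Gen.f (n := n) (H := H) i)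

/-- The defining relators of the Kac-Moody algebra: linearity of `𝔥`, the Chevalley relations
and the Serre relations `ad(e_i)^(1 - a_ij) e_j = 0`, `ad(f_i)^(1 - a_ij) f_j = 0` for `i ≠ j`. -/
inductive IsRelator (R : Realization A H) : FreeLieAlgebra ℂ (Gen n H) → Prop
  | add (x y : H) : IsRelator R (gh (x + y) - gh x - gh y)
  | smul (c : ℂ) (x : H) : IsRelator R (gh (c • x) - c • gh x)
  | hh (x y : H) : IsRelator R ⁅gh x, gh y⁆
  | ef_same (i : Fin n) : IsRelator R (⁅ge i, gf i⁆ - gh (R.coroot i))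
  | ef_ne (i j : Fin n) (hij : i ≠ j) : IsRelator R ⁅ge i, gf j⁆
  | he (x : H) (i : Fin n) : IsRelator R (⁅gh x, ge i⁆ - R.root i x • ge i)
  | hf (x : H) (i : Fin n) : IsRelator R (⁅gh x, gf i⁆ + R.root i x • gf i)
  | serre_e (i j : Fin n) (hij : i ≠ j) :
      IsRelator R (((LieAlgebra.ad ℂ _ (ge i)) ^ (1 - A i j).toNat) (ge j))
  | serre_f (i j : Fin n) (hij : i ≠ j) :
      IsRelator R (((LieAlgebra.ad ℂ _ (gf i)) ^ (1 - A i j).toNat) (gf j))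

/-- The ideal generated by the relators. -/
def relIdeal (R : Realization A H) : LieIdeal ℂ (FreeLieAlgebra ℂ (Gen n H)) :=
  LieSubmodule.lieSpan ℂ _ {z | IsRelator R z}

/-- The Kac-Moody algebra `𝔤`. -/
def KM (R : Realization A H) : Type _ := FreeLieAlgebra ℂ (Gen n H) ⧸ relIdeal R

instance (R : Realization A H) : LieRing (KM R) :=
  inferInstanceAs (LieRing (FreeLieAlgebra ℂ (Gen n H) ⧸ relIdeal R))

instance (R : Realization A H) : LieAlgebra ℂ (KM R) :=
  inferInstanceAs (LieAlgebra ℂ (FreeLieAlgebra ℂ (Gen n H) ⧸ relIdeal R))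

/-- The class in `𝔤` of an element of the free Lie algebra. -/
def KM.mk (R : Realization A H) : FreeLieAlgebra ℂ (Gen n H) →ₗ⁅ℂ⁆ KM R where
  toLinearMap := (relIdeal R).toSubmodule.mkQ
  map_lie' := by
    intro x y
    exact LieSubmodule.Quotient.mk_bracket (I := relIdeal R) x y

theorem KM.mk_relator (R : Realization A H) {z : FreeLieAlgebra ℂ (Gen n H)}
    (hz : IsRelator R z) : KM.mk R z = 0 :=
  (Submodule.Quotient.mk_eq_zero _).2 (LieSubmodule.subset_lieSpan hz)

/-- The Chevalley generator `e_i`. -/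
def chevE (R : Realization A H) (i : Fin n) : KM R := KM.mk R (ge i)

/-- The Chevalley generator `f_i`. -/
def chevF (R : Realization A H) (i : Fin n) : KM R := KM.mk R (gf i)

/-- The canonical linear map `𝔥 → 𝔤`. -/
def cartan (R : Realization A H) : H →ₗ[ℂ] KM R where
  toFun x := KM.mk R (gh x)
  map_add' x y := by
    have := KM.mk_relator R (IsRelator.add x y)
    rw [map_sub, map_sub, sub_sub, sub_eq_zero] at this
    exact this
  map_smul' c x := by
    have := KM.mk_relator R (IsRelator.smul c x)
    rw [map_sub, map_smul, sub_eq_zero] at this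
    exact this

/-- The subalgebra `𝔫_+`, generated by the `e_i`. -/
def nPlus (R : Realization A H) : LieSubalgebra ℂ (KM R) :=
  LieSubalgebra.lieSpan ℂ _ (Set.range (chevE R))

/-- The subalgebra `𝔫_-`, generated by the `f_i`. -/
def nMinus (R : Realization A H) : LieSubalgebra ℂ (KM R) :=
  LieSubalgebra.lieSpan ℂ _ (Set.range (chevF R))

/-- `e_i` as an element of `𝔫_+`. -/
def nE (R : Realization A H) (i : Fin n) : nPlus R :=
  ⟨chevE R i, LieSubalgebra.subset_lieSpan ⟨i, rfl⟩⟩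

/-- `f_i` as an element of `𝔫_-`. -/
def nF (R : Realization A H) (i : Fin n) : nMinus R :=
  ⟨chevF R i, LieSubalgebra.subset_lieSpan ⟨i, rfl⟩⟩

/-! ### Weights, category `𝓞` -/

/-- The weight subspace `M[χ]` of a `𝔤`-module `M`. -/
def wtSpace (R : Realization A H) (M : Type*) [AddCommGroup M] [Module ℂ M]
    [LieRingModule (KM R) M] [LieModule ℂ (KM R) M] (χ : Dual ℂ H) : Submodule ℂ M where
  carrier := {m | ∀ x : H, ⁅cartan R x, m⁆ = χ x • m}
  add_mem' {a b} ha hb x := by rw [lie_add, ha x, hb x, smul_add]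
  zero_mem' x := by simp
  smul_mem' c m hm x := by rw [lie_smul, hm x, smul_comm]

open Classical in
/-- The projection `M → M[χ]` along the sum of the other weight subspaces, for an
`𝔥`-diagonalizable module `M`. -/
def wtProj (R : Realization A H) (M : Type*) [AddCommGroup M] [Module ℂ M]
    [LieRingModule (KM R) M] [LieModule ℂ (KM R) M] (χ : Dual ℂ H) : M →ₗ[ℂ] wtSpace R M χ :=
  if h : IsCompl (wtSpace R M χ) (⨆ (χ' : Dual ℂ H) (_ : χ' ≠ χ), wtSpace R M χ') then
    (wtSpace R M χ).projectionOnto _ h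
  else 0

/-- The element `∑ β_i α_i` of the positive part of the root lattice. -/
def posLattice (R : Realization A H) (β : Fin n → ℕ) : Dual ℂ H := ∑ i, β i • R.root i

/-- The set `Δ^+` of positive roots. -/
def posRoots (R : Realization A H) : Set (Dual ℂ H) :=
  {α | ∃ β : Fin n → ℕ, β ≠ 0 ∧ α = posLattice R β ∧ wtSpace R (KM R) α ≠ ⊥}

/-- Category `𝓞`: `𝔥`-diagonalizable `𝔤`-modules with finite dimensional weight subspaces whose
weights lie in a finite union of sets `χ - ∑ ℕ α_i`. -/
structure IsCategoryO (R : Realization A H) (M : Type*) [AddCommGroup M] [Module ℂ M]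
    [LieRingModule (KM R) M] [LieModule ℂ (KM R) M] : Prop where
  diagonalizable : ⨆ χ : Dual ℂ H, wtSpace R M χ = ⊤
  finite_wtSpace : ∀ χ : Dual ℂ H, FiniteDimensional ℂ (wtSpace R M χ)
  bounded : ∃ s : Finset (Dual ℂ H), ∀ χ : Dual ℂ H, wtSpace R M χ ≠ ⊥ →
    ∃ χ₀ ∈ s, ∃ β : Fin n → ℕ, χ = χ₀ - posLattice R β

/-! ### Verma modules -/

/-- The universal enveloping algebra `U(𝔤)`. -/
abbrev UKM (R : Realization A H) : Type _ := UniversalEnvelopingAlgebra ℂ (KM R)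

/-- The left ideal of `U(𝔤)` generated by `𝔫_+` and the elements `x - χ(x)`, `x ∈ 𝔥`. -/
def vermaIdeal (R : Realization A H) (χ : Dual ℂ H) : Submodule (UKM R) (UKM R) :=
  Submodule.span (UKM R)
    ({z | ∃ x ∈ nPlus R, z = UniversalEnvelopingAlgebra.ι ℂ x} ∪
     {z | ∃ x : H, z = UniversalEnvelopingAlgebra.ι ℂ (cartan R x) -
        algebraMap ℂ (UKM R) (χ x)})

/-- The Verma module `M_χ` of highest weight `χ`. -/
def Verma (R : Realization A H) (χ : Dual ℂ H) : Type _ := UKM R ⧸ vermaIdeal R χ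

instance (R : Realization A H) (χ : Dual ℂ H) : AddCommGroup (Verma R χ) :=
  inferInstanceAs (AddCommGroup (UKM R ⧸ vermaIdeal R χ))

instance (R : Realization A H) (χ : Dual ℂ H) : Module (UKM R) (Verma R χ) :=
  inferInstanceAs (Module (UKM R) (UKM R ⧸ vermaIdeal R χ))

instance (R : Realization A H) (χ : Dual ℂ H) : Module ℂ (Verma R χ) :=
  inferInstanceAs (Module ℂ (UKM R ⧸ vermaIdeal R χ))

instance (R : Realization A H) (χ : Dual ℂ H) : IsScalarTower ℂ (UKM R) (Verma R χ) :=
  inferInstanceAs (IsScalarTower ℂ (UKM R) (UKM R ⧸ vermaIdeal R χ))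

/-- The action of `𝔤` on the Verma module: `⁅x, m⁆ = ι(x) m`. -/
instance (R : Realization A H) (χ : Dual ℂ H) : LieRingModule (KM R) (Verma R χ) where
  bracket x m := UniversalEnvelopingAlgebra.ι ℂ x • m
  add_lie x y m := by
    rw [map_add, add_smul]
  lie_add x m m' := smul_add (UniversalEnvelopingAlgebra.ι ℂ x) m m'
  leibniz_lie x y m := by
    change UniversalEnvelopingAlgebra.ι ℂ x • UniversalEnvelopingAlgebra.ι ℂ y • m =
      UniversalEnvelopingAlgebra.ι ℂ ⁅x, y⁆ • m +
        UniversalEnvelopingAlgebra.ι ℂ y • UniversalEnvelopingAlgebra.ι ℂ x • m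
    rw [LieHom.map_lie, LieRing.of_associative_ring_bracket, sub_smul, mul_smul, mul_smul,
      sub_add_cancel]

theorem verma_lie_def (R : Realization A H) (χ : Dual ℂ H) (x : KM R) (m : Verma R χ) :
    ⁅x, m⁆ = UniversalEnvelopingAlgebra.ι ℂ x • m := rfl

instance (R : Realization A H) (χ : Dual ℂ H) : LieModule ℂ (KM R) (Verma R χ) where
  smul_lie c x m := by
    rw [verma_lie_def, verma_lie_def, map_smul, smul_assoc]
  lie_smul c x m := by
    rw [verma_lie_def, verma_lie_def, ← algebraMap_smul (UKM R) c m, smul_smul,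
      ← Algebra.commutes, ← smul_smul, algebraMap_smul]

/-- The highest weight vector `v_χ` of the Verma module. -/
def hwv (R : Realization A H) (χ : Dual ℂ H) : Verma R χ :=
  (vermaIdeal R χ).mkQ 1

/-! ### The invariant form -/

/-- `κ` is a nondegenerate invariant symmetric bilinear form on `𝔤`. -/
structure IsInvariantForm (R : Realization A H) (κ : LinearMap.BilinForm ℂ (KM R)) : Prop where
  symm : ∀ x y, κ x y = κ y x
  invariant : ∀ x y z, κ ⁅x, y⁆ z = κ x ⁅y, z⁆
  nondegenerate : κ.Nondegenerate

/-- The restriction of the form to `𝔥`. -/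
def hForm (R : Realization A H) (κ : LinearMap.BilinForm ℂ (KM R)) : LinearMap.BilinForm ℂ H :=
  κ.compl₁₂ (cartan R) (cartan R)

open Classical in
/-- The identification `𝔥^* → 𝔥` given by the (nondegenerate) form on `𝔥`. -/
def sharp (R : Realization A H) (κ : LinearMap.BilinForm ℂ (KM R)) : Dual ℂ H →ₗ[ℂ] H :=
  haveI := R.finiteDimensional
  if h : (hForm R κ).Nondegenerate then ((hForm R κ).toDual h).symm.toLinearMap else 0

/-- The form on `𝔥^*` induced by the form on `𝔥`. -/
def dualForm (R : Realization A H) (κ : LinearMap.BilinForm ℂ (KM R)) (φ ψ : Dual ℂ H) : ℂ :=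
  hForm R κ (sharp R κ φ) (sharp R κ ψ)

/-- Bases `e_α^(t)` of `𝔤_α` and `f_α^(t)` of `𝔤_{-α}`, for each positive root `α`, dual to each
other with respect to the form. -/
structure DualRootBases (R : Realization A H) (κ : LinearMap.BilinForm ℂ (KM R)) where
  mult : posRoots R → ℕ
  e : ∀ α : posRoots R, Fin (mult α) → nPlus R
  f : ∀ α : posRoots R, Fin (mult α) → nMinus R
  e_linearIndependent : ∀ α, LinearIndependent ℂ (fun t => (e α t : KM R))
  f_linearIndependent : ∀ α, LinearIndependent ℂ (fun t => (f α t : KM R))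
  e_span : ∀ α : posRoots R,
    Submodule.span ℂ (Set.range fun t => (e α t : KM R)) = wtSpace R (KM R) α
  f_span : ∀ α : posRoots R,
    Submodule.span ℂ (Set.range fun t => (f α t : KM R)) = wtSpace R (KM R) (-(α : Dual ℂ H))
  dual : ∀ α t t', κ (e α t) (f α t') = if t = t' then 1 else 0

/-! ### Generalized Belavin-Drinfeld triples -/

/-- A generalized Belavin-Drinfeld triple: subsets `Γ₁`, `Γ₂` of the set of simple roots and an
inner product preserving bijection `T : Γ₁ → Γ₂`. -/
structure GBDTriple (R : Realization A H) (κ : LinearMap.BilinForm ℂ (KM R)) where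
  Γ₁ : Set (Fin n)
  Γ₂ : Set (Fin n)
  T : Γ₁ ≃ Γ₂
  inner_eq : ∀ i j : Γ₁,
    dualForm R κ (R.root (T i)) (R.root (T j)) = dualForm R κ (R.root i) (R.root j)

variable {R : Realization A H} {κ : LinearMap.BilinForm ℂ (KM R)}

/-- The subspace `𝔩 ⊂ 𝔥` on which all `α - T α`, `α ∈ Γ₁`, vanish. -/
def GBDTriple.l (𝒯 : GBDTriple R κ) : Submodule ℂ H :=
  ⨅ i : 𝒯.Γ₁, LinearMap.ker (R.root i - R.root (𝒯.T i))

/-- The orthogonal complement `𝔥₀` of `𝔩` in `𝔥`. -/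
def GBDTriple.h₀ (𝒯 : GBDTriple R κ) : Submodule ℂ H := (hForm R κ).orthogonal 𝒯.l

/-- The triple is nondegenerate: the form is nondegenerate on `𝔩`. -/
def GBDTriple.IsNondegenerate (𝒯 : GBDTriple R κ) : Prop :=
  ((hForm R κ).restrict 𝒯.l).Nondegenerate

open Classical in
/-- The defining property of the Lie algebra endomorphism `B` of `𝔫_-`. -/
def GBDTriple.IsB (𝒯 : GBDTriple R κ) (B : nMinus R →ₗ⁅ℂ⁆ nMinus R) : Prop :=
  ∀ i, B (nF R i) = if h : i ∈ 𝒯.Γ₁ then nF R (𝒯.T ⟨i, h⟩) else 0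

open Classical in
/-- The defining property of the Lie algebra endomorphism `B⁻¹` of `𝔫_+`. -/
def GBDTriple.IsBInv (𝒯 : GBDTriple R κ) (B : nPlus R →ₗ⁅ℂ⁆ nPlus R) : Prop :=
  ∀ i, B (nE R i) = if h : i ∈ 𝒯.Γ₂ then nE R (𝒯.T.symm ⟨i, h⟩) else 0

open Classical in
/-- The unique Lie algebra homomorphism `B : 𝔫_- → 𝔫_-` with `B(f_α) = f_{T α}` for `α ∈ Γ₁` and
`B(f_α) = 0` for the other simple roots `α`. -/
def GBDTriple.B (𝒯 : GBDTriple R κ) : nMinus R →ₗ⁅ℂ⁆ nMinus R :=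
  if h : ∃ B, 𝒯.IsB B then h.choose else 0

open Classical in
/-- The unique Lie algebra homomorphism `B⁻¹ : 𝔫_+ → 𝔫_+` with `B⁻¹(e_α) = e_{T⁻¹ α}` for
`α ∈ Γ₂` and `B⁻¹(e_α) = 0` for the other simple roots `α`. -/
def GBDTriple.BInv (𝒯 : GBDTriple R κ) : nPlus R →ₗ⁅ℂ⁆ nPlus R :=
  if h : ∃ B, 𝒯.IsBInv B then h.choose else 0

/-- The defining property of the Cayley transform: `(α - T α, C x) = (α + T α, x)` for all
`x ∈ 𝔥₀` and `α ∈ Γ₁`. -/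
def GBDTriple.IsCayley (𝒯 : GBDTriple R κ) (C : 𝒯.h₀ →ₗ[ℂ] 𝒯.h₀) : Prop :=
  ∀ (x : 𝒯.h₀) (i : 𝒯.Γ₁),
    (R.root i - R.root (𝒯.T i)) (C x : H) = (R.root i + R.root (𝒯.T i)) (x : H)

open Classical in
/-- The Cayley transform `C_T : 𝔥₀ → 𝔥₀` of `T`. -/
def GBDTriple.cayley (𝒯 : GBDTriple R κ) : 𝒯.h₀ →ₗ[ℂ] 𝒯.h₀ :=
  if h : ∃ C, 𝒯.IsCayley C then h.choose else 0

/-- The homomorphism `U(𝔫_-) → U(𝔤)` induced by the inclusion. -/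
def uIncl (R : Realization A H) :
    UniversalEnvelopingAlgebra ℂ (nMinus R) →ₐ[ℂ] UKM R :=
  UniversalEnvelopingAlgebra.lift ℂ ((UniversalEnvelopingAlgebra.ι ℂ).comp (nMinus R).incl)

/-- The extension of `B` to `U(𝔫_-)`. -/
def GBDTriple.uB (𝒯 : GBDTriple R κ) :
    UniversalEnvelopingAlgebra ℂ (nMinus R) →ₐ[ℂ] UniversalEnvelopingAlgebra ℂ (nMinus R) :=
  UniversalEnvelopingAlgebra.lift ℂ ((UniversalEnvelopingAlgebra.ι ℂ).comp 𝒯.B)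

/-- The defining property of the operator `B : M_{μ'} → M_μ`: `B (x v_{μ'}) = B(x) v_μ` for all
`x ∈ U(𝔫_-)`. -/
def GBDTriple.IsVermaB (𝒯 : GBDTriple R κ) (μ' μ : Dual ℂ H)
    (b : Verma R μ' →ₗ[ℂ] Verma R μ) : Prop :=
  ∀ x : UniversalEnvelopingAlgebra ℂ (nMinus R),
    b (uIncl R x • hwv R μ') = uIncl R (𝒯.uB x) • hwv R μ

open Classical in
/-- The linear operator `B : M_{μ'} → M_μ`, `B (x v_{μ'}) = B(x) v_μ`. It exists and is unique since
Verma modules are freely generated over `U(𝔫_-)` by their highest weight vectors. -/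
def GBDTriple.vermaB (𝒯 : GBDTriple R κ) (μ' μ : Dual ℂ H) : Verma R μ' →ₗ[ℂ] Verma R μ :=
  if h : ∃ b, 𝒯.IsVermaB μ' μ b then h.choose else 0

/-! ### Tensor products and compositions of operators -/

/-- The canonical map `V₀ ⊗ (V₁ ⊗ ... ⊗ V_r) → V₀ ⊗ V₁ ⊗ ... ⊗ V_r`. -/
def tensorCons {r : ℕ} (V : Fin (r + 1) → Type*) [∀ i, AddCommGroup (V i)]
    [∀ i, Module ℂ (V i)] :
    V 0 ⊗[ℂ] (⨂[ℂ] i : Fin r, V i.succ) →ₗ[ℂ] ⨂[ℂ] i, V i :=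
  TensorProduct.lift
    ((PiTensorProduct.lift (R := ℂ) (s := fun i : Fin r => V i.succ)
        (E := ⨂[ℂ] i, V i)).toLinearMap ∘ₗ (PiTensorProduct.tprod ℂ (s := V)).curryLeft)

/-- The composition `Φ_1 Φ_2 ... Φ_r : M_r → M_0 ⊗ V_1 ⊗ ... ⊗ V_r` of operators
`Φ_i : M_i → M_{i-1} ⊗ V_i`, where each operator acts in the first tensor component.
(The index `i : Fin r` stands for `i + 1` in this description.) -/
def compAll : ∀ {r : ℕ} (M : Fin (r + 1) → Type*) (V : Fin r → Type*)
    [∀ i, AddCommGroup (M i)] [∀ i, Module ℂ (M i)]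
    [∀ i, AddCommGroup (V i)] [∀ i, Module ℂ (V i)]
    (_ : ∀ i : Fin r, M i.succ →ₗ[ℂ] M i.castSucc ⊗[ℂ] V i),
    M (Fin.last r) →ₗ[ℂ] M 0 ⊗[ℂ] (⨂[ℂ] i, V i)
  | 0, M, V, _, _, _, _, _ =>
      (TensorProduct.mk ℂ (M 0) (⨂[ℂ] i, V i)).flip (PiTensorProduct.tprod ℂ isEmptyElim)
  | r + 1, M, V, _, _, _, _, Φ =>
      (tensorCons V).lTensor (M 0) ∘ₗ
      (TensorProduct.assoc ℂ (M 0) (V 0) (⨂[ℂ] i : Fin r, V i.succ)).toLinearMap ∘ₗ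
      (Φ 0).rTensor (⨂[ℂ] i : Fin r, V i.succ) ∘ₗ
      compAll (r := r) (fun i => M i.succ) (fun i => V i.succ) (fun i => Φ i.succ)

/-- The operator on `V_1 ⊗ ... ⊗ V_r` by which `x ∈ 𝔤` acts in the factor `V_i`. -/
def actAt {r : ℕ} (R : Realization A H) (V : Fin r → Type*) [∀ i, AddCommGroup (V i)]
    [∀ i, Module ℂ (V i)] [∀ i, LieRingModule (KM R) (V i)] [∀ i, LieModule ℂ (KM R) (V i)]
    (i : Fin r) : KM R →ₗ[ℂ] End ℂ (⨂[ℂ] i, V i) :=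
  (PiTensorProduct.mapMultilinear ℂ V V).toLinearMap (fun _ => LinearMap.id) i ∘ₗ
    (LieModule.toEnd ℂ (KM R) (V i)).toLinearMap

/-- The operator `(x ⊗ y)|_{V_i ⊗ V_j} = x|_{V_i} y|_{V_j}` on `V_1 ⊗ ... ⊗ V_r`. -/
def actPair {r : ℕ} (R : Realization A H) (V : Fin r → Type*) [∀ i, AddCommGroup (V i)]
    [∀ i, Module ℂ (V i)] [∀ i, LieRingModule (KM R) (V i)] [∀ i, LieModule ℂ (KM R) (V i)]
    (i j : Fin r) : KM R ⊗[ℂ] KM R →ₗ[ℂ] End ℂ (⨂[ℂ] i, V i) :=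
  TensorProduct.lift ((LinearMap.mul ℂ (End ℂ (⨂[ℂ] i, V i))).compl₁₂
    (actAt R V i) (actAt R V j))

/-! ### Formal series in `λ ∈ 𝔩^*` -/

/-- A formal series `∑_ξ c_ξ e^{(λ, ξ)}` in `λ ∈ 𝔩^*`, recorded by its coefficients `c_ξ ∈ W`,
`ξ ∈ 𝔩^*`. -/
abbrev Series (𝒯 : GBDTriple R κ) (W : Type*) : Type _ := Dual ℂ 𝒯.l → W

/-- The product of formal series with respect to a bilinear pairing of the coefficients. -/
def Series.mul {𝒯 : GBDTriple R κ} {U V W : Type*} [AddCommGroup U] [AddCommGroup V]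
    [AddCommGroup W] [Module ℂ U] [Module ℂ V] [Module ℂ W] (p : U →ₗ[ℂ] V →ₗ[ℂ] W)
    (a : Series 𝒯 U) (b : Series 𝒯 V) : Series 𝒯 W :=
  fun ξ => ∑ᶠ η : Dual ℂ 𝒯.l, p (a η) (b (ξ - η))

/-- The derivative `∂/∂x` of a formal series in the direction of `x ∈ 𝔩 ≅ 𝔩^*`:
`∂_x e^{(λ, ξ)} = ⟨ξ, x⟩ e^{(λ, ξ)}`. -/
def Series.deriv {𝒯 : GBDTriple R κ} {W : Type*} [AddCommGroup W] [Module ℂ W]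
    (x : 𝒯.l) (c : Series 𝒯 W) : Series 𝒯 W :=
  fun ξ => ξ x • c ξ

/-- The restriction `𝔥^* → 𝔩^*`. -/
def GBDTriple.res (𝒯 : GBDTriple R κ) (χ : Dual ℂ H) : Dual ℂ 𝒯.l := χ ∘ₗ 𝒯.l.subtype

/-! ### Traces -/

/-- The contribution of `M[χ]` to the trace over `M` of an operator `ψ : M → M ⊗ W`; it is an
element of `W`. -/
def wtTrace (R : Realization A H) {M W : Type*} [AddCommGroup M] [Module ℂ M]
    [LieRingModule (KM R) M] [LieModule ℂ (KM R) M] [AddCommGroup W] [Module ℂ W]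
    (ψ : M →ₗ[ℂ] M ⊗[ℂ] W) (χ : Dual ℂ H) : W :=
  let b := Basis.ofVectorSpace ℂ (wtSpace R M χ)
  ∑ᶠ k, TensorProduct.lid ℂ W ((b.coord k ∘ₗ wtProj R M χ).rTensor W (ψ (b k)))

/-- The formal series `Tr_M (ψ e^λ) = ∑_χ e^{(λ, χ)} Tr_{M[χ]}(ψ)`, for `ψ : M → M ⊗ W`. -/
def traceSeries (𝒯 : GBDTriple R κ) {M W : Type*} [AddCommGroup M] [Module ℂ M]
    [LieRingModule (KM R) M] [LieModule ℂ (KM R) M] [AddCommGroup W] [Module ℂ W]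
    (ψ : M →ₗ[ℂ] M ⊗[ℂ] W) : Series 𝒯 W :=
  fun ξ => ∑ᶠ (χ : Dual ℂ H) (_ : 𝒯.res χ = ξ), wtTrace R ψ χ

/-- The formal series `Tr_{M_{-ρ}} (B e^λ)`. -/
def GBDTriple.charB (𝒯 : GBDTriple R κ) (ρ : Dual ℂ H) : Series 𝒯 ℂ :=
  traceSeries 𝒯 ((TensorProduct.rid ℂ (Verma R (-ρ))).symm.toLinearMap ∘ₗ 𝒯.vermaB (-ρ) (-ρ))

open Classical in
/-- `δ` is the inverse of `Tr_{M_{-ρ}} (B e^λ)`, in the ring of formal series with exponents in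
finite unions of sets `ξ - ∑ ℕ α_i`. -/
def GBDTriple.IsDelta (𝒯 : GBDTriple R κ) (ρ : Dual ℂ H) (δ : Series 𝒯 ℂ) : Prop :=
  (∀ ξ, δ ξ ≠ 0 → ∃ β : Fin n → ℕ, ξ = 𝒯.res (ρ - posLattice R β)) ∧
    Series.mul (LinearMap.mul ℂ ℂ) (𝒯.charB ρ) δ = fun ξ => if ξ = 0 then 1 else 0

open Classical in
/-- The formal series `δ_B(λ) = (Tr_{M_{-ρ}} (B e^λ))⁻¹`. -/
def GBDTriple.delta (𝒯 : GBDTriple R κ) (ρ : Dual ℂ H) : Series 𝒯 ℂ :=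
  if h : ∃ δ, 𝒯.IsDelta ρ δ then h.choose else 0

/-- The weights `μ_i = μ - ν_{i+1} - ... - ν_r`, `0 ≤ i ≤ r`. -/
def partialWt {r : ℕ} (ν : Fin r → Dual ℂ H) (μ : Dual ℂ H) (i : Fin (r + 1)) : Dual ℂ H :=
  μ - ∑ j : Fin r with i ≤ j.castSucc, ν j

/-- `Φ : M_χ → M_χ' ⊗ V` is an intertwining operator with `⟨v_χ'^*, Φ v_χ⟩ = v`, that is, the
component of `Φ v_χ` in `M_χ'[χ'] ⊗ V` is `v_χ' ⊗ v`. -/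
def IsLeading (R : Realization A H) {χ χ' : Dual ℂ H} {V : Type*} [AddCommGroup V] [Module ℂ V]
    [LieRingModule (KM R) V] [LieModule ℂ (KM R) V]
    (Φ : Verma R χ →ₗ⁅ℂ,KM R⁆ Verma R χ' ⊗[ℂ] V) (v : V) : Prop :=
  ((wtSpace R (Verma R χ') χ').subtype ∘ₗ wtProj R (Verma R χ') χ').rTensor V (Φ (hwv R χ)) =
    hwv R χ' ⊗ₜ[ℂ] v

/-- The twisted trace `F(λ, μ) = Tr (Φ_1 ... Φ_r B e^λ)`, with
`B e^λ : M_{μ'} → M_μ`, `Φ_i : M_{μ_i} → M_{μ_{i-1}} ⊗ V_i` and `μ' = μ_0 = μ - ν`. -/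
def GBDTriple.trace (𝒯 : GBDTriple R κ) {r : ℕ} {V : Fin r → Type*}
    [∀ i, AddCommGroup (V i)] [∀ i, Module ℂ (V i)] [∀ i, LieRingModule (KM R) (V i)]
    [∀ i, LieModule ℂ (KM R) (V i)] (m : Fin (r + 1) → Dual ℂ H)
    (Φ : ∀ i : Fin r, Verma R (m i.succ) →ₗ⁅ℂ,KM R⁆ Verma R (m i.castSucc) ⊗[ℂ] V i) :
    Series 𝒯 (⨂[ℂ] i, V i) :=
  traceSeries 𝒯
    (compAll (fun i => Verma R (m i)) V (fun i => (Φ i : _ →ₗ[ℂ] _)) ∘ₗ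
      𝒯.vermaB (m 0) (m (Fin.last r)))

/-- The normalized twisted trace `𝔽(λ, μ) = δ_B(λ) F(λ, μ)`. -/
def GBDTriple.normTrace (𝒯 : GBDTriple R κ) (ρ : Dual ℂ H) {r : ℕ} {V : Fin r → Type*}
    [∀ i, AddCommGroup (V i)] [∀ i, Module ℂ (V i)] [∀ i, LieRingModule (KM R) (V i)]
    [∀ i, LieModule ℂ (KM R) (V i)] (m : Fin (r + 1) → Dual ℂ H)
    (Φ : ∀ i : Fin r, Verma R (m i.succ) →ₗ⁅ℂ,KM R⁆ Verma R (m i.castSucc) ⊗[ℂ] V i) :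
    Series 𝒯 (⨂[ℂ] i, V i) :=
  Series.mul (LinearMap.lsmul ℂ (⨂[ℂ] i, V i)) (𝒯.delta ρ) (𝒯.trace m Φ)

/-! ### The operator `S_T` -/

/-- The vector `(1 - C_T) x / 2`, regarded as an element of `𝔤`. -/
def GBDTriple.halfCayley (𝒯 : GBDTriple R κ) (x : 𝒯.h₀) : KM R :=
  cartan R (((1 / 2 : ℂ) • (x - 𝒯.cayley x) : 𝒯.h₀) : H)

open Classical in
/-- The formal series
`S_T(λ) = ∑_{α, t} ∑_{s ≥ 0} ∑_{v ≥ 1} e^{-(s + v)(α, λ)}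
  (B^s f_α^(t) ⊗ B^{-v} e_α^(t) + B^{-v} e_α^(t) ⊗ B^s f_α^(t))
  - ∑_j (1 - C_T)/2 y_j ⊗ (1 - C_T)/2 y_j`
with coefficients in `𝔤 ⊗ 𝔤`, where `y` is a basis of `𝔥₀`. In the code `v = w + 1`. -/
def GBDTriple.S (𝒯 : GBDTriple R κ) (D : DualRootBases R κ) {I₂ : Type*} [Fintype I₂]
    (y : I₂ → 𝒯.h₀) : Series 𝒯 (KM R ⊗[ℂ] KM R) := fun ξ =>
  (∑ᶠ (α : posRoots R) (s : ℕ) (w : ℕ) (_ : ξ = -((s + (w + 1)) • 𝒯.res α)),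
    ∑ t : Fin (D.mult α),
      (((𝒯.B^[s] (D.f α t) : nMinus R) : KM R) ⊗ₜ[ℂ]
          ((𝒯.BInv^[w + 1] (D.e α t) : nPlus R) : KM R) +
        ((𝒯.BInv^[w + 1] (D.e α t) : nPlus R) : KM R) ⊗ₜ[ℂ]
          ((𝒯.B^[s] (D.f α t) : nMinus R) : KM R))) -
  if ξ = 0 then ∑ j, 𝒯.halfCayley (y j) ⊗ₜ[ℂ] 𝒯.halfCayley (y j) else 0

end KacMoody

end TwistedTrace

end

open scoped TensorProduct
open Module

noncomputable section

namespace TwistedTrace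

attribute [local instance 100] LieRing.ofAssociativeRing
attribute [local instance 2000] lieRingSelfModule

/-! ### Serre elements commute with the opposite generators -/

section Serre

variable {L M : Type*} [LieRing L] [LieAlgebra ℂ L] [AddCommGroup M] [Module ℂ M]
  [LieRingModule L M] [LieModule ℂ L M]

/-! The Casimir operator, formally `∑ x_a² + 2 ρ^♯ + 2 ∑ f_α e_α`, acts on `M_μ` by the scalar `(μ,
μ + 2ρ)`. Inserting it between the intertwiners and `B e^λ` therefore multiplies `F` by this scalar.
The theorem comes from computing the same trace by moving the factors of the Casimir operator around
it.

The basic move is `GBDTriple.twTrace_lmul`. The composition of the `Φ_i` is an intertwiner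
(`compAll_lie`), so a factor to its right splits into an action on `V_1 ⊗ ... ⊗ V_r` and an action
on the Verma module, and the latter goes by cyclicity to the right of `B`. The relations `B f = B(f)
B` on `𝔫_-` and `e B = B B⁻¹(e)` on `𝔫_+` then allow another turn. The compatibility of `μ'` and `μ`
is what makes the relation for `e` hold. Used forwards for `f` and backwards for `e`, a turn applies
`B` to `f` or `B⁻¹` to `e` and costs a factor `e^{-(α, λ)}`. For a fixed exponent the remainder
vanishes after finitely many turns, because the shifted exponent lies above the highest weight. This
produces the double sum in `S_T`.

Elements of `𝔩` commute with `B` and act as derivatives. For `𝔥₀` the relation `(C + 1)x/2 · B = B ·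
(C - 1)x/2` turns `x` into `(1 - C)x/2` acting on the tensor factors. Moving `f` past `e` creates
brackets `[e, B^{s+1} f]` in `𝔥`. As `B` and `B⁻¹` are adjoint for the invariant form, the
`𝔥₀`-components of these brackets cancel after summation over dual bases, and the `𝔩`-components
give first order terms `2 ∑ φ_j ∂_j F`. The outcome is `GBDTriple.Compat.series_identity`.

The first order terms are removed by `δ_B`, and no product formula for the character of `B` is
needed. The same identity is applied to the trivial module at the weights `-ρ + z`, `z ∈ 𝔩`, whose
characters are translates of one another. Comparing `z = x_k` with `z = 0` gives `∂_k Tr = -φ_k Tr`,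
hence `∂_k δ_B = φ_k δ_B`, and `z = 0` gives `∑ ∂_j² δ_B = (ρ, ρ) δ_B`. The Leibniz rule concludes
in `GBDTriple.Compat.normalized_identity`.

The operators `B`, `B⁻¹`, their extension to Verma modules, `C_T` and `δ_B` are defined by choice,
so their existence has to be proved. Freeness of Verma modules over `U(𝔫_-)` is obtained from an
explicit module of words in the `f_i` modulo the Serre relations (`exists_model_action`), which also
shows that these relations present `U(𝔫_-)`. -/

theorem lie_pow_toEnd_of_lie_eq_zero {x y : L} (h : ⁅x, y⁆ = 0) (k : ℕ) (m : M) :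
    ⁅x, ((LieModule.toEnd ℂ L M y) ^ k) m⁆ = ((LieModule.toEnd ℂ L M y) ^ k) ⁅x, m⁆ := by
  induction k with
  | zero => simp
  | succ k ih =>
    rw [pow_succ', Module.End.mul_apply, Module.End.mul_apply, LieModule.toEnd_apply_apply,
      LieModule.toEnd_apply_apply, leibniz_lie, h, zero_lie, zero_add, ih]

theorem lie_pow_toEnd_weight {h y : L} {c : ℂ} (hy : ⁅h, y⁆ = c • y) {μ : ℂ} {m : M}
    (hm : ⁅h, m⁆ = μ • m) (k : ℕ) :
    ⁅h, ((LieModule.toEnd ℂ L M y) ^ k) m⁆ =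
      (μ + k * c) • ((LieModule.toEnd ℂ L M y) ^ k) m := by
  induction k with
  | zero => simpa using hm
  | succ k ih =>
    rw [pow_succ', Module.End.mul_apply, LieModule.toEnd_apply_apply, leibniz_lie, hy, ih,
      smul_lie, lie_smul, ← add_smul]
    congr 1
    push_cast
    ring

/-- Each passage of `x` through a `y` leaves an `h`, and the eigenvalues `μ, μ - 2, ..., μ - 2k` met
on the way add up to `(k + 1)(μ - k)`. The vanishing at `k = μ` singles out the Serre exponents. -/
theorem lie_pow_succ_toEnd_primitive {x y h : L} (hxy : ⁅x, y⁆ = h)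
    (hy : ⁅h, y⁆ = (-2 : ℂ) • y) {μ : ℂ} {m : M} (hm : ⁅h, m⁆ = μ • m) (xm : ⁅x, m⁆ = 0) (k : ℕ) :
    ⁅x, ((LieModule.toEnd ℂ L M y) ^ (k + 1)) m⁆ =
      ((k + 1) * (μ - k)) • ((LieModule.toEnd ℂ L M y) ^ k) m := by
  induction k with
  | zero => simp [leibniz_lie, hxy, hm, xm]
  | succ k ih =>
    rw [pow_succ', Module.End.mul_apply, LieModule.toEnd_apply_apply, leibniz_lie, hxy, ih,
      lie_pow_toEnd_weight hy hm, lie_smul]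
    rw [pow_succ' _ k, Module.End.mul_apply, LieModule.toEnd_apply_apply, ← add_smul]
    congr 1
    push_cast
    ring

/-- The Serre elements in the `f_i` commute with the `e_k`. -/
theorem lie_serre_eq_zero {n : ℕ} {A : Matrix (Fin n) (Fin n) ℤ} (hA : IsSymmetrizableGCM A)
    {e f h : Fin n → L} (hef : ∀ i j, ⁅e i, f j⁆ = if i = j then h i else 0)
    (hhf : ∀ i j, ⁅h i, f j⁆ = (-(A i j : ℂ)) • f j) (k i j : Fin n) (hij : i ≠ j) :
    ⁅e k, ((LieModule.toEnd ℂ L L (f i)) ^ (1 - A i j).toNat) (f j)⁆ = 0 := by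
  have hle := hA.offDiag i j hij
  obtain ⟨m, hm⟩ := Int.eq_ofNat_of_zero_le (show 0 ≤ -A i j by lia)
  have hmc : (-(A i j : ℂ)) = m := by exact_mod_cast congrArg (Int.cast : ℤ → ℂ) hm
  have hnat : (1 - A i j).toNat = m + 1 := by lia
  rw [hnat]
  by_cases hki : k = i
  · subst hki
    -- The exponent is `m + 1`, where `m = -a_ij` is the eigenvalue of `h_i` on `f_j`, so the scalar
    -- is `(m + 1)(m - m) = 0`.
    rw [lie_pow_succ_toEnd_primitive (h := h k) (μ := m) (by rw [hef, if_pos rfl])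
      (by rw [hhf, hA.diag]; norm_num) (by rw [hhf, hmc]) (by rw [hef, if_neg hij])]
    simp
  · rw [lie_pow_toEnd_of_lie_eq_zero (by rw [hef, if_neg hki]), hef]
    split_ifs with hkj
    · subst hkj
      have h1 : ⁅f i, h k⁆ = (A k i : ℂ) • f i := by
        rw [← lie_skew, hhf, neg_smul, neg_neg]
      rw [pow_succ, Module.End.mul_apply, LieModule.toEnd_apply_apply, h1, map_smul]
      -- What remains is `a_ki` times `ad(f_i)^m f_i`. For `m = 0` the coefficient vanishes together
      -- with `a_ik`, and for `m > 0` the bracket `[f_i, f_i]` does.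
      rcases m with _ | m
      · have : A k i = 0 := (hA.zero_iff i k).1 (by lia)
        simp [this]
      · simp [pow_succ]
    · simp

end Serre

/-! ### The free module on words in the `f_i` -/

section Free

variable {n : ℕ} {A : Matrix (Fin n) (Fin n) ℤ} {H : Type*} [AddCommGroup H] [Module ℂ H]
  (R : Realization A H) (χ : Dual ℂ H)

/-- The sum of the simple roots indexed by the letters of a word. -/
def wordWt (w : List (Fin n)) : Dual ℂ H := (w.map R.root).sum

/-- The space of formal linear combinations of words in the `f_i`. -/
def Words (n : ℕ) : Type := List (Fin n) →₀ ℂ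

instance : AddCommGroup (Words n) := inferInstanceAs (AddCommGroup (List (Fin n) →₀ ℂ))

instance : Module ℂ (Words n) := inferInstanceAs (Module ℂ (List (Fin n) →₀ ℂ))

/-- The basis of words. -/
def word : Basis (List (Fin n)) ℂ (Words n) := Finsupp.basisSingleOne

/-- The operator by which `f_j` acts on words. -/
def freeF (j : Fin n) : End ℂ (Words n) := word.constr ℂ fun w => word (j :: w)

/-- The operator by which `x ∈ 𝔥` acts on words, for the highest weight `χ`. -/
def freeH (x : H) : End ℂ (Words n) :=
  word.constr ℂ fun w => (χ - wordWt R w) x • word w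

/-- The image of a word under `e_i`. -/
def freeEWord (i : Fin n) : List (Fin n) → Words n
  | [] => 0
  | j :: w => freeF j (freeEWord i w) + if i = j then freeH R χ (R.coroot i) (word w) else 0

/-- The operator by which `e_i` acts on words, for the highest weight `χ`. -/
def freeE (i : Fin n) : End ℂ (Words n) := word.constr ℂ (freeEWord R χ i)

@[simp] theorem freeF_word (j : Fin n) (w : List (Fin n)) : freeF j (word w) = word (j :: w) :=
  word.constr_basis ℂ _ w

@[simp] theorem freeH_word (x : H) (w : List (Fin n)) :
    freeH R χ x (word w) = (χ - wordWt R w) x • word w :=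
  word.constr_basis ℂ _ w

@[simp] theorem freeE_word (i : Fin n) (w : List (Fin n)) :
    freeE R χ i (word w) = freeEWord R χ i w :=
  word.constr_basis ℂ _ w

/-- All words arise from the empty one by the operators `freeF j`. Relations between operators are
thus reduced to the empty word and to brackets with `freeF j`. -/
theorem end_words_eq_zero {X : End ℂ (Words n)} (h₀ : X (word []) = 0)
    (h : ∀ j : Fin n, ⁅X, freeF j⁆ = 0) : X = 0 := by
  apply word.ext
  intro w
  induction w with
  | nil => exact h₀
  | cons j w ih =>
    have := LinearMap.congr_fun (h j) (word w)
    rw [LieRing.of_associative_ring_bracket, LinearMap.sub_apply, Module.End.mul_apply,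
      Module.End.mul_apply, ih, LinearMap.zero_apply, map_zero, sub_zero, freeF_word] at this
    exact this

theorem freeH_freeF (x : H) (j : Fin n) :
    ⁅freeH R χ x, freeF j⁆ = -(R.root j x • freeF j) := by
  rw [LieRing.of_associative_ring_bracket]
  apply word.ext
  intro w
  simp only [LinearMap.sub_apply, Module.End.mul_apply, freeF_word, freeH_word, map_smul,
    LinearMap.neg_apply, LinearMap.smul_apply]
  rw [← sub_smul, ← neg_smul]
  congr 1
  simp [wordWt]

theorem freeE_freeF (i j : Fin n) :
    ⁅freeE R χ i, freeF j⁆ = if i = j then freeH R χ (R.coroot i) else 0 := by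
  rw [LieRing.of_associative_ring_bracket]
  apply word.ext
  intro w
  simp only [LinearMap.sub_apply, Module.End.mul_apply, freeF_word, freeE_word, freeEWord]
  split_ifs <;> simp

theorem freeH_freeH (x y : H) : ⁅freeH R χ x, freeH R χ y⁆ = 0 := by
  apply end_words_eq_zero
  · rw [LieRing.of_associative_ring_bracket]
    simp [smul_smul, mul_comm]
  · intro j
    rw [lie_lie, freeH_freeF, freeH_freeF]
    simp only [lie_neg, lie_smul, freeH_freeF, smul_neg, neg_neg, smul_smul]
    rw [mul_comm, sub_self]

theorem freeH_freeE (x : H) (i : Fin n) :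
    ⁅freeH R χ x, freeE R χ i⁆ = R.root i x • freeE R χ i := by
  rw [← sub_eq_zero]
  apply end_words_eq_zero
  · rw [LieRing.of_associative_ring_bracket]
    simp [freeE_word, freeEWord]
  · intro j
    rw [sub_lie, lie_lie, smul_lie, freeE_freeF, freeH_freeF]
    simp only [lie_neg, lie_smul, freeE_freeF]
    split_ifs with h
    · subst h; simp [freeH_freeH]
    · simp

theorem freeH_add (x y : H) : freeH R χ (x + y) = freeH R χ x + freeH R χ y := by
  apply word.ext
  intro w
  simp only [freeH_word, LinearMap.add_apply, map_add, add_smul]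

theorem freeH_smul (c : ℂ) (x : H) : freeH R χ (c • x) = c • freeH R χ x := by
  apply word.ext
  intro w
  simp only [freeH_word, LinearMap.smul_apply, map_smul, smul_assoc]

/-- The Serre element in the operators `f_i`. -/
def freeSerre (A : Matrix (Fin n) (Fin n) ℤ) (i j : Fin n) : End ℂ (Words n) :=
  ((LieModule.toEnd ℂ (End ℂ (Words n)) (End ℂ (Words n)) (freeF i)) ^ (1 - A i j).toNat) (freeF j)

theorem freeH_lie_coroot (i j : Fin n) :
    ⁅freeH R χ (R.coroot i), freeF j⁆ = (-(A i j : ℂ)) • freeF j := by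
  rw [freeH_freeF, R.pairing, neg_smul]

variable {R χ} in
theorem freeE_serre (hA : IsSymmetrizableGCM A) (k i j : Fin n) (hij : i ≠ j) :
    ⁅freeE R χ k, freeSerre A i j⁆ = 0 :=
  lie_serre_eq_zero hA (h := fun i => freeH R χ (R.coroot i)) (freeE_freeF R χ)
    (freeH_lie_coroot R χ) k i j hij

theorem freeH_serre (x : H) (i j : Fin n) :
    ∃ c : ℂ, ⁅freeH R χ x, freeSerre A i j⁆ = c • freeSerre A i j :=
  ⟨_, lie_pow_toEnd_weight (c := -(R.root i x)) (μ := -(R.root j x))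
    (by rw [freeH_freeF, neg_smul]) (by rw [freeH_freeF, neg_smul]) _⟩

/-- The Serre elements in the `e_i` act by zero on words. -/
theorem freeE_serre_eq_zero (hA : IsSymmetrizableGCM A) (i j : Fin n) (hij : i ≠ j) :
    ((LieModule.toEnd ℂ (End ℂ (Words n)) (End ℂ (Words n)) (freeE R χ i)) ^
      (1 - A i j).toNat) (freeE R χ j) = 0 := by
  apply end_words_eq_zero
  · have h : ∀ k : ℕ, (((LieModule.toEnd ℂ (End ℂ (Words n)) (End ℂ (Words n)) (freeE R χ i)) ^
        k) (freeE R χ j)) (word []) = 0 := by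
      intro k
      induction k with
      | zero => simp [freeE_word, freeEWord]
      | succ k ih =>
        rw [pow_succ', Module.End.mul_apply, LieModule.toEnd_apply_apply,
          LieRing.of_associative_ring_bracket, LinearMap.sub_apply, Module.End.mul_apply,
          Module.End.mul_apply, ih, freeE_word, freeEWord]
        simp
    exact h _
  · intro k
    -- The relations are symmetric under exchanging the two families of generators and replacing `h`
    -- by `-h`.
    have := lie_serre_eq_zero hA (e := freeF) (f := freeE R χ)
      (h := fun i => -freeH R χ (R.coroot i))
      (fun i j => by
        rw [← lie_skew, freeE_freeF]
        by_cases h : i = j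
        · subst h; simp
        · rw [if_neg h, if_neg (Ne.symm h), neg_zero])
      (fun i j => by rw [neg_lie, freeH_freeE, R.pairing, neg_smul]) k i j hij
    rw [← lie_skew, this, neg_zero]

/-- The subspace of words generated by the Serre relations. -/
def serreSub (A : Matrix (Fin n) (Fin n) ℤ) : Submodule ℂ (Words n) :=
  sInf {p | (∀ i j, i ≠ j → ∀ u, freeSerre A i j u ∈ p) ∧ ∀ j, ∀ u ∈ p, freeF j u ∈ p}

theorem freeSerre_mem_serreSub (i j : Fin n) (hij : i ≠ j) (u : Words n) :
    freeSerre A i j u ∈ serreSub A :=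
  (Submodule.mem_sInf).2 fun _ hp => hp.1 i j hij u

theorem freeF_mem_serreSub (j : Fin n) {u : Words n} (hu : u ∈ serreSub A) :
    freeF j u ∈ serreSub A :=
  (Submodule.mem_sInf).2 fun p hp => hp.2 j u ((Submodule.mem_sInf).1 hu p hp)

theorem serreSub_le {p : Submodule ℂ (Words n)} (h₁ : ∀ i j, i ≠ j → ∀ u, freeSerre A i j u ∈ p)
    (h₂ : ∀ j, ∀ u ∈ p, freeF j u ∈ p) : serreSub A ≤ p :=
  sInf_le ⟨h₁, h₂⟩

theorem apply_apply_of_lie {X Y : End ℂ (Words n)} (u : Words n) :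
    X (Y u) = ⁅X, Y⁆ u + Y (X u) := by
  simp [LieRing.of_associative_ring_bracket]

/-- The vectors of `serreSub` whose images under all `freeH` and `freeE` stay in `serreSub` form a
subspace to which minimality of `serreSub` applies: Serre elements are eigenvectors for `𝔥` and
commute with the `e_k`. -/
theorem freeEH_mem_serreSub (hA : IsSymmetrizableGCM A) {u : Words n} (hu : u ∈ serreSub A) :
    (∀ x, freeH R χ x u ∈ serreSub A) ∧ ∀ k, freeE R χ k u ∈ serreSub A := by
  let p : Submodule ℂ (Words n) := serreSub A ⊓
    ((⨅ x, (serreSub A).comap (freeH R χ x)) ⊓ ⨅ k, (serreSub A).comap (freeE R χ k))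
  have hp : ∀ u, u ∈ p ↔ u ∈ serreSub A ∧ (∀ x, freeH R χ x u ∈ serreSub A) ∧
      ∀ k, freeE R χ k u ∈ serreSub A := by
    intro u
    simp [p, Submodule.mem_inf, Submodule.mem_iInf]
  have hle : serreSub A ≤ p := by
    apply serreSub_le
    · intro i j hij u
      rw [hp]
      refine ⟨freeSerre_mem_serreSub i j hij u, fun x => ?_, fun k => ?_⟩
      · obtain ⟨c, hc⟩ := freeH_serre R χ x i j
        rw [apply_apply_of_lie, hc]
        exact add_mem (Submodule.smul_mem _ c (freeSerre_mem_serreSub i j hij u))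
          (freeSerre_mem_serreSub i j hij _)
      · rw [apply_apply_of_lie, freeE_serre hA k i j hij, LinearMap.zero_apply, zero_add]
        exact freeSerre_mem_serreSub i j hij _
    · intro j u hu
      rw [hp] at hu ⊢
      refine ⟨freeF_mem_serreSub j hu.1, fun x => ?_, fun k => ?_⟩
      · rw [apply_apply_of_lie, freeH_freeF]
        exact add_mem (neg_mem (Submodule.smul_mem _ _ (freeF_mem_serreSub j hu.1)))
          (freeF_mem_serreSub j (hu.2.1 x))
      · rw [apply_apply_of_lie, freeE_freeF]
        refine add_mem ?_ (freeF_mem_serreSub j (hu.2.2 k))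
        split_ifs
        · exact hu.2.1 _
        · exact zero_mem _
  exact ((hp u).1 (hle hu)).2

/-- The operators `freeF j`, and so the Serre elements, produce only words of positive length. Hence
the highest weight vector survives in the quotient. -/
theorem word_nil_notMem_serreSub :
    (word [] : Words n) ∉ serreSub A := by
  have hle : serreSub A ≤ LinearMap.ker (word.coord []) := by
    have hF : ∀ (j : Fin n) (u : Words n), word.coord [] (freeF j u) = 0 := by
      intro j u
      have : word.coord [] ∘ₗ freeF j = 0 := by
        apply word.ext
        intro w
        simp
      exact LinearMap.congr_fun this u
    apply serreSub_le
    · intro i j hij u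
      have h : ∀ (k : ℕ) (u : Words n),
          word.coord [] ((((LieModule.toEnd ℂ (End ℂ (Words n)) (End ℂ (Words n)) (freeF i)) ^ k)
            (freeF j)) u) = 0 := by
        intro k
        induction k with
        | zero => intro u; simpa using hF j u
        | succ k ih =>
          intro u
          rw [pow_succ', Module.End.mul_apply, LieModule.toEnd_apply_apply,
            LieRing.of_associative_ring_bracket, LinearMap.sub_apply, Module.End.mul_apply,
            Module.End.mul_apply, map_sub, ih, hF, sub_zero]
      exact h _ u
    · intro j u _
      exact hF j u
  intro h
  have := hle h
  simp at this

end Free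

/-! ### Homomorphisms from the Kac-Moody algebra -/

section KMLift

variable {n : ℕ} {A : Matrix (Fin n) (Fin n) ℤ} {H : Type*} [AddCommGroup H] [Module ℂ H]
  (R : Realization A H)

theorem cartan_lie_cartan (x y : H) : ⁅cartan R x, cartan R y⁆ = 0 :=
  ((KM.mk R).map_lie _ _).symm.trans (KM.mk_relator R (IsRelator.hh x y))

theorem chevE_lie_chevF (i j : Fin n) :
    ⁅chevE R i, chevF R j⁆ = if i = j then cartan R (R.coroot i) else 0 := by
  refine ((KM.mk R).map_lie _ _).symm.trans ?_
  split_ifs with h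
  · subst h
    have := KM.mk_relator R (IsRelator.ef_same i)
    rwa [map_sub, sub_eq_zero] at this
  · exact KM.mk_relator R (IsRelator.ef_ne i j h)

theorem cartan_lie_chevE (x : H) (i : Fin n) : ⁅cartan R x, chevE R i⁆ = R.root i x • chevE R i := by
  have := KM.mk_relator R (IsRelator.he x i)
  rw [map_sub, map_smul, sub_eq_zero, LieHom.map_lie] at this
  exact this

theorem cartan_lie_chevF (x : H) (i : Fin n) :
    ⁅cartan R x, chevF R i⁆ = -(R.root i x • chevF R i) := by
  have := KM.mk_relator R (IsRelator.hf x i)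
  rw [map_add, map_smul, add_eq_zero_iff_eq_neg, LieHom.map_lie] at this
  exact this

theorem map_pow_ad {L L' : Type*} [LieRing L] [LieAlgebra ℂ L] [LieRing L'] [LieAlgebra ℂ L']
    (φ : L →ₗ⁅ℂ⁆ L') (x y : L) (k : ℕ) :
    φ (((LieModule.toEnd ℂ L L x) ^ k) y) = ((LieModule.toEnd ℂ L' L' (φ x)) ^ k) (φ y) := by
  induction k with
  | zero => rfl
  | succ k ih =>
    rw [pow_succ', pow_succ', Module.End.mul_apply, Module.End.mul_apply,
      LieModule.toEnd_apply_apply, LieModule.toEnd_apply_apply, LieHom.map_lie, ih]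

theorem chevE_serre (i j : Fin n) (hij : i ≠ j) :
    ((LieModule.toEnd ℂ (KM R) (KM R) (chevE R i)) ^ (1 - A i j).toNat) (chevE R j) = 0 :=
  (map_pow_ad (KM.mk R) _ _ _).symm.trans (KM.mk_relator R (IsRelator.serre_e i j hij))

theorem chevF_serre (i j : Fin n) (hij : i ≠ j) :
    ((LieModule.toEnd ℂ (KM R) (KM R) (chevF R i)) ^ (1 - A i j).toNat) (chevF R j) = 0 :=
  (map_pow_ad (KM.mk R) _ _ _).symm.trans (KM.mk_relator R (IsRelator.serre_f i j hij))

theorem KM.mk_surjective : Function.Surjective (KM.mk R) :=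
  Submodule.Quotient.mk_surjective _

/-- Data in a Lie algebra satisfying the defining relations of the Kac-Moody algebra. -/
structure ChevalleyData {L : Type*} [LieRing L] [LieAlgebra ℂ L] (h : H →ₗ[ℂ] L)
    (e f : Fin n → L) : Prop where
  hh : ∀ x y, ⁅h x, h y⁆ = 0
  ef : ∀ i j, ⁅e i, f j⁆ = if i = j then h (R.coroot i) else 0
  he : ∀ x i, ⁅h x, e i⁆ = R.root i x • e i
  hf : ∀ x i, ⁅h x, f i⁆ = -(R.root i x • f i)
  serre_e : ∀ i j, i ≠ j → ((LieModule.toEnd ℂ L L (e i)) ^ (1 - A i j).toNat) (e j) = 0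
  serre_f : ∀ i j, i ≠ j → ((LieModule.toEnd ℂ L L (f i)) ^ (1 - A i j).toNat) (f j) = 0

variable {R}

/-- The homomorphism from the free Lie algebra determined by the images of the generators. -/
def freeLift {L : Type*} [LieRing L] [LieAlgebra ℂ L] (h : H →ₗ[ℂ] L) (e f : Fin n → L) :
    FreeLieAlgebra ℂ (Gen n H) →ₗ⁅ℂ⁆ L :=
  FreeLieAlgebra.lift ℂ fun g => match g with
    | .h x => h x
    | .e i => e i
    | .f i => f i

theorem ChevalleyData.exists_hom {L : Type*} [LieRing L] [LieAlgebra ℂ L] {h : H →ₗ[ℂ] L}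
    {e f : Fin n → L} (D : ChevalleyData R h e f) :
    ∃ φ : KM R →ₗ⁅ℂ⁆ L, (∀ x, φ (cartan R x) = h x) ∧ (∀ i, φ (chevE R i) = e i) ∧
      ∀ i, φ (chevF R i) = f i := by
  have hh : ∀ x, freeLift h e f (FreeLieAlgebra.of ℂ (Gen.h x)) = h x :=
    fun x => FreeLieAlgebra.lift_of_apply _ (Gen.h x)
  have he : ∀ i, freeLift h e f (FreeLieAlgebra.of ℂ (Gen.e i)) = e i :=
    fun i => FreeLieAlgebra.lift_of_apply _ (Gen.e i)
  have hf : ∀ i, freeLift h e f (FreeLieAlgebra.of ℂ (Gen.f i)) = f i :=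
    fun i => FreeLieAlgebra.lift_of_apply _ (Gen.f i)
  have hle : relIdeal R ≤ (freeLift h e f).ker := by
    refine LieSubmodule.lieSpan_le.2 ?_
    rintro z hz
    rw [SetLike.mem_coe, LieHom.mem_ker]
    cases hz with
    | add x y => simp only [map_sub, hh, map_add]; abel
    | smul c x => simp only [map_sub, map_smul, hh, sub_self]
    | hh x y => rw [LieHom.map_lie, hh, hh, D.hh]
    | ef_same i => rw [map_sub, LieHom.map_lie, he, hf, hh, D.ef, if_pos rfl, sub_self]
    | ef_ne i j hij => rw [LieHom.map_lie, he, hf, D.ef, if_neg hij]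
    | he x i => rw [map_sub, LieHom.map_lie, map_smul, hh, he, D.he, sub_self]
    | hf x i => rw [map_add, LieHom.map_lie, map_smul, hh, hf, D.hf, neg_add_cancel]
    | serre_e i j hij =>
      refine (map_pow_ad (freeLift h e f) _ _ _).trans ?_
      rw [he, he, D.serre_e i j hij]
    | serre_f i j hij =>
      refine (map_pow_ad (freeLift h e f) _ _ _).trans ?_
      rw [hf, hf, D.serre_f i j hij]
  let g : KM R →ₗ[ℂ] L := (relIdeal R).toSubmodule.liftQ (freeLift h e f).toLinearMap
    (fun z hz => hle hz)
  have hg : ∀ z, g (KM.mk R z) = freeLift h e f z := fun z => rfl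
  refine ⟨{ g with map_lie' := ?_ }, fun x => (hg _).trans (hh x), fun i => (hg _).trans (he i),
    fun i => (hg _).trans (hf i)⟩
  intro x y
  obtain ⟨x, rfl⟩ := KM.mk_surjective R x
  obtain ⟨y, rfl⟩ := KM.mk_surjective R y
  change g ⁅KM.mk R x, KM.mk R y⁆ = ⁅g (KM.mk R x), g (KM.mk R y)⁆
  rw [← LieHom.map_lie, hg, hg, hg, LieHom.map_lie]

/-- The Kac-Moody algebra is generated by the Chevalley generators and `𝔥`. -/
theorem KM_induction {p : KM R → Prop} (h : ∀ x, p (cartan R x)) (e : ∀ i, p (chevE R i))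
    (f : ∀ i, p (chevF R i)) (zero : p 0) (add : ∀ x y, p x → p y → p (x + y))
    (smul : ∀ (c : ℂ) x, p x → p (c • x)) (lie : ∀ x y, p x → p y → p ⁅x, y⁆) (x : KM R) : p x := by
  let S : LieSubalgebra ℂ (KM R) :=
    { carrier := {x | p x}, add_mem' := fun ha hb => add _ _ ha hb, zero_mem' := zero,
      smul_mem' := fun c x hx => smul c x hx, lie_mem' := fun ha hb => lie _ _ ha hb }
  obtain ⟨z, rfl⟩ := KM.mk_surjective R x
  let φ : FreeLieAlgebra ℂ (Gen n H) →ₗ⁅ℂ⁆ S := FreeLieAlgebra.lift ℂ fun g => match g with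
    | .h x => ⟨cartan R x, h x⟩
    | .e i => ⟨chevE R i, e i⟩
    | .f i => ⟨chevF R i, f i⟩
  have hφ : S.incl.comp φ = KM.mk R := by
    apply FreeLieAlgebra.hom_ext
    intro g
    rw [LieHom.comp_apply, FreeLieAlgebra.lift_of_apply]
    cases g <;> rfl
  rw [← hφ]
  exact (φ z).2

/-- The Chevalley involution. -/
theorem exists_chevalley_involution (R : Realization A H) :
    ∃ ω : KM R →ₗ⁅ℂ⁆ KM R, (∀ x, ω (cartan R x) = -cartan R x) ∧
      (∀ i, ω (chevE R i) = -chevF R i) ∧ ∀ i, ω (chevF R i) = -chevE R i := by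
  have hpow : ∀ (x y : KM R) (k : ℕ), ((LieModule.toEnd ℂ (KM R) (KM R) x) ^ k) y = 0 →
      ((LieModule.toEnd ℂ (KM R) (KM R) (-x)) ^ k) (-y) = 0 := by
    intro x y k h
    rw [map_neg, map_neg, neg_pow, Module.End.mul_apply, h, map_zero, neg_zero]
  have D : ChevalleyData R (-cartan R) (fun i => -chevF R i) (fun i => -chevE R i) :=
    { hh := fun x y => by simp [cartan_lie_cartan]
      ef := fun i j => by
        rw [neg_lie, lie_neg, neg_neg, ← lie_skew, chevE_lie_chevF]
        by_cases h : i = j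
        · subst h; simp
        · rw [if_neg h, if_neg (Ne.symm h), neg_zero]
      he := fun x i => by simp [cartan_lie_chevF]
      hf := fun x i => by simp [cartan_lie_chevE]
      serre_e := fun i j hij => hpow _ _ _ (chevF_serre R i j hij)
      serre_f := fun i j hij => hpow _ _ _ (chevE_serre R i j hij) }
  obtain ⟨ω, h1, h2, h3⟩ := D.exists_hom
  exact ⟨ω, h1, h2, h3⟩

end KMLift

/-! ### The module of words modulo the Serre relations -/

section Model

variable {n : ℕ} {A : Matrix (Fin n) (Fin n) ℤ} {H : Type*} [AddCommGroup H] [Module ℂ H]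

/-- The space of words modulo the Serre relations. -/
abbrev Model (A : Matrix (Fin n) (Fin n) ℤ) : Type := Words n ⧸ serreSub A

/-- The operator `X'` on words modulo Serre relations is induced by the operator `X` on words. -/
def Descends (X : End ℂ (Words n)) (X' : End ℂ (Model A)) : Prop :=
  ∀ u, X' ((serreSub A).mkQ u) = (serreSub A).mkQ (X u)

theorem Descends.lie {X Y : End ℂ (Words n)} {X' Y' : End ℂ (Model A)} (hX : Descends X X')
    (hY : Descends Y Y') : Descends ⁅X, Y⁆ ⁅X', Y'⁆ := by
  intro u
  rw [LieRing.of_associative_ring_bracket, LieRing.of_associative_ring_bracket,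
    LinearMap.sub_apply, LinearMap.sub_apply, Module.End.mul_apply, Module.End.mul_apply,
    Module.End.mul_apply, Module.End.mul_apply, hY, hX, hX, hY, map_sub]

theorem Descends.pow_ad {X Y : End ℂ (Words n)} {X' Y' : End ℂ (Model A)} (hX : Descends X X')
    (hY : Descends Y Y') (k : ℕ) :
    Descends (((LieModule.toEnd ℂ (End ℂ (Words n)) (End ℂ (Words n)) X) ^ k) Y)
      (((LieModule.toEnd ℂ (End ℂ (Model A)) (End ℂ (Model A)) X') ^ k) Y') := by
  induction k with
  | zero => exact hY
  | succ k ih =>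
    rw [pow_succ', pow_succ', Module.End.mul_apply, Module.End.mul_apply,
      LieModule.toEnd_apply_apply, LieModule.toEnd_apply_apply]
    exact hX.lie ih

theorem Descends.eq {X Y : End ℂ (Words n)} {X' Y' : End ℂ (Model A)} (hX : Descends X X')
    (hY : Descends Y Y') (h : ∀ u, X u - Y u ∈ serreSub A) : X' = Y' := by
  ext u
  change X' ((serreSub A).mkQ u) = Y' ((serreSub A).mkQ u)
  rw [hX, hY, ← sub_eq_zero, ← map_sub]
  exact (Submodule.Quotient.mk_eq_zero _).2 (h u)

theorem exists_descends {X : End ℂ (Words n)} (h : ∀ u ∈ serreSub A, X u ∈ serreSub A) :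
    ∃ X' : End ℂ (Model A), Descends X X' :=
  ⟨(serreSub A).mapQ (serreSub A) X h, fun _ => rfl⟩

/-- This quotient is a Verma module made by hand and plays the part of the Poincaré–Birkhoff–Witt
theorem: it bounds the relations that can hold in `Verma R χ`. The Serre relations of the `e_i` hold
already on words, those of the `f_i` hold because they have been divided out. -/
theorem exists_model_action (hA : IsSymmetrizableGCM A) (R : Realization A H) (χ : Dual ℂ H) :
    ∃ ρ : KM R →ₗ⁅ℂ⁆ End ℂ (Model A), (∀ x, Descends (freeH R χ x) (ρ (cartan R x))) ∧
      (∀ i, Descends (freeE R χ i) (ρ (chevE R i))) ∧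
      (∀ i, Descends (freeF i) (ρ (chevF R i))) := by
  choose h' hh' using fun x => exists_descends (A := A)
    (fun u hu => (freeEH_mem_serreSub R χ hA hu).1 x)
  choose e he using fun i => exists_descends (A := A)
    (fun u hu => (freeEH_mem_serreSub R χ hA hu).2 i)
  choose f hf using fun i => exists_descends (A := A) (fun u hu => freeF_mem_serreSub i hu)
  have D0 : Descends (A := A) (0 : End ℂ (Words n)) 0 := fun u => by simp
  let h : H →ₗ[ℂ] End ℂ (Model A) :=
    { toFun := h'
      map_add' := fun x y => Descends.eq (X := freeH R χ (x + y))
        (Y := freeH R χ x + freeH R χ y) (hh' _)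
        (fun u => by rw [LinearMap.add_apply, hh', hh', LinearMap.add_apply, map_add])
        (fun u => by rw [freeH_add, sub_self]; exact zero_mem _)
      map_smul' := fun c x => Descends.eq (X := freeH R χ (c • x))
        (Y := c • freeH R χ x) (hh' _)
        (fun u => by rw [RingHom.id_apply, LinearMap.smul_apply, hh', LinearMap.smul_apply, map_smul])
        (fun u => by rw [freeH_smul, sub_self]; exact zero_mem _) }
  have hh : ∀ x, Descends (freeH R χ x) (h x) := hh'
  have D : ChevalleyData R h e f :=
    { hh := fun x y => ((hh x).lie (hh y)).eq D0
        (fun u => by rw [freeH_freeH, sub_self]; exact zero_mem _)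
      ef := fun i j => ((he i).lie (hf j)).eq
        (Y := if i = j then freeH R χ (R.coroot i) else 0)
        (by split_ifs; exacts [hh _, D0])
        (fun u => by rw [freeE_freeF, sub_self]; exact zero_mem _)
      he := fun x i => ((hh x).lie (he i)).eq (Y := R.root i x • freeE R χ i)
        (fun u => by rw [LinearMap.smul_apply, he, LinearMap.smul_apply, map_smul])
        (fun u => by rw [freeH_freeE, sub_self]; exact zero_mem _)
      hf := fun x i => ((hh x).lie (hf i)).eq (Y := -(R.root i x • freeF i))
        (fun u => by
          rw [LinearMap.neg_apply, LinearMap.smul_apply, hf, LinearMap.neg_apply,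
            LinearMap.smul_apply, map_neg, map_smul])
        (fun u => by rw [freeH_freeF, sub_self]; exact zero_mem _)
      serre_e := fun i j hij => ((he i).pow_ad (he j) _).eq D0
        (fun u => by rw [freeE_serre_eq_zero R χ hA i j hij, sub_self]; exact zero_mem _)
      serre_f := fun i j hij => ((hf i).pow_ad (hf j) _).eq D0
        (fun u => by
          rw [LinearMap.zero_apply, sub_zero]
          exact freeSerre_mem_serreSub i j hij u) }
  obtain ⟨ρ, h1, h2, h3⟩ := D.exists_hom
  exact ⟨ρ, fun x => by rw [h1]; exact hh x, fun x => by rw [h2]; exact he x,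
    fun x => by rw [h3]; exact hf x⟩

/-- On the empty word `cartan R x` acts by `χ x`, the empty word is nonzero in the quotient, and `χ`
is arbitrary. -/
theorem cartan_injective (hA : IsSymmetrizableGCM A) (R : Realization A H) :
    Function.Injective (cartan R) := by
  rw [injective_iff_map_eq_zero]
  intro x hx
  rw [← Module.forall_dual_apply_eq_zero_iff ℂ x]
  intro χ
  obtain ⟨ρ, h1, -, -⟩ := exists_model_action hA R χ
  have := h1 x (word [])
  rw [hx, map_zero, LinearMap.zero_apply, freeH_word, map_smul] at this
  simpa [wordWt, word_nil_notMem_serreSub] using this.symm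

/-- The linear map from words to an algebra determined by the images of the letters. -/
def evalWord {B : Type*} [Ring B] [Algebra ℂ B] (φ : Fin n → B) : Words n →ₗ[ℂ] B :=
  word.constr ℂ fun w => (w.map φ).prod

@[simp] theorem evalWord_word {B : Type*} [Ring B] [Algebra ℂ B] (φ : Fin n → B)
    (w : List (Fin n)) : evalWord φ (word w) = (w.map φ).prod :=
  word.constr_basis ℂ _ w

theorem evalWord_freeF {B : Type*} [Ring B] [Algebra ℂ B] (φ : Fin n → B) (j : Fin n)
    (u : Words n) : evalWord φ (freeF j u) = φ j * evalWord φ u := by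
  have : evalWord φ ∘ₗ freeF j = LinearMap.mulLeft ℂ (φ j) ∘ₗ evalWord φ := by
    apply word.ext
    intro w
    simp
  exact LinearMap.congr_fun this u

/-- The elements `φ i` of an associative algebra satisfy the Serre relations. -/
def SatisfiesSerre (A : Matrix (Fin n) (Fin n) ℤ) {B : Type*} [LieRing B] [LieAlgebra ℂ B]
    (φ : Fin n → B) : Prop :=
  ∀ i j, i ≠ j → ((LieModule.toEnd ℂ B B (φ i)) ^ (1 - A i j).toNat) (φ j) = 0

/-- Evaluation turns `freeF j` into left multiplication by `φ j`, hence `freeSerre` into left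
multiplication by the Serre element of the `φ i`. -/
theorem evalWord_eq_zero {B : Type*} [Ring B] [Algebra ℂ B] {φ : Fin n → B}
    (h : SatisfiesSerre A φ) {u : Words n} (hu : u ∈ serreSub A) : evalWord φ u = 0 := by
  have hle : serreSub A ≤ LinearMap.ker (evalWord φ) := by
    apply serreSub_le
    · intro i j hij u
      have key : ∀ (k : ℕ) (u : Words n),
          evalWord φ ((((LieModule.toEnd ℂ (End ℂ (Words n)) (End ℂ (Words n)) (freeF i)) ^ k)
            (freeF j)) u) = (((LieModule.toEnd ℂ B B (φ i)) ^ k) (φ j)) * evalWord φ u := by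
        intro k
        induction k with
        | zero => exact fun u => evalWord_freeF φ j u
        | succ k ih =>
          intro u
          rw [pow_succ', pow_succ', Module.End.mul_apply, Module.End.mul_apply,
            LieModule.toEnd_apply_apply, LieModule.toEnd_apply_apply,
            LieRing.of_associative_ring_bracket, LieRing.of_associative_ring_bracket,
            LinearMap.sub_apply, Module.End.mul_apply, Module.End.mul_apply, map_sub, ih,
            evalWord_freeF, evalWord_freeF, ih, sub_mul, mul_assoc, mul_assoc]
      rw [LinearMap.mem_ker, freeSerre, key, h i j hij, zero_mul]
    · intro j u hu
      rw [LinearMap.mem_ker] at hu ⊢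
      rw [evalWord_freeF, hu, mul_zero]
  exact hle hu

end Model

/-! ### Enveloping algebra of `𝔫_-` and freeness of Verma modules -/

section Enveloping

variable {n : ℕ} {A : Matrix (Fin n) (Fin n) ℤ} {H : Type*} [AddCommGroup H] [Module ℂ H]
  {R : Realization A H}

@[elab_as_elim]
theorem nMinus_induction {p : nMinus R → Prop} (f : ∀ i, p (nF R i)) (zero : p 0)
    (add : ∀ x y, p x → p y → p (x + y)) (smul : ∀ (c : ℂ) x, p x → p (c • x))
    (lie : ∀ x y, p x → p y → p ⁅x, y⁆) (x : nMinus R) : p x := by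
  obtain ⟨x, hx⟩ := x
  induction hx using LieSubalgebra.lieSpan_induction with
  | mem x h => obtain ⟨i, rfl⟩ := h; exact f i
  | zero => exact zero
  | add x y hx hy h1 h2 => exact add _ _ h1 h2
  | smul c x hx h => exact smul c _ h
  | lie x y hx hy h1 h2 => exact lie _ _ h1 h2

@[elab_as_elim]
theorem nPlus_induction {p : nPlus R → Prop} (e : ∀ i, p (nE R i)) (zero : p 0)
    (add : ∀ x y, p x → p y → p (x + y)) (smul : ∀ (c : ℂ) x, p x → p (c • x))
    (lie : ∀ x y, p x → p y → p ⁅x, y⁆) (x : nPlus R) : p x := by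
  obtain ⟨x, hx⟩ := x
  induction hx using LieSubalgebra.lieSpan_induction with
  | mem x h => obtain ⟨i, rfl⟩ := h; exact e i
  | zero => exact zero
  | add x y hx hy h1 h2 => exact add _ _ h1 h2
  | smul c x hx h => exact smul c _ h
  | lie x y hx hy h1 h2 => exact lie _ _ h1 h2

/-- The homomorphism to `S` induced by `ι`, followed by the inclusion of `S`, is the identity on
generators and so everywhere. -/
theorem uea_subalgebra_eq_top {L : Type*} [LieRing L] [LieAlgebra ℂ L]
    {S : Subalgebra ℂ (UniversalEnvelopingAlgebra ℂ L)}
    (h : ∀ x : L, UniversalEnvelopingAlgebra.ι ℂ x ∈ S) (a : UniversalEnvelopingAlgebra ℂ L) :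
    a ∈ S := by
  let φ : L →ₗ⁅ℂ⁆ S :=
    { toFun := fun x => ⟨UniversalEnvelopingAlgebra.ι ℂ x, h x⟩
      map_add' := fun x y => Subtype.ext (map_add _ x y)
      map_smul' := fun c x => Subtype.ext (map_smul _ c x)
      map_lie' := fun {x y} => Subtype.ext (LieHom.map_lie _ x y) }
  have : S.val.comp (UniversalEnvelopingAlgebra.lift ℂ φ) = AlgHom.id ℂ _ := by
    apply UniversalEnvelopingAlgebra.hom_ext
    ext x
    change ((UniversalEnvelopingAlgebra.lift ℂ φ (UniversalEnvelopingAlgebra.ι ℂ x) : S) :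
      UniversalEnvelopingAlgebra ℂ L) = _
    rw [UniversalEnvelopingAlgebra.lift_ι_apply]
    rfl
  have h2 := DFunLike.congr_fun this a
  rw [AlgHom.id_apply] at h2
  rw [← h2]
  exact (UniversalEnvelopingAlgebra.lift ℂ φ a).2

variable (R) in
/-- The generator `f_i` in `U(𝔫_-)`. -/
def uF (i : Fin n) : UniversalEnvelopingAlgebra ℂ (nMinus R) :=
  UniversalEnvelopingAlgebra.ι ℂ (nF R i)

theorem evalWord_uF_surjective : Function.Surjective (evalWord (uF R)) := by
  -- The elements whose left multiplication preserves the range form a subalgebra containing `𝔫_-`.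
  -- Applying an arbitrary element to the value `1` of the empty word then gives surjectivity.
  let S : Subalgebra ℂ (UniversalEnvelopingAlgebra ℂ (nMinus R)) :=
    { carrier := {a | ∀ b ∈ LinearMap.range (evalWord (uF R)), a * b ∈ LinearMap.range
        (evalWord (uF R))}
      mul_mem' := fun {a a'} ha ha' b hb => by rw [mul_assoc]; exact ha _ (ha' _ hb)
      add_mem' := fun {a a'} ha ha' b hb => by rw [add_mul]; exact add_mem (ha _ hb) (ha' _ hb)
      algebraMap_mem' := fun c b hb => by
        rw [← Algebra.smul_def]; exact Submodule.smul_mem _ c hb }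
  have hS : ∀ x : nMinus R, UniversalEnvelopingAlgebra.ι ℂ x ∈ S := by
    intro x
    induction x using nMinus_induction with
    | f i =>
      rintro _ ⟨u, rfl⟩
      exact ⟨freeF i u, evalWord_freeF _ _ _⟩
    | zero => rw [map_zero]; exact zero_mem S
    | add x y hx hy => rw [map_add]; exact add_mem hx hy
    | smul c x hx => rw [map_smul]; exact S.smul_mem hx c
    | lie x y hx hy =>
      rw [LieHom.map_lie, LieRing.of_associative_ring_bracket]
      exact sub_mem (mul_mem hx hy) (mul_mem hy hx)
  intro a
  have := uea_subalgebra_eq_top hS a 1 ⟨word [], by simp⟩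
  rwa [mul_one] at this

theorem uIncl_ι (x : nMinus R) : uIncl R (UniversalEnvelopingAlgebra.ι ℂ x) =
    UniversalEnvelopingAlgebra.ι ℂ (x : KM R) := by
  rw [uIncl, UniversalEnvelopingAlgebra.lift_ι_apply]
  rfl

variable (R) in
/-- The linear combination of words in the `f_i`, applied to the highest weight vector. -/
def vermaWord (χ : Dual ℂ H) : Words n →ₗ[ℂ] Verma R χ :=
  ((LinearMap.toSpanSingleton (UKM R) (Verma R χ) (hwv R χ)).restrictScalars ℂ) ∘ₗ
    (uIncl R).toLinearMap ∘ₗ evalWord (uF R)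

theorem vermaWord_apply (χ : Dual ℂ H) (u : Words n) :
    vermaWord R χ u = uIncl R (evalWord (uF R) u) • hwv R χ := rfl

theorem vermaWord_nil (χ : Dual ℂ H) : vermaWord R χ (word []) = hwv R χ := by
  simp [vermaWord_apply]

theorem ι_smul_verma (χ : Dual ℂ H) (x : nMinus R) (a : UniversalEnvelopingAlgebra ℂ (nMinus R))
    (m : Verma R χ) :
    uIncl R (UniversalEnvelopingAlgebra.ι ℂ x * a) • m = ⁅(x : KM R), uIncl R a • m⁆ := by
  rw [map_mul, mul_smul, uIncl_ι, verma_lie_def]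

theorem vermaWord_freeF (χ : Dual ℂ H) (j : Fin n) (u : Words n) :
    vermaWord R χ (freeF j u) = ⁅chevF R j, vermaWord R χ u⁆ := by
  rw [vermaWord_apply, evalWord_freeF, uF, ι_smul_verma]
  rfl

theorem smul_hwv (χ : Dual ℂ H) (z : UKM R) : z • hwv R χ = (vermaIdeal R χ).mkQ z := by
  rw [hwv]
  change (vermaIdeal R χ).mkQ (z • 1) = _
  rw [smul_eq_mul, mul_one]

theorem cartan_lie_hwv (χ : Dual ℂ H) (x : H) : ⁅cartan R x, hwv R χ⁆ = χ x • hwv R χ := by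
  rw [verma_lie_def, ← algebraMap_smul (UKM R) (χ x), ← sub_eq_zero, ← sub_smul, smul_hwv]
  exact (Submodule.Quotient.mk_eq_zero _).2 (Submodule.subset_span (Or.inr ⟨x, rfl⟩))

theorem nPlus_lie_hwv (χ : Dual ℂ H) (x : nPlus R) : ⁅(x : KM R), hwv R χ⁆ = 0 := by
  rw [verma_lie_def, smul_hwv]
  exact (Submodule.Quotient.mk_eq_zero _).2 (Submodule.subset_span (Or.inl ⟨x, x.2, rfl⟩))

theorem vermaWord_freeH (χ : Dual ℂ H) (x : H) (u : Words n) :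
    vermaWord R χ (freeH R χ x u) = ⁅cartan R x, vermaWord R χ u⁆ := by
  have : vermaWord R χ ∘ₗ freeH R χ x =
      LieModule.toEnd ℂ (KM R) (Verma R χ) (cartan R x) ∘ₗ vermaWord R χ := by
    apply word.ext
    intro w
    induction w with
    | nil => simp [vermaWord_nil, cartan_lie_hwv, wordWt]
    | cons j w ih =>
      rw [LinearMap.comp_apply, LinearMap.comp_apply, ← freeF_word, apply_apply_of_lie, freeH_freeF,
        vermaWord_freeF, map_add, LieModule.toEnd_apply_apply, leibniz_lie, cartan_lie_chevF,
        vermaWord_freeF]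
      rw [LinearMap.comp_apply, LinearMap.comp_apply, LieModule.toEnd_apply_apply] at ih
      rw [ih, LinearMap.neg_apply, LinearMap.smul_apply, map_neg, map_smul, vermaWord_freeF,
        neg_lie, smul_lie]
  exact LinearMap.congr_fun this u

theorem vermaWord_freeE (χ : Dual ℂ H) (i : Fin n) (u : Words n) :
    vermaWord R χ (freeE R χ i u) = ⁅chevE R i, vermaWord R χ u⁆ := by
  have : vermaWord R χ ∘ₗ freeE R χ i =
      LieModule.toEnd ℂ (KM R) (Verma R χ) (chevE R i) ∘ₗ vermaWord R χ := by
    apply word.ext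
    intro w
    induction w with
    | nil =>
      rw [LinearMap.comp_apply, LinearMap.comp_apply, freeE_word, freeEWord, map_zero,
        vermaWord_nil]
      exact (nPlus_lie_hwv χ (nE R i)).symm
    | cons j w ih =>
      rw [LinearMap.comp_apply, LinearMap.comp_apply, ← freeF_word, apply_apply_of_lie, freeE_freeF,
        vermaWord_freeF, map_add, LieModule.toEnd_apply_apply, leibniz_lie, chevE_lie_chevF,
        vermaWord_freeF]
      rw [LinearMap.comp_apply, LinearMap.comp_apply, LieModule.toEnd_apply_apply] at ih
      rw [ih]
      split_ifs
      · rw [vermaWord_freeH]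
      · simp
  exact LinearMap.congr_fun this u

/-- The range is stable under the Chevalley generators and `𝔥`, because `freeF`, `freeE` and `freeH`
mirror their action. It is therefore stable under `U(𝔤)`, and it contains the highest weight vector.
-/
theorem vermaWord_surjective (χ : Dual ℂ H) : Function.Surjective (vermaWord R χ) := by
  let P := LinearMap.range (vermaWord R χ)
  have hP : ∀ x : KM R, ∀ m ∈ P, ⁅x, m⁆ ∈ P := by
    intro x
    induction x using KM_induction with
    | h x => rintro _ ⟨u, rfl⟩; exact ⟨_, vermaWord_freeH χ x u⟩
    | e i => rintro _ ⟨u, rfl⟩; exact ⟨_, vermaWord_freeE χ i u⟩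
    | f i => rintro _ ⟨u, rfl⟩; exact ⟨_, vermaWord_freeF χ i u⟩
    | zero => intro m _; rw [zero_lie]; exact zero_mem P
    | add x y hx hy => intro m hm; rw [add_lie]; exact add_mem (hx m hm) (hy m hm)
    | smul c x hx => intro m hm; rw [smul_lie]; exact P.smul_mem c (hx m hm)
    | lie x y hx hy =>
      intro m hm; rw [lie_lie]; exact sub_mem (hx _ (hy m hm)) (hy _ (hx m hm))
  let S : Subalgebra ℂ (UKM R) :=
    { carrier := {a | ∀ m ∈ P, a • m ∈ P}
      mul_mem' := fun {a a'} ha ha' b hb => by rw [mul_smul]; exact ha _ (ha' _ hb)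
      add_mem' := fun {a a'} ha ha' b hb => by rw [add_smul]; exact add_mem (ha _ hb) (ha' _ hb)
      algebraMap_mem' := fun c b hb => by
        rw [algebraMap_smul]; exact Submodule.smul_mem _ c hb }
  intro m
  obtain ⟨z, rfl⟩ := (vermaIdeal R χ).mkQ_surjective m
  rw [← smul_hwv]
  exact uea_subalgebra_eq_top (S := S) hP z _ ⟨_, vermaWord_nil χ⟩

/-- The model module receives a map from the Verma module taking the highest weight vector to the
empty word. Composed with `vermaWord` this map is the quotient by `serreSub`. -/
theorem mem_serreSub_of_vermaWord_eq_zero (hA : IsSymmetrizableGCM A) {χ : Dual ℂ H} {u : Words n}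
    (hu : vermaWord R χ u = 0) : u ∈ serreSub A := by
  obtain ⟨ρ, hρh, hρe, hρf⟩ := exists_model_action hA R χ
  let v : Model A := (serreSub A).mkQ (word [])
  let ρ' : UKM R →ₐ[ℂ] End ℂ (Model A) := UniversalEnvelopingAlgebra.lift ℂ ρ
  have hρ' : ∀ x : KM R, ρ' (UniversalEnvelopingAlgebra.ι ℂ x) = ρ x :=
    UniversalEnvelopingAlgebra.lift_ι_apply ℂ ρ
  let ev : UKM R →ₗ[ℂ] Model A := LinearMap.applyₗ v ∘ₗ ρ'.toLinearMap
  have hev : ∀ z, ev z = ρ' z v := fun z => rfl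
  have hplus : ∀ x : nPlus R, ρ x v = 0 := by
    intro x
    induction x using nPlus_induction with
    | e i =>
      change ρ (chevE R i) ((serreSub A).mkQ (word [])) = 0
      rw [hρe, freeE_word, freeEWord, map_zero]
    | zero => simp
    | add x y hx hy => 
      change ρ ((x : KM R) + y) v = 0
      rw [map_add, LinearMap.add_apply, hx, hy, add_zero]
    | smul c x hx => 
      change ρ (c • (x : KM R)) v = 0
      rw [map_smul, LinearMap.smul_apply, hx, smul_zero]
    | lie x y hx hy =>
      rw [LieSubalgebra.coe_bracket, LieHom.map_lie, LieRing.of_associative_ring_bracket,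
        LinearMap.sub_apply, Module.End.mul_apply, Module.End.mul_apply, hx, hy, map_zero,
        map_zero, sub_zero]
  have hker : ∀ z ∈ vermaIdeal R χ, ev z = 0 := by
    intro z hz
    induction hz using Submodule.span_induction with
    | mem z hz =>
      rw [hev]
      rcases hz with ⟨x, hx, rfl⟩ | ⟨x, rfl⟩
      · rw [hρ']; exact hplus ⟨x, hx⟩
      · rw [map_sub, hρ', AlgHom.commutes, LinearMap.sub_apply, Module.algebraMap_end_apply,
          hρh, freeH_word, map_smul]
        simp [wordWt, v]
    | zero => exact map_zero ev
    | add x y _ _ hx hy => rw [map_add, hx, hy, add_zero]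
    | smul a x _ hx => rw [hev, smul_eq_mul, map_mul, Module.End.mul_apply, ← hev, hx, map_zero]
  let L : Verma R χ →ₗ[ℂ] Model A := ((vermaIdeal R χ).restrictScalars ℂ).liftQ ev hker
  have hL : ∀ z : UKM R, L (z • hwv R χ) = ρ' z v := by
    intro z
    rw [smul_hwv]
    rfl
  have hLw : L ∘ₗ vermaWord R χ = (serreSub A).mkQ := by
    apply word.ext
    intro w
    rw [LinearMap.comp_apply, vermaWord_apply, hL]
    induction w with
    | nil => simp [v]
    | cons j w ih =>
      rw [← freeF_word, evalWord_freeF, uF, map_mul, uIncl_ι, map_mul, hρ', Module.End.mul_apply, ih]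
      exact hρf j _
  have h2 := LinearMap.congr_fun hLw u
  rw [LinearMap.comp_apply, hu, map_zero] at h2
  exact (Submodule.Quotient.mk_eq_zero _).1 h2.symm

theorem satisfiesSerre_map {L B : Type*} [LieRing L] [LieAlgebra ℂ L] [LieRing B] [LieAlgebra ℂ B]
    (φ : L →ₗ⁅ℂ⁆ B) {f : Fin n → L} (hf : SatisfiesSerre A f) :
    SatisfiesSerre A (fun i => φ (f i)) := by
  intro i j hij
  rw [← map_pow_ad, hf i j hij, map_zero]

variable (R) in
theorem satisfiesSerre_nF : SatisfiesSerre A (nF R) := by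
  intro i j hij
  have := map_pow_ad (nMinus R).incl (nF R i) (nF R j) (1 - A i j).toNat
  apply Subtype.ext
  exact this.trans (chevF_serre R i j hij)

/-- An element of `U(𝔫_-)` that vanishes kills a highest weight vector, which puts the combination
of words in `serreSub`. The weight `0` used for this is immaterial. -/
theorem evalWord_uF_eq_zero_iff (hA : IsSymmetrizableGCM A) {u : Words n} :
    evalWord (uF R) u = 0 ↔ u ∈ serreSub A := by
  refine ⟨fun h => mem_serreSub_of_vermaWord_eq_zero (R := R) (χ := 0) hA ?_, fun h =>
    evalWord_eq_zero (satisfiesSerre_map (UniversalEnvelopingAlgebra.ι ℂ) (satisfiesSerre_nF R)) h⟩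
  rw [vermaWord_apply, h, map_zero, zero_smul]

/-- Verma modules are free over `U(𝔫_-)`. -/
theorem verma_free (hA : IsSymmetrizableGCM A) (χ : Dual ℂ H)
    {a : UniversalEnvelopingAlgebra ℂ (nMinus R)} (ha : uIncl R a • hwv R χ = 0) : a = 0 := by
  obtain ⟨u, rfl⟩ := evalWord_uF_surjective a
  rw [evalWord_uF_eq_zero_iff hA]
  exact mem_serreSub_of_vermaWord_eq_zero hA ha

theorem verma_generated (χ : Dual ℂ H) (m : Verma R χ) :
    ∃ a : UniversalEnvelopingAlgebra ℂ (nMinus R), m = uIncl R a • hwv R χ := by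
  obtain ⟨u, rfl⟩ := vermaWord_surjective χ m
  exact ⟨_, vermaWord_apply χ u⟩

/-- The linear isomorphism `U(𝔫_-) ≃ M_χ`. -/
def vermaEquiv (hA : IsSymmetrizableGCM A) (χ : Dual ℂ H) :
    UniversalEnvelopingAlgebra ℂ (nMinus R) ≃ₗ[ℂ] Verma R χ :=
  LinearEquiv.ofBijective
    (((LinearMap.toSpanSingleton (UKM R) (Verma R χ) (hwv R χ)).restrictScalars ℂ) ∘ₗ
      (uIncl R).toLinearMap)
    ⟨(injective_iff_map_eq_zero _).2 fun _ h => verma_free hA χ h,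
      fun m => (verma_generated χ m).imp fun _ h => h.symm⟩

theorem vermaEquiv_apply (hA : IsSymmetrizableGCM A) (χ : Dual ℂ H)
    (a : UniversalEnvelopingAlgebra ℂ (nMinus R)) :
    vermaEquiv hA χ a = uIncl R a • hwv R χ := rfl

/-- The universal property of `U(𝔫_-)`: it is presented by the Serre relations. -/
theorem exists_uea_hom (hA : IsSymmetrizableGCM A) (R : Realization A H) {B : Type*} [Ring B]
    [Algebra ℂ B] {φ : Fin n → B}
    (hφ : SatisfiesSerre A φ) :
    ∃ g : UniversalEnvelopingAlgebra ℂ (nMinus R) →ₐ[ℂ] B, ∀ i, g (uF R i) = φ i := by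
  have hs := evalWord_uF_surjective (R := R)
  let E := (evalWord (uF R)).quotKerEquivOfSurjective hs
  have hle : LinearMap.ker (evalWord (uF R)) ≤ LinearMap.ker (evalWord φ) :=
    fun u hu => evalWord_eq_zero hφ ((evalWord_uF_eq_zero_iff hA).1 hu)
  let g : UniversalEnvelopingAlgebra ℂ (nMinus R) →ₗ[ℂ] B :=
    (LinearMap.ker (evalWord (uF R))).liftQ (evalWord φ) hle ∘ₗ E.symm.toLinearMap
  have hg : ∀ u, g (evalWord (uF R) u) = evalWord φ u := by
    intro u
    have : E.symm (evalWord (uF R) u) = (LinearMap.ker (evalWord (uF R))).mkQ u := by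
      rw [LinearEquiv.symm_apply_eq]
      rfl
    change (LinearMap.ker (evalWord (uF R))).liftQ (evalWord φ) hle (E.symm _) = _
    rw [this]
    rfl
  have hone : g 1 = 1 := by
    have := hg (word [])
    simpa using this
  -- Multiplicativity is tested with a word as left factor, removing one letter at a time.
  have hmulw : ∀ (w : List (Fin n)) u, g (evalWord (uF R) (word w) * evalWord (uF R) u) =
      evalWord φ (word w) * evalWord φ u := by
    intro w
    induction w with
    | nil => intro u; simp [hg]
    | cons j w ih =>
      intro u
      obtain ⟨u', hu'⟩ := hs (evalWord (uF R) (word w) * evalWord (uF R) u)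
      rw [← freeF_word, evalWord_freeF, evalWord_freeF, mul_assoc, ← hu', ← evalWord_freeF, hg,
        evalWord_freeF, ← hg, hu', ih, mul_assoc]
  have hmul : ∀ a b, g (a * b) = g a * g b := by
    intro a b
    obtain ⟨u, rfl⟩ := hs a
    obtain ⟨u', rfl⟩ := hs b
    have : g ∘ₗ LinearMap.mulRight ℂ (evalWord (uF R) u') ∘ₗ evalWord (uF R) =
        LinearMap.mulRight ℂ (evalWord φ u') ∘ₗ evalWord φ := by
      apply word.ext
      intro w
      exact hmulw w u'
    rw [hg, hg]
    exact LinearMap.congr_fun this u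
  refine ⟨AlgHom.ofLinearMap g hone hmul, fun i => ?_⟩
  have := hg (word [i])
  simpa using this

end Enveloping

/-! ### Weight decompositions -/

section Weights

/-- Splitting off the spanning vectors outside `E k` leaves a difference lying both in `E k` and in
the sum of the other components, hence zero. This isolates vectors of a given height or weight
without first producing a direct sum decomposition. -/
theorem mem_span_of_iSupIndep {M : Type*} [AddCommGroup M] [Module ℂ M] {ι κ : Type*}
    {E : κ → Submodule ℂ M} (hE : iSupIndep E) {v : ι → M} {c : ι → κ} (hv : ∀ i, v i ∈ E (c i))
    {x : M} {k : κ} (hx : x ∈ E k) (hx' : x ∈ Submodule.span ℂ (Set.range v)) :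
    x ∈ Submodule.span ℂ (v '' {i | c i = k}) := by
  have hu : Set.range v = v '' {i | c i = k} ∪ v '' {i | c i ≠ k} := by
    rw [← Set.image_union, ← Set.image_univ]
    congr 1
    ext i
    simp [em]
  rw [hu, Submodule.span_union, Submodule.mem_sup] at hx'
  obtain ⟨y, hy, z, hz, rfl⟩ := hx'
  have hyE : y ∈ E k := by
    refine Submodule.span_le.2 ?_ hy
    rintro _ ⟨i, hi, rfl⟩
    exact hi ▸ hv i
  have hz1 : z ∈ E k := by simpa using sub_mem hx hyE
  have hz2 : z ∈ ⨆ (j) (_ : j ≠ k), E j := by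
    refine Submodule.span_le.2 ?_ hz
    rintro _ ⟨i, hi, rfl⟩
    exact Submodule.mem_iSup_of_mem (c i) (Submodule.mem_iSup_of_mem hi (hv i))
  have := (hE k).le_bot ⟨hz1, hz2⟩
  rw [Submodule.mem_bot] at this
  rwa [this, add_zero]

variable {n : ℕ} {A : Matrix (Fin n) (Fin n) ℤ} {H : Type*} [AddCommGroup H] [Module ℂ H]
  {R : Realization A H}

theorem lie_mem_wtSpace {M : Type*} [AddCommGroup M] [Module ℂ M] [LieRingModule (KM R) M]
    [LieModule ℂ (KM R) M] {γ χ : Dual ℂ H} {x : KM R} (hx : x ∈ wtSpace R (KM R) γ) {m : M}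
    (hm : m ∈ wtSpace R M χ) : ⁅x, m⁆ ∈ wtSpace R M (γ + χ) := by
  intro z
  rw [leibniz_lie, hx z, hm z, smul_lie, lie_smul, ← add_smul]
  rfl

/-- The operators of `𝔥` commute, so their simultaneous generalized eigenspaces are independent, and
the weight spaces lie inside these. -/
theorem iSupIndep_wtSpace (R : Realization A H) (M : Type*) [AddCommGroup M] [Module ℂ M]
    [LieRingModule (KM R) M] [LieModule ℂ (KM R) M] : iSupIndep (wtSpace R M) := by
  let f : H → End ℂ M := fun x => LieModule.toEnd ℂ (KM R) M (cartan R x)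
  have hcomm : ∀ x y, Commute (f x) (f y) := by
    intro x y
    rw [commute_iff_lie_eq, ← LieHom.map_lie, cartan_lie_cartan, map_zero]
  have h1 := Module.End.independent_iInf_maxGenEigenspace_of_forall_mapsTo f
    (fun i j φ => Module.End.mapsTo_maxGenEigenspace_of_comm (hcomm j i) φ)
  have h2 : iSupIndep fun χ : Dual ℂ H => ⨅ i, (f i).maxGenEigenspace (χ i) :=
    h1.comp DFunLike.coe_injective
  refine h2.mono fun χ m hm => ?_
  rw [Submodule.mem_iInf]
  intro x
  exact Module.End.mem_maxGenEigenspace _ _ _ |>.2 ⟨1, by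
    rw [pow_one, LinearMap.sub_apply, LieModule.toEnd_apply_apply, hm x]; simp⟩

section Proj

variable {M : Type*} [AddCommGroup M] [Module ℂ M] [LieRingModule (KM R) M]
  [LieModule ℂ (KM R) M]

theorem isCompl_wtSpace (hM : ⨆ χ : Dual ℂ H, wtSpace R M χ = ⊤) (χ : Dual ℂ H) :
    IsCompl (wtSpace R M χ) (⨆ (χ' : Dual ℂ H) (_ : χ' ≠ χ), wtSpace R M χ') := by
  refine ⟨iSupIndep_wtSpace R M χ, ?_⟩
  rw [codisjoint_iff, eq_top_iff, ← hM]
  refine iSup_le fun χ' => ?_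
  by_cases h : χ' = χ
  · subst h; exact le_sup_left
  · exact le_sup_of_le_right (le_iSup₂_of_le χ' h le_rfl)

theorem wtProj_of_mem (hM : ⨆ χ : Dual ℂ H, wtSpace R M χ = ⊤) {χ : Dual ℂ H} {m : M}
    (hm : m ∈ wtSpace R M χ) : wtProj R M χ m = ⟨m, hm⟩ := by
  rw [wtProj, dif_pos (isCompl_wtSpace hM χ)]
  exact Submodule.projectionOnto_apply_of_mem_left _ hm

theorem wtProj_of_mem_ne (hM : ⨆ χ : Dual ℂ H, wtSpace R M χ = ⊤) {χ χ' : Dual ℂ H}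
    (h : χ' ≠ χ) {m : M} (hm : m ∈ wtSpace R M χ') : wtProj R M χ m = 0 := by
  rw [wtProj, dif_pos (isCompl_wtSpace hM χ)]
  exact Submodule.projectionOnto_apply_of_mem_right _
    (Submodule.mem_iSup_of_mem χ' (Submodule.mem_iSup_of_mem h hm))

end Proj

end Weights

/-! ### Structure of the Kac-Moody algebra -/

section Structure

variable {n : ℕ} {A : Matrix (Fin n) (Fin n) ℤ} {H : Type*} [AddCommGroup H] [Module ℂ H]
  (R : Realization A H)

/-- Linear independence of the simple roots gives a functional on their span, which extends to `𝔥^*`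
and is evaluation at a vector since `𝔥` is finite dimensional. With all values `1` this yields the
principal grading, which often replaces the full weight grading below. -/
theorem exists_root_eq (c : Fin n → ℂ) : ∃ x : H, ∀ i, R.root i x = c i := by
  have := R.finiteDimensional
  obtain ⟨g, hg⟩ := LinearMap.exists_extend
    (Finsupp.linearCombination ℂ c ∘ₗ R.root_linearIndependent.repr)
  refine ⟨(Module.evalEquiv ℂ H).symm g, fun i => ?_⟩
  have h1 : R.root i ((Module.evalEquiv ℂ H).symm g) = g (R.root i) :=
    Module.apply_evalEquiv_symm_apply _ _ _ _
  have h2 := LinearMap.congr_fun hg ⟨R.root i, Submodule.subset_span ⟨i, rfl⟩⟩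
  rw [LinearMap.comp_apply, LinearMap.comp_apply] at h2
  rw [h1]
  refine h2.trans ?_
  change Finsupp.linearCombination ℂ c (R.root_linearIndependent.repr _) = _
  rw [R.root_linearIndependent.repr_eq_single i _ rfl, Finsupp.linearCombination_single, one_smul]

/-- An element of `𝔥` on which all simple roots take the value `1`. -/
def gradElt : H := (exists_root_eq R fun _ => 1).choose

theorem root_gradElt (i : Fin n) : R.root i (gradElt R) = 1 :=
  (exists_root_eq R fun _ => 1).choose_spec i

theorem posLattice_gradElt (β : Fin n → ℕ) :
    posLattice R β (gradElt R) = ((∑ i, β i : ℕ) : ℂ) := by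
  simp [posLattice, LinearMap.sum_apply, root_gradElt]

theorem posLattice_add (β β' : Fin n → ℕ) :
    posLattice R (β + β') = posLattice R β + posLattice R β' := by
  simp [posLattice, add_smul, Finset.sum_add_distrib]

theorem posLattice_single (i : Fin n) : posLattice R (Pi.single i 1) = R.root i := by
  rw [posLattice, Finset.sum_eq_single i]
  · simp
  · intro j _ hj; simp [hj]
  · simp

variable {R}

/-- The height of a positive root. -/
def ht (α : posRoots R) : ℕ := ∑ i, α.2.choose i

theorem root_eq_posLattice (α : posRoots R) : (α : Dual ℂ H) = posLattice R α.2.choose :=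
  α.2.choose_spec.2.1

/-- The height was defined through chosen coordinates; this ties it to the root itself and makes
heights visible as eigenvalues. -/
theorem posRoots_gradElt (α : posRoots R) : (α : Dual ℂ H) (gradElt R) = ht α := by
  conv_lhs => rw [root_eq_posLattice α, posLattice_gradElt]
  rfl

theorem ht_pos (α : posRoots R) : 0 < ht α := by
  rw [ht, Finset.sum_pos_iff]
  by_contra! h
  exact α.2.choose_spec.1 (funext fun i => Nat.le_zero.1 (h i (Finset.mem_univ i)))

theorem finite_ht_le (K : ℕ) : {α : posRoots R | ht α ≤ K}.Finite := by
  have h : {α : posRoots R | ht α ≤ K} ⊆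
      (fun α : posRoots R => (α.2.choose : Fin n → ℕ)) ⁻¹' Set.Iic (fun _ => K) := by
    intro α hα i
    exact (Finset.single_le_sum (f := α.2.choose) (fun _ _ => Nat.zero_le _)
      (Finset.mem_univ i)).trans hα
  refine ((Set.finite_Iic _).preimage ?_).subset h
  intro α _ α' _ hh
  apply Subtype.ext
  rw [root_eq_posLattice α, root_eq_posLattice α']
  exact congrArg _ hh

theorem chevE_mem_wtSpace (i : Fin n) : chevE R i ∈ wtSpace R (KM R) (R.root i) :=
  fun x => cartan_lie_chevE R x i

theorem chevF_mem_wtSpace (i : Fin n) : chevF R i ∈ wtSpace R (KM R) (-R.root i) :=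
  fun x => by rw [cartan_lie_chevF, LinearMap.neg_apply, neg_smul]

theorem cartan_mem_wtSpace (x : H) : cartan R x ∈ wtSpace R (KM R) 0 :=
  fun z => by rw [cartan_lie_cartan, LinearMap.zero_apply, zero_smul]

/-- The Chevalley involution negates weights and is its own inverse. Positive roots are defined
through `𝔤_α`, so this is needed to control `𝔤_{-α}`. -/
theorem wtSpace_neg_posLattice {β : Fin n → ℕ} (h : wtSpace R (KM R) (-posLattice R β) ≠ ⊥) :
    wtSpace R (KM R) (posLattice R β) ≠ ⊥ := by
  obtain ⟨ω, h1, h2, h3⟩ := exists_chevalley_involution R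
  have hω : ∀ x, ω (ω x) = x := by
    intro x
    induction x using KM_induction with
    | h x => rw [h1, map_neg, h1, neg_neg]
    | e i => rw [h2, map_neg, h3, neg_neg]
    | f i => rw [h3, map_neg, h2, neg_neg]
    | zero => rw [map_zero, map_zero]
    | add x y hx hy => rw [map_add, map_add, hx, hy]
    | smul c x hx => rw [map_smul, map_smul, hx]
    | lie x y hx hy => rw [LieHom.map_lie, LieHom.map_lie, hx, hy]
  obtain ⟨x, hx, hx0⟩ := Submodule.exists_mem_ne_zero_of_ne_bot h
  refine (Submodule.ne_bot_iff _).2 ⟨ω x, fun z => ?_, fun h0 => hx0 ?_⟩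
  · have h4 := congrArg ω (hx z)
    rw [LieHom.map_lie, h1, map_smul, neg_lie, LinearMap.neg_apply, neg_smul, neg_inj] at h4
    exact h4
  · rw [← hω x, h0, map_zero]

variable {κ : LinearMap.BilinForm ℂ (KM R)} (D : DualRootBases R κ)

/-- The index set of the bases of `𝔫_+` and `𝔫_-`. -/
abbrev DualRootBases.Idx : Type _ := Σ α : posRoots R, Fin (D.mult α)

/-- The basis elements of `𝔫_+`. -/
def DualRootBases.bE (i : D.Idx) : nPlus R := D.e i.1 i.2

/-- The basis elements of `𝔫_-`. -/
def DualRootBases.bF (i : D.Idx) : nMinus R := D.f i.1 i.2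

theorem DualRootBases.bE_mem (i : D.Idx) : (D.bE i : KM R) ∈ wtSpace R (KM R) i.1 := by
  rw [← D.e_span]
  exact Submodule.subset_span ⟨i.2, rfl⟩

theorem DualRootBases.bF_mem (i : D.Idx) :
    (D.bF i : KM R) ∈ wtSpace R (KM R) (-(i.1 : Dual ℂ H)) := by
  rw [← D.f_span]
  exact Submodule.subset_span ⟨i.2, rfl⟩

theorem mem_span_bE_of_wt {β : Fin n → ℕ} (hβ : β ≠ 0) {x : KM R}
    (hx : x ∈ wtSpace R (KM R) (posLattice R β)) :
    x ∈ Submodule.span ℂ (Set.range fun i => (D.bE i : KM R)) := by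
  by_cases h : wtSpace R (KM R) (posLattice R β) = ⊥
  · rw [h, Submodule.mem_bot] at hx
    rw [hx]; exact zero_mem _
  · let α : posRoots R := ⟨posLattice R β, β, hβ, rfl, h⟩
    have hx' : x ∈ wtSpace R (KM R) (α : Dual ℂ H) := hx
    rw [← D.e_span] at hx'
    refine Submodule.span_mono ?_ hx'
    rintro _ ⟨t, rfl⟩
    exact ⟨⟨α, t⟩, rfl⟩

theorem mem_span_bF_of_wt {β : Fin n → ℕ} (hβ : β ≠ 0) {x : KM R}
    (hx : x ∈ wtSpace R (KM R) (-posLattice R β)) :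
    x ∈ Submodule.span ℂ (Set.range fun i => (D.bF i : KM R)) := by
  by_cases h : wtSpace R (KM R) (-posLattice R β) = ⊥
  · rw [h, Submodule.mem_bot] at hx
    rw [hx]; exact zero_mem _
  · let α : posRoots R := ⟨posLattice R β, β, hβ, rfl, wtSpace_neg_posLattice h⟩
    have hx' : x ∈ wtSpace R (KM R) (-(α : Dual ℂ H)) := hx
    rw [← D.f_span] at hx'
    refine Submodule.span_mono ?_ hx'
    rintro _ ⟨t, rfl⟩
    exact ⟨⟨α, t⟩, rfl⟩

theorem span_lie_mem {L : Type*} [LieRing L] [LieAlgebra ℂ L] {s : Set L}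
    (hs : ∀ x ∈ s, ∀ y ∈ s, ⁅x, y⁆ ∈ Submodule.span ℂ s) {x y : L}
    (hx : x ∈ Submodule.span ℂ s) (hy : y ∈ Submodule.span ℂ s) :
    ⁅x, y⁆ ∈ Submodule.span ℂ s := by
  induction hx using Submodule.span_induction with
  | mem x hx =>
    induction hy using Submodule.span_induction with
    | mem y hy => exact hs x hx y hy
    | zero => rw [lie_zero]; exact zero_mem _
    | add y y' _ _ h h' => rw [lie_add]; exact add_mem h h'
    | smul c y _ h => rw [lie_smul]; exact Submodule.smul_mem _ c h
  | zero => rw [zero_lie]; exact zero_mem _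
  | add y y' _ _ h h' => rw [add_lie]; exact add_mem h h'
  | smul c y _ h => rw [smul_lie]; exact Submodule.smul_mem _ c h

theorem posLattice_choose_add_ne_zero (α α' : posRoots R) :
    α.2.choose + α'.2.choose ≠ 0 := by
  intro h
  exact α.2.choose_spec.1 (funext fun i => by
    have := congrFun h i; simp only [Pi.add_apply, Pi.zero_apply] at this ⊢; lia)

theorem nPlus_mem_span (x : nPlus R) :
    (x : KM R) ∈ Submodule.span ℂ (Set.range fun i => (D.bE i : KM R)) := by
  induction x using nPlus_induction with
  | e i =>
    refine mem_span_bE_of_wt D (β := Pi.single i 1) (by simp) ?_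
    rw [posLattice_single]
    exact chevE_mem_wtSpace i
  | zero => exact zero_mem _
  | add x y hx hy => exact add_mem hx hy
  | smul c x hx => exact Submodule.smul_mem _ c hx
  | lie x y hx hy =>
    refine span_lie_mem ?_ hx hy
    rintro _ ⟨i, rfl⟩ _ ⟨j, rfl⟩
    refine mem_span_bE_of_wt D (posLattice_choose_add_ne_zero i.1 j.1) ?_
    have := lie_mem_wtSpace (D.bE_mem i) (D.bE_mem j)
    rwa [root_eq_posLattice i.1, root_eq_posLattice j.1, ← posLattice_add] at this

theorem nMinus_mem_span (x : nMinus R) :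
    (x : KM R) ∈ Submodule.span ℂ (Set.range fun i => (D.bF i : KM R)) := by
  induction x using nMinus_induction with
  | f i =>
    refine mem_span_bF_of_wt D (β := Pi.single i 1) (by simp) ?_
    rw [posLattice_single]
    exact chevF_mem_wtSpace i
  | zero => exact zero_mem _
  | add x y hx hy => exact add_mem hx hy
  | smul c x hx => exact Submodule.smul_mem _ c hx
  | lie x y hx hy =>
    refine span_lie_mem ?_ hx hy
    rintro _ ⟨i, rfl⟩ _ ⟨j, rfl⟩
    refine mem_span_bF_of_wt D (posLattice_choose_add_ne_zero i.1 j.1) ?_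
    have := lie_mem_wtSpace (D.bF_mem i) (D.bF_mem j)
    rwa [root_eq_posLattice i.1, root_eq_posLattice j.1, ← neg_add, ← posLattice_add] at this

/-- A spanning family of `𝔤` consisting of weight vectors. -/
def DualRootBases.all : D.Idx ⊕ H ⊕ D.Idx → KM R :=
  Sum.elim (fun i => D.bF i) (Sum.elim (cartan R) fun i => D.bE i)

/-- The heights of the elements of the spanning family. -/
def DualRootBases.allHt : D.Idx ⊕ H ⊕ D.Idx → ℂ :=
  Sum.elim (fun i => -(ht i.1 : ℂ)) (Sum.elim (fun _ => 0) fun i => (ht i.1 : ℂ))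

theorem nMinus_le_span_all (x : nMinus R) :
    (x : KM R) ∈ Submodule.span ℂ (Set.range D.all) := by
  refine Submodule.span_mono ?_ (nMinus_mem_span D x)
  rintro _ ⟨i, rfl⟩
  exact ⟨Sum.inl i, rfl⟩

theorem nPlus_le_span_all (x : nPlus R) :
    (x : KM R) ∈ Submodule.span ℂ (Set.range D.all) := by
  refine Submodule.span_mono ?_ (nPlus_mem_span D x)
  rintro _ ⟨i, rfl⟩
  exact ⟨Sum.inr (Sum.inr i), rfl⟩

theorem cartan_mem_span_all (x : H) :
    cartan R x ∈ Submodule.span ℂ (Set.range D.all) :=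
  Submodule.subset_span ⟨Sum.inr (Sum.inl x), rfl⟩

/-- One half of the triangular decomposition. Closure under brackets of elements of `𝔫_-` uses that
`𝔥` normalizes `𝔫_-`, which is `hc`. -/
theorem chevE_lie_nMinus (i : Fin n) (x : nMinus R) :
    ∃ (y : nMinus R) (h : H), ⁅chevE R i, (x : KM R)⁆ = y + cartan R h := by
  have hc : ∀ (x : nMinus R) (h : H), ∃ y : nMinus R, ⁅(x : KM R), cartan R h⁆ = y := by
    intro x h
    induction x using nMinus_induction with
    | f i =>
      refine ⟨R.root i h • nF R i, ?_⟩
      rw [← lie_skew]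
      change -⁅cartan R h, chevF R i⁆ = _
      rw [cartan_lie_chevF, neg_neg]
      rfl
    | zero => exact ⟨0, zero_lie _⟩
    | add x y hx hy =>
      obtain ⟨a, ha⟩ := hx
      obtain ⟨b, hb⟩ := hy
      exact ⟨a + b, (add_lie _ _ _).trans (by rw [ha, hb]; rfl)⟩
    | smul c x hx =>
      obtain ⟨a, ha⟩ := hx
      exact ⟨c • a, (smul_lie _ _ _).trans (by rw [ha]; rfl)⟩
    | lie x y hx hy =>
      obtain ⟨a, ha⟩ := hx
      obtain ⟨b, hb⟩ := hy
      refine ⟨⁅x, b⁆ - ⁅y, a⁆, (lie_lie _ _ _).trans (by rw [ha, hb]; rfl)⟩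
  induction x using nMinus_induction with
  | f j =>
    refine ⟨0, if i = j then R.coroot i else 0, ?_⟩
    change ⁅chevE R i, chevF R j⁆ = 0 + _
    rw [chevE_lie_chevF, zero_add]
    split_ifs <;> simp
  | zero => exact ⟨0, 0, by simp⟩
  | add x y hx hy =>
    obtain ⟨a, h, ha⟩ := hx
    obtain ⟨b, h', hb⟩ := hy
    refine ⟨a + b, h + h', (lie_add _ _ _).trans ?_⟩
    rw [ha, hb, map_add, add_add_add_comm]
    rfl
  | smul c x hx =>
    obtain ⟨a, h, ha⟩ := hx
    refine ⟨c • a, c • h, (lie_smul _ _ _).trans ?_⟩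
    rw [ha, map_smul, smul_add]
    rfl
  | lie x y hx hy =>
    obtain ⟨a, h, ha⟩ := hx
    obtain ⟨b, h', hb⟩ := hy
    obtain ⟨c, hc1⟩ := hc y h
    obtain ⟨d, hd1⟩ := hc x h'
    refine ⟨⁅a, y⁆ - c + ⁅x, b⁆ + d, 0, (leibniz_lie _ _ _).trans ?_⟩
    rw [ha, hb, add_lie, lie_add, hd1, ← lie_skew (cartan R h), hc1, map_zero, add_zero]
    change ⁅(a : KM R), (y : KM R)⁆ + -c + (⁅(x : KM R), (b : KM R)⁆ + d) =
      ⁅(a : KM R), (y : KM R)⁆ - c + ⁅(x : KM R), (b : KM R)⁆ + d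
    abel

theorem chevF_lie_nPlus (i : Fin n) (x : nPlus R) :
    ∃ (y : nPlus R) (h : H), ⁅chevF R i, (x : KM R)⁆ = y + cartan R h := by
  have hc : ∀ (x : nPlus R) (h : H), ∃ y : nPlus R, ⁅(x : KM R), cartan R h⁆ = y := by
    intro x h
    induction x using nPlus_induction with
    | e i =>
      refine ⟨-(R.root i h • nE R i), ?_⟩
      rw [← lie_skew]
      change -⁅cartan R h, chevE R i⁆ = _
      rw [cartan_lie_chevE]
      rfl
    | zero => exact ⟨0, zero_lie _⟩
    | add x y hx hy =>
      obtain ⟨a, ha⟩ := hx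
      obtain ⟨b, hb⟩ := hy
      exact ⟨a + b, (add_lie _ _ _).trans (by rw [ha, hb]; rfl)⟩
    | smul c x hx =>
      obtain ⟨a, ha⟩ := hx
      exact ⟨c • a, (smul_lie _ _ _).trans (by rw [ha]; rfl)⟩
    | lie x y hx hy =>
      obtain ⟨a, ha⟩ := hx
      obtain ⟨b, hb⟩ := hy
      refine ⟨⁅x, b⁆ - ⁅y, a⁆, (lie_lie _ _ _).trans (by rw [ha, hb]; rfl)⟩
  induction x using nPlus_induction with
  | e j =>
    refine ⟨0, if j = i then -R.coroot j else 0, ?_⟩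
    change ⁅chevF R i, chevE R j⁆ = 0 + _
    rw [← lie_skew, chevE_lie_chevF, zero_add]
    split_ifs <;> simp
  | zero => exact ⟨0, 0, by simp⟩
  | add x y hx hy =>
    obtain ⟨a, h, ha⟩ := hx
    obtain ⟨b, h', hb⟩ := hy
    refine ⟨a + b, h + h', (lie_add _ _ _).trans ?_⟩
    rw [ha, hb, map_add, add_add_add_comm]
    rfl
  | smul c x hx =>
    obtain ⟨a, h, ha⟩ := hx
    refine ⟨c • a, c • h, (lie_smul _ _ _).trans ?_⟩
    rw [ha, map_smul, smul_add]
    rfl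
  | lie x y hx hy =>
    obtain ⟨a, h, ha⟩ := hx
    obtain ⟨b, h', hb⟩ := hy
    obtain ⟨c, hc1⟩ := hc y h
    obtain ⟨d, hd1⟩ := hc x h'
    refine ⟨⁅a, y⁆ - c + ⁅x, b⁆ + d, 0, (leibniz_lie _ _ _).trans ?_⟩
    rw [ha, hb, add_lie, lie_add, hd1, ← lie_skew (cartan R h), hc1, map_zero, add_zero]
    change ⁅(a : KM R), (y : KM R)⁆ + -c + (⁅(x : KM R), (b : KM R)⁆ + d) =
      ⁅(a : KM R), (y : KM R)⁆ - c + ⁅(x : KM R), (b : KM R)⁆ + d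
    abel

theorem DualRootBases.all_mem (i : D.Idx ⊕ H ⊕ D.Idx) :
    D.all i ∈ (LieModule.toEnd ℂ (KM R) (KM R) (cartan R (gradElt R))).eigenspace (D.allHt i) := by
  rw [Module.End.mem_eigenspace_iff, LieModule.toEnd_apply_apply]
  rcases i with i | x | i
  · refine (D.bF_mem i (gradElt R)).trans ?_
    rw [LinearMap.neg_apply, posRoots_gradElt]
    rfl
  · refine (cartan_mem_wtSpace x (gradElt R)).trans ?_
    rfl
  · refine (D.bE_mem i (gradElt R)).trans ?_
    rw [posRoots_gradElt]
    rfl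

/-- The span of `𝔫_-`, `𝔥` and `𝔫_+` is stable under the Chevalley generators, hence under `ad 𝔤`,
and contains the generators of `𝔤`. -/
theorem DualRootBases.span_all : Submodule.span ℂ (Set.range D.all) = ⊤ := by
  rw [eq_top_iff]
  have hst : ∀ x : KM R, ∀ m ∈ Submodule.span ℂ (Set.range D.all),
      ⁅x, m⁆ ∈ Submodule.span ℂ (Set.range D.all) := by
    intro x
    induction x using KM_induction with
    | h x =>
      intro m hm
      induction hm using Submodule.span_induction with
      | mem m hm =>
        obtain ⟨i, rfl⟩ := hm
        rcases i with i | y | i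
        · refine (congrArg (· ∈ _) (D.bF_mem i x)).mpr (Submodule.smul_mem _ _ ?_)
          exact Submodule.subset_span ⟨Sum.inl i, rfl⟩
        · refine (congrArg (· ∈ _) (cartan_lie_cartan R x y)).mpr (zero_mem _)
        · refine (congrArg (· ∈ _) (D.bE_mem i x)).mpr (Submodule.smul_mem _ _ ?_)
          exact Submodule.subset_span ⟨Sum.inr (Sum.inr i), rfl⟩
      | zero => rw [lie_zero]; exact zero_mem _
      | add y y' _ _ h h' => rw [lie_add]; exact add_mem h h'
      | smul c y _ h => rw [lie_smul]; exact Submodule.smul_mem _ c h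
    | e j =>
      intro m hm
      induction hm using Submodule.span_induction with
      | mem m hm =>
        obtain ⟨i, rfl⟩ := hm
        rcases i with i | y | i
        · obtain ⟨y, h, hy⟩ := chevE_lie_nMinus j (D.bF i)
          refine (congrArg (· ∈ _) hy).mpr (add_mem (nMinus_le_span_all D y)
            (cartan_mem_span_all D h))
        · change ⁅chevE R j, cartan R y⁆ ∈ _
          rw [← lie_skew, cartan_lie_chevE]
          exact neg_mem (Submodule.smul_mem _ _ (nPlus_le_span_all D (nE R j)))
        · exact nPlus_le_span_all D ⁅nE R j, D.bE i⁆
      | zero => rw [lie_zero]; exact zero_mem _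
      | add y y' _ _ h h' => rw [lie_add]; exact add_mem h h'
      | smul c y _ h => rw [lie_smul]; exact Submodule.smul_mem _ c h
    | f j =>
      intro m hm
      induction hm using Submodule.span_induction with
      | mem m hm =>
        obtain ⟨i, rfl⟩ := hm
        rcases i with i | y | i
        · exact nMinus_le_span_all D ⁅nF R j, D.bF i⁆
        · change ⁅chevF R j, cartan R y⁆ ∈ _
          rw [← lie_skew, cartan_lie_chevF, neg_neg]
          exact Submodule.smul_mem _ _ (nMinus_le_span_all D (nF R j))
        · obtain ⟨y, h, hy⟩ := chevF_lie_nPlus j (D.bE i)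
          refine (congrArg (· ∈ _) hy).mpr (add_mem (nPlus_le_span_all D y)
            (cartan_mem_span_all D h))
      | zero => rw [lie_zero]; exact zero_mem _
      | add y y' _ _ h h' => rw [lie_add]; exact add_mem h h'
      | smul c y _ h => rw [lie_smul]; exact Submodule.smul_mem _ c h
    | zero => intro m _; rw [zero_lie]; exact zero_mem _
    | add x y hx hy => intro m hm; rw [add_lie]; exact add_mem (hx m hm) (hy m hm)
    | smul c x hx => intro m hm; rw [smul_lie]; exact Submodule.smul_mem _ c (hx m hm)
    | lie x y hx hy =>
      intro m hm; rw [lie_lie]; exact sub_mem (hx _ (hy m hm)) (hy _ (hx m hm))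
  intro x _
  induction x using KM_induction with
  | h x => exact cartan_mem_span_all D x
  | e i => exact nPlus_le_span_all D (nE R i)
  | f i => exact nMinus_le_span_all D (nF R i)
  | zero => exact zero_mem _
  | add x y hx hy => exact add_mem (hx trivial) (hy trivial)
  | smul c x hx => exact Submodule.smul_mem _ c (hx trivial)
  | lie x y hx hy => exact hst x y (hy trivial)

theorem mem_span_all_of_ht {x : KM R} {c : ℂ} (hx : ⁅cartan R (gradElt R), x⁆ = c • x) :
    x ∈ Submodule.span ℂ (D.all '' {i | D.allHt i = c}) :=
  mem_span_of_iSupIndep (Module.End.eigenspaces_iSupIndep _) D.all_mem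
    (Module.End.mem_eigenspace_iff.2 hx) (by rw [D.span_all]; trivial)

theorem mem_span_bE_of_ht {x : KM R} {k : ℕ} (hk : 0 < k)
    (hx : ⁅cartan R (gradElt R), x⁆ = (k : ℂ) • x) :
    x ∈ Submodule.span ℂ ((fun i => (D.bE i : KM R)) '' {i | ht i.1 = k}) := by
  refine Submodule.span_le.2 ?_ (mem_span_all_of_ht D hx)
  rintro _ ⟨i, hi, rfl⟩
  rcases i with i | y | i
  · exfalso
    have h2 : -(ht i.1 : ℂ) = k := hi
    have h3 : ((ht i.1 + k : ℕ) : ℂ) = 0 := by push_cast; rw [← h2]; ring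
    rw [Nat.cast_eq_zero] at h3
    lia
  · exfalso
    have h2 : (0 : ℂ) = k := hi
    have := Nat.cast_eq_zero.1 h2.symm
    lia
  · exact Submodule.subset_span ⟨i, Nat.cast_injective (R := ℂ) hi, rfl⟩

theorem mem_span_bF_of_ht {x : KM R} {k : ℕ} (hk : 0 < k)
    (hx : ⁅cartan R (gradElt R), x⁆ = (-(k : ℂ)) • x) :
    x ∈ Submodule.span ℂ ((fun i => (D.bF i : KM R)) '' {i | ht i.1 = k}) := by
  refine Submodule.span_le.2 ?_ (mem_span_all_of_ht D hx)
  rintro _ ⟨i, hi, rfl⟩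
  rcases i with i | y | i
  · exact Submodule.subset_span ⟨i, Nat.cast_injective (R := ℂ) (neg_inj.1 hi), rfl⟩
  · exfalso
    have h2 : (0 : ℂ) = -k := hi
    have := Nat.cast_eq_zero.1 (neg_eq_zero.1 h2.symm)
    lia
  · exfalso
    have h2 : (ht i.1 : ℂ) = -k := hi
    have h3 : ((ht i.1 + k : ℕ) : ℂ) = 0 := by push_cast; rw [h2]; ring
    rw [Nat.cast_eq_zero] at h3
    lia

/-- In the spanning family only the elements of `𝔥` have height zero. All brackets of `e`'s with
`f`'s of equal height are recognized as elements of `𝔥` in this way. -/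
theorem exists_cartan_of_ht (D : DualRootBases R κ) {x : KM R} (hx : ⁅cartan R (gradElt R), x⁆ = 0) :
    ∃ h, x = cartan R h := by
  have h1 := mem_span_all_of_ht D (c := 0) (by rw [hx, zero_smul])
  have h2 : Submodule.span ℂ (D.all '' {i | D.allHt i = 0}) ≤ LinearMap.range (cartan R) := by
    refine Submodule.span_le.2 ?_
    rintro _ ⟨i, hi, rfl⟩
    have := ht_pos (R := R)
    rcases i with i | y | i
    · exact absurd (Nat.cast_eq_zero.1 (neg_eq_zero.1 (hi : -(ht i.1 : ℂ) = 0))) (this i.1).ne'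
    · exact ⟨y, rfl⟩
    · exact absurd (Nat.cast_eq_zero.1 (hi : (ht i.1 : ℂ) = 0)) (this i.1).ne'
  obtain ⟨h, hh⟩ := h2 h1
  exact ⟨h, hh.symm⟩

end Structure

/-! ### The invariant form -/

section Form

variable {n : ℕ} {A : Matrix (Fin n) (Fin n) ℤ} {H : Type*} [AddCommGroup H] [Module ℂ H]
  {R : Realization A H} {κ : LinearMap.BilinForm ℂ (KM R)}

theorem IsInvariantForm.eq_zero_of_lie (hκ : IsInvariantForm R κ) {z x y : KM R} {a b : ℂ}
    (hx : ⁅z, x⁆ = a • x) (hy : ⁅z, y⁆ = b • y) (hab : a + b ≠ 0) : κ x y = 0 := by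
  have h := hκ.invariant x z y
  rw [← lie_skew, hx, hy, map_neg, LinearMap.neg_apply, map_smul, LinearMap.smul_apply, map_smul,
    smul_eq_mul, smul_eq_mul] at h
  have : (a + b) * κ x y = 0 := by linear_combination -h
  exact (mul_eq_zero.1 this).resolve_left hab

theorem hForm_apply (x y : H) : hForm R κ x y = κ (cartan R x) (cartan R y) := rfl

theorem hForm_comm (hκ : IsInvariantForm R κ) (x y : H) : hForm R κ x y = hForm R κ y x :=
  hκ.symm _ _

/-- Root vectors have nonzero height and are therefore orthogonal to `𝔥`, so a vector in the radical
on `𝔥` is in the radical on `𝔤`. -/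
theorem hForm_nondegenerate (hA : IsSymmetrizableGCM A) (hκ : IsInvariantForm R κ)
    (D : DualRootBases R κ) : (hForm R κ).Nondegenerate := by
  have key : ∀ x, (∀ y, hForm R κ x y = 0) → x = 0 := by
    intro x hx
    apply cartan_injective hA R
    rw [map_zero]
    apply hκ.nondegenerate.1
    intro z
    have hz : z ∈ Submodule.span ℂ (Set.range D.all) := by rw [D.span_all]; trivial
    induction hz using Submodule.span_induction with
    | mem z hz =>
      obtain ⟨i, rfl⟩ := hz
      have h0 : ⁅cartan R (gradElt R), cartan R x⁆ = (0 : ℂ) • cartan R x := by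
        rw [cartan_lie_cartan, zero_smul]
      have hi := Module.End.mem_eigenspace_iff.1 (D.all_mem i)
      rw [LieModule.toEnd_apply_apply] at hi
      rcases i with i | y | i
      · refine hκ.eq_zero_of_lie h0 hi ?_
        rw [zero_add]
        exact neg_ne_zero.2 (Nat.cast_ne_zero.2 (ht_pos i.1).ne')
      · exact hx y
      · refine hκ.eq_zero_of_lie h0 hi ?_
        rw [zero_add]
        exact Nat.cast_ne_zero.2 (ht_pos i.1).ne'
    | zero => exact map_zero _
    | add y y' _ _ h h' => rw [map_add, h, h', add_zero]
    | smul c y _ h => rw [map_smul, h, smul_zero]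
  refine ⟨key, fun y hy => key y fun x => ?_⟩
  rw [hForm_comm hκ]
  exact hy x

theorem hForm_sharp (hA : IsSymmetrizableGCM A) (hκ : IsInvariantForm R κ)
    (D : DualRootBases R κ) (φ : Dual ℂ H) (y : H) : hForm R κ (sharp R κ φ) y = φ y := by
  have := R.finiteDimensional
  rw [sharp, dif_pos (hForm_nondegenerate hA hκ D)]
  exact LinearMap.BilinForm.apply_toDual_symm_apply (B := hForm R κ) φ y

theorem eq_sharp (hA : IsSymmetrizableGCM A) (hκ : IsInvariantForm R κ)
    (D : DualRootBases R κ) {φ : Dual ℂ H} {x : H} (h : ∀ y, hForm R κ x y = φ y) :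
    x = sharp R κ φ := by
  rw [← sub_eq_zero]
  apply (hForm_nondegenerate hA hκ D).1
  intro y
  rw [map_sub, LinearMap.sub_apply, h, hForm_sharp hA hκ D, sub_self]

theorem dualForm_eq (hA : IsSymmetrizableGCM A) (hκ : IsInvariantForm R κ)
    (D : DualRootBases R κ) (φ ψ : Dual ℂ H) : dualForm R κ φ ψ = φ (sharp R κ ψ) :=
  hForm_sharp hA hκ D _ _

theorem dualForm_comm (hκ : IsInvariantForm R κ) (φ ψ : Dual ℂ H) :
    dualForm R κ φ ψ = dualForm R κ ψ φ :=
  hForm_comm hκ _ _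

/-- The bracket has height zero, so it lies in `𝔥`, and invariance computes its pairing with all of
`𝔥`. Only the height of `x` must match `γ`, not its weight, which lets the formula be used for a
whole level of root vectors at once. -/
theorem lie_eq_form_smul (hA : IsSymmetrizableGCM A) (hκ : IsInvariantForm R κ)
    (D : DualRootBases R κ) {γ : Dual ℂ H} {x y : KM R}
    (hx : ⁅cartan R (gradElt R), x⁆ = γ (gradElt R) • x) (hy : y ∈ wtSpace R (KM R) (-γ)) :
    ⁅x, y⁆ = κ x y • cartan R (sharp R κ γ) := by
  have h0 : ⁅cartan R (gradElt R), ⁅x, y⁆⁆ = 0 := by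
    rw [leibniz_lie, hx, hy, smul_lie, lie_smul, ← add_smul]
    simp
  obtain ⟨u, hu⟩ := exists_cartan_of_ht D h0
  rw [hu, ← map_smul]
  congr 1
  rw [← map_smul]
  refine eq_sharp hA hκ D fun h => ?_
  rw [hForm_apply, ← hu, hκ.invariant, ← lie_skew, hy h, map_neg, map_smul, LinearMap.smul_apply]
  simp [mul_comm]

/-- The value of the form on the pair `e_i`, `f_i`. -/
def chevForm (R : Realization A H) (κ : LinearMap.BilinForm ℂ (KM R)) (i : Fin n) : ℂ :=
  κ (chevE R i) (chevF R i)

theorem coroot_eq (hA : IsSymmetrizableGCM A) (hκ : IsInvariantForm R κ)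
    (D : DualRootBases R κ) (i : Fin n) :
    R.coroot i = chevForm R κ i • sharp R κ (R.root i) := by
  apply cartan_injective hA R
  rw [map_smul, chevForm, ← lie_eq_form_smul hA hκ D (chevE_mem_wtSpace i _) (chevF_mem_wtSpace i),
    chevE_lie_chevF, if_pos rfl]

theorem chevForm_mul_dualForm (hA : IsSymmetrizableGCM A) (hκ : IsInvariantForm R κ)
    (D : DualRootBases R κ) (φ : Dual ℂ H) (i : Fin n) :
    chevForm R κ i * dualForm R κ φ (R.root i) = φ (R.coroot i) := by
  rw [coroot_eq hA hκ D, map_smul, dualForm_eq hA hκ D, smul_eq_mul]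

theorem chevForm_mul_root (hA : IsSymmetrizableGCM A) (hκ : IsInvariantForm R κ)
    (D : DualRootBases R κ) (i j : Fin n) :
    chevForm R κ i * dualForm R κ (R.root j) (R.root i) = A i j := by
  rw [chevForm_mul_dualForm hA hκ D, R.pairing]

theorem chevForm_mul_root_self (hA : IsSymmetrizableGCM A) (hκ : IsInvariantForm R κ)
    (D : DualRootBases R κ) (i : Fin n) :
    chevForm R κ i * dualForm R κ (R.root i) (R.root i) = 2 := by
  rw [chevForm_mul_root hA hκ D, hA.diag]
  norm_num

theorem chevForm_ne_zero (hA : IsSymmetrizableGCM A) (hκ : IsInvariantForm R κ)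
    (D : DualRootBases R κ) (i : Fin n) : chevForm R κ i ≠ 0 := by
  intro h
  have := chevForm_mul_root_self hA hκ D i
  rw [h, zero_mul] at this
  norm_num at this

variable (𝒯 : GBDTriple R κ)

/-- The constant `(e_i, f_i) = 2 / (α_i, α_i)` depends only on the length of the root, which `T`
preserves. -/
theorem GBDTriple.chevForm_T (hA : IsSymmetrizableGCM A) (hκ : IsInvariantForm R κ)
    (D : DualRootBases R κ) (i : 𝒯.Γ₁) : chevForm R κ (𝒯.T i) = chevForm R κ i := by
  have h1 := chevForm_mul_root_self hA hκ D (𝒯.T i)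
  have h2 := chevForm_mul_root_self hA hκ D i
  rw [𝒯.inner_eq i i] at h1
  have h3 : dualForm R κ (R.root i) (R.root i) ≠ 0 := by
    intro h; rw [h, mul_zero] at h2; norm_num at h2
  exact mul_right_cancel₀ h3 (h1.trans h2.symm)

/-- Entries of the Cartan matrix are recovered from inner products and root lengths. This is the
form in which the isometry `T` is compatible with the Serre relations. -/
theorem GBDTriple.cartanMatrix_T (hA : IsSymmetrizableGCM A) (hκ : IsInvariantForm R κ)
    (D : DualRootBases R κ) (i j : 𝒯.Γ₁) : A (𝒯.T i) (𝒯.T j) = A i j := by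
  have h1 := chevForm_mul_root hA hκ D (𝒯.T i) (𝒯.T j)
  rw [𝒯.inner_eq j i, 𝒯.chevForm_T hA hκ D, chevForm_mul_root hA hκ D] at h1
  exact_mod_cast h1.symm

end Form

/-! ### Existence of `B` and `B⁻¹` -/

section ExistsB

variable {n : ℕ} {A : Matrix (Fin n) (Fin n) ℤ} {H : Type*} [AddCommGroup H] [Module ℂ H]
  {R : Realization A H} {κ : LinearMap.BilinForm ℂ (KM R)}

theorem nMinus_eq_zero_of_ht (D : DualRootBases R κ) (x : nMinus R)
    (h : ⁅cartan R (gradElt R), (x : KM R)⁆ = 0) : (x : KM R) = 0 := by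
  have h1 := mem_span_of_iSupIndep (v := fun i => (D.bF i : KM R)) (c := fun i => -(ht i.1 : ℂ))
    (k := 0) (x := (x : KM R)) (Module.End.eigenspaces_iSupIndep
      (LieModule.toEnd ℂ (KM R) (KM R) (cartan R (gradElt R)))) (fun i => D.all_mem (Sum.inl i))
    (Module.End.mem_eigenspace_iff.2 (by rw [zero_smul]; exact h)) (nMinus_mem_span D x)
  have h2 : (fun i => (D.bF i : KM R)) '' {i | -(ht i.1 : ℂ) = 0} ⊆ {0} := by
    rintro _ ⟨i, hi, rfl⟩
    exact absurd (Nat.cast_eq_zero.1 (neg_eq_zero.1 hi)) (ht_pos i.1).ne'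
  have h3 := Submodule.span_mono h2 h1
  simpa using h3

/-- If `ι x = 0`, then `x` acts by zero in the adjoint representation of `U(𝔤)`, in particular on
the grading element. An element of `𝔫_-` commuting with the grading element is zero, since all its
components have negative height. -/
theorem ι_nMinus_injective (D : DualRootBases R κ) :
    Function.Injective (UniversalEnvelopingAlgebra.ι ℂ (L := nMinus R)) := by
  rw [injective_iff_map_eq_zero]
  intro x hx
  apply Subtype.ext
  apply nMinus_eq_zero_of_ht D
  have h1 := uIncl_ι x
  rw [hx, map_zero] at h1
  have h2 : UniversalEnvelopingAlgebra.lift ℂ (LieModule.toEnd ℂ (KM R) (KM R))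
      (UniversalEnvelopingAlgebra.ι ℂ (x : KM R)) = LieModule.toEnd ℂ (KM R) (KM R) x :=
    UniversalEnvelopingAlgebra.lift_ι_apply ℂ _ _
  rw [← h1, map_zero] at h2
  have h3 := LinearMap.congr_fun h2 (cartan R (gradElt R))
  rw [LinearMap.zero_apply, LieModule.toEnd_apply_apply, ← lie_skew] at h3
  exact neg_eq_zero.1 h3.symm

/-- The universal property of `𝔫_-` for homomorphisms to itself. -/
theorem exists_nMinus_hom (hA : IsSymmetrizableGCM A) (D : DualRootBases R κ)
    {φ : Fin n → nMinus R} (hφ : SatisfiesSerre A φ) :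
    ∃ B : nMinus R →ₗ⁅ℂ⁆ nMinus R, ∀ i, B (nF R i) = φ i := by
  obtain ⟨g, hg⟩ := exists_uea_hom hA R
    (satisfiesSerre_map (UniversalEnvelopingAlgebra.ι ℂ (L := nMinus R)) hφ)
  -- The homomorphism of enveloping algebras maps generators of `𝔫_-` into `𝔫_-`, hence all of
  -- `𝔫_-`. Injectivity of `ι` then gives a homomorphism of Lie algebras.
  have hex : ∀ x : nMinus R, ∃ y : nMinus R, UniversalEnvelopingAlgebra.ι ℂ y =
      g (UniversalEnvelopingAlgebra.ι ℂ x) := by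
    intro x
    induction x using nMinus_induction with
    | f i => exact ⟨φ i, (hg i).symm⟩
    | zero => exact ⟨0, by simp only [map_zero]⟩
    | add x y hx hy =>
      obtain ⟨a, ha⟩ := hx
      obtain ⟨b, hb⟩ := hy
      exact ⟨a + b, by simp only [map_add, ha, hb]⟩
    | smul c x hx =>
      obtain ⟨a, ha⟩ := hx
      exact ⟨c • a, by simp only [map_smul, ha]⟩
    | lie x y hx hy =>
      obtain ⟨a, ha⟩ := hx
      obtain ⟨b, hb⟩ := hy
      exact ⟨⁅a, b⁆, by
        simp only [LieHom.map_lie, LieRing.of_associative_ring_bracket, map_sub, map_mul, ha, hb]⟩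
  choose B hB using hex
  have hinj := ι_nMinus_injective D
  refine ⟨{ toFun := B, map_add' := fun x y => hinj ?_, map_smul' := fun c x => hinj ?_,
            map_lie' := fun {x y} => hinj ?_ }, fun i => hinj ?_⟩
  · simp only [map_add, hB]
  · simp only [map_smul, hB, RingHom.id_apply]
  · simp only [LieHom.map_lie, LieRing.of_associative_ring_bracket, map_sub, map_mul, hB]
  · exact (hB _).trans (hg i)

open Classical in
theorem satisfiesSerre_partial (Γ : Set (Fin n)) (T : Γ → Fin n)
    (hT : ∀ i j, A (T i) (T j) = A i j) (hA : IsSymmetrizableGCM A) (R : Realization A H) :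
    SatisfiesSerre A (fun i => if h : i ∈ Γ then nF R (T ⟨i, h⟩) else 0) := by
  intro i j hij
  by_cases hi : i ∈ Γ
  · by_cases hj : j ∈ Γ
    · simp only [dif_pos hi, dif_pos hj]
      have h1 := hT ⟨i, hi⟩ ⟨j, hj⟩
      -- An equality `T i = T j` would give `a_ij = 2`, against `a_ij ≤ 0`.
      have h2 := satisfiesSerre_nF R (T ⟨i, hi⟩) (T ⟨j, hj⟩) (by
        intro h
        rw [h, hA.diag] at h1
        have := hA.offDiag i j hij
        change 2 = A i j at h1
        lia)
      rw [h1] at h2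
      exact h2
    · simp only [dif_neg hj, map_zero]
  -- Here the operator is `ad 0`, and its power vanishes because `1 - a_ij` is positive.
  · simp only [dif_neg hi, map_zero]
    have := hA.offDiag i j hij
    rw [zero_pow (by lia), LinearMap.zero_apply]

theorem GBDTriple.isB (𝒯 : GBDTriple R κ) (hA : IsSymmetrizableGCM A) (hκ : IsInvariantForm R κ)
    (D : DualRootBases R κ) : 𝒯.IsB 𝒯.B := by
  classical
  have h : ∃ B, 𝒯.IsB B := by
    obtain ⟨B, hB⟩ := exists_nMinus_hom hA D
      (satisfiesSerre_partial 𝒯.Γ₁ (fun i => 𝒯.T i) (𝒯.cartanMatrix_T hA hκ D) hA R)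
    refine ⟨B, fun i => ?_⟩
    rw [hB]
  rw [GBDTriple.B, dif_pos h]
  exact h.choose_spec

theorem GBDTriple.isBInv (𝒯 : GBDTriple R κ) (hA : IsSymmetrizableGCM A)
    (hκ : IsInvariantForm R κ) (D : DualRootBases R κ) : 𝒯.IsBInv 𝒯.BInv := by
  classical
  have h : ∃ B, 𝒯.IsBInv B := by
    obtain ⟨B, hB⟩ := exists_nMinus_hom hA D
      (satisfiesSerre_partial 𝒯.Γ₂ (fun i => 𝒯.T.symm i) (fun i j => by
        have := 𝒯.cartanMatrix_T hA hκ D (𝒯.T.symm i) (𝒯.T.symm j)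
        rw [Equiv.apply_symm_apply, Equiv.apply_symm_apply] at this
        exact this.symm) hA R)
    -- The endomorphism of `𝔫_-` attached to `T⁻¹` is carried to `𝔫_+` by the Chevalley involution;
    -- the two signs cancel on generators.
    obtain ⟨ω, -, h2, h3⟩ := exists_chevalley_involution R
    have hp : ∀ x : nPlus R, ω x ∈ nMinus R := by
      intro x
      induction x using nPlus_induction with
      | e i => exact (congrArg (· ∈ _) (h2 i)).mpr (neg_mem (nF R i).2)
      | zero => rw [ZeroMemClass.coe_zero, map_zero]; exact zero_mem _
      | add x y hx hy =>
        change ω ((x : KM R) + (y : KM R)) ∈ nMinus R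
        rw [map_add]
        exact add_mem hx hy
      | smul c x hx =>
        change ω (c • (x : KM R)) ∈ nMinus R
        rw [map_smul]
        exact (nMinus R).smul_mem c hx
      | lie x y hx hy =>
        change ω ⁅(x : KM R), (y : KM R)⁆ ∈ nMinus R
        rw [LieHom.map_lie]
        exact (nMinus R).lie_mem hx hy
    have hm : ∀ x : nMinus R, ω x ∈ nPlus R := by
      intro x
      induction x using nMinus_induction with
      | f i => exact (congrArg (· ∈ _) (h3 i)).mpr (neg_mem (nE R i).2)
      | zero => rw [ZeroMemClass.coe_zero, map_zero]; exact zero_mem _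
      | add x y hx hy =>
        change ω ((x : KM R) + (y : KM R)) ∈ nPlus R
        rw [map_add]
        exact add_mem hx hy
      | smul c x hx =>
        change ω (c • (x : KM R)) ∈ nPlus R
        rw [map_smul]
        exact (nPlus R).smul_mem c hx
      | lie x y hx hy =>
        change ω ⁅(x : KM R), (y : KM R)⁆ ∈ nPlus R
        rw [LieHom.map_lie]
        exact (nPlus R).lie_mem hx hy
    let ωp : nPlus R →ₗ⁅ℂ⁆ nMinus R :=
      { toFun := fun x => ⟨ω x, hp x⟩
        map_add' := fun x y => Subtype.ext (map_add ω (x : KM R) y)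
        map_smul' := fun c x => Subtype.ext (map_smul ω c (x : KM R))
        map_lie' := fun {x y} => Subtype.ext (ω.map_lie (x : KM R) y) }
    let ωm : nMinus R →ₗ⁅ℂ⁆ nPlus R :=
      { toFun := fun x => ⟨ω x, hm x⟩
        map_add' := fun x y => Subtype.ext (map_add ω (x : KM R) y)
        map_smul' := fun c x => Subtype.ext (map_smul ω c (x : KM R))
        map_lie' := fun {x y} => Subtype.ext (ω.map_lie (x : KM R) y) }
    have h4 : ∀ i, ωp (nE R i) = -nF R i := fun i => Subtype.ext (h2 i)
    have h5 : ∀ i, ωm (nF R i) = -nE R i := fun i => Subtype.ext (h3 i)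
    refine ⟨ωm.comp (B.comp ωp), fun i => ?_⟩
    rw [LieHom.comp_apply, LieHom.comp_apply, h4, map_neg, map_neg, hB]
    split_ifs with hi
    · rw [h5, neg_neg]
    · simp
  rw [GBDTriple.BInv, dif_pos h]
  exact h.choose_spec

theorem GBDTriple.B_nF (𝒯 : GBDTriple R κ) (hA : IsSymmetrizableGCM A) (hκ : IsInvariantForm R κ)
    (D : DualRootBases R κ) (i : 𝒯.Γ₁) : 𝒯.B (nF R i) = nF R (𝒯.T i) := by
  rw [𝒯.isB hA hκ D i, dif_pos i.2]

theorem GBDTriple.B_nF_eq_zero (𝒯 : GBDTriple R κ) (hA : IsSymmetrizableGCM A)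
    (hκ : IsInvariantForm R κ) (D : DualRootBases R κ) {i : Fin n} (hi : i ∉ 𝒯.Γ₁) :
    𝒯.B (nF R i) = 0 := by
  rw [𝒯.isB hA hκ D i, dif_neg hi]

theorem GBDTriple.BInv_nE (𝒯 : GBDTriple R κ) (hA : IsSymmetrizableGCM A)
    (hκ : IsInvariantForm R κ) (D : DualRootBases R κ) (i : 𝒯.Γ₁) :
    𝒯.BInv (nE R (𝒯.T i)) = nE R i := by
  rw [𝒯.isBInv hA hκ D (𝒯.T i), dif_pos (𝒯.T i).2]
  simp

theorem GBDTriple.BInv_nE_eq_zero (𝒯 : GBDTriple R κ) (hA : IsSymmetrizableGCM A)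
    (hκ : IsInvariantForm R κ) (D : DualRootBases R κ) {i : Fin n} (hi : i ∉ 𝒯.Γ₂) :
    𝒯.BInv (nE R i) = 0 := by
  rw [𝒯.isBInv hA hκ D i, dif_neg hi]

/-- `B` as an operator between Verma modules has its defining property. -/
theorem GBDTriple.isVermaB (𝒯 : GBDTriple R κ) (hA : IsSymmetrizableGCM A) (μ' μ : Dual ℂ H) :
    𝒯.IsVermaB μ' μ (𝒯.vermaB μ' μ) := by
  have h : ∃ b, 𝒯.IsVermaB μ' μ b := by
    refine ⟨(vermaEquiv hA μ).toLinearMap ∘ₗ 𝒯.uB.toLinearMap ∘ₗ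
      (vermaEquiv hA μ').symm.toLinearMap, fun x => ?_⟩
    rw [← vermaEquiv_apply hA, ← vermaEquiv_apply hA]
    simp
  rw [GBDTriple.vermaB, dif_pos h]
  exact h.choose_spec

end ExistsB

/-! ### The operators `B` and `B⁻¹` and the invariant form -/

section OperatorB

variable {n : ℕ} {A : Matrix (Fin n) (Fin n) ℤ} {H : Type*} [AddCommGroup H] [Module ℂ H]
  {R : Realization A H} {κ : LinearMap.BilinForm ℂ (KM R)}

theorem cartan_lie_mem_nMinus (h : H) (x : nMinus R) : ⁅cartan R h, (x : KM R)⁆ ∈ nMinus R := by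
  induction x using nMinus_induction with
  | f i =>
    change ⁅cartan R h, chevF R i⁆ ∈ nMinus R
    rw [cartan_lie_chevF]
    exact neg_mem ((nMinus R).smul_mem _ (nF R i).2)
  | zero => rw [ZeroMemClass.coe_zero, lie_zero]; exact zero_mem _
  | add x y hx hy =>
    change ⁅cartan R h, (x : KM R) + (y : KM R)⁆ ∈ nMinus R
    rw [lie_add]
    exact add_mem hx hy
  | smul c x hx =>
    change ⁅cartan R h, c • (x : KM R)⁆ ∈ nMinus R
    rw [lie_smul]
    exact (nMinus R).smul_mem c hx
  | lie x y hx hy =>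
    change ⁅cartan R h, ⁅(x : KM R), (y : KM R)⁆⁆ ∈ nMinus R
    rw [leibniz_lie]
    exact add_mem ((nMinus R).lie_mem hx y.2) ((nMinus R).lie_mem x.2 hy)

theorem cartan_lie_mem_nPlus (h : H) (x : nPlus R) : ⁅cartan R h, (x : KM R)⁆ ∈ nPlus R := by
  induction x using nPlus_induction with
  | e i =>
    change ⁅cartan R h, chevE R i⁆ ∈ nPlus R
    rw [cartan_lie_chevE]
    exact (nPlus R).smul_mem _ (nE R i).2
  | zero => rw [ZeroMemClass.coe_zero, lie_zero]; exact zero_mem _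
  | add x y hx hy =>
    change ⁅cartan R h, (x : KM R) + (y : KM R)⁆ ∈ nPlus R
    rw [lie_add]
    exact add_mem hx hy
  | smul c x hx =>
    change ⁅cartan R h, c • (x : KM R)⁆ ∈ nPlus R
    rw [lie_smul]
    exact (nPlus R).smul_mem c hx
  | lie x y hx hy =>
    change ⁅cartan R h, ⁅(x : KM R), (y : KM R)⁆⁆ ∈ nPlus R
    rw [leibniz_lie]
    exact add_mem ((nPlus R).lie_mem hx y.2) ((nPlus R).lie_mem x.2 hy)

/-- The action of `h ∈ 𝔥` on `𝔫_-`. -/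
def adMinus (R : Realization A H) (h : H) : nMinus R →ₗ[ℂ] nMinus R where
  toFun x := ⟨⁅cartan R h, (x : KM R)⁆, cartan_lie_mem_nMinus h x⟩
  map_add' x y := Subtype.ext (lie_add (cartan R h) (x : KM R) y)
  map_smul' c x := Subtype.ext (lie_smul c (cartan R h) (x : KM R))

/-- The action of `h ∈ 𝔥` on `𝔫_+`. -/
def adPlus (R : Realization A H) (h : H) : nPlus R →ₗ[ℂ] nPlus R where
  toFun x := ⟨⁅cartan R h, (x : KM R)⁆, cartan_lie_mem_nPlus h x⟩
  map_add' x y := Subtype.ext (lie_add (cartan R h) (x : KM R) y)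
  map_smul' c x := Subtype.ext (lie_smul c (cartan R h) (x : KM R))

theorem coe_adMinus (h : H) (x : nMinus R) : (adMinus R h x : KM R) = ⁅cartan R h, (x : KM R)⁆ :=
  rfl

theorem adMinus_lie (h : H) (x y : nMinus R) :
    adMinus R h ⁅x, y⁆ = ⁅adMinus R h x, y⁆ + ⁅x, adMinus R h y⁆ :=
  Subtype.ext (leibniz_lie (cartan R h) (x : KM R) (y : KM R))

theorem adPlus_lie (h : H) (x y : nPlus R) :
    adPlus R h ⁅x, y⁆ = ⁅adPlus R h x, y⁆ + ⁅x, adPlus R h y⁆ :=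
  Subtype.ext (leibniz_lie (cartan R h) (x : KM R) (y : KM R))

theorem adMinus_nF (h : H) (i : Fin n) : adMinus R h (nF R i) = -(R.root i h • nF R i) :=
  Subtype.ext (cartan_lie_chevF R h i)

theorem adPlus_nE (h : H) (i : Fin n) : adPlus R h (nE R i) = R.root i h • nE R i :=
  Subtype.ext (cartan_lie_chevE R h i)

variable (𝒯 : GBDTriple R κ)

/-- A root vector for `α` goes to one for `T α`, so `B` exchanges `h` with any `h'` having matching
values on roots. This covers elements of `𝔩` (with `h' = h`), the coroots `h_{T j}` and `h_j`, and
the pairs given by the Cayley transform. -/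
theorem GBDTriple.adMinus_B (hA : IsSymmetrizableGCM A) (hκ : IsInvariantForm R κ)
    (D : DualRootBases R κ) {h h' : H} (hh : ∀ i : 𝒯.Γ₁, R.root (𝒯.T i) h = R.root i h')
    (x : nMinus R) : adMinus R h (𝒯.B x) = 𝒯.B (adMinus R h' x) := by
  induction x using nMinus_induction with
  | f i =>
    by_cases hi : i ∈ 𝒯.Γ₁
    · rw [adMinus_nF, 𝒯.B_nF hA hκ D ⟨i, hi⟩, adMinus_nF, hh, map_neg, map_smul,
        𝒯.B_nF hA hκ D ⟨i, hi⟩]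
    · rw [adMinus_nF, map_neg, map_smul, 𝒯.B_nF_eq_zero hA hκ D hi]
      simp
  | zero => simp only [map_zero]
  | add x y hx hy => simp only [map_add, hx, hy]
  | smul c x hx => simp only [map_smul, hx]
  | lie x y hx hy => simp only [LieHom.map_lie, adMinus_lie, hx, hy, map_add]

theorem GBDTriple.BInv_adPlus (hA : IsSymmetrizableGCM A) (hκ : IsInvariantForm R κ)
    (D : DualRootBases R κ) {h h' : H} (hh : ∀ i : 𝒯.Γ₁, R.root (𝒯.T i) h = R.root i h')
    (x : nPlus R) : 𝒯.BInv (adPlus R h x) = adPlus R h' (𝒯.BInv x) := by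
  induction x using nPlus_induction with
  | e i =>
    by_cases hi : i ∈ 𝒯.Γ₂
    · obtain ⟨j, hj⟩ := 𝒯.T.surjective ⟨i, hi⟩
      have hj' : i = 𝒯.T j := by rw [hj]
      subst hj'
      rw [adPlus_nE, map_smul, 𝒯.BInv_nE hA hκ D, adPlus_nE, hh]
    · rw [adPlus_nE, map_smul, 𝒯.BInv_nE_eq_zero hA hκ D hi]
      simp
  | zero => simp only [map_zero]
  | add x y hx hy => simp only [map_add, hx, hy]
  | smul c x hx => simp only [map_smul, hx]
  | lie x y hx hy => simp only [LieHom.map_lie, adPlus_lie, hx, hy, map_add]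

theorem GBDTriple.mem_l {z : H} :
    z ∈ 𝒯.l ↔ ∀ i : 𝒯.Γ₁, R.root (𝒯.T i) z = R.root i z := by
  rw [GBDTriple.l, Submodule.mem_iInf]
  refine forall_congr' fun i => ?_
  rw [LinearMap.mem_ker, LinearMap.sub_apply, sub_eq_zero, eq_comm]

theorem GBDTriple.gradElt_mem_l : gradElt R ∈ 𝒯.l := by
  rw [GBDTriple.mem_l]
  intro i
  rw [root_gradElt, root_gradElt]

/-- The compatibility of the weights `μ'` and `μ` with the triple. -/
structure GBDTriple.Compat (μ' μ : Dual ℂ H) : Prop where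
  inner : ∀ i : 𝒯.Γ₁, dualForm R κ μ' (R.root i) = dualForm R κ μ (R.root (𝒯.T i))
  res : ∀ z ∈ 𝒯.l, μ z = μ' z

variable {𝒯} in
theorem GBDTriple.Compat.coroot {μ' μ : Dual ℂ H} (hc : 𝒯.Compat μ' μ)
    (hA : IsSymmetrizableGCM A) (hκ : IsInvariantForm R κ) (D : DualRootBases R κ) (i : 𝒯.Γ₁) :
    μ (R.coroot (𝒯.T i)) = μ' (R.coroot i) := by
  rw [← chevForm_mul_dualForm hA hκ D, ← chevForm_mul_dualForm hA hκ D, 𝒯.chevForm_T hA hκ D,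
    hc.inner]

variable {μ' μ : Dual ℂ H}

theorem verma_hom_eq_zero {N : Type*} [AddCommGroup N] [Module ℂ N] {χ : Dual ℂ H}
    {X : Verma R χ →ₗ[ℂ] N} (h₀ : X (hwv R χ) = 0)
    (h : ∀ j m, X m = 0 → X ⁅chevF R j, m⁆ = 0) : X = 0 := by
  have hX : X ∘ₗ vermaWord R χ = 0 := by
    apply word.ext
    intro w
    induction w with
    | nil => rw [LinearMap.comp_apply, vermaWord_nil, h₀, LinearMap.zero_apply]
    | cons j w ih =>
      rw [LinearMap.comp_apply, ← freeF_word, vermaWord_freeF, LinearMap.zero_apply]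
      exact h j _ ih
  ext m
  obtain ⟨u, rfl⟩ := vermaWord_surjective χ m
  exact LinearMap.congr_fun hX u

theorem GBDTriple.vermaB_hwv (hA : IsSymmetrizableGCM A) :
    𝒯.vermaB μ' μ (hwv R μ') = hwv R μ := by
  have := 𝒯.isVermaB hA μ' μ 1
  simpa using this

theorem GBDTriple.vermaB_lie (hA : IsSymmetrizableGCM A) (x : nMinus R) (m : Verma R μ') :
    𝒯.vermaB μ' μ ⁅(x : KM R), m⁆ = ⁅(𝒯.B x : KM R), 𝒯.vermaB μ' μ m⁆ := by
  obtain ⟨a, rfl⟩ := verma_generated μ' m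
  rw [← ι_smul_verma, 𝒯.isVermaB hA, 𝒯.isVermaB hA, map_mul, GBDTriple.uB,
    UniversalEnvelopingAlgebra.lift_ι_apply, LieHom.comp_apply, ι_smul_verma]

theorem GBDTriple.cartan_lie_vermaB (hA : IsSymmetrizableGCM A) (hκ : IsInvariantForm R κ)
    (D : DualRootBases R κ) {h h' : H} (hh : ∀ i : 𝒯.Γ₁, R.root (𝒯.T i) h = R.root i h')
    (hm : μ h = μ' h') (m : Verma R μ') :
    ⁅cartan R h, 𝒯.vermaB μ' μ m⁆ = 𝒯.vermaB μ' μ ⁅cartan R h', m⁆ := by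
  have hX : LieModule.toEnd ℂ (KM R) (Verma R μ) (cartan R h) ∘ₗ 𝒯.vermaB μ' μ -
      𝒯.vermaB μ' μ ∘ₗ LieModule.toEnd ℂ (KM R) (Verma R μ') (cartan R h') = 0 := by
    apply verma_hom_eq_zero
    · simp [𝒯.vermaB_hwv hA, cartan_lie_hwv, hm]
    · intro j m hm
      simp only [LinearMap.sub_apply, LinearMap.comp_apply, LieModule.toEnd_apply_apply,
        sub_eq_zero] at hm ⊢
      have hB : ⁅cartan R h, (𝒯.B (nF R j) : KM R)⁆ = 𝒯.B (adMinus R h' (nF R j)) := by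
        rw [← 𝒯.adMinus_B hA hκ D hh]; rfl
      change ⁅cartan R h, 𝒯.vermaB μ' μ ⁅(nF R j : KM R), m⁆⁆ =
        𝒯.vermaB μ' μ ⁅cartan R h', ⁅(nF R j : KM R), m⁆⁆
      rw [𝒯.vermaB_lie hA, leibniz_lie, hm, leibniz_lie (cartan R h'), map_add, 𝒯.vermaB_lie hA,
        hB, ← coe_adMinus, 𝒯.vermaB_lie hA]
  have := LinearMap.congr_fun hX m
  simpa [sub_eq_zero] using this

/-- Both sides vanish on the highest weight vector, and on applying `f_j` the brackets `[e_i, B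
f_j]` and `[B⁻¹ e_i, f_j]` must be matched. They are nonzero only for `i = T k`, `j = k`, where they
are `h_{T k}` and `h_k`, and exchanging these across `B` requires `μ(h_{T k}) = μ'(h_k)`. -/
theorem GBDTriple.Compat.chevE_lie_vermaB {𝒯 : GBDTriple R κ} (hc : 𝒯.Compat μ' μ)
    (hA : IsSymmetrizableGCM A) (hκ : IsInvariantForm R κ) (D : DualRootBases R κ) (i : Fin n)
    (m : Verma R μ') :
    ⁅chevE R i, 𝒯.vermaB μ' μ m⁆ = 𝒯.vermaB μ' μ ⁅(𝒯.BInv (nE R i) : KM R), m⁆ := by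
  have hX : LieModule.toEnd ℂ (KM R) (Verma R μ) (chevE R i) ∘ₗ 𝒯.vermaB μ' μ -
      𝒯.vermaB μ' μ ∘ₗ LieModule.toEnd ℂ (KM R) (Verma R μ') (𝒯.BInv (nE R i)) = 0 := by
    apply verma_hom_eq_zero
    · simp only [LinearMap.sub_apply, LinearMap.comp_apply, LieModule.toEnd_apply_apply,
        𝒯.vermaB_hwv hA, nPlus_lie_hwv, map_zero, sub_zero]
      exact nPlus_lie_hwv μ (nE R i)
    · intro j m hm
      simp only [LinearMap.sub_apply, LinearMap.comp_apply, LieModule.toEnd_apply_apply,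
        sub_eq_zero] at hm ⊢
      change ⁅chevE R i, 𝒯.vermaB μ' μ ⁅(nF R j : KM R), m⁆⁆ =
        𝒯.vermaB μ' μ ⁅(𝒯.BInv (nE R i) : KM R), ⁅(nF R j : KM R), m⁆⁆
      rw [𝒯.vermaB_lie hA, leibniz_lie, hm, leibniz_lie (𝒯.BInv (nE R i) : KM R), map_add,
        𝒯.vermaB_lie hA, add_left_inj]
      by_cases hj : j ∈ 𝒯.Γ₁
      · rw [𝒯.B_nF hA hκ D ⟨j, hj⟩]
        change ⁅⁅chevE R i, chevF R _⁆, _⁆ = 𝒯.vermaB μ' μ ⁅⁅_, chevF R j⁆, m⁆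
        by_cases hi : i ∈ 𝒯.Γ₂
        · obtain ⟨k, hk⟩ := 𝒯.T.surjective ⟨i, hi⟩
          have hk' : i = 𝒯.T k := by rw [hk]
          subst hk'
          rw [𝒯.BInv_nE hA hκ D]
          change ⁅⁅chevE R (𝒯.T k), chevF R _⁆, _⁆ = 𝒯.vermaB μ' μ ⁅⁅chevE R k, chevF R j⁆, m⁆
          rw [chevE_lie_chevF, chevE_lie_chevF]
          by_cases hkj : (k : Fin n) = j
          · have hkj' : k = ⟨j, hj⟩ := Subtype.ext hkj
            rw [if_pos hkj, if_pos (by rw [hkj'])]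
            refine 𝒯.cartan_lie_vermaB hA hκ D (fun i => ?_) (hc.coroot hA hκ D k) m
            rw [R.pairing, R.pairing, 𝒯.cartanMatrix_T hA hκ D]
          · rw [if_neg hkj, if_neg (fun h => hkj (by
              rw [𝒯.T.injective (Subtype.ext h)]))]
            simp
        · rw [𝒯.BInv_nE_eq_zero hA hκ D hi, chevE_lie_chevF,
            if_neg (fun h : i = (𝒯.T ⟨j, hj⟩ : Fin n) => hi (by rw [h]; exact (𝒯.T ⟨j, hj⟩).2))]
          simp
      · rw [𝒯.B_nF_eq_zero hA hκ D hj]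
        simp only [ZeroMemClass.coe_zero, lie_zero, zero_lie]
        by_cases hi : i ∈ 𝒯.Γ₂
        · obtain ⟨k, hk⟩ := 𝒯.T.surjective ⟨i, hi⟩
          have hk' : i = 𝒯.T k := by rw [hk]
          subst hk'
          rw [𝒯.BInv_nE hA hκ D]
          change 0 = 𝒯.vermaB μ' μ ⁅⁅chevE R k, chevF R j⁆, m⁆
          rw [chevE_lie_chevF, if_neg (fun h : (k : Fin n) = j => hj (h ▸ k.2))]
          simp
        · rw [𝒯.BInv_nE_eq_zero hA hκ D hi]
          simp
  have := LinearMap.congr_fun hX m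
  simpa [sub_eq_zero] using this

theorem GBDTriple.Compat.nPlus_lie_vermaB {𝒯 : GBDTriple R κ} (hc : 𝒯.Compat μ' μ)
    (hA : IsSymmetrizableGCM A) (hκ : IsInvariantForm R κ) (D : DualRootBases R κ) (x : nPlus R)
    (m : Verma R μ') :
    ⁅(x : KM R), 𝒯.vermaB μ' μ m⁆ = 𝒯.vermaB μ' μ ⁅(𝒯.BInv x : KM R), m⁆ := by
  induction x using nPlus_induction generalizing m with
  | e i => exact hc.chevE_lie_vermaB hA hκ D i m
  | zero => simp
  | add x y hx hy =>
    change ⁅(x : KM R) + (y : KM R), _⁆ = _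
    rw [map_add, add_lie, hx, hy, ← map_add, ← add_lie]
    rfl
  | smul c x hx =>
    change ⁅c • (x : KM R), _⁆ = _
    rw [map_smul, smul_lie, hx, ← map_smul, ← smul_lie]
    rfl
  | lie x y hx hy =>
    change ⁅⁅(x : KM R), (y : KM R)⁆, _⁆ = _
    rw [LieHom.map_lie, lie_lie, hx, hy, hy, hx, ← map_sub, ← lie_lie]
    rfl

theorem hwv_ne_zero (hA : IsSymmetrizableGCM A) (χ : Dual ℂ H) : hwv R χ ≠ 0 := by
  intro h
  rw [← vermaWord_nil] at h
  exact word_nil_notMem_serreSub (mem_serreSub_of_vermaWord_eq_zero hA h)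

theorem nPlus_mem_span_bE (D : DualRootBases R κ) (x : nPlus R) :
    x ∈ Submodule.span ℂ (Set.range D.bE) := by
  have h := nPlus_mem_span D x
  have h2 : (Set.range fun i => (D.bE i : KM R)) =
      (nPlus R).toSubmodule.subtype '' (Set.range D.bE) := by
    rw [← Set.range_comp]; rfl
  rw [h2, ← Submodule.map_span, Submodule.mem_map] at h
  obtain ⟨y, hy, hxy⟩ := h
  rwa [← Subtype.ext hxy]

theorem nMinus_mem_span_bF (D : DualRootBases R κ) (x : nMinus R) :
    x ∈ Submodule.span ℂ (Set.range D.bF) := by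
  have h := nMinus_mem_span D x
  have h2 : (Set.range fun i => (D.bF i : KM R)) =
      (nMinus R).toSubmodule.subtype '' (Set.range D.bF) := by
    rw [← Set.range_comp]; rfl
  rw [h2, ← Submodule.map_span, Submodule.mem_map] at h
  obtain ⟨y, hy, hxy⟩ := h
  rwa [← Subtype.ext hxy]

theorem adPlus_bE (D : DualRootBases R κ) (i : D.Idx) (z : H) :
    adPlus R z (D.bE i) = (i.1 : Dual ℂ H) z • D.bE i :=
  Subtype.ext (D.bE_mem i z)

theorem adMinus_bF (D : DualRootBases R κ) (i : D.Idx) (z : H) :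
    adMinus R z (D.bF i) = (-(i.1 : Dual ℂ H) z) • D.bF i :=
  Subtype.ext (D.bF_mem i z)

theorem GBDTriple.adMinus_iterate_B (hA : IsSymmetrizableGCM A) (hκ : IsInvariantForm R κ)
    (D : DualRootBases R κ) {z : H} (hz : z ∈ 𝒯.l) {x : nMinus R} {c : ℂ}
    (hx : adMinus R z x = c • x) (s : ℕ) : adMinus R z (𝒯.B^[s] x) = c • 𝒯.B^[s] x := by
  induction s with
  | zero => exact hx
  | succ s ih =>
    rw [Function.iterate_succ_apply', 𝒯.adMinus_B hA hκ D ((𝒯.mem_l).1 hz), ih, map_smul]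

theorem GBDTriple.adPlus_iterate_BInv (hA : IsSymmetrizableGCM A) (hκ : IsInvariantForm R κ)
    (D : DualRootBases R κ) {z : H} (hz : z ∈ 𝒯.l) {x : nPlus R} {c : ℂ}
    (hx : adPlus R z x = c • x) (s : ℕ) : adPlus R z (𝒯.BInv^[s] x) = c • 𝒯.BInv^[s] x := by
  induction s with
  | zero => exact hx
  | succ s ih =>
    rw [Function.iterate_succ_apply', ← 𝒯.BInv_adPlus hA hκ D ((𝒯.mem_l).1 hz), ih, map_smul]

/-- `B⁻¹` is adjoint to `B`. -/
theorem GBDTriple.form_BInv (hA : IsSymmetrizableGCM A) (hκ : IsInvariantForm R κ)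
    (D : DualRootBases R κ) (x : nPlus R) (y : nMinus R) :
    κ (𝒯.BInv x) y = κ x (𝒯.B y) := by
  let β : nPlus R →ₗ[ℂ] nMinus R →ₗ[ℂ] ℂ :=
    κ.compl₁₂ ((nPlus R).toSubmodule.subtype ∘ₗ 𝒯.BInv.toLinearMap) (nMinus R).toSubmodule.subtype -
    κ.compl₁₂ (nPlus R).toSubmodule.subtype ((nMinus R).toSubmodule.subtype ∘ₗ 𝒯.B.toLinearMap)
  have hβ : ∀ x y, β x y = κ (𝒯.BInv x) y - κ x (𝒯.B y) := fun x y => rfl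
  suffices h : β x y = 0 by rwa [hβ, sub_eq_zero] at h
  have hx := nPlus_mem_span_bE D x
  have hy := nMinus_mem_span_bF D y
  induction hx using Submodule.span_induction with
  | zero => rw [map_zero, LinearMap.zero_apply]
  | add x x' _ _ h h' => rw [map_add, LinearMap.add_apply, h, h', add_zero]
  | smul c x _ h => rw [map_smul, LinearMap.smul_apply, h, smul_zero]
  | mem x hx =>
    obtain ⟨i, rfl⟩ := hx
    induction hy using Submodule.span_induction with
    | zero => rw [map_zero]
    | add x x' _ _ h h' => rw [map_add, h, h', add_zero]
    | smul c x _ h => rw [map_smul, h, smul_zero]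
    | mem y hy =>
      obtain ⟨j, rfl⟩ := hy
      rw [hβ]
      have g1 := D.bE_mem i (gradElt R)
      have g2 : ⁅cartan R (gradElt R), (𝒯.BInv (D.bE i) : KM R)⁆ = _ := congrArg Subtype.val
        (𝒯.adPlus_iterate_BInv hA hκ D 𝒯.gradElt_mem_l (adPlus_bE D i _) 1)
      have g3 := D.bF_mem j (gradElt R)
      have g4 : ⁅cartan R (gradElt R), (𝒯.B (D.bF j) : KM R)⁆ = _ := congrArg Subtype.val
        (𝒯.adMinus_iterate_B hA hκ D 𝒯.gradElt_mem_l (adMinus_bF D j _) 1)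
      rw [LinearMap.neg_apply] at g3
      rw [posRoots_gradElt] at g1 g2 g3 g4
      replace g2 : ⁅cartan R (gradElt R), (𝒯.BInv (D.bE i) : KM R)⁆ =
        (ht i.1 : ℂ) • (𝒯.BInv (D.bE i) : KM R) := g2
      replace g4 : ⁅cartan R (gradElt R), (𝒯.B (D.bF j) : KM R)⁆ =
        (-(ht j.1 : ℂ)) • (𝒯.B (D.bF j) : KM R) := g4
      by_cases hij : ht i.1 = ht j.1
      · rw [hij] at g1 g2
        -- Adjointness is read off a Verma module. With `x₀ = gradElt R`, the weight `(x₀, ·)` is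
        -- compatible with itself because all simple roots take the value `1` on `x₀`. On its
        -- highest weight vector `[e, B f]` and `[B⁻¹ e, f]` act by equal scalars, and invariance
        -- shows that these scalars are the height times the two sides.
        have hc : 𝒯.Compat (hForm R κ (gradElt R)) (hForm R κ (gradElt R)) := by
          refine ⟨fun i => ?_, fun z _ => rfl⟩
          rw [dualForm_comm hκ, dualForm_comm hκ _ (R.root (𝒯.T i)), dualForm_eq hA hκ D,
            dualForm_eq hA hκ D, ← eq_sharp hA hκ D (fun y => rfl), root_gradElt, root_gradElt]
        obtain ⟨u, hu⟩ := exists_cartan_of_ht D (x := ⁅(D.bE i : KM R), (𝒯.B (D.bF j) : KM R)⁆)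
          (by rw [leibniz_lie, g1, g4, smul_lie, lie_smul, ← add_smul, add_neg_cancel, zero_smul])
        obtain ⟨u', hu'⟩ := exists_cartan_of_ht D (x := ⁅(𝒯.BInv (D.bE i) : KM R), (D.bF j : KM R)⁆)
          (by rw [leibniz_lie, g2, g3, smul_lie, lie_smul, ← add_smul, add_neg_cancel, zero_smul])
        set χ := hForm R κ (gradElt R)
        have e1 : ⁅⁅(D.bE i : KM R), (𝒯.B (D.bF j) : KM R)⁆, 𝒯.vermaB χ χ (hwv R χ)⁆ =
            𝒯.vermaB χ χ ⁅⁅(𝒯.BInv (D.bE i) : KM R), (D.bF j : KM R)⁆, hwv R χ⁆ := by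
          rw [lie_lie, ← 𝒯.vermaB_lie hA, hc.nPlus_lie_vermaB hA hκ D,
            hc.nPlus_lie_vermaB hA hκ D, ← 𝒯.vermaB_lie hA, ← map_sub, ← lie_lie]
        rw [hu, hu', 𝒯.vermaB_hwv hA, cartan_lie_hwv, cartan_lie_hwv, map_smul,
          𝒯.vermaB_hwv hA] at e1
        have e2 : χ u = χ u' := smul_left_injective ℂ (hwv_ne_zero hA χ) e1
        have e3 : χ u = ht j.1 * κ (D.bE i) (𝒯.B (D.bF j)) := by
          change κ (cartan R (gradElt R)) (cartan R u) = _
          rw [← hu, ← hκ.invariant, g1, map_smul, LinearMap.smul_apply, smul_eq_mul]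
        have e4 : χ u' = ht j.1 * κ (𝒯.BInv (D.bE i)) (D.bF j) := by
          change κ (cartan R (gradElt R)) (cartan R u') = _
          rw [← hu', ← hκ.invariant, g2, map_smul, LinearMap.smul_apply, smul_eq_mul]
        rw [e3, e4] at e2
        rw [sub_eq_zero]
        exact (mul_left_cancel₀ (Nat.cast_ne_zero.2 (ht_pos j.1).ne') e2).symm
      · have hne : (ht i.1 : ℂ) + -(ht j.1 : ℂ) ≠ 0 := by
          intro h
          exact hij (by exact_mod_cast add_neg_eq_zero.1 h)
        rw [hκ.eq_zero_of_lie g2 g3 hne, hκ.eq_zero_of_lie g1 g4 hne, sub_zero]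

end OperatorB

/-! ### Completeness relations, transfer of `B`, and the Cayley transform -/

section Levels

variable {n : ℕ} {A : Matrix (Fin n) (Fin n) ℤ} {H : Type*} [AddCommGroup H] [Module ℂ H]
  {R : Realization A H} {κ : LinearMap.BilinForm ℂ (KM R)}

theorem finite_level (D : DualRootBases R κ) (k : ℕ) : {i : D.Idx | ht i.1 = k}.Finite := by
  refine (((finite_ht_le (R := R) k).toFinset.sigma fun α =>
    (Finset.univ : Finset (Fin (D.mult α)))).finite_toSet).subset fun i hi => ?_
  have hi' : ht i.1 = k := hi
  simp [hi'.le]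

/-- The indices of the basis vectors of height `k`. -/
def DualRootBases.level (D : DualRootBases R κ) (k : ℕ) : Finset D.Idx :=
  (finite_level D k).toFinset

variable (D : DualRootBases R κ)

@[simp] theorem DualRootBases.mem_level {k : ℕ} {i : D.Idx} : i ∈ D.level k ↔ ht i.1 = k :=
  (finite_level D k).mem_toFinset

theorem form_bE_bF_self (i : D.Idx) : κ (D.bE i) (D.bF i) = 1 := by
  have := D.dual i.1 i.2 i.2
  rwa [if_pos rfl] at this

theorem form_bE_bF_ne (hκ : IsInvariantForm R κ) {i j : D.Idx} (hij : i ≠ j) :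
    κ (D.bE i) (D.bF j) = 0 := by
  obtain ⟨α, t⟩ := i
  obtain ⟨β, t'⟩ := j
  by_cases h : α = β
  · subst h
    have := D.dual α t t'
    rwa [if_neg (fun h => hij (by rw [h]))] at this
  · have hne : (α : Dual ℂ H) ≠ β := fun h' => h (Subtype.ext h')
    obtain ⟨z, hz⟩ := DFunLike.ne_iff.1 hne
    refine hκ.eq_zero_of_lie (D.bE_mem ⟨α, t⟩ z) (D.bF_mem ⟨β, t'⟩ z) ?_
    rw [LinearMap.neg_apply]
    exact fun h => hz (add_neg_eq_zero.1 h)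

theorem eq_sum_bE (hκ : IsInvariantForm R κ) {k : ℕ} (hk : 0 < k) {x : KM R}
    (hx : ⁅cartan R (gradElt R), x⁆ = (k : ℂ) • x) :
    x = ∑ i ∈ D.level k, κ x (D.bF i) • (D.bE i : KM R) := by
  have hmem := mem_span_bE_of_ht D hk hx
  clear hx
  induction hmem using Submodule.span_induction with
  | mem x hx =>
    obtain ⟨i, hi, rfl⟩ := hx
    rw [Finset.sum_eq_single_of_mem i (D.mem_level.2 hi), form_bE_bF_self, one_smul]
    intro j _ hj
    rw [form_bE_bF_ne D hκ hj.symm, zero_smul]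
  | zero => simp
  | add x y _ _ h h' =>
    simp only [map_add, LinearMap.add_apply, add_smul, Finset.sum_add_distrib]
    rw [← h, ← h']
  | smul c x _ h =>
    simp only [map_smul, LinearMap.smul_apply, smul_assoc, ← Finset.smul_sum]
    rw [← h]

theorem eq_sum_bF (hκ : IsInvariantForm R κ) {k : ℕ} (hk : 0 < k) {x : KM R}
    (hx : ⁅cartan R (gradElt R), x⁆ = (-(k : ℂ)) • x) :
    x = ∑ i ∈ D.level k, κ (D.bE i) x • (D.bF i : KM R) := by
  have hmem := mem_span_bF_of_ht D hk hx
  clear hx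
  induction hmem using Submodule.span_induction with
  | mem x hx =>
    obtain ⟨i, hi, rfl⟩ := hx
    rw [Finset.sum_eq_single_of_mem i (D.mem_level.2 hi), form_bE_bF_self, one_smul]
    intro j _ hj
    rw [form_bE_bF_ne D hκ hj, zero_smul]
  | zero => simp
  | add x y _ _ h h' =>
    simp only [map_add, add_smul, Finset.sum_add_distrib]
    rw [← h, ← h']
  | smul c x _ h =>
    simp only [map_smul, smul_assoc, ← Finset.smul_sum]
    rw [← h]

theorem adPlus_gradElt_bE (i : D.Idx) :
    adPlus R (gradElt R) (D.bE i) = (ht i.1 : ℂ) • D.bE i := by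
  rw [adPlus_bE, posRoots_gradElt]

theorem adMinus_gradElt_bF (i : D.Idx) :
    adMinus R (gradElt R) (D.bF i) = (-(ht i.1 : ℂ)) • D.bF i := by
  rw [adMinus_bF, posRoots_gradElt]

theorem nPlus_eq_sum_bE (hκ : IsInvariantForm R κ) {k : ℕ} (hk : 0 < k) {x : nPlus R}
    (hx : adPlus R (gradElt R) x = (k : ℂ) • x) :
    x = ∑ i ∈ D.level k, κ x (D.bF i) • D.bE i := by
  apply Subtype.ext
  refine (eq_sum_bE D hκ hk (congrArg Subtype.val hx)).trans ?_
  change _ = (nPlus R).toSubmodule.subtype _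
  rw [map_sum]
  rfl

theorem nMinus_eq_sum_bF (hκ : IsInvariantForm R κ) {k : ℕ} (hk : 0 < k) {x : nMinus R}
    (hx : adMinus R (gradElt R) x = (-(k : ℂ)) • x) :
    x = ∑ i ∈ D.level k, κ (D.bE i) x • D.bF i := by
  apply Subtype.ext
  refine (eq_sum_bF D hκ hk (congrArg Subtype.val hx)).trans ?_
  change _ = (nMinus R).toSubmodule.subtype _
  rw [map_sum]
  rfl

variable (𝒯 : GBDTriple R κ)

/-- The restriction to `𝔩` of the root of a basis vector. -/
def GBDTriple.lroot (𝒯 : GBDTriple R κ) {D : DualRootBases R κ} (i : D.Idx) : Dual ℂ 𝒯.l :=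
  𝒯.res (i.1 : Dual ℂ H)

variable {𝒯}

theorem GBDTriple.lroot_eq_of_BInv (hA : IsSymmetrizableGCM A) (hκ : IsInvariantForm R κ)
    {i j : D.Idx} {v : ℕ} (h : κ (𝒯.BInv^[v] (D.bE i) : nPlus R) (D.bF j) ≠ 0) :
    𝒯.lroot i = 𝒯.lroot j := by
  ext z
  by_contra hne
  refine h (hκ.eq_zero_of_lie (z := cartan R z) (congrArg Subtype.val
    (𝒯.adPlus_iterate_BInv hA hκ D z.2 (adPlus_bE D i z) v))
    (congrArg Subtype.val (adMinus_bF D j z)) ?_)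
  exact fun h => hne (add_neg_eq_zero.1 h)

theorem GBDTriple.lroot_eq_of_B (hA : IsSymmetrizableGCM A) (hκ : IsInvariantForm R κ)
    {i j : D.Idx} {v : ℕ} (h : κ (D.bE i) (𝒯.B^[v] (D.bF j) : nMinus R) ≠ 0) :
    𝒯.lroot i = 𝒯.lroot j := by
  ext z
  by_contra hne
  refine h (hκ.eq_zero_of_lie (z := cartan R z) (congrArg Subtype.val (adPlus_bE D i z))
    (congrArg Subtype.val (𝒯.adMinus_iterate_B hA hκ D z.2 (adMinus_bF D j z) v)) ?_)
  exact fun h => hne (add_neg_eq_zero.1 h)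

theorem GBDTriple.BInv_iterate_eq_sum (hA : IsSymmetrizableGCM A) (hκ : IsInvariantForm R κ)
    (i : D.Idx) (v : ℕ) : 𝒯.BInv^[v] (D.bE i) =
      ∑ j ∈ D.level (ht i.1), κ (𝒯.BInv^[v] (D.bE i) : nPlus R) (D.bF j) • D.bE j :=
  nPlus_eq_sum_bE D hκ (ht_pos i.1) (𝒯.adPlus_iterate_BInv hA hκ D 𝒯.gradElt_mem_l
    (adPlus_gradElt_bE D i) v)

theorem GBDTriple.B_iterate_eq_sum (hA : IsSymmetrizableGCM A) (hκ : IsInvariantForm R κ)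
    (i : D.Idx) (v : ℕ) : 𝒯.B^[v] (D.bF i) =
      ∑ j ∈ D.level (ht i.1), κ (D.bE j) (𝒯.B^[v] (D.bF i) : nMinus R) • D.bF j :=
  nMinus_eq_sum_bF D hκ (ht_pos i.1) (𝒯.adMinus_iterate_B hA hκ D 𝒯.gradElt_mem_l
    (adMinus_gradElt_bF D i) v)

/-- Adjointness of `B` and `B⁻¹` in terms of the canonical element of height `k`. -/
theorem GBDTriple.sum_level_transfer (hA : IsSymmetrizableGCM A) (hκ : IsInvariantForm R κ)
    {W : Type*} [AddCommGroup W] [Module ℂ W]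
    (Ψ : Dual ℂ 𝒯.l → nPlus R →ₗ[ℂ] nMinus R →ₗ[ℂ] W) (k : ℕ) :
    ∑ i ∈ D.level k, Ψ (𝒯.lroot i) (𝒯.BInv (D.bE i)) (D.bF i) =
      ∑ i ∈ D.level k, Ψ (𝒯.lroot i) (D.bE i) (𝒯.B (D.bF i)) := by
  have h1 : ∀ i ∈ D.level k, Ψ (𝒯.lroot i) (𝒯.BInv (D.bE i)) (D.bF i) =
      ∑ j ∈ D.level k, κ (𝒯.BInv (D.bE i)) (D.bF j) • Ψ (𝒯.lroot i) (D.bE j) (D.bF i) := by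
    intro i hi
    have h := 𝒯.BInv_iterate_eq_sum D hA hκ i 1
    rw [D.mem_level.1 hi] at h
    have h' := congrArg (fun x => Ψ (𝒯.lroot i) x (D.bF i)) h
    simpa only [Function.iterate_one, map_sum, LinearMap.sum_apply, map_smul,
      LinearMap.smul_apply] using h'
  have h2 : ∀ i ∈ D.level k, Ψ (𝒯.lroot i) (D.bE i) (𝒯.B (D.bF i)) =
      ∑ j ∈ D.level k, κ (D.bE j) (𝒯.B (D.bF i)) • Ψ (𝒯.lroot i) (D.bE i) (D.bF j) := by
    intro i hi
    have h := 𝒯.B_iterate_eq_sum D hA hκ i 1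
    rw [D.mem_level.1 hi] at h
    have h' := congrArg (fun x => Ψ (𝒯.lroot i) (D.bE i) x) h
    simpa only [Function.iterate_one, map_sum, LinearMap.sum_apply, map_smul,
      LinearMap.smul_apply] using h'
  rw [Finset.sum_congr rfl h1, Finset.sum_congr rfl h2, Finset.sum_comm]
  refine Finset.sum_congr rfl fun i _ => Finset.sum_congr rfl fun j _ => ?_
  rw [𝒯.form_BInv hA hκ D]
  -- A nonzero pairing forces the two roots to agree on `𝔩`, so the label of `Ψ` may be exchanged.
  by_cases h : κ (D.bE j) (𝒯.B (D.bF i)) = 0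
  · rw [h, zero_smul, zero_smul]
  · rw [𝒯.lroot_eq_of_B D hA hκ (v := 1) h]

theorem GBDTriple.sum_level_transfer_iterate (hA : IsSymmetrizableGCM A)
    (hκ : IsInvariantForm R κ) {W : Type*} [AddCommGroup W] [Module ℂ W]
    (Ψ : Dual ℂ 𝒯.l → nPlus R →ₗ[ℂ] nMinus R →ₗ[ℂ] W) (k v s : ℕ) :
    ∑ i ∈ D.level k, Ψ (𝒯.lroot i) (𝒯.BInv^[v] (D.bE i)) (𝒯.B^[s] (D.bF i)) =
      ∑ i ∈ D.level k, Ψ (𝒯.lroot i) (D.bE i) (𝒯.B^[s + v] (D.bF i)) := by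
  induction v generalizing s with
  | zero => rfl
  | succ v ih =>
    have h := 𝒯.sum_level_transfer D hA hκ (fun η => (Ψ η).compl₁₂
      ((𝒯.BInv : nPlus R →ₗ[ℂ] nPlus R) ^ v) ((𝒯.B : nMinus R →ₗ[ℂ] nMinus R) ^ s)) k
    simp only [LinearMap.compl₁₂_apply, Module.End.pow_apply] at h
    rw [add_comm v 1, ← add_assoc, ← ih, add_comm 1 v]
    exact h

theorem GBDTriple.orthogonal_l {D : DualRootBases R κ} (hA : IsSymmetrizableGCM A)
    (hκ : IsInvariantForm R κ) (i : 𝒯.Γ₁) :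
    sharp R κ (R.root i - R.root (𝒯.T i)) ∈ 𝒯.h₀ := by
  rw [GBDTriple.h₀, LinearMap.BilinForm.mem_orthogonal_iff]
  intro z hz
  rw [hForm_comm hκ, hForm_sharp hA hκ D, LinearMap.sub_apply, (𝒯.mem_l).1 hz, sub_self]

theorem GBDTriple.mem_span_of_l {φ : Dual ℂ H} (h : ∀ z ∈ 𝒯.l, φ z = 0) :
    φ ∈ Submodule.span ℂ (Set.range fun i : 𝒯.Γ₁ => R.root i - R.root (𝒯.T i)) :=
  mem_span_of_iInf_ker_le_ker fun z hz => h z hz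

theorem GBDTriple.h₀_eq_span {D : DualRootBases R κ} (hA : IsSymmetrizableGCM A)
    (hκ : IsInvariantForm R κ) : 𝒯.h₀ =
      Submodule.span ℂ (Set.range fun i : 𝒯.Γ₁ => sharp R κ (R.root i - R.root (𝒯.T i))) := by
  apply le_antisymm
  · intro y hy
    rw [GBDTriple.h₀, LinearMap.BilinForm.mem_orthogonal_iff] at hy
    have h := Submodule.mem_map_of_mem (f := sharp R κ) (𝒯.mem_span_of_l (φ := hForm R κ y)
      fun z hz => by rw [hForm_comm hκ]; exact hy z hz)
    rw [← eq_sharp hA hκ D (fun y => rfl), Submodule.map_span, ← Set.range_comp] at h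
    exact h
  · rw [Submodule.span_le]
    rintro _ ⟨i, rfl⟩
    exact 𝒯.orthogonal_l (D := D) hA hκ i

/-- The `𝔥₀`-components of the elements `[e, B^s f]`, `s > 0`, cancel. -/
theorem GBDTriple.sum_level_form_h₀ (hA : IsSymmetrizableGCM A) (hκ : IsInvariantForm R κ)
    {W : Type*} [AddCommGroup W] [Module ℂ W] (g : Dual ℂ 𝒯.l → W) (k s : ℕ) {y : H}
    (hy : y ∈ 𝒯.h₀) :
    ∑ i ∈ D.level k, κ ⁅(D.bE i : KM R), ((𝒯.B^[s + 1] (D.bF i) : nMinus R) : KM R)⁆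
      (cartan R y) • g (𝒯.lroot i) = 0 := by
  rw [𝒯.h₀_eq_span (D := D) hA hκ] at hy
  induction hy using Submodule.span_induction with
  | zero => simp
  | add y y' _ _ h h' =>
    simp only [map_add, add_smul, Finset.sum_add_distrib]
    rw [h, h', add_zero]
  | smul c y _ h =>
    simp only [map_smul, smul_assoc, ← Finset.smul_sum]
    rw [h, smul_zero]
  | mem y hy =>
    obtain ⟨j, rfl⟩ := hy
    dsimp only
    have hc := chevForm_ne_zero hA hκ D j
    -- The spanning vectors of `𝔥₀` are multiples of `h_j - h_{T j}`, since `h_j` and `h_{T j}` have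
    -- the same normalization. It remains to see that both coroots give the same sum.
    have hy : sharp R κ (R.root j - R.root (𝒯.T j)) =
        (chevForm R κ j)⁻¹ • (R.coroot j - R.coroot (𝒯.T j)) := by
      rw [coroot_eq hA hκ D, coroot_eq hA hκ D, 𝒯.chevForm_T hA hκ D, ← smul_sub, smul_smul,
        inv_mul_cancel₀ hc, one_smul, map_sub]
    have hh : ∀ i : 𝒯.Γ₁, R.root (𝒯.T i) (R.coroot (𝒯.T j)) = R.root i (R.coroot j) := by
      intro i
      rw [R.pairing, R.pairing, 𝒯.cartanMatrix_T hA hκ D]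
    have hswap : ∀ (x : nPlus R) (f : nMinus R) (h : H),
        κ ⁅(x : KM R), (f : KM R)⁆ (cartan R h) = -κ x (adMinus R h f) := by
      intro x f h
      rw [hκ.invariant, ← lie_skew, map_neg]
      rfl
    rw [hy]
    simp only [map_smul, map_sub, smul_assoc, ← Finset.smul_sum, sub_smul, Finset.sum_sub_distrib,
      hswap, neg_smul, Finset.sum_neg_distrib]
    -- Passing `h_{T j}` through one `B` makes it `h_j`, while adjointness moves that `B` to `e` as
    -- `B⁻¹`. Transferring it back with `h_j` in place gives the sum for `h_j`.
    have e1 : ∀ i, κ (D.bE i) (adMinus R (R.coroot (𝒯.T j)) (𝒯.B^[s + 1] (D.bF i))) =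
        κ (𝒯.BInv (D.bE i)) (adMinus R (R.coroot j) (𝒯.B^[s] (D.bF i))) := by
      intro i
      rw [Function.iterate_succ_apply', 𝒯.adMinus_B hA hκ D hh, 𝒯.form_BInv hA hκ D]
    let Ψ : Dual ℂ 𝒯.l → nPlus R →ₗ[ℂ] nMinus R →ₗ[ℂ] W := fun η =>
      (κ.compl₁₂ (nPlus R).toSubmodule.subtype ((nMinus R).toSubmodule.subtype ∘ₗ
        adMinus R (R.coroot j) ∘ₗ ((𝒯.B : nMinus R →ₗ[ℂ] nMinus R) ^ s))).compr₂
        ((LinearMap.id : ℂ →ₗ[ℂ] ℂ).smulRight (g η))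
    have hΨ : ∀ η x f, Ψ η x f = κ x (adMinus R (R.coroot j) (𝒯.B^[s] f)) • g η := by
      intro η x f
      simp only [Ψ, LinearMap.compr₂_apply, LinearMap.compl₁₂_apply, LinearMap.smulRight_apply,
        LinearMap.comp_apply, Module.End.pow_apply, LinearMap.id_apply]
      rfl
    have e2 := 𝒯.sum_level_transfer D hA hκ Ψ k
    simp only [hΨ, ← e1] at e2
    simp only [← Function.iterate_succ_apply] at e2
    rw [e2, neg_sub_neg, sub_self, smul_zero]

end Levels

/-! ### The Cayley transform of `T` on `𝔥₀`. -/

section Cayley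

variable {n : ℕ} {A : Matrix (Fin n) (Fin n) ℤ} {H : Type*} [AddCommGroup H] [Module ℂ H]
  {R : Realization A H} {κ : LinearMap.BilinForm ℂ (KM R)} {D : DualRootBases R κ}
  {𝒯 : GBDTriple R κ}

theorem GBDTriple.isCompl_l (hκ : IsInvariantForm R κ) (h𝒯 : 𝒯.IsNondegenerate) :
    IsCompl 𝒯.l 𝒯.h₀ := by
  have := R.finiteDimensional
  exact LinearMap.BilinForm.isCompl_orthogonal_of_restrict_nondegenerate
    (fun x y h => by rw [hForm_comm hκ, h]) h𝒯

theorem GBDTriple.hForm_l_h₀ {z y : H} (hz : z ∈ 𝒯.l) (hy : y ∈ 𝒯.h₀) : hForm R κ z y = 0 := by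
  rw [GBDTriple.h₀, LinearMap.BilinForm.mem_orthogonal_iff] at hy
  exact hy z hz

theorem GBDTriple.hForm_h₀_l (hκ : IsInvariantForm R κ) {z y : H} (hz : z ∈ 𝒯.l)
    (hy : y ∈ 𝒯.h₀) : hForm R κ y z = 0 := by
  rw [hForm_comm hκ, 𝒯.hForm_l_h₀ hz hy]

theorem eq_sum_of_orthonormal {β : LinearMap.BilinForm ℂ H} {p : Submodule ℂ H} {I : Type*}
    [Fintype I] [DecidableEq I] (x : Basis I ℂ p)
    (hx : ∀ i j, β (x i) (x j) = if i = j then 1 else 0) {z : H} (hz : z ∈ p) :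
    z = ∑ j, β z (x j) • (x j : H) := by
  have h1 : z = ∑ j, x.repr ⟨z, hz⟩ j • (x j : H) := by
    have := congrArg Subtype.val (x.sum_repr ⟨z, hz⟩)
    rw [Submodule.coe_sum] at this
    exact this.symm
  have h2 : ∀ j, β z (x j) = x.repr ⟨z, hz⟩ j := by
    intro j
    conv_lhs => rw [h1]
    simp [LinearMap.sum_apply, hx]
  simp only [h2]
  exact h1

theorem GBDTriple.eq_sum_bases (hκ : IsInvariantForm R κ) (h𝒯 : 𝒯.IsNondegenerate)
    {I₁ I₂ : Type*} [Fintype I₁] [Fintype I₂] [DecidableEq I₁] [DecidableEq I₂]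
    (x : Basis I₁ ℂ 𝒯.l) (y : Basis I₂ ℂ 𝒯.h₀)
    (hx : ∀ i j, hForm R κ (x i) (x j) = if i = j then 1 else 0)
    (hy : ∀ i j, hForm R κ (y i) (y j) = if i = j then 1 else 0) (u : H) :
    u = ∑ j, hForm R κ u (x j) • (x j : H) + ∑ j, hForm R κ u (y j) • (y j : H) := by
  have hu : u ∈ 𝒯.l ⊔ 𝒯.h₀ := by rw [(𝒯.isCompl_l hκ h𝒯).sup_eq_top]; trivial
  obtain ⟨z, hz, w, hw, rfl⟩ := Submodule.mem_sup.1 hu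
  have h1 : ∀ j, hForm R κ (z + w) (x j) = hForm R κ z (x j) := fun j => by
    rw [map_add, LinearMap.add_apply, 𝒯.hForm_h₀_l hκ (x j).2 hw, add_zero]
  have h2 : ∀ j, hForm R κ (z + w) (y j) = hForm R κ w (y j) := fun j => by
    rw [map_add, LinearMap.add_apply, 𝒯.hForm_l_h₀ hz (y j).2, zero_add]
  simp only [h1, h2]
  rw [← eq_sum_of_orthonormal x hx hz, ← eq_sum_of_orthonormal y hy hw]

/-- The mixed products agree on both sides, and the others cancel because `T` is an isometry. This
skewness is what makes the Cayley transform consistent. -/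
theorem GBDTriple.root_antisymm (D : DualRootBases R κ) (hA : IsSymmetrizableGCM A)
    (hκ : IsInvariantForm R κ) (i j : 𝒯.Γ₁) :
    (R.root i + R.root (𝒯.T i)) (sharp R κ (R.root j - R.root (𝒯.T j))) =
      -(R.root i - R.root (𝒯.T i)) (sharp R κ (R.root j + R.root (𝒯.T j))) := by
  have h := 𝒯.inner_eq i j
  rw [dualForm_eq hA hκ D, dualForm_eq hA hκ D] at h
  simp only [map_add, map_sub, LinearMap.add_apply, LinearMap.sub_apply]
  linear_combination -2 * h

/-- The transform should send `(α - T α)^♯` to minus the `𝔥₀`-component of `(α + T α)^♯`. A linear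
section `s` writes a vector of `𝔥₀` as a combination of the former, and `hPQ` shows that the values
under the `α_i - T α_i` do not depend on the combination chosen. -/
theorem GBDTriple.isCayley (D : DualRootBases R κ) (hA : IsSymmetrizableGCM A)
    (hκ : IsInvariantForm R κ) (h𝒯 : 𝒯.IsNondegenerate) : 𝒯.IsCayley 𝒯.cayley := by
  have hex : ∃ C, 𝒯.IsCayley C := by
    let P₀ : (𝒯.Γ₁ →₀ ℂ) →ₗ[ℂ] H :=
      Finsupp.linearCombination ℂ fun i => sharp R κ (R.root i - R.root (𝒯.T i))
    have hP : LinearMap.range P₀ = 𝒯.h₀ := by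
      rw [Finsupp.range_linearCombination, 𝒯.h₀_eq_span (D := D) hA hκ]
    let P : (𝒯.Γ₁ →₀ ℂ) →ₗ[ℂ] 𝒯.h₀ := P₀.codRestrict _ fun a => hP.le ⟨a, rfl⟩
    let Q : (𝒯.Γ₁ →₀ ℂ) →ₗ[ℂ] H :=
      Finsupp.linearCombination ℂ fun i => sharp R κ (R.root i + R.root (𝒯.T i))
    obtain ⟨s, hs⟩ := P.exists_rightInverse_of_surjective (by
      rw [LinearMap.range_eq_top]
      intro y
      obtain ⟨a, ha⟩ : (y : H) ∈ LinearMap.range P₀ := hP.ge y.2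
      exact ⟨a, Subtype.ext ha⟩)
    have hPQ : ∀ (i : 𝒯.Γ₁) a, (R.root i - R.root (𝒯.T i)) (Q a) =
        -(R.root i + R.root (𝒯.T i)) (P₀ a) := by
      intro i a
      induction a using Finsupp.induction_linear with
      | zero => simp
      | add a b ha hb => rw [map_add, map_add, map_add, map_add, ha, hb, neg_add]
      | single j c =>
        simp only [Q, P₀, Finsupp.linearCombination_single, map_smul]
        rw [𝒯.root_antisymm D hA hκ, smul_neg, neg_neg]
    have hcompl := 𝒯.isCompl_l hκ h𝒯
    refine ⟨-((𝒯.h₀).projectionOnto 𝒯.l hcompl.symm ∘ₗ Q ∘ₗ s), fun x i => ?_⟩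
    have hproj : ∀ u : H, (R.root i - R.root (𝒯.T i)) ((𝒯.h₀).projectionOnto 𝒯.l hcompl.symm u) =
        (R.root i - R.root (𝒯.T i)) u := by
      intro u
      have hu : u ∈ 𝒯.l ⊔ 𝒯.h₀ := by rw [hcompl.sup_eq_top]; trivial
      obtain ⟨z, hz, w, hw, rfl⟩ := Submodule.mem_sup.1 hu
      rw [map_add, Submodule.projectionOnto_apply_of_mem_right _ hz,
        Submodule.projectionOnto_apply_of_mem_left _ hw, zero_add, map_add,
        LinearMap.sub_apply _ _ z, (𝒯.mem_l).1 hz, sub_self, zero_add]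
    have hx : P₀ (s x) = x := congrArg Subtype.val (LinearMap.congr_fun hs x)
    rw [LinearMap.neg_apply, Submodule.coe_neg, map_neg, LinearMap.comp_apply, hproj,
      LinearMap.comp_apply, hPQ, neg_neg, hx]
  rw [GBDTriple.cayley, dif_pos hex]
  exact hex.choose_spec

/-- The element `(C + 1) x / 2`. -/
def GBDTriple.cayleyAdd (𝒯 : GBDTriple R κ) (x : 𝒯.h₀) : H :=
  (((1 / 2 : ℂ) • (𝒯.cayley x + x) : 𝒯.h₀) : H)

/-- The element `(C - 1) x / 2`. -/
def GBDTriple.cayleySub (𝒯 : GBDTriple R κ) (x : 𝒯.h₀) : H :=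
  (((1 / 2 : ℂ) • (𝒯.cayley x - x) : 𝒯.h₀) : H)

theorem GBDTriple.cayleyAdd_eq (x : 𝒯.h₀) : 𝒯.cayleyAdd x = (x : H) + 𝒯.cayleySub x := by
  rw [GBDTriple.cayleyAdd, GBDTriple.cayleySub, ← Submodule.coe_add]
  congr 1
  module

theorem GBDTriple.halfCayley_eq (x : 𝒯.h₀) : 𝒯.halfCayley x = -cartan R (𝒯.cayleySub x) := by
  rw [GBDTriple.halfCayley, GBDTriple.cayleySub, ← map_neg, ← Submodule.coe_neg]
  congr 2
  module

/-- The defining property of the Cayley transform in the form needed to pass `(C + 1)x/2` across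
`B`. -/
theorem GBDTriple.root_cayley (D : DualRootBases R κ) (hA : IsSymmetrizableGCM A)
    (hκ : IsInvariantForm R κ) (h𝒯 : 𝒯.IsNondegenerate) (x : 𝒯.h₀) (i : 𝒯.Γ₁) :
    R.root (𝒯.T i) (𝒯.cayleyAdd x) = R.root i (𝒯.cayleySub x) := by
  have h := 𝒯.isCayley D hA hκ h𝒯 x i
  simp only [GBDTriple.cayleyAdd, GBDTriple.cayleySub, Submodule.coe_smul, Submodule.coe_add,
    Submodule.coe_sub, map_smul, map_add, map_sub, LinearMap.sub_apply, LinearMap.add_apply,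
    smul_eq_mul] at h ⊢
  linear_combination (-1 / 2) * h

/-- The claim is `(μ - μ')(C x) + (μ + μ')(x) = 0`. As `μ - μ'` vanishes on `𝔩`, it is a combination
of the `α - T α`, so for `x = (α_j - T α_j)^♯` skewness evaluates the first term and leaves `2(μ',
α_j) - 2(μ, T α_j)`. -/
theorem GBDTriple.Compat.apply_cayley (D : DualRootBases R κ) (hA : IsSymmetrizableGCM A)
    (hκ : IsInvariantForm R κ) (h𝒯 : 𝒯.IsNondegenerate) {μ' μ : Dual ℂ H}
    (hc : 𝒯.Compat μ' μ) (x : 𝒯.h₀) : μ (𝒯.cayleyAdd x) = μ' (𝒯.cayleySub x) := by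
  have hspan := 𝒯.mem_span_of_l (φ := μ - μ') fun z hz => by
    rw [LinearMap.sub_apply, hc.res z hz, sub_self]
  have key : ∀ j : 𝒯.Γ₁, ∀ φ ∈ Submodule.span ℂ (Set.range fun i : 𝒯.Γ₁ =>
      R.root i - R.root (𝒯.T i)), ∀ w : 𝒯.h₀,
      (w : H) = sharp R κ (R.root j - R.root (𝒯.T j)) →
      φ (𝒯.cayley w) = -φ (sharp R κ (R.root j + R.root (𝒯.T j))) := by
    intro j φ hφ w hw
    induction hφ using Submodule.span_induction with
    | zero => simp
    | add φ ψ _ _ h h' => rw [LinearMap.add_apply, h, h', LinearMap.add_apply, neg_add]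
    | smul c φ _ h => rw [LinearMap.smul_apply, h, LinearMap.smul_apply, smul_neg]
    | mem φ hφ =>
      obtain ⟨i, rfl⟩ := hφ
      rw [𝒯.isCayley D hA hκ h𝒯, hw, 𝒯.root_antisymm D hA hκ]
  suffices h : ∀ u ∈ 𝒯.h₀, ∀ x : 𝒯.h₀, (x : H) = u →
      (μ - μ') (𝒯.cayley x) + (μ + μ') x = 0 by
    have h' := h x x.2 x rfl
    simp only [GBDTriple.cayleyAdd, GBDTriple.cayleySub, Submodule.coe_smul, Submodule.coe_add,
      Submodule.coe_sub, map_smul, map_add, map_sub, LinearMap.sub_apply, LinearMap.add_apply,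
      smul_eq_mul] at h' ⊢
    linear_combination (1 / 2) * h'
  intro u hu
  have hu' := hu
  rw [𝒯.h₀_eq_span (D := D) hA hκ] at hu'
  clear hu
  induction hu' using Submodule.span_induction with
  | zero =>
    intro x hx
    have : x = 0 := Subtype.ext hx
    rw [this]; simp
  | add u v hu hv h h' =>
    intro x hx
    rw [← 𝒯.h₀_eq_span (D := D) hA hκ] at hu hv
    have : x = ⟨u, hu⟩ + ⟨v, hv⟩ := Subtype.ext hx
    have e1 := h ⟨u, hu⟩ rfl
    have e2 := h' ⟨v, hv⟩ rfl
    rw [this, map_add, Submodule.coe_add, Submodule.coe_add, map_add, map_add]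
    linear_combination e1 + e2
  | smul c u hu h =>
    intro x hx
    rw [← 𝒯.h₀_eq_span (D := D) hA hκ] at hu
    have : x = c • ⟨u, hu⟩ := Subtype.ext hx
    have e1 := h ⟨u, hu⟩ rfl
    rw [this, map_smul, Submodule.coe_smul, Submodule.coe_smul, map_smul, map_smul, smul_eq_mul,
      smul_eq_mul]
    linear_combination c * e1
  | mem u hu =>
    obtain ⟨j, rfl⟩ := hu
    intro x hx
    rw [key j _ hspan x hx, hx]
    have h := hc.inner j
    rw [dualForm_eq hA hκ D, dualForm_eq hA hκ D] at h
    simp only [map_add, map_sub, LinearMap.add_apply, LinearMap.sub_apply]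
    linear_combination 2 * h

end Cayley

/-! ### The Casimir operator -/

section Casimir

variable {n : ℕ} {A : Matrix (Fin n) (Fin n) ℤ} {H : Type*} [AddCommGroup H] [Module ℂ H]
  {R : Realization A H} {κ : LinearMap.BilinForm ℂ (KM R)}

theorem wordWt_gradElt (w : List (Fin n)) : wordWt R w (gradElt R) = w.length := by
  induction w with
  | nil => simp [wordWt]
  | cons j w ih =>
    have : wordWt R (j :: w) = R.root j + wordWt R w := by simp [wordWt]
    rw [this, LinearMap.add_apply, ih, root_gradElt, List.length_cons]
    push_cast
    ring

theorem vermaWord_mem_wtSpace (χ : Dual ℂ H) (w : List (Fin n)) :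
    vermaWord R χ (word w) ∈ wtSpace R (Verma R χ) (χ - wordWt R w) := by
  intro x
  rw [← vermaWord_freeH, freeH_word, map_smul]

theorem span_vermaWord (χ : Dual ℂ H) :
    Submodule.span ℂ (Set.range fun w => vermaWord R χ (word w)) = ⊤ := by
  have h : (Set.range fun w => vermaWord R χ (word w)) = vermaWord R χ '' Set.range word := by
    rw [← Set.range_comp]; rfl
  rw [h, ← Submodule.map_span, word.span_eq, Submodule.map_top, LinearMap.range_eq_top]
  exact vermaWord_surjective χ

theorem mem_span_vermaWord_of_ht {χ : Dual ℂ H} {m : Verma R χ} {c : ℂ}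
    (hm : ⁅cartan R (gradElt R), m⁆ = c • m) : m ∈ Submodule.span ℂ
      ((fun w => vermaWord R χ (word w)) '' {w | χ (gradElt R) - w.length = c}) :=
  mem_span_of_iSupIndep (v := fun w => vermaWord R χ (word w))
    (c := fun w => χ (gradElt R) - w.length)
    (Module.End.eigenspaces_iSupIndep
      (LieModule.toEnd ℂ (KM R) (Verma R χ) (cartan R (gradElt R))))
    (fun w => Module.End.mem_eigenspace_iff.2 (by
      rw [LieModule.toEnd_apply_apply, vermaWord_mem_wtSpace χ w (gradElt R),
        LinearMap.sub_apply, wordWt_gradElt]))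
    (Module.End.mem_eigenspace_iff.2 hm) (by rw [span_vermaWord]; trivial)

theorem mem_span_vermaWord_of_wt {χ χ' : Dual ℂ H} {m : Verma R χ}
    (hm : m ∈ wtSpace R (Verma R χ) χ') : m ∈ Submodule.span ℂ
      ((fun w => vermaWord R χ (word w)) '' {w | χ - wordWt R w = χ'}) :=
  mem_span_of_iSupIndep (v := fun w => vermaWord R χ (word w))
    (c := fun w => χ - wordWt R w) (iSupIndep_wtSpace R _)
    (vermaWord_mem_wtSpace χ) hm (by rw [span_vermaWord]; trivial)

theorem verma_eq_zero_of_ht {χ : Dual ℂ H} {m : Verma R χ} {c : ℂ}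
    (hm : ⁅cartan R (gradElt R), m⁆ = c • m) (hc : ∀ k : ℕ, χ (gradElt R) - k ≠ c) : m = 0 := by
  have h := mem_span_vermaWord_of_ht hm
  have h2 : {w : List (Fin n) | χ (gradElt R) - w.length = c} = ∅ :=
    Set.eq_empty_of_forall_notMem fun w hw => hc _ hw
  rwa [h2, Set.image_empty, Submodule.span_empty, Submodule.mem_bot] at h

/-- Raising by more than the length of the word would exceed the highest weight. Hence the Casimir
operator is a finite sum on each vector. -/
theorem bE_lie_vermaWord (D : DualRootBases R κ) {χ : Dual ℂ H} {w : List (Fin n)} {i : D.Idx}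
    (h : w.length < ht i.1) : ⁅(D.bE i : KM R), vermaWord R χ (word w)⁆ = 0 := by
  have h1 := lie_mem_wtSpace (D.bE_mem i) (vermaWord_mem_wtSpace (R := R) χ w) (gradElt R)
  refine verma_eq_zero_of_ht h1 fun k hk => ?_
  rw [LinearMap.add_apply, LinearMap.sub_apply, wordWt_gradElt, posRoots_gradElt] at hk
  have h2 : ((w.length : ℕ) : ℂ) = ((ht i.1 + k : ℕ) : ℂ) := by
    push_cast
    linear_combination hk
  have := Nat.cast_injective h2
  lia

section Commutator

variable {M : Type*} [AddCommGroup M] [LieRingModule (KM R) M] (D : DualRootBases R κ)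

/-- The part of height `k` of the Casimir operator. -/
def DualRootBases.omega (k : ℕ) (m : M) : M :=
  ∑ i ∈ D.level k, ⁅(D.bF i : KM R), ⁅(D.bE i : KM R), m⁆⁆

/-- First part of the commutator of the height `k` part of the Casimir operator with `f_j`. -/
def DualRootBases.commF (k : ℕ) (j : Fin n) (m : M) : M :=
  ∑ i ∈ D.level k, ⁅⁅(D.bF i : KM R), chevF R j⁆, ⁅(D.bE i : KM R), m⁆⁆

/-- Second part of the commutator of the height `k` part of the Casimir operator with `f_j`. -/
def DualRootBases.commE (k : ℕ) (j : Fin n) (m : M) : M :=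
  ∑ i ∈ D.level k, ⁅(D.bF i : KM R), ⁅⁅(D.bE i : KM R), chevF R j⁆, m⁆⁆

theorem omega_chevF (k : ℕ) (j : Fin n) (m : M) :
    D.omega k ⁅chevF R j, m⁆ = ⁅chevF R j, D.omega k m⁆ + (D.commF k j m + D.commE k j m) := by
  rw [DualRootBases.omega, DualRootBases.omega, DualRootBases.commF, DualRootBases.commE, lie_sum,
    ← Finset.sum_add_distrib, ← Finset.sum_add_distrib]
  refine Finset.sum_congr rfl fun i _ => ?_
  rw [leibniz_lie (D.bE i : KM R), lie_add, leibniz_lie (D.bF i : KM R) (chevF R j)]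
  abel

variable [Module ℂ M] [LieModule ℂ (KM R) M]

theorem gradElt_lie_bE (i : D.Idx) :
    ⁅cartan R (gradElt R), (D.bE i : KM R)⁆ = (ht i.1 : ℂ) • (D.bE i : KM R) :=
  congrArg Subtype.val (adPlus_gradElt_bE D i)

theorem gradElt_lie_bF (i : D.Idx) :
    ⁅cartan R (gradElt R), (D.bF i : KM R)⁆ = (-(ht i.1 : ℂ)) • (D.bF i : KM R) :=
  congrArg Subtype.val (adMinus_gradElt_bF D i)

theorem gradElt_lie_chevF (j : Fin n) :
    ⁅cartan R (gradElt R), chevF R j⁆ = (-1 : ℂ) • chevF R j := by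
  rw [cartan_lie_chevF, root_gradElt]
  module

/-- Expand `[e_i, f_j]` in the `e`'s of height `k` and `[f_a, f_j]` in the `f`'s of height `k + 1`.
By invariance both have the coefficients `(e_i, [f_j, f_a])` up to sign, so the commutators of
consecutive heights telescope. -/
theorem commE_succ (hκ : IsInvariantForm R κ) {k : ℕ} (hk : 0 < k) (j : Fin n) (m : M) :
    D.commE (k + 1) j m = -D.commF k j m := by
  have h1 : ∀ i ∈ D.level (k + 1), ⁅(D.bE i : KM R), chevF R j⁆ =
      ∑ a ∈ D.level k, κ (D.bE i) ⁅chevF R j, (D.bF a : KM R)⁆ • (D.bE a : KM R) := by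
    intro i hi
    have hx : ⁅cartan R (gradElt R), ⁅(D.bE i : KM R), chevF R j⁆⁆ =
        (k : ℂ) • ⁅(D.bE i : KM R), chevF R j⁆ := by
      rw [leibniz_lie, gradElt_lie_bE, gradElt_lie_chevF, smul_lie, lie_smul, ← add_smul,
        D.mem_level.1 hi]
      congr 1
      push_cast
      ring
    refine (eq_sum_bE D hκ hk hx).trans (Finset.sum_congr rfl fun a _ => ?_)
    rw [hκ.invariant]
  have h2 : ∀ a ∈ D.level k, ⁅(D.bF a : KM R), chevF R j⁆ =
      ∑ i ∈ D.level (k + 1), (-κ (D.bE i) ⁅chevF R j, (D.bF a : KM R)⁆) • (D.bF i : KM R) := by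
    intro a ha
    have hx : ⁅cartan R (gradElt R), ⁅(D.bF a : KM R), chevF R j⁆⁆ =
        (-((k + 1 : ℕ) : ℂ)) • ⁅(D.bF a : KM R), chevF R j⁆ := by
      rw [leibniz_lie, gradElt_lie_bF, gradElt_lie_chevF, smul_lie, lie_smul, ← add_smul,
        D.mem_level.1 ha]
      congr 1
      push_cast
      ring
    refine (eq_sum_bF D hκ k.succ_pos hx).trans (Finset.sum_congr rfl fun i _ => ?_)
    rw [← lie_skew, map_neg]
  rw [DualRootBases.commE, DualRootBases.commF, ← Finset.sum_neg_distrib]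
  have e1 : ∀ i ∈ D.level (k + 1), ⁅(D.bF i : KM R), ⁅⁅(D.bE i : KM R), chevF R j⁆, m⁆⁆ =
      ∑ a ∈ D.level k, κ (D.bE i) ⁅chevF R j, (D.bF a : KM R)⁆ •
        ⁅(D.bF i : KM R), ⁅(D.bE a : KM R), m⁆⁆ := by
    intro i hi
    rw [h1 i hi, sum_lie, lie_sum]
    simp only [smul_lie, lie_smul]
  have e2 : ∀ a ∈ D.level k, -⁅⁅(D.bF a : KM R), chevF R j⁆, ⁅(D.bE a : KM R), m⁆⁆ =
      ∑ i ∈ D.level (k + 1), κ (D.bE i) ⁅chevF R j, (D.bF a : KM R)⁆ •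
        ⁅(D.bF i : KM R), ⁅(D.bE a : KM R), m⁆⁆ := by
    intro a ha
    rw [h2 a ha, sum_lie, ← Finset.sum_neg_distrib]
    simp only [neg_lie, smul_lie, neg_smul, neg_neg]
  rw [Finset.sum_congr rfl e1, Finset.sum_congr rfl e2, Finset.sum_comm]

theorem commE_one (hA : IsSymmetrizableGCM A) (hκ : IsInvariantForm R κ) (j : Fin n) (m : M) :
    D.commE 1 j m = ⁅chevF R j, ⁅cartan R (sharp R κ (R.root j)), m⁆⁆ := by
  have h1 : chevF R j = ∑ i ∈ D.level 1, κ (D.bE i) (chevF R j) • (D.bF i : KM R) :=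
    eq_sum_bF D hκ one_pos (by rw [gradElt_lie_chevF, Nat.cast_one])
  rw [DualRootBases.commE]
  conv_rhs => rw [h1, sum_lie]
  refine Finset.sum_congr rfl fun i hi => ?_
  rw [lie_eq_form_smul hA hκ D (γ := R.root j) (by
    rw [gradElt_lie_bE, D.mem_level.1 hi, root_gradElt, Nat.cast_one]) (chevF_mem_wtSpace j),
    smul_lie, smul_lie, lie_smul]

theorem sum_comm_eq (hA : IsSymmetrizableGCM A) (hκ : IsInvariantForm R κ) (j : Fin n) (m : M)
    (K : ℕ) : ∑ k ∈ Finset.range (K + 1), (D.commF (k + 1) j m + D.commE (k + 1) j m) =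
      ⁅chevF R j, ⁅cartan R (sharp R κ (R.root j)), m⁆⁆ + D.commF (K + 1) j m := by
  induction K with
  | zero =>
    rw [Finset.sum_range_one, zero_add, commE_one D hA hκ, add_comm]
  | succ K ih =>
    rw [Finset.sum_range_succ, ih, commE_succ D hκ K.succ_pos]
    abel

variable {I : Type*} [Fintype I] {X : I → H}

theorem sum_cartan_chevF (D : DualRootBases R κ) (hA : IsSymmetrizableGCM A) (hκ : IsInvariantForm R κ)
    (hX : ∀ u, u = ∑ a, hForm R κ u (X a) • X a) (j : Fin n) (m : M) :
    ∑ a, ⁅cartan R (X a), ⁅cartan R (X a), ⁅chevF R j, m⁆⁆⁆ =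
      ⁅chevF R j, ∑ a, ⁅cartan R (X a), ⁅cartan R (X a), m⁆⁆⁆
      - (2 : ℂ) • ⁅chevF R j, ⁅cartan R (sharp R κ (R.root j)), m⁆⁆
      + dualForm R κ (R.root j) (R.root j) • ⁅chevF R j, m⁆ := by
  have hs : sharp R κ (R.root j) = ∑ a, R.root j (X a) • X a := by
    refine (hX _).trans (Finset.sum_congr rfl fun a _ => ?_)
    rw [hForm_sharp hA hκ D]
  have hd : dualForm R κ (R.root j) (R.root j) = ∑ a, R.root j (X a) * R.root j (X a) := by
    rw [dualForm_eq hA hκ D, hs, map_sum]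
    simp only [map_smul, smul_eq_mul]
  rw [hs, hd, map_sum, sum_lie, lie_sum, lie_sum, Finset.smul_sum, Finset.sum_smul,
    ← Finset.sum_sub_distrib, ← Finset.sum_add_distrib]
  refine Finset.sum_congr rfl fun a _ => ?_
  rw [leibniz_lie (cartan R (X a)) (chevF R j) m, lie_add, leibniz_lie (cartan R (X a)) (chevF R j),
    cartan_lie_chevF, neg_lie, neg_lie, smul_lie, lie_neg, lie_smul, smul_lie, map_smul, smul_lie,
    lie_smul, leibniz_lie (cartan R (X a)) (chevF R j), cartan_lie_chevF, neg_lie, smul_lie]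
  module

theorem cartan_lie_chevF_lie (h : H) (j : Fin n) (m : M) :
    ⁅cartan R h, ⁅chevF R j, m⁆⁆ = ⁅chevF R j, ⁅cartan R h, m⁆⁆ - R.root j h • ⁅chevF R j, m⁆ := by
  rw [leibniz_lie, cartan_lie_chevF, neg_lie, smul_lie]
  abel

end Commutator

variable (D : DualRootBases R κ) {I : Type*} [Fintype I] {X : I → H}

theorem dualForm_eq_sum (D : DualRootBases R κ) (hA : IsSymmetrizableGCM A) (hκ : IsInvariantForm R κ)
    (hX : ∀ u, u = ∑ a, hForm R κ u (X a) • X a) (φ ψ : Dual ℂ H) :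
    dualForm R κ φ ψ = ∑ a, φ (X a) * ψ (X a) := by
  have hs : sharp R κ ψ = ∑ a, ψ (X a) • X a := by
    refine (hX _).trans (Finset.sum_congr rfl fun a _ => ?_)
    rw [hForm_sharp hA hκ D]
  rw [dualForm_eq hA hκ D, hs, map_sum]
  simp only [map_smul, smul_eq_mul, mul_comm]

theorem two_mul_dualForm_rho (D : DualRootBases R κ) (hA : IsSymmetrizableGCM A) (hκ : IsInvariantForm R κ)
    {ρ : Dual ℂ H} (hρ : ∀ i, ρ (R.coroot i) = 1) (j : Fin n) :
    2 * dualForm R κ ρ (R.root j) = dualForm R κ (R.root j) (R.root j) := by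
  have h1 := chevForm_mul_dualForm hA hκ D ρ j
  have h2 := chevForm_mul_root_self hA hκ D j
  rw [hρ] at h1
  exact mul_left_cancel₀ (chevForm_ne_zero hA hκ D j) (by linear_combination 2 * h1 - h2)

/-- On the highest weight vector only the Cartan part acts. On passing `f_j`, the quadratic Cartan
part produces `-2 f_j α_j^♯ + (α_j, α_j) f_j`, the `ρ`-term produces `-2(ρ, α_j) f_j` and the root
vectors produce `2 f_j α_j^♯`; these cancel because `2(ρ, α_j) = (α_j, α_j)`. -/
theorem casimir_vermaWord (hA : IsSymmetrizableGCM A) (hκ : IsInvariantForm R κ)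
    {ρ : Dual ℂ H} (hρ : ∀ i, ρ (R.coroot i) = 1)
    (hX : ∀ u, u = ∑ a, hForm R κ u (X a) • X a) (μ : Dual ℂ H) {K : ℕ} {w : List (Fin n)}
    (hw : w.length ≤ K) :
    ∑ a, ⁅cartan R (X a), ⁅cartan R (X a), vermaWord R μ (word w)⁆⁆ +
      (2 : ℂ) • ⁅cartan R (sharp R κ ρ), vermaWord R μ (word w)⁆ +
      (2 : ℂ) • ∑ k ∈ Finset.range K, D.omega (k + 1) (vermaWord R μ (word w)) =
    (dualForm R κ μ μ + 2 * dualForm R κ μ ρ) • vermaWord R μ (word w) := by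
  induction w with
  | nil =>
    have h0 : ∀ k, D.omega (k + 1) (vermaWord R μ (word [])) = 0 := by
      intro k
      refine Finset.sum_eq_zero fun i hi => ?_
      rw [bE_lie_vermaWord D (by simpa using ht_pos i.1), lie_zero]
    simp only [h0, Finset.sum_const_zero, smul_zero, add_zero]
    rw [vermaWord_nil]
    simp only [cartan_lie_hwv, lie_smul, smul_smul]
    rw [← Finset.sum_smul, ← dualForm_eq_sum D hA hκ hX, ← dualForm_eq hA hκ D, ← add_smul]
  | cons j w ih =>
    have hw' : w.length + 1 ≤ K := hw
    obtain ⟨K, rfl⟩ : ∃ K', K = K' + 1 := ⟨K - 1, by lia⟩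
    have ih' := congrArg (fun m => ⁅chevF R j, m⁆) (ih (by lia))
    simp only [lie_add, lie_smul] at ih'
    rw [← freeF_word, vermaWord_freeF]
    set m := vermaWord R μ (word w) with hm
    -- The end term of the telescoping sum contains `e`'s of height `K + 1`, which exceeds the
    -- length of `w`.
    have h0 : D.commF (K + 1) j m = 0 := by
      refine Finset.sum_eq_zero fun i hi => ?_
      rw [bE_lie_vermaWord D (by rw [D.mem_level.1 hi]; lia), lie_zero]
    simp only [omega_chevF, Finset.sum_add_distrib (f := fun k => ⁅chevF R j, D.omega (k + 1) m⁆)]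
    rw [sum_comm_eq D hA hκ, h0, sum_cartan_chevF D hA hκ hX, cartan_lie_chevF_lie, ← ih',
      ← two_mul_dualForm_rho D hA hκ hρ, dualForm_comm hκ ρ, dualForm_eq hA hκ D _ ρ]
    simp only [lie_sum]
    module

theorem casimir_verma (hA : IsSymmetrizableGCM A) (hκ : IsInvariantForm R κ)
    {ρ : Dual ℂ H} (hρ : ∀ i, ρ (R.coroot i) = 1)
    (hX : ∀ u, u = ∑ a, hForm R κ u (X a) • X a) {μ : Dual ℂ H} {d K : ℕ} (hd : d ≤ K)
    {m : Verma R μ} (hm : ⁅cartan R (gradElt R), m⁆ = (μ (gradElt R) - d) • m) :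
    ∑ a, ⁅cartan R (X a), ⁅cartan R (X a), m⁆⁆ +
      (2 : ℂ) • ⁅cartan R (sharp R κ ρ), m⁆ +
      (2 : ℂ) • ∑ k ∈ Finset.range K, D.omega (k + 1) m =
    (dualForm R κ μ μ + 2 * dualForm R κ μ ρ) • m := by
  have hspan := mem_span_vermaWord_of_ht hm
  clear hm
  induction hspan using Submodule.span_induction with
  | mem m hm =>
    obtain ⟨w, hw, rfl⟩ := hm
    have hw' : μ (gradElt R) - w.length = μ (gradElt R) - d := hw
    have : w.length = d := Nat.cast_injective (R := ℂ) (by linear_combination -hw')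
    exact casimir_vermaWord D hA hκ hρ hX μ (by lia)
  | zero => simp [DualRootBases.omega]
  | add m m' _ _ h h' =>
    rw [smul_add, ← h, ← h']
    simp only [DualRootBases.omega, lie_add, Finset.sum_add_distrib, smul_add]
    abel
  | smul c m _ h =>
    rw [smul_comm, ← h]
    simp only [DualRootBases.omega, lie_smul, ← Finset.smul_sum, smul_add]
    simp only [smul_comm c (2 : ℂ)]

end Casimir

/-! ### Traces over weight modules -/

section Slice

variable {M W : Type*} [AddCommGroup M] [Module ℂ M] [AddCommGroup W] [Module ℂ W]

/-- The map `M ⊗ W → M` given by a linear functional on `W`. -/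
def slice (M : Type*) [AddCommGroup M] [Module ℂ M] (w : Dual ℂ W) : M ⊗[ℂ] W →ₗ[ℂ] M :=
  (TensorProduct.rid ℂ M).toLinearMap ∘ₗ w.lTensor M

@[simp] theorem slice_tmul (w : Dual ℂ W) (m : M) (u : W) : slice M w (m ⊗ₜ u) = w u • m := by
  simp [slice]

theorem slice_rTensor (w : Dual ℂ W) (X : M →ₗ[ℂ] M) :
    slice M w ∘ₗ X.rTensor W = X ∘ₗ slice M w := by
  ext m u
  simp

theorem slice_lTensor (w : Dual ℂ W) (a : W →ₗ[ℂ] W) :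
    slice M w ∘ₗ a.lTensor M = slice M (w ∘ₗ a) := by
  ext m u
  simp

theorem dual_lid_rTensor (w : Dual ℂ W) (c : M →ₗ[ℂ] ℂ) (t : M ⊗[ℂ] W) :
    w (TensorProduct.lid ℂ W (c.rTensor W t)) = c (slice M w t) := by
  induction t with
  | zero => simp
  | add t t' h h' => simp only [map_add, h, h']
  | tmul m u => simp [mul_comm]

theorem eq_of_forall_dual {u v : W} (h : ∀ w : Dual ℂ W, w u = w v) : u = v := by
  rw [← sub_eq_zero, ← Module.forall_dual_apply_eq_zero_iff ℂ]
  intro w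
  rw [map_sub, h, sub_self]

end Slice

section Trace

variable {n : ℕ} {A : Matrix (Fin n) (Fin n) ℤ} {H : Type*} [AddCommGroup H] [Module ℂ H]
  {R : Realization A H} {κ : LinearMap.BilinForm ℂ (KM R)}
  {M W : Type*} [AddCommGroup M] [Module ℂ M] [LieRingModule (KM R) M] [LieModule ℂ (KM R) M]
  [AddCommGroup W] [Module ℂ W]

/-- Functionals on `W` turn `W`-valued traces into ordinary traces on a finite dimensional weight
space, and they separate points. -/
theorem dual_wtTrace {χ : Dual ℂ H} [FiniteDimensional ℂ (wtSpace R M χ)]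
    (ψ : M →ₗ[ℂ] M ⊗[ℂ] W) (w : Dual ℂ W) :
    w (wtTrace R ψ χ) = LinearMap.trace ℂ (wtSpace R M χ)
      (wtProj R M χ ∘ₗ slice M w ∘ₗ ψ ∘ₗ (wtSpace R M χ).subtype) := by
  classical
  rw [wtTrace]
  set b := Basis.ofVectorSpace ℂ (wtSpace R M χ)
  have := Module.Finite.finite_basis b
  have := Fintype.ofFinite (Basis.ofVectorSpaceIndex ℂ (wtSpace R M χ))
  rw [LinearMap.trace_eq_matrix_trace ℂ b, Matrix.trace]
  rw [finsum_eq_sum_of_fintype, map_sum]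
  refine Finset.sum_congr rfl fun k _ => ?_
  rw [dual_lid_rTensor, Matrix.diag_apply, LinearMap.toMatrix_apply]
  rfl

section FiniteWeights

variable (hM : ⨆ χ : Dual ℂ H, wtSpace R M χ = ⊤)
  (hfd : ∀ χ : Dual ℂ H, FiniteDimensional ℂ (wtSpace R M χ))

theorem wtProj_lie (hM : ⨆ χ : Dual ℂ H, wtSpace R M χ = ⊤) {γ χ : Dual ℂ H} {x : KM R}
    (hx : x ∈ wtSpace R (KM R) γ) (m : M) :
    (wtProj R M χ ⁅x, m⁆ : M) = ⁅x, (wtProj R M (χ - γ) m : M)⁆ := by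
  have hm : m ∈ ⨆ χ : Dual ℂ H, wtSpace R M χ := by rw [hM]; trivial
  induction hm using Submodule.iSup_induction' with
  | zero => simp
  | add m m' _ _ h h' => simp only [lie_add, map_add, Submodule.coe_add, h, h']
  | mem χ' m hm =>
    have hxm := lie_mem_wtSpace hx hm
    by_cases h : χ' = χ - γ
    · subst h
      rw [add_sub_cancel] at hxm
      rw [wtProj_of_mem hM hm, wtProj_of_mem hM hxm]
    · rw [wtProj_of_mem_ne hM h hm, wtProj_of_mem_ne hM (fun h' => h (by
        rw [← h', add_sub_cancel_left])) hxm]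
      simp

/-- This is `Tr(X Y) = Tr(Y X)` for maps between the two weight spaces `M[χ - γ]` and `M[χ]`. -/
theorem trace_lie_comp (hM : ⨆ χ : Dual ℂ H, wtSpace R M χ = ⊤)
    (hfd : ∀ χ : Dual ℂ H, FiniteDimensional ℂ (wtSpace R M χ)) {γ : Dual ℂ H} {x : KM R}
    (hx : x ∈ wtSpace R (KM R) γ) (χ : Dual ℂ H) (φ : M →ₗ[ℂ] M) :
    LinearMap.trace ℂ (wtSpace R M χ) (wtProj R M χ ∘ₗ LieModule.toEnd ℂ (KM R) M x ∘ₗ φ ∘ₗ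
      (wtSpace R M χ).subtype) =
    LinearMap.trace ℂ (wtSpace R M (χ - γ)) (wtProj R M (χ - γ) ∘ₗ φ ∘ₗ
      LieModule.toEnd ℂ (KM R) M x ∘ₗ (wtSpace R M (χ - γ)).subtype) := by
  let X : wtSpace R M (χ - γ) →ₗ[ℂ] wtSpace R M χ :=
    (LieModule.toEnd ℂ (KM R) M x).restrict fun m hm => by
      have := lie_mem_wtSpace hx hm
      rwa [add_sub_cancel] at this
  have h1 : wtProj R M χ ∘ₗ LieModule.toEnd ℂ (KM R) M x ∘ₗ φ ∘ₗ (wtSpace R M χ).subtype =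
      X ∘ₗ (wtProj R M (χ - γ) ∘ₗ φ ∘ₗ (wtSpace R M χ).subtype) := by
    ext m
    exact wtProj_lie hM hx _
  rw [h1, LinearMap.trace_comp_comm']
  rfl

theorem wtTrace_rTensor (hM : ⨆ χ : Dual ℂ H, wtSpace R M χ = ⊤)
    (hfd : ∀ χ : Dual ℂ H, FiniteDimensional ℂ (wtSpace R M χ)) {γ : Dual ℂ H} {x : KM R}
    (hx : x ∈ wtSpace R (KM R) γ) (χ : Dual ℂ H) (ψ : M →ₗ[ℂ] M ⊗[ℂ] W) :
    wtTrace R ((LieModule.toEnd ℂ (KM R) M x).rTensor W ∘ₗ ψ) χ =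
      wtTrace R (ψ ∘ₗ LieModule.toEnd ℂ (KM R) M x) (χ - γ) := by
  refine eq_of_forall_dual fun w => ?_
  have h : slice M w ∘ₗ ((LieModule.toEnd ℂ (KM R) M x).rTensor W ∘ₗ ψ) ∘ₗ
      (wtSpace R M χ).subtype = LieModule.toEnd ℂ (KM R) M x ∘ₗ (slice M w ∘ₗ ψ) ∘ₗ
      (wtSpace R M χ).subtype := by
    ext m
    exact LinearMap.congr_fun (slice_rTensor w (LieModule.toEnd ℂ (KM R) M x)) _
  rw [dual_wtTrace, dual_wtTrace, h]
  exact trace_lie_comp hM hfd hx χ (slice M w ∘ₗ ψ)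

end FiniteWeights

variable {χ : Dual ℂ H} [FiniteDimensional ℂ (wtSpace R M χ)]

theorem wtTrace_add (ψ ψ' : M →ₗ[ℂ] M ⊗[ℂ] W) :
    wtTrace R (ψ + ψ') χ = wtTrace R ψ χ + wtTrace R ψ' χ := by
  refine eq_of_forall_dual fun w => ?_
  rw [map_add, dual_wtTrace, dual_wtTrace, dual_wtTrace, ← map_add]
  congr 1
  ext m
  simp

theorem wtTrace_smul (c : ℂ) (ψ : M →ₗ[ℂ] M ⊗[ℂ] W) :
    wtTrace R (c • ψ) χ = c • wtTrace R ψ χ := by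
  refine eq_of_forall_dual fun w => ?_
  rw [map_smul, dual_wtTrace, dual_wtTrace, ← map_smul]
  congr 1
  ext m
  simp

theorem wtTrace_lTensor (a : W →ₗ[ℂ] W) (ψ : M →ₗ[ℂ] M ⊗[ℂ] W) :
    wtTrace R (a.lTensor M ∘ₗ ψ) χ = a (wtTrace R ψ χ) := by
  refine eq_of_forall_dual fun w => ?_
  rw [← LinearMap.comp_apply w, dual_wtTrace, dual_wtTrace, ← slice_lTensor]
  rfl

theorem wtTrace_congr {ψ ψ' : M →ₗ[ℂ] M ⊗[ℂ] W} (h : ∀ m ∈ wtSpace R M χ, ψ m = ψ' m) :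
    wtTrace R ψ χ = wtTrace R ψ' χ := by
  refine eq_of_forall_dual fun w => ?_
  rw [dual_wtTrace, dual_wtTrace]
  congr 1
  ext m
  simp [h m m.2]

end Trace

/-! ### Trace series over Verma modules and the cyclic move. -/

section VermaTrace

variable {n : ℕ} {A : Matrix (Fin n) (Fin n) ℤ} {H : Type*} [AddCommGroup H] [Module ℂ H]
  {R : Realization A H} {κ : LinearMap.BilinForm ℂ (KM R)}

theorem iSup_wtSpace_verma (χ : Dual ℂ H) : ⨆ χ' : Dual ℂ H, wtSpace R (Verma R χ) χ' = ⊤ := by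
  rw [eq_top_iff, ← span_vermaWord, Submodule.span_le]
  rintro _ ⟨w, rfl⟩
  exact Submodule.mem_iSup_of_mem _ (vermaWord_mem_wtSpace χ w)

theorem finite_words_wt (χ : Dual ℂ H) (c : ℂ) :
    {w : List (Fin n) | (χ - wordWt R w) (gradElt R) = c}.Finite := by
  by_cases h : ∃ d : ℕ, χ (gradElt R) - d = c
  · obtain ⟨d, rfl⟩ := h
    refine (List.finite_length_eq (Fin n) d).subset fun w hw => ?_
    have hw' : (χ - wordWt R w) (gradElt R) = χ (gradElt R) - d := hw
    rw [LinearMap.sub_apply, wordWt_gradElt] at hw'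
    exact Nat.cast_injective (R := ℂ) (by linear_combination -hw')
  · refine Set.Finite.subset Set.finite_empty fun w hw => h ⟨w.length, ?_⟩
    rw [← wordWt_gradElt (R := R)]
    exact hw

instance finiteDimensional_wtSpace_verma (χ χ' : Dual ℂ H) :
    FiniteDimensional ℂ (wtSpace R (Verma R χ) χ') := by
  have hfin : {w : List (Fin n) | χ - wordWt R w = χ'}.Finite :=
    (finite_words_wt χ (χ' (gradElt R))).subset fun w hw =>
      congrArg (fun φ : Dual ℂ H => φ (gradElt R)) (hw : χ - wordWt R w = χ')
  have := FiniteDimensional.span_of_finite ℂ (hfin.image fun w => vermaWord R χ (word w))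
  exact Submodule.finiteDimensional_of_le (fun m hm => mem_span_vermaWord_of_wt hm)

theorem wtSpace_verma_eq_bot {χ χ' : Dual ℂ H} (h : ∀ w, χ - wordWt R w ≠ χ') :
    wtSpace R (Verma R χ) χ' = ⊥ := by
  rw [eq_bot_iff]
  intro m hm
  have h1 := mem_span_vermaWord_of_wt hm
  rwa [Set.eq_empty_of_forall_notMem (s := {w | χ - wordWt R w = χ'}) h, Set.image_empty,
    Submodule.span_empty] at h1

variable (𝒯 : GBDTriple R κ) {μ' μ : Dual ℂ H} {W : Type*} [AddCommGroup W] [Module ℂ W]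

theorem wtTrace_zero {χ : Dual ℂ H} : wtTrace R (0 : Verma R μ' →ₗ[ℂ] Verma R μ' ⊗[ℂ] W) χ = 0 := by
  have := wtTrace_smul (R := R) (χ := χ) (0 : ℂ) (0 : Verma R μ' →ₗ[ℂ] Verma R μ' ⊗[ℂ] W)
  rwa [zero_smul, zero_smul] at this

theorem wtTrace_verma_eq_zero {χ : Dual ℂ H} (ψ : Verma R μ' →ₗ[ℂ] Verma R μ' ⊗[ℂ] W)
    (h : ∀ w, μ' - wordWt R w ≠ χ) : wtTrace R ψ χ = 0 := by
  rw [wtTrace_congr (ψ' := 0), wtTrace_zero]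
  intro m hm
  rw [wtSpace_verma_eq_bot h, Submodule.mem_bot] at hm
  rw [hm, map_zero, map_zero]

/-- The element `x₀ ∈ 𝔩` on which all simple roots take the value `1`. -/
def GBDTriple.grad : 𝒯.l := ⟨gradElt R, 𝒯.gradElt_mem_l⟩

theorem GBDTriple.finite_wts (μ' : Dual ℂ H) (ξ : Dual ℂ 𝒯.l) :
    {χ : Dual ℂ H | 𝒯.res χ = ξ ∧ ∃ w, μ' - wordWt R w = χ}.Finite := by
  refine ((finite_words_wt (R := R) μ' (ξ 𝒯.grad)).image fun w => μ' - wordWt R w).subset ?_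
  rintro _ ⟨rfl, w, rfl⟩
  exact ⟨w, rfl, rfl⟩

theorem traceSeries_eq_sum (ψ : Verma R μ' →ₗ[ℂ] Verma R μ' ⊗[ℂ] W) (ξ : Dual ℂ 𝒯.l) :
    traceSeries 𝒯 ψ ξ = ∑ χ ∈ (𝒯.finite_wts μ' ξ).toFinset, wtTrace R ψ χ := by
  rw [traceSeries]
  change ∑ᶠ χ ∈ {χ : Dual ℂ H | 𝒯.res χ = ξ}, wtTrace R ψ χ = _
  refine finsum_mem_eq_sum_of_inter_support_eq _ ?_
  ext χ
  simp only [Set.mem_inter_iff, Set.mem_ofPred_eq, Function.mem_support, Set.Finite.coe_toFinset,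
    and_assoc]
  refine and_congr_right fun _ => ⟨fun h => ⟨?_, h⟩, fun h => h.2⟩
  by_contra! h'
  exact h (wtTrace_verma_eq_zero ψ h')

theorem traceSeries_eq_zero {ψ : Verma R μ' →ₗ[ℂ] Verma R μ' ⊗[ℂ] W} {ξ : Dual ℂ 𝒯.l}
    (h : ∀ w, 𝒯.res (μ' - wordWt R w) ≠ ξ) : traceSeries 𝒯 ψ ξ = 0 := by
  rw [traceSeries_eq_sum]
  refine Finset.sum_eq_zero fun χ hχ => ?_
  obtain ⟨h1, w, rfl⟩ := (Set.Finite.mem_toFinset _).1 hχ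
  exact absurd h1 (h w)

theorem traceSeries_comp_lie {γ : Dual ℂ H} {x : KM R} (hx : x ∈ wtSpace R (KM R) γ)
    (ψ : Verma R μ' →ₗ[ℂ] Verma R μ' ⊗[ℂ] W) (ξ : Dual ℂ 𝒯.l) :
    traceSeries 𝒯 (ψ ∘ₗ LieModule.toEnd ℂ (KM R) (Verma R μ') x) (ξ - 𝒯.res γ) =
      traceSeries 𝒯 ((LieModule.toEnd ℂ (KM R) (Verma R μ') x).rTensor W ∘ₗ ψ) ξ := by
  rw [traceSeries, ← finsum_comp_equiv (Equiv.subRight γ), traceSeries]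
  refine finsum_congr fun χ => finsum_congr_Prop (propext ?_) fun _ => ?_
  · rw [Equiv.subRight_apply]
    exact sub_left_inj (a := 𝒯.res γ) (b := 𝒯.res χ)
  · exact (wtTrace_rTensor (iSup_wtSpace_verma μ') inferInstance hx χ ψ).symm

theorem traceSeries_add (ψ ψ' : Verma R μ' →ₗ[ℂ] Verma R μ' ⊗[ℂ] W) (ξ : Dual ℂ 𝒯.l) :
    traceSeries 𝒯 (ψ + ψ') ξ = traceSeries 𝒯 ψ ξ + traceSeries 𝒯 ψ' ξ := by
  rw [traceSeries_eq_sum, traceSeries_eq_sum, traceSeries_eq_sum, ← Finset.sum_add_distrib]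
  simp only [wtTrace_add]

theorem traceSeries_lTensor (a : W →ₗ[ℂ] W) (ψ : Verma R μ' →ₗ[ℂ] Verma R μ' ⊗[ℂ] W)
    (ξ : Dual ℂ 𝒯.l) :
    traceSeries 𝒯 (a.lTensor (Verma R μ') ∘ₗ ψ) ξ = a (traceSeries 𝒯 ψ ξ) := by
  rw [traceSeries_eq_sum, traceSeries_eq_sum, map_sum]
  simp only [wtTrace_lTensor]

variable [LieRingModule (KM R) W] [LieModule ℂ (KM R) W]
  (Θ : Verma R μ →ₗ⁅ℂ,KM R⁆ Verma R μ' ⊗[ℂ] W)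

/-- The trace series of `Θ ∘ φ`. -/
def GBDTriple.twTrace : (Verma R μ' →ₗ[ℂ] Verma R μ) →ₗ[ℂ] Series 𝒯 W where
  toFun φ := traceSeries 𝒯 ((Θ : Verma R μ →ₗ[ℂ] Verma R μ' ⊗[ℂ] W) ∘ₗ φ)
  map_add' φ φ' := by
    ext ξ
    rw [Pi.add_apply, LinearMap.comp_add, traceSeries_add]
  map_smul' c φ := by
    ext ξ
    rw [RingHom.id_apply, Pi.smul_apply, traceSeries_eq_sum, traceSeries_eq_sum, Finset.smul_sum,
      LinearMap.comp_smul]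
    simp only [wtTrace_smul]

theorem GBDTriple.twTrace_apply (φ : Verma R μ' →ₗ[ℂ] Verma R μ) :
    𝒯.twTrace Θ φ = traceSeries 𝒯 ((Θ : Verma R μ →ₗ[ℂ] Verma R μ' ⊗[ℂ] W) ∘ₗ φ) := rfl

/-- The operator `x φ`. -/
def lmul (x : KM R) (φ : Verma R μ' →ₗ[ℂ] Verma R μ) : Verma R μ' →ₗ[ℂ] Verma R μ :=
  LieModule.toEnd ℂ (KM R) _ x ∘ₗ φ

/-- The operator `φ x`. -/
def rmul (φ : Verma R μ' →ₗ[ℂ] Verma R μ) (x : KM R) : Verma R μ' →ₗ[ℂ] Verma R μ :=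
  φ ∘ₗ LieModule.toEnd ℂ (KM R) _ x

theorem lmul_apply (x : KM R) (φ : Verma R μ' →ₗ[ℂ] Verma R μ) (m : Verma R μ') :
    lmul x φ m = ⁅x, φ m⁆ := rfl

theorem rmul_apply (x : KM R) (φ : Verma R μ' →ₗ[ℂ] Verma R μ) (m : Verma R μ') :
    rmul φ x m = φ ⁅x, m⁆ := rfl

variable {Θ}

theorem GBDTriple.twTrace_congr {φ φ' : Verma R μ' →ₗ[ℂ] Verma R μ} {ξ : Dual ℂ 𝒯.l}
    (h : ∀ χ, 𝒯.res χ = ξ → ∀ m ∈ wtSpace R (Verma R μ') χ, φ m = φ' m) :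
    𝒯.twTrace Θ φ ξ = 𝒯.twTrace Θ φ' ξ := by
  rw [GBDTriple.twTrace_apply, GBDTriple.twTrace_apply, traceSeries_eq_sum, traceSeries_eq_sum]
  refine Finset.sum_congr rfl fun χ hχ => wtTrace_congr fun m hm => ?_
  rw [LinearMap.comp_apply, LinearMap.comp_apply, h χ ((Set.Finite.mem_toFinset _).1 hχ).1 m hm]

theorem GBDTriple.twTrace_eq_zero {φ : Verma R μ' →ₗ[ℂ] Verma R μ} {ξ : Dual ℂ 𝒯.l}
    (h : ∀ k : ℕ, μ' (gradElt R) - k ≠ ξ 𝒯.grad) : 𝒯.twTrace Θ φ ξ = 0 := by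
  refine traceSeries_eq_zero 𝒯 fun w hw => h w.length ?_
  rw [← hw, ← wordWt_gradElt (R := R)]
  rfl

theorem GBDTriple.twTrace_rmul_cartan (φ : Verma R μ' →ₗ[ℂ] Verma R μ) (z : 𝒯.l)
    (ξ : Dual ℂ 𝒯.l) : 𝒯.twTrace Θ (rmul φ (cartan R z)) ξ = ξ z • 𝒯.twTrace Θ φ ξ := by
  rw [← Pi.smul_apply, ← map_smul]
  refine 𝒯.twTrace_congr fun χ hχ m hm => ?_
  rw [rmul_apply, hm z, map_smul, ← hχ]
  rfl

/-- The span of the root vectors of `𝔤` whose weight restricts to `η` on `𝔩`. -/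
def GBDTriple.lwt (η : Dual ℂ 𝒯.l) : Submodule ℂ (KM R) :=
  ⨆ (γ : Dual ℂ H) (_ : 𝒯.res γ = η), wtSpace R (KM R) γ

theorem GBDTriple.mem_lwt {γ : Dual ℂ H} {x : KM R} (hx : x ∈ wtSpace R (KM R) γ) :
    x ∈ 𝒯.lwt (𝒯.res γ) :=
  Submodule.mem_iSup_of_mem γ (Submodule.mem_iSup_of_mem rfl hx)

theorem lmul_add_left (x y : KM R) (φ : Verma R μ' →ₗ[ℂ] Verma R μ) :
    lmul (x + y) φ = lmul x φ + lmul y φ := by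
  ext m; exact add_lie x y _

theorem rmul_add_right (x y : KM R) (φ : Verma R μ' →ₗ[ℂ] Verma R μ) :
    rmul φ (x + y) = rmul φ x + rmul φ y := by
  ext m
  simp only [rmul_apply, add_lie, map_add, LinearMap.add_apply]

theorem lie_tensor_eq (x : KM R) {M : Type*} [AddCommGroup M] [Module ℂ M]
    [LieRingModule (KM R) M] [LieModule ℂ (KM R) M] (t : M ⊗[ℂ] W) :
    ⁅x, t⁆ = (LieModule.toEnd ℂ (KM R) W x).lTensor M t +
      (LieModule.toEnd ℂ (KM R) M x).rTensor W t := by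
  induction t with
  | zero => simp
  | add t t' h h' => rw [lie_add, h, h', map_add, map_add]; abel
  | tmul m u =>
    rw [TensorProduct.LieModule.lie_tmul_right]
    simp [add_comm]

theorem comp_lmul (x : KM R) (φ : Verma R μ' →ₗ[ℂ] Verma R μ) :
    (Θ : Verma R μ →ₗ[ℂ] Verma R μ' ⊗[ℂ] W) ∘ₗ lmul x φ =
      (LieModule.toEnd ℂ (KM R) W x).lTensor (Verma R μ') ∘ₗ
        ((Θ : Verma R μ →ₗ[ℂ] Verma R μ' ⊗[ℂ] W) ∘ₗ φ) +
      (LieModule.toEnd ℂ (KM R) (Verma R μ') x).rTensor W ∘ₗ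
        ((Θ : Verma R μ →ₗ[ℂ] Verma R μ' ⊗[ℂ] W) ∘ₗ φ) :=
  LinearMap.ext fun m => (LieModuleHom.map_lie Θ x (φ m)).trans (lie_tensor_eq x _)

theorem GBDTriple.twTrace_lmul_of_wt {γ : Dual ℂ H} {x : KM R} (hx : x ∈ wtSpace R (KM R) γ)
    (φ : Verma R μ' →ₗ[ℂ] Verma R μ) (ξ : Dual ℂ 𝒯.l) : 𝒯.twTrace Θ (lmul x φ) ξ =
      ⁅x, 𝒯.twTrace Θ φ ξ⁆ + 𝒯.twTrace Θ (rmul φ x) (ξ - 𝒯.res γ) := by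
  rw [GBDTriple.twTrace_apply, GBDTriple.twTrace_apply, GBDTriple.twTrace_apply, comp_lmul,
    traceSeries_add, traceSeries_lTensor, ← traceSeries_comp_lie 𝒯 hx, rmul,
    LieModule.toEnd_apply_apply, LinearMap.comp_assoc]

/-- The intertwiner splits the action of `x` on the tensor product, and cyclicity carries the part
in the Verma module to the right of `φ`. Only the restriction of the weight of `x` to `𝔩` matters,
and that is what `B` and `B⁻¹` preserve. -/
theorem GBDTriple.twTrace_lmul {η : Dual ℂ 𝒯.l} {x : KM R} (hx : x ∈ 𝒯.lwt η)
    (φ : Verma R μ' →ₗ[ℂ] Verma R μ) (ξ : Dual ℂ 𝒯.l) : 𝒯.twTrace Θ (lmul x φ) ξ =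
      ⁅x, 𝒯.twTrace Θ φ ξ⁆ + 𝒯.twTrace Θ (rmul φ x) (ξ - η) := by
  have hz : ∀ y ∈ 𝒯.lwt η, 𝒯.twTrace Θ (lmul y φ) ξ =
      ⁅y, 𝒯.twTrace Θ φ ξ⁆ + 𝒯.twTrace Θ (rmul φ y) (ξ - η) := by
    intro y hy
    rw [GBDTriple.lwt, iSup_subtype'] at hy
    induction hy using Submodule.iSup_induction' with
    | mem γ y hy =>
      obtain ⟨γ, rfl⟩ := γ
      exact 𝒯.twTrace_lmul_of_wt hy φ ξ
    | zero =>
      have h1 : lmul (0 : KM R) φ = 0 := by ext m; exact zero_lie (L := KM R) (φ m)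
      have h2 : rmul φ (0 : KM R) = 0 := by ext m; rw [rmul_apply, zero_lie, map_zero]; rfl
      rw [h1, h2, map_zero]
      simp
    | add y y' _ _ h h' =>
      rw [lmul_add_left, rmul_add_right, map_add, map_add, Pi.add_apply, Pi.add_apply, h, h',
        add_lie]
      abel
  exact hz x hx

end VermaTrace

/-! ### The trace identity -/

section TraceIdentity

variable {n : ℕ} {A : Matrix (Fin n) (Fin n) ℤ} {H : Type*} [AddCommGroup H] [Module ℂ H]
  {R : Realization A H} {κ : LinearMap.BilinForm ℂ (KM R)} {𝒯 : GBDTriple R κ}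
  {μ' μ : Dual ℂ H}

/-- The map `x ↦ x φ`. -/
def lmulHom (φ : Verma R μ' →ₗ[ℂ] Verma R μ) : KM R →ₗ[ℂ] Verma R μ' →ₗ[ℂ] Verma R μ where
  toFun x := lmul x φ
  map_add' x y := lmul_add_left x y φ
  map_smul' c x := by
    ext m
    exact smul_lie c x (φ m)

theorem lmul_lie (x y : KM R) (φ : Verma R μ' →ₗ[ℂ] Verma R μ) :
    lmul x (lmul y φ) = lmul ⁅x, y⁆ φ + lmul y (lmul x φ) := by
  ext m
  exact leibniz_lie x y (φ m)

theorem rmul_lmul (x y : KM R) (φ : Verma R μ' →ₗ[ℂ] Verma R μ) :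
    rmul (lmul x φ) y = lmul x (rmul φ y) := by
  ext m
  rw [rmul_apply, lmul_apply, lmul_apply, rmul_apply]

theorem GBDTriple.rmul_vermaB (hA : IsSymmetrizableGCM A) (f : nMinus R) :
    rmul (𝒯.vermaB μ' μ) (f : KM R) = lmul (𝒯.B f : KM R) (𝒯.vermaB μ' μ) := by
  ext m
  exact 𝒯.vermaB_lie hA f m

theorem GBDTriple.Compat.lmul_vermaB (hc : 𝒯.Compat μ' μ) (hA : IsSymmetrizableGCM A)
    (hκ : IsInvariantForm R κ) (D : DualRootBases R κ) (e : nPlus R) :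
    lmul (e : KM R) (𝒯.vermaB μ' μ) = rmul (𝒯.vermaB μ' μ) (𝒯.BInv e : KM R) := by
  ext m
  exact hc.nPlus_lie_vermaB hA hκ D e m

theorem GBDTriple.lmul_cartan_vermaB (hA : IsSymmetrizableGCM A) (hκ : IsInvariantForm R κ)
    (D : DualRootBases R κ) {h h' : H} (hh : ∀ i : 𝒯.Γ₁, R.root (𝒯.T i) h = R.root i h')
    (hm : μ h = μ' h') :
    lmul (cartan R h) (𝒯.vermaB μ' μ) = rmul (𝒯.vermaB μ' μ) (cartan R h') := by
  ext m
  exact 𝒯.cartan_lie_vermaB hA hκ D hh hm m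

theorem GBDTriple.Compat.lmul_l (hc : 𝒯.Compat μ' μ) (hA : IsSymmetrizableGCM A)
    (hκ : IsInvariantForm R κ) (D : DualRootBases R κ) (z : 𝒯.l) :
    lmul (cartan R z) (𝒯.vermaB μ' μ) = rmul (𝒯.vermaB μ' μ) (cartan R z) :=
  𝒯.lmul_cartan_vermaB hA hκ D (𝒯.mem_l.1 z.2) (hc.res z z.2)

theorem GBDTriple.cartan_mem_lwt (z : H) : cartan R z ∈ 𝒯.lwt 0 :=
  𝒯.mem_lwt (γ := 0) (cartan_mem_wtSpace z)

theorem GBDTriple.BInv_iterate_mem_lwt (D : DualRootBases R κ) (hA : IsSymmetrizableGCM A)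
    (hκ : IsInvariantForm R κ) (i : D.Idx) (v : ℕ) :
    ((𝒯.BInv^[v] (D.bE i) : nPlus R) : KM R) ∈ 𝒯.lwt (𝒯.lroot i) := by
  have h := congrArg (nPlus R).toSubmodule.subtype (𝒯.BInv_iterate_eq_sum D hA hκ i v)
  rw [map_sum] at h
  refine (congrArg (· ∈ 𝒯.lwt (𝒯.lroot i)) h).mpr (Submodule.sum_mem _ fun j _ => ?_)
  rw [map_smul]
  by_cases h0 : κ (𝒯.BInv^[v] (D.bE i) : nPlus R) (D.bF j) = 0
  · rw [h0, zero_smul]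
    exact zero_mem _
  · rw [𝒯.lroot_eq_of_BInv D hA hκ h0]
    exact Submodule.smul_mem _ _ (𝒯.mem_lwt (D.bE_mem j))

theorem GBDTriple.B_iterate_mem_lwt (D : DualRootBases R κ) (hA : IsSymmetrizableGCM A)
    (hκ : IsInvariantForm R κ) (i : D.Idx) (s : ℕ) :
    ((𝒯.B^[s] (D.bF i) : nMinus R) : KM R) ∈ 𝒯.lwt (-𝒯.lroot i) := by
  have h := congrArg (nMinus R).toSubmodule.subtype (𝒯.B_iterate_eq_sum D hA hκ i s)
  rw [map_sum] at h
  refine (congrArg (· ∈ 𝒯.lwt (-𝒯.lroot i)) h).mpr (Submodule.sum_mem _ fun j _ => ?_)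
  rw [map_smul]
  by_cases h0 : κ (D.bE j) (𝒯.B^[s] (D.bF i) : nMinus R) = 0
  · rw [h0, zero_smul]
    exact zero_mem _
  · rw [← 𝒯.lroot_eq_of_B D hA hκ h0]
    have h1 := 𝒯.mem_lwt (D.bF_mem j)
    have h2 : 𝒯.res (-(j.1 : Dual ℂ H)) = -𝒯.lroot j := by ext z; rfl
    rw [h2] at h1
    exact Submodule.smul_mem _ _ h1

theorem gradElt_lie_lie_iterate (D : DualRootBases R κ) (hA : IsSymmetrizableGCM A)
    (hκ : IsInvariantForm R κ) (i : D.Idx) (s : ℕ) :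
    ⁅cartan R (gradElt R), ⁅(D.bE i : KM R), ((𝒯.B^[s] (D.bF i) : nMinus R) : KM R)⁆⁆ = 0 := by
  have h := congrArg Subtype.val
    (𝒯.adMinus_iterate_B hA hκ D 𝒯.gradElt_mem_l (adMinus_gradElt_bF D i) s)
  rw [coe_adMinus, SetLike.val_smul] at h
  rw [leibniz_lie, h, gradElt_lie_bE, smul_lie, lie_smul, ← add_smul, add_neg_cancel, zero_smul]

/-- A choice of orthonormal bases of `𝔩` and `𝔥₀`. -/
structure GBDTriple.IsOrthonormal (𝒯 : GBDTriple R κ) {I₁ I₂ : Type*} [Fintype I₁] [Fintype I₂]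
    (x : I₁ → 𝒯.l) (y : I₂ → 𝒯.h₀) : Prop where
  eq_sum : ∀ u, u = ∑ j, hForm R κ u (x j) • (x j : H) + ∑ j, hForm R κ u (y j) • (y j : H)

variable {I₁ I₂ : Type*} [Fintype I₁] [Fintype I₂] {x : I₁ → 𝒯.l} {y : I₂ → 𝒯.h₀}

/-- Each bracket has height zero and so decomposes along `𝔩` and `𝔥₀`; the `𝔥₀`-parts cancel in the
sum over the level by adjointness of `B` and `B⁻¹`. -/
theorem GBDTriple.IsOrthonormal.sum_level_lie (hxy : 𝒯.IsOrthonormal x y) (D : DualRootBases R κ)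
    (hA : IsSymmetrizableGCM A) (hκ : IsInvariantForm R κ) {V : Type*} [AddCommGroup V]
    [Module ℂ V] (L : Dual ℂ 𝒯.l → KM R →ₗ[ℂ] V) (k s : ℕ) :
    ∑ i ∈ D.level k, L (𝒯.lroot i) ⁅(D.bE i : KM R), ((𝒯.B^[s + 1] (D.bF i) : nMinus R) : KM R)⁆ =
    ∑ i ∈ D.level k, ∑ j, κ ⁅(D.bE i : KM R), ((𝒯.B^[s + 1] (D.bF i) : nMinus R) : KM R)⁆
      (cartan R (x j)) • L (𝒯.lroot i) (cartan R (x j)) := by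
  have h1 : ∀ i, L (𝒯.lroot i) ⁅(D.bE i : KM R), ((𝒯.B^[s + 1] (D.bF i) : nMinus R) : KM R)⁆ =
      ∑ j, κ ⁅(D.bE i : KM R), ((𝒯.B^[s + 1] (D.bF i) : nMinus R) : KM R)⁆
        (cartan R (x j)) • L (𝒯.lroot i) (cartan R (x j)) +
      ∑ j, κ ⁅(D.bE i : KM R), ((𝒯.B^[s + 1] (D.bF i) : nMinus R) : KM R)⁆
        (cartan R (y j)) • L (𝒯.lroot i) (cartan R (y j)) := by
    intro i
    obtain ⟨u, hu⟩ := exists_cartan_of_ht D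
      (gradElt_lie_lie_iterate (𝒯 := 𝒯) D hA hκ i (s + 1))
    rw [hu]
    conv_lhs => rw [hxy.eq_sum u]
    simp only [map_add, map_sum, map_smul]
    rfl
  rw [Finset.sum_congr rfl fun i _ => h1 i, Finset.sum_add_distrib, add_eq_left, Finset.sum_comm]
  refine Finset.sum_eq_zero fun j _ => ?_
  exact 𝒯.sum_level_form_h₀ D hA hκ (fun η => L η (cartan R (y j))) k s (y j).2

variable {W : Type*} [AddCommGroup W] [Module ℂ W] [LieRingModule (KM R) W]
  [LieModule ℂ (KM R) W] {Θ : Verma R μ →ₗ⁅ℂ,KM R⁆ Verma R μ' ⊗[ℂ] W}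

/-- Such an element commutes with `B` and does not shift exponents. One turn around the trace
therefore returns the same trace plus its action on `W`. -/
theorem GBDTriple.Compat.lie_l (hc : 𝒯.Compat μ' μ) (hA : IsSymmetrizableGCM A)
    (hκ : IsInvariantForm R κ) (D : DualRootBases R κ) (z : 𝒯.l) (ξ : Dual ℂ 𝒯.l) :
    ⁅cartan R z, 𝒯.twTrace Θ (𝒯.vermaB μ' μ) ξ⁆ = 0 := by
  have h := 𝒯.twTrace_lmul (Θ := Θ) (𝒯.cartan_mem_lwt (z : H)) (𝒯.vermaB μ' μ) ξ
  rwa [hc.lmul_l hA hκ D, sub_zero, right_eq_add] at h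

theorem GBDTriple.Compat.twTrace_l (hc : 𝒯.Compat μ' μ) (hA : IsSymmetrizableGCM A)
    (hκ : IsInvariantForm R κ) (D : DualRootBases R κ) (z : 𝒯.l) (ξ : Dual ℂ 𝒯.l) :
    𝒯.twTrace Θ (lmul (cartan R z) (𝒯.vermaB μ' μ)) ξ =
      ξ z • 𝒯.twTrace Θ (𝒯.vermaB μ' μ) ξ := by
  rw [hc.lmul_l hA hκ D, 𝒯.twTrace_rmul_cartan]

theorem GBDTriple.Compat.twTrace_l_l (hc : 𝒯.Compat μ' μ) (hA : IsSymmetrizableGCM A)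
    (hκ : IsInvariantForm R κ) (D : DualRootBases R κ) (z : 𝒯.l) (ξ : Dual ℂ 𝒯.l) :
    𝒯.twTrace Θ (lmul (cartan R z) (lmul (cartan R z) (𝒯.vermaB μ' μ))) ξ =
      ξ z • ξ z • 𝒯.twTrace Θ (𝒯.vermaB μ' μ) ξ := by
  conv_lhs => rw [hc.lmul_l hA hκ D, ← rmul_lmul]
  rw [𝒯.twTrace_rmul_cartan, hc.twTrace_l hA hκ D]

/-- One turn of `(C - 1)u/2` ends as `(C + 1)u/2` on the left of `φ`. The two differ by `u`, so the
trace of `u φ` is the negative of the action of `(C - 1)u/2` on `W`. -/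
theorem GBDTriple.twTrace_h₀ {φ : Verma R μ' →ₗ[ℂ] Verma R μ} (u : 𝒯.h₀)
    (h : lmul (cartan R (𝒯.cayleyAdd u)) φ = rmul φ (cartan R (𝒯.cayleySub u)))
    (ξ : Dual ℂ 𝒯.l) : 𝒯.twTrace Θ (lmul (cartan R u) φ) ξ =
      ⁅𝒯.halfCayley u, 𝒯.twTrace Θ φ ξ⁆ := by
  have h1 := 𝒯.twTrace_lmul (Θ := Θ) (𝒯.cartan_mem_lwt (𝒯.cayleySub u)) φ ξ
  rw [sub_zero, ← h, 𝒯.cayleyAdd_eq, map_add, lmul_add_left, map_add, Pi.add_apply] at h1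
  rw [𝒯.halfCayley_eq, neg_lie]
  exact (neg_eq_of_add_eq_zero_right (add_right_cancel (b := 𝒯.twTrace Θ (lmul (cartan R
    (𝒯.cayleySub u)) φ) ξ) (by rw [zero_add, add_assoc]; exact h1.symm))).symm

theorem GBDTriple.Compat.lmul_cayley (hc : 𝒯.Compat μ' μ) (D : DualRootBases R κ)
    (hA : IsSymmetrizableGCM A) (hκ : IsInvariantForm R κ) (h𝒯 : 𝒯.IsNondegenerate) (u : 𝒯.h₀) :
    lmul (cartan R (𝒯.cayleyAdd u)) (𝒯.vermaB μ' μ) =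
      rmul (𝒯.vermaB μ' μ) (cartan R (𝒯.cayleySub u)) :=
  𝒯.lmul_cartan_vermaB hA hκ D (𝒯.root_cayley D hA hκ h𝒯 u) (hc.apply_cayley D hA hκ h𝒯 u)

theorem GBDTriple.Compat.twTrace_h₀_h₀ (hc : 𝒯.Compat μ' μ) (D : DualRootBases R κ)
    (hA : IsSymmetrizableGCM A) (hκ : IsInvariantForm R κ) (h𝒯 : 𝒯.IsNondegenerate)
    (u : 𝒯.h₀) (ξ : Dual ℂ 𝒯.l) :
    𝒯.twTrace Θ (lmul (cartan R u) (lmul (cartan R u) (𝒯.vermaB μ' μ))) ξ =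
      ⁅𝒯.halfCayley u, ⁅𝒯.halfCayley u, 𝒯.twTrace Θ (𝒯.vermaB μ' μ) ξ⁆⁆ := by
  have h := hc.lmul_cayley D hA hκ h𝒯 u
  rw [𝒯.twTrace_h₀ u, 𝒯.twTrace_h₀ u h]
  -- The same argument for `u B` in place of `B` needs the exchange relation for `u B`, which
  -- follows because `𝔥` is commutative.
  rw [lmul_lie, cartan_lie_cartan, h, rmul_lmul]
  ext m
  simp [lmul_apply]

/-- The shift of `ξ` by `N` times the restriction of a root. -/
theorem GBDTriple.exists_twTrace_bound (μ' : Dual ℂ H) (ξ : Dual ℂ 𝒯.l) :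
    ∃ K : ℕ, (∀ d : ℕ, ξ 𝒯.grad = μ' (gradElt R) - d → d ≤ K) ∧
      ∀ k, K ≤ k → ∀ d : ℕ, μ' (gradElt R) - d ≠ ξ 𝒯.grad + k := by
  -- On the grading element the exponents take the values `μ'(x₀) - d`. At most one `d` belongs to
  -- `ξ`, and shifting up by `K = d + 1` or more overshoots the highest weight; if there is none, no
  -- upward shift reaches an exponent and `K = 0` works.
  by_cases h : ∃ d : ℕ, ξ 𝒯.grad = μ' (gradElt R) - d
  · obtain ⟨d, hd⟩ := h
    refine ⟨d + 1, fun d' hd' => ?_, fun k hk d' hd' => ?_⟩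
    · have : d' = d := Nat.cast_injective (R := ℂ) (by linear_combination hd' - hd)
      lia
    · have : d = d' + k := Nat.cast_injective (R := ℂ) (by
        push_cast; linear_combination hd' + hd)
      lia
  · refine ⟨0, fun d hd => absurd ⟨d, hd⟩ h, fun k _ d hd => h ⟨d + k, ?_⟩⟩
    push_cast
    linear_combination -hd

theorem GBDTriple.lroot_grad {D : DualRootBases R κ} (i : D.Idx) :
    𝒯.lroot i 𝒯.grad = ht i.1 := posRoots_gradElt i.1

/-- Heights of positive roots are at least `1`, so `N` turns raise the exponent by at least `N`.
This kills the remainders of all iterations below. -/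
theorem GBDTriple.twTrace_far {D : DualRootBases R κ} {ξ : Dual ℂ 𝒯.l} {K : ℕ}
    (hK : ∀ k, K ≤ k → ∀ d : ℕ, μ' (gradElt R) - d ≠ ξ 𝒯.grad + k)
    (φ : Verma R μ' →ₗ[ℂ] Verma R μ) (i : D.Idx) {N : ℕ} (hN : K ≤ N) :
    𝒯.twTrace Θ φ (ξ + N • 𝒯.lroot i) = 0 := by
  refine 𝒯.twTrace_eq_zero fun d hd => hK (N * ht i.1) ?_ d ?_
  · exact hN.trans (Nat.le_mul_of_pos_right N (ht_pos i.1))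
  · rw [hd, LinearMap.add_apply, LinearMap.smul_apply, 𝒯.lroot_grad]
    push_cast
    simp

/-- The cyclic move for `B^{-(v+1)} e` at the raised exponent, read backwards: the term on the right
of `B` is `B · B^{-(v+1)} e = B^{-v} e · B`. -/
theorem GBDTriple.Compat.twTrace_bE (hc : 𝒯.Compat μ' μ) (D : DualRootBases R κ)
    (hA : IsSymmetrizableGCM A) (hκ : IsInvariantForm R κ) (i : D.Idx) (ξ : Dual ℂ 𝒯.l) (v : ℕ) :
    𝒯.twTrace Θ (lmul ((𝒯.BInv^[v] (D.bE i) : nPlus R) : KM R) (𝒯.vermaB μ' μ)) ξ =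
      𝒯.twTrace Θ (lmul ((𝒯.BInv^[v + 1] (D.bE i) : nPlus R) : KM R) (𝒯.vermaB μ' μ))
        (ξ + 𝒯.lroot i) -
      ⁅((𝒯.BInv^[v + 1] (D.bE i) : nPlus R) : KM R),
        𝒯.twTrace Θ (𝒯.vermaB μ' μ) (ξ + 𝒯.lroot i)⁆ := by
  have h := 𝒯.twTrace_lmul (Θ := Θ) (𝒯.BInv_iterate_mem_lwt D hA hκ i (v + 1))
    (𝒯.vermaB μ' μ) (ξ + 𝒯.lroot i)
  rw [h, add_sub_cancel_left, add_sub_cancel_right, Function.iterate_succ_apply',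
    hc.lmul_vermaB hA hκ D]

theorem GBDTriple.Compat.twTrace_bE_sum (hc : 𝒯.Compat μ' μ) (D : DualRootBases R κ)
    (hA : IsSymmetrizableGCM A) (hκ : IsInvariantForm R κ) (i : D.Idx) (ξ : Dual ℂ 𝒯.l) (K : ℕ) :
    𝒯.twTrace Θ (lmul (D.bE i : KM R) (𝒯.vermaB μ' μ)) ξ =
      𝒯.twTrace Θ (lmul ((𝒯.BInv^[K] (D.bE i) : nPlus R) : KM R) (𝒯.vermaB μ' μ))
        (ξ + K • 𝒯.lroot i) -
      ∑ w ∈ Finset.range K, ⁅((𝒯.BInv^[w + 1] (D.bE i) : nPlus R) : KM R),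
        𝒯.twTrace Θ (𝒯.vermaB μ' μ) (ξ + (w + 1) • 𝒯.lroot i)⁆ := by
  induction K with
  | zero => simp
  | succ K ih =>
    rw [ih, hc.twTrace_bE D hA hκ, Finset.sum_range_succ, add_assoc ξ, ← succ_nsmul]
    abel

/-- After one turn `B^s f` stands to the right of `e B` and returns across `B` as `B^{s+1} f`.
Restoring the order with `e` costs the bracket. -/
theorem GBDTriple.twTrace_bF (D : DualRootBases R κ) (hA : IsSymmetrizableGCM A)
    (hκ : IsInvariantForm R κ) (i : D.Idx) (ξ : Dual ℂ 𝒯.l) (s : ℕ) (e : KM R) :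
    𝒯.twTrace Θ (lmul ((𝒯.B^[s] (D.bF i) : nMinus R) : KM R) (lmul e (𝒯.vermaB μ' μ))) ξ =
      ⁅((𝒯.B^[s] (D.bF i) : nMinus R) : KM R), 𝒯.twTrace Θ (lmul e (𝒯.vermaB μ' μ)) ξ⁆ +
      𝒯.twTrace Θ (lmul ⁅e, ((𝒯.B^[s + 1] (D.bF i) : nMinus R) : KM R)⁆ (𝒯.vermaB μ' μ))
        (ξ + 𝒯.lroot i) +
      𝒯.twTrace Θ (lmul ((𝒯.B^[s + 1] (D.bF i) : nMinus R) : KM R) (lmul e (𝒯.vermaB μ' μ)))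
        (ξ + 𝒯.lroot i) := by
  rw [𝒯.twTrace_lmul (Θ := Θ) (𝒯.B_iterate_mem_lwt D hA hκ i s), rmul_lmul,
    𝒯.rmul_vermaB hA, lmul_lie e, map_add, Pi.add_apply, sub_neg_eq_add, add_assoc,
    Function.iterate_succ_apply']

theorem GBDTriple.twTrace_bF_sum (D : DualRootBases R κ) (hA : IsSymmetrizableGCM A)
    (hκ : IsInvariantForm R κ) (i : D.Idx) (ξ : Dual ℂ 𝒯.l) (e : KM R) (K : ℕ) :
    𝒯.twTrace Θ (lmul (D.bF i : KM R) (lmul e (𝒯.vermaB μ' μ))) ξ =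
      ∑ s ∈ Finset.range K, ⁅((𝒯.B^[s] (D.bF i) : nMinus R) : KM R),
        𝒯.twTrace Θ (lmul e (𝒯.vermaB μ' μ)) (ξ + s • 𝒯.lroot i)⁆ +
      ∑ s ∈ Finset.range K,
        𝒯.twTrace Θ (lmul ⁅e, ((𝒯.B^[s + 1] (D.bF i) : nMinus R) : KM R)⁆ (𝒯.vermaB μ' μ))
          (ξ + (s + 1) • 𝒯.lroot i) +
      𝒯.twTrace Θ (lmul ((𝒯.B^[K] (D.bF i) : nMinus R) : KM R) (lmul e (𝒯.vermaB μ' μ)))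
        (ξ + K • 𝒯.lroot i) := by
  induction K with
  | zero => simp
  | succ K ih =>
    rw [ih, 𝒯.twTrace_bF D hA hκ, Finset.sum_range_succ, Finset.sum_range_succ, add_assoc ξ,
      ← succ_nsmul]
    abel

/-- The trace of `f e B` for dual basis vectors `f`, `e`. -/
theorem GBDTriple.Compat.twTrace_bF_bE (hc : 𝒯.Compat μ' μ) (D : DualRootBases R κ)
    (hA : IsSymmetrizableGCM A) (hκ : IsInvariantForm R κ) (i : D.Idx) {ξ : Dual ℂ 𝒯.l} {K : ℕ}
    (hK : ∀ k, K ≤ k → ∀ d : ℕ, μ' (gradElt R) - d ≠ ξ 𝒯.grad + k) :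
    𝒯.twTrace Θ (lmul (D.bF i : KM R) (lmul (D.bE i : KM R) (𝒯.vermaB μ' μ))) ξ =
      ∑ s ∈ Finset.range K,
        𝒯.twTrace Θ (lmul ⁅(D.bE i : KM R), ((𝒯.B^[s + 1] (D.bF i) : nMinus R) : KM R)⁆
          (𝒯.vermaB μ' μ)) (ξ + (s + 1) • 𝒯.lroot i) -
      ∑ s ∈ Finset.range K, ∑ w ∈ Finset.range K,
        ⁅((𝒯.B^[s] (D.bF i) : nMinus R) : KM R), ⁅((𝒯.BInv^[w + 1] (D.bE i) : nPlus R) : KM R),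
          𝒯.twTrace Θ (𝒯.vermaB μ' μ) (ξ + (s + (w + 1)) • 𝒯.lroot i)⁆⁆ := by
  -- The lowering vectors are carried around first, and then the raising vectors in each resulting
  -- term. By the choice of `K` both remainders vanish, and the minus sign comes from running the
  -- turns of `e` backwards.
  rw [𝒯.twTrace_bF_sum D hA hκ i ξ _ K, 𝒯.twTrace_far hK _ i le_rfl, add_zero, add_comm,
    sub_eq_add_neg, ← Finset.sum_neg_distrib]
  congr 1
  refine Finset.sum_congr rfl fun s _ => ?_
  rw [hc.twTrace_bE_sum D hA hκ i _ K, add_assoc ξ, ← add_nsmul,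
    𝒯.twTrace_far hK _ i (Nat.le_add_left K s), zero_sub, lie_neg, lie_sum]
  congr 1
  refine Finset.sum_congr rfl fun w _ => ?_
  rw [add_assoc ξ, ← add_nsmul]

theorem GBDTriple.Compat.sum_level_lie_twTrace (hc : 𝒯.Compat μ' μ)
    (hxy : 𝒯.IsOrthonormal x y) (D : DualRootBases R κ)
    (hA : IsSymmetrizableGCM A) (hκ : IsInvariantForm R κ) (ξ : Dual ℂ 𝒯.l) (k s : ℕ) :
    ∑ i ∈ D.level k,
      𝒯.twTrace Θ (lmul ⁅(D.bE i : KM R), ((𝒯.B^[s + 1] (D.bF i) : nMinus R) : KM R)⁆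
        (𝒯.vermaB μ' μ)) (ξ + (s + 1) • 𝒯.lroot i) =
    ∑ i ∈ D.level k, ∑ j, κ ⁅(D.bE i : KM R), ((𝒯.B^[s + 1] (D.bF i) : nMinus R) : KM R)⁆
      (cartan R (x j)) • (ξ + (s + 1) • 𝒯.lroot i) (x j) •
        𝒯.twTrace Θ (𝒯.vermaB μ' μ) (ξ + (s + 1) • 𝒯.lroot i) := by
  have h := hxy.sum_level_lie D hA hκ (fun η =>
    (LinearMap.proj (R := ℂ) (φ := fun _ : Dual ℂ 𝒯.l => W) (ξ + (s + 1) • η)) ∘ₗ 𝒯.twTrace Θ ∘ₗ lmulHom (𝒯.vermaB μ' μ)) k s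
  refine h.trans (Finset.sum_congr rfl fun i _ => Finset.sum_congr rfl fun j _ => ?_)
  rw [← hc.twTrace_l hA hκ D]
  rfl

/-- After transfer to `[e, B^{s+w+1} f]` the `𝔥₀`-parts cancel in the sum, and the `𝔩`-parts kill
the trace, which is `𝔩`-invariant. Hence the order of the two root vectors acting on `W` is
irrelevant, and `S_T` may be written symmetrically. -/
theorem GBDTriple.Compat.sum_level_lie_lie (hc : 𝒯.Compat μ' μ)
    (hxy : 𝒯.IsOrthonormal x y) (D : DualRootBases R κ)
    (hA : IsSymmetrizableGCM A) (hκ : IsInvariantForm R κ) (ξ : Dual ℂ 𝒯.l) (k s w : ℕ) :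
    ∑ i ∈ D.level k, ⁅⁅((𝒯.BInv^[w + 1] (D.bE i) : nPlus R) : KM R),
      ((𝒯.B^[s] (D.bF i) : nMinus R) : KM R)⁆,
        𝒯.twTrace Θ (𝒯.vermaB μ' μ) (ξ + (s + (w + 1)) • 𝒯.lroot i)⁆ = 0 := by
  let L : Dual ℂ 𝒯.l → KM R →ₗ[ℂ] W := fun η => (LieModule.toEnd ℂ (KM R) W).toLinearMap.flip
    (𝒯.twTrace Θ (𝒯.vermaB μ' μ) (ξ + (s + (w + 1)) • η))
  have h1 := 𝒯.sum_level_transfer_iterate D hA hκ (fun η =>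
    ((LieModule.toEnd ℂ (KM R) (KM R)).toLinearMap.compl₁₂ (nPlus R).toSubmodule.subtype
      (nMinus R).toSubmodule.subtype).compr₂ (L η)) k (w + 1) s
  have h2 := hxy.sum_level_lie D hA hκ L k (s + w)
  refine h1.trans (h2.trans (Finset.sum_eq_zero fun i _ => Finset.sum_eq_zero fun j _ => ?_))
  have h3 : L (𝒯.lroot i) (cartan R (x j)) = 0 := hc.lie_l hA hκ D (x j) _
  rw [h3, smul_zero]

end TraceIdentity

/-! ### The Casimir operator inside the twisted trace. -/

section CasimirTrace

variable {n : ℕ} {A : Matrix (Fin n) (Fin n) ℤ} {H : Type*} [AddCommGroup H] [Module ℂ H]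
  {R : Realization A H} {κ : LinearMap.BilinForm ℂ (KM R)} {𝒯 : GBDTriple R κ}
  {μ' μ : Dual ℂ H}

/-- From `2(ρ, α) = (α, α)` and the invariance of root lengths under `T`. The linear term of the
Casimir operator is thus a derivative along `𝔩`. -/
theorem GBDTriple.sharp_rho_mem_l (D : DualRootBases R κ) (hA : IsSymmetrizableGCM A)
    (hκ : IsInvariantForm R κ) {ρ : Dual ℂ H} (hρ : ∀ i, ρ (R.coroot i) = 1) :
    sharp R κ ρ ∈ 𝒯.l := by
  rw [𝒯.mem_l]
  intro i
  have h1 := two_mul_dualForm_rho D hA hκ hρ i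
  have h2 := two_mul_dualForm_rho D hA hκ hρ (𝒯.T i)
  rw [𝒯.inner_eq, ← h1] at h2
  rw [← dualForm_eq hA hκ D, ← dualForm_eq hA hκ D, dualForm_comm hκ, dualForm_comm hκ _ ρ]
  exact mul_left_cancel₀ two_ne_zero h2

variable {I₁ I₂ : Type*} [Fintype I₁] [Fintype I₂] {x : I₁ → 𝒯.l} {y : I₂ → 𝒯.h₀}

theorem GBDTriple.IsOrthonormal.apply_sharp_rho (hxy : 𝒯.IsOrthonormal x y)
    (D : DualRootBases R κ) (hA : IsSymmetrizableGCM A)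
    (hκ : IsInvariantForm R κ) {ρ : Dual ℂ H} (hρ : ∀ i, ρ (R.coroot i) = 1) (ξ : Dual ℂ 𝒯.l) :
    ξ ⟨sharp R κ ρ, 𝒯.sharp_rho_mem_l D hA hκ hρ⟩ = ∑ j, ρ (x j) * ξ (x j) := by
  have h : (⟨sharp R κ ρ, 𝒯.sharp_rho_mem_l D hA hκ hρ⟩ : 𝒯.l) = ∑ j, ρ (x j) • x j := by
    apply Subtype.ext
    rw [Submodule.coe_sum]
    refine (hxy.eq_sum (sharp R κ ρ)).trans ?_
    have h0 : ∑ j, hForm R κ (sharp R κ ρ) (y j) • (y j : H) = 0 :=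
      Finset.sum_eq_zero fun j _ => by
        rw [𝒯.hForm_l_h₀ (𝒯.sharp_rho_mem_l D hA hκ hρ) (y j).2, zero_smul]
    rw [h0, add_zero]
    refine Finset.sum_congr rfl fun j _ => ?_
    rw [hForm_sharp hA hκ D, Submodule.coe_smul]
  rw [h, map_sum]
  simp only [map_smul, smul_eq_mul]

theorem sum_lmul_apply {ι : Type*} (s : Finset ι) (φ : ι → Verma R μ' →ₗ[ℂ] Verma R μ)
    (m : Verma R μ') : (∑ i ∈ s, φ i) m = ∑ i ∈ s, φ i m := LinearMap.sum_apply s φ m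

theorem GBDTriple.Compat.casimir_vermaB (hc : 𝒯.Compat μ' μ) (hxy : 𝒯.IsOrthonormal x y)
    (D : DualRootBases R κ) (hA : IsSymmetrizableGCM A) (hκ : IsInvariantForm R κ)
    {ρ : Dual ℂ H} (hρ : ∀ i, ρ (R.coroot i) = 1) {d K : ℕ} (hd : d ≤ K) {m : Verma R μ'}
    (hm : ⁅cartan R (gradElt R), m⁆ = (μ' (gradElt R) - d) • m) :
    (∑ j, lmul (cartan R (x j)) (lmul (cartan R (x j)) (𝒯.vermaB μ' μ)) +
      ∑ j, lmul (cartan R (y j)) (lmul (cartan R (y j)) (𝒯.vermaB μ' μ)) +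
      (2 : ℂ) • lmul (cartan R (sharp R κ ρ)) (𝒯.vermaB μ' μ) +
      (2 : ℂ) • ∑ k ∈ Finset.range K, ∑ i ∈ D.level (k + 1),
        lmul (D.bF i : KM R) (lmul (D.bE i : KM R) (𝒯.vermaB μ' μ))) m =
    ((dualForm R κ μ μ + 2 * dualForm R κ μ ρ) • 𝒯.vermaB μ' μ) m := by
  have h1 : ⁅cartan R (gradElt R), 𝒯.vermaB μ' μ m⁆ =
      (μ (gradElt R) - d) • 𝒯.vermaB μ' μ m := by
    rw [𝒯.cartan_lie_vermaB hA hκ D (𝒯.mem_l.1 𝒯.gradElt_mem_l)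
      (hc.res _ 𝒯.gradElt_mem_l), hm, map_smul, hc.res _ 𝒯.gradElt_mem_l]
  have h2 := casimir_verma D hA hκ hρ (X := Sum.elim (fun j => (x j : H)) fun j => (y j : H))
    (fun u => by
      rw [Fintype.sum_sum_type]
      exact hxy.eq_sum u) hd h1
  rw [Fintype.sum_sum_type] at h2
  simp only [LinearMap.add_apply, LinearMap.smul_apply, sum_lmul_apply, lmul_apply]
  exact h2

variable {W : Type*} [AddCommGroup W] [Module ℂ W] [LieRingModule (KM R) W]
  [LieModule ℂ (KM R) W] {Θ : Verma R μ →ₗ⁅ℂ,KM R⁆ Verma R μ' ⊗[ℂ] W}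

theorem sum_range_level_comm {V : Type*} [AddCommMonoid V] (D : DualRootBases R κ) (K : ℕ)
    (g : D.Idx → ℕ → V) :
    ∑ k ∈ Finset.range K, ∑ i ∈ D.level (k + 1), ∑ s ∈ Finset.range K, g i s =
      ∑ k ∈ Finset.range K, ∑ s ∈ Finset.range K, ∑ i ∈ D.level (k + 1), g i s :=
  Finset.sum_congr rfl fun _ _ => Finset.sum_comm

theorem GBDTriple.Compat.casimir_twTrace (hc : 𝒯.Compat μ' μ) (hxy : 𝒯.IsOrthonormal x y)
    (D : DualRootBases R κ) (hA : IsSymmetrizableGCM A) (hκ : IsInvariantForm R κ)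
    {ρ : Dual ℂ H} (hρ : ∀ i, ρ (R.coroot i) = 1) {ξ : Dual ℂ 𝒯.l} {K : ℕ}
    (hK : ∀ d : ℕ, ξ 𝒯.grad = μ' (gradElt R) - d → d ≤ K) :
    (dualForm R κ μ μ + 2 * dualForm R κ μ ρ) • 𝒯.twTrace Θ (𝒯.vermaB μ' μ) ξ =
      ∑ j, 𝒯.twTrace Θ (lmul (cartan R (x j)) (lmul (cartan R (x j)) (𝒯.vermaB μ' μ))) ξ +
      ∑ j, 𝒯.twTrace Θ (lmul (cartan R (y j)) (lmul (cartan R (y j)) (𝒯.vermaB μ' μ))) ξ +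
      (2 : ℂ) • 𝒯.twTrace Θ (lmul (cartan R (sharp R κ ρ)) (𝒯.vermaB μ' μ)) ξ +
      (2 : ℂ) • ∑ k ∈ Finset.range K, ∑ i ∈ D.level (k + 1),
        𝒯.twTrace Θ (lmul (D.bF i : KM R) (lmul (D.bE i : KM R) (𝒯.vermaB μ' μ))) ξ := by
  have h := 𝒯.twTrace_congr (Θ := Θ) (ξ := ξ)
    (φ := ∑ j, lmul (cartan R (x j)) (lmul (cartan R (x j)) (𝒯.vermaB μ' μ)) +
      ∑ j, lmul (cartan R (y j)) (lmul (cartan R (y j)) (𝒯.vermaB μ' μ)) +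
      (2 : ℂ) • lmul (cartan R (sharp R κ ρ)) (𝒯.vermaB μ' μ) +
      (2 : ℂ) • ∑ k ∈ Finset.range K, ∑ i ∈ D.level (k + 1),
        lmul (D.bF i : KM R) (lmul (D.bE i : KM R) (𝒯.vermaB μ' μ)))
    (φ' := (dualForm R κ μ μ + 2 * dualForm R κ μ ρ) • 𝒯.vermaB μ' μ) (by
      intro χ hχ m hm
      by_cases h0 : m = 0
      · rw [h0, map_zero, map_zero]
      · have hm0 := hm (gradElt R)
        -- A nonzero weight vector sits at some depth `d` below `μ'`, and `d ≤ K` makes the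
        -- truncated Casimir operator exact on its image under `B`.
        obtain ⟨d, hd⟩ : ∃ d : ℕ, μ' (gradElt R) - d = χ (gradElt R) := by
          by_contra! h'
          exact h0 (verma_eq_zero_of_ht hm0 h')
        rw [← hd] at hm0
        refine hc.casimir_vermaB hxy D hA hκ hρ (hK d ?_) hm0
        rw [hd, ← hχ]
        rfl)
  simp only [map_add, map_smul, map_sum, Pi.add_apply, Pi.smul_apply, Finset.sum_apply] at h
  exact h.symm

theorem GBDTriple.Compat.sum_level_symm (hc : 𝒯.Compat μ' μ) (hxy : 𝒯.IsOrthonormal x y)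
    (D : DualRootBases R κ) (hA : IsSymmetrizableGCM A) (hκ : IsInvariantForm R κ)
    (ξ : Dual ℂ 𝒯.l) (k s w : ℕ) :
    (2 : ℂ) • ∑ i ∈ D.level k, ⁅((𝒯.B^[s] (D.bF i) : nMinus R) : KM R),
      ⁅((𝒯.BInv^[w + 1] (D.bE i) : nPlus R) : KM R),
        𝒯.twTrace Θ (𝒯.vermaB μ' μ) (ξ + (s + (w + 1)) • 𝒯.lroot i)⁆⁆ =
    ∑ i ∈ D.level k, (⁅((𝒯.B^[s] (D.bF i) : nMinus R) : KM R),
      ⁅((𝒯.BInv^[w + 1] (D.bE i) : nPlus R) : KM R),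
        𝒯.twTrace Θ (𝒯.vermaB μ' μ) (ξ + (s + (w + 1)) • 𝒯.lroot i)⁆⁆ +
      ⁅((𝒯.BInv^[w + 1] (D.bE i) : nPlus R) : KM R),
        ⁅((𝒯.B^[s] (D.bF i) : nMinus R) : KM R),
          𝒯.twTrace Θ (𝒯.vermaB μ' μ) (ξ + (s + (w + 1)) • 𝒯.lroot i)⁆⁆) := by
  have h := hc.sum_level_lie_lie (Θ := Θ) hxy D hA hκ ξ k s w
  simp only [lie_lie, Finset.sum_sub_distrib, sub_eq_zero] at h
  rw [Finset.sum_add_distrib, h, two_smul]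

/-- The trace identity obtained from the Casimir operator. -/
theorem GBDTriple.Compat.trace_identity (hc : 𝒯.Compat μ' μ) (hxy : 𝒯.IsOrthonormal x y)
    (D : DualRootBases R κ) (hA : IsSymmetrizableGCM A) (hκ : IsInvariantForm R κ)
    (h𝒯 : 𝒯.IsNondegenerate) {ρ : Dual ℂ H} (hρ : ∀ i, ρ (R.coroot i) = 1) {ξ : Dual ℂ 𝒯.l}
    {K : ℕ} (hK : ∀ d : ℕ, ξ 𝒯.grad = μ' (gradElt R) - d → d ≤ K)
    (hK' : ∀ k, K ≤ k → ∀ d : ℕ, μ' (gradElt R) - d ≠ ξ 𝒯.grad + k) :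
    (dualForm R κ μ μ + 2 * dualForm R κ μ ρ) • 𝒯.twTrace Θ (𝒯.vermaB μ' μ) ξ =
      ∑ j, ξ (x j) • ξ (x j) • 𝒯.twTrace Θ (𝒯.vermaB μ' μ) ξ +
      ∑ j, ⁅𝒯.halfCayley (y j), ⁅𝒯.halfCayley (y j), 𝒯.twTrace Θ (𝒯.vermaB μ' μ) ξ⁆⁆ +
      (2 : ℂ) • ∑ j, ρ (x j) • ξ (x j) • 𝒯.twTrace Θ (𝒯.vermaB μ' μ) ξ +
      ((2 : ℂ) • ∑ k ∈ Finset.range K, ∑ i ∈ D.level (k + 1), ∑ s ∈ Finset.range K,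
        ∑ j, κ ⁅(D.bE i : KM R), ((𝒯.B^[s + 1] (D.bF i) : nMinus R) : KM R)⁆
          (cartan R (x j)) • (ξ + (s + 1) • 𝒯.lroot i) (x j) •
          𝒯.twTrace Θ (𝒯.vermaB μ' μ) (ξ + (s + 1) • 𝒯.lroot i) -
      ∑ k ∈ Finset.range K, ∑ i ∈ D.level (k + 1), ∑ s ∈ Finset.range K, ∑ w ∈ Finset.range K,
        (⁅((𝒯.B^[s] (D.bF i) : nMinus R) : KM R),
          ⁅((𝒯.BInv^[w + 1] (D.bE i) : nPlus R) : KM R),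
            𝒯.twTrace Θ (𝒯.vermaB μ' μ) (ξ + (s + (w + 1)) • 𝒯.lroot i)⁆⁆ +
          ⁅((𝒯.BInv^[w + 1] (D.bE i) : nPlus R) : KM R),
            ⁅((𝒯.B^[s] (D.bF i) : nMinus R) : KM R),
              𝒯.twTrace Θ (𝒯.vermaB μ' μ) (ξ + (s + (w + 1)) • 𝒯.lroot i)⁆⁆)) := by
  have h1 : ∑ k ∈ Finset.range K, ∑ i ∈ D.level (k + 1),
      𝒯.twTrace Θ (lmul (D.bF i : KM R) (lmul (D.bE i : KM R) (𝒯.vermaB μ' μ))) ξ =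
      ∑ k ∈ Finset.range K, ∑ i ∈ D.level (k + 1), ∑ s ∈ Finset.range K,
        ∑ j, κ ⁅(D.bE i : KM R), ((𝒯.B^[s + 1] (D.bF i) : nMinus R) : KM R)⁆
          (cartan R (x j)) • (ξ + (s + 1) • 𝒯.lroot i) (x j) •
          𝒯.twTrace Θ (𝒯.vermaB μ' μ) (ξ + (s + 1) • 𝒯.lroot i) -
      ∑ k ∈ Finset.range K, ∑ i ∈ D.level (k + 1), ∑ s ∈ Finset.range K, ∑ w ∈ Finset.range K,
        ⁅((𝒯.B^[s] (D.bF i) : nMinus R) : KM R),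
          ⁅((𝒯.BInv^[w + 1] (D.bE i) : nPlus R) : KM R),
            𝒯.twTrace Θ (𝒯.vermaB μ' μ) (ξ + (s + (w + 1)) • 𝒯.lroot i)⁆⁆ := by
    simp only [hc.twTrace_bF_bE D hA hκ _ hK', Finset.sum_sub_distrib]
    congr 1
    rw [sum_range_level_comm, sum_range_level_comm]
    refine Finset.sum_congr rfl fun k _ => Finset.sum_congr rfl fun s _ => ?_
    exact hc.sum_level_lie_twTrace hxy D hA hκ ξ (k + 1) s
  rw [hc.casimir_twTrace hxy D hA hκ hρ hK, h1, smul_sub]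
  congr 1
  · congr 1
    · congr 1
      · exact Finset.sum_congr rfl fun j _ => hc.twTrace_l_l hA hκ D (x j) ξ
      · exact Finset.sum_congr rfl fun j _ => hc.twTrace_h₀_h₀ D hA hκ h𝒯 (y j) ξ
    · congr 1
      rw [hc.twTrace_l hA hκ D ⟨sharp R κ ρ, 𝒯.sharp_rho_mem_l D hA hκ hρ⟩ ξ,
        hxy.apply_sharp_rho D hA hκ hρ, Finset.sum_smul]
      simp only [mul_smul]
  · congr 1
    rw [sum_range_level_comm, sum_range_level_comm, Finset.smul_sum]
    refine Finset.sum_congr rfl fun k _ => ?_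
    rw [Finset.smul_sum]
    refine Finset.sum_congr rfl fun s _ => ?_
    rw [Finset.sum_comm, Finset.sum_comm (s := D.level (k + 1)), Finset.smul_sum]
    exact Finset.sum_congr rfl fun w _ => hc.sum_level_symm hxy D hA hκ ξ (k + 1) s w

end CasimirTrace

/-! ### Algebra of formal series -/

section FormalSeries

variable {n : ℕ} {A : Matrix (Fin n) (Fin n) ℤ} {H : Type*} [AddCommGroup H] [Module ℂ H]
  {R : Realization A H} {κ : LinearMap.BilinForm ℂ (KM R)} {𝒯 : GBDTriple R κ}

/-- The exponents of the series lie in a set `ξ₀ - ∑ ℕ α_i`. -/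
def Series.Bdd {V : Type*} [Zero V] (a : Series 𝒯 V) : Prop :=
  ∃ ξ₀ : Dual ℂ 𝒯.l, ∀ ξ, a ξ ≠ 0 → ∃ β : Fin n → ℕ, ξ = ξ₀ - 𝒯.res (posLattice R β)

theorem GBDTriple.res_posLattice_grad (β : Fin n → ℕ) :
    𝒯.res (posLattice R β) 𝒯.grad = ((∑ i, β i : ℕ) : ℂ) := posLattice_gradElt R β

theorem GBDTriple.res_posLattice_add (β β' : Fin n → ℕ) :
    𝒯.res (posLattice R (β + β')) = 𝒯.res (posLattice R β) + 𝒯.res (posLattice R β') := by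
  rw [posLattice_add]; rfl

theorem finite_cone (ξ₀ : Dual ℂ 𝒯.l) (c : ℂ) :
    {ξ : Dual ℂ 𝒯.l | ∃ β β' : Fin n → ℕ, ξ = ξ₀ - 𝒯.res (posLattice R β) ∧
      ((∑ i, β i : ℕ) : ℂ) + ((∑ i, β' i : ℕ) : ℂ) = c}.Finite := by
  by_cases h : ∃ d : ℕ, (d : ℂ) = c
  · obtain ⟨d, rfl⟩ := h
    refine ((Set.finite_Iic (fun _ : Fin n => d)).image
      fun β => ξ₀ - 𝒯.res (posLattice R β)).subset ?_
    rintro _ ⟨β, β', rfl, hd⟩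
    refine ⟨β, fun i => ?_, rfl⟩
    have h1 : (∑ i, β i) + ∑ i, β' i = d := by exact_mod_cast hd
    have h2 := Finset.single_le_sum (f := β) (fun _ _ => Nat.zero_le _) (Finset.mem_univ i)
    lia
  · refine Set.finite_empty.subset ?_
    rintro _ ⟨β, β', rfl, hd⟩
    exact h ⟨∑ i, β i + ∑ i, β' i, by push_cast at hd ⊢; exact hd⟩

section Finite

variable {U V W : Type*} [Zero U] [Zero V] [Zero W] {a : Series 𝒯 U} {b : Series 𝒯 V}
  {c : Series 𝒯 W}

/-- The exponent `ξ` fixes the total height of the two lattice elements, and there are finitely many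
elements of bounded height. This makes the `finsum` in a product of series a genuine sum. -/
theorem Series.Bdd.finite (ha : a.Bdd) (hb : b.Bdd) (ξ : Dual ℂ 𝒯.l) :
    {η | a η ≠ 0 ∧ b (ξ - η) ≠ 0}.Finite := by
  obtain ⟨α₀, ha⟩ := ha
  obtain ⟨β₀, hb⟩ := hb
  refine (finite_cone α₀ ((α₀ + β₀ - ξ) 𝒯.grad)).subset ?_
  rintro η ⟨h1, h2⟩
  obtain ⟨β, h1⟩ := ha _ h1
  obtain ⟨β', h2⟩ := hb _ h2
  refine ⟨β, β', h1, ?_⟩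
  rw [← 𝒯.res_posLattice_grad, ← 𝒯.res_posLattice_grad, ← LinearMap.add_apply]
  congr 1
  rw [sub_eq_iff_eq_add.1 h2, h1]
  abel

theorem Series.Bdd.finite₃ (ha : a.Bdd) (hb : b.Bdd) (hc : c.Bdd) (ξ : Dual ℂ 𝒯.l) :
    {z : Dual ℂ 𝒯.l × Dual ℂ 𝒯.l | a z.1 ≠ 0 ∧ b z.2 ≠ 0 ∧ c (ξ - z.1 - z.2) ≠ 0}.Finite := by
  obtain ⟨α₀, ha⟩ := ha
  obtain ⟨β₀, hb⟩ := hb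
  obtain ⟨γ₀, hc⟩ := hc
  refine ((finite_cone α₀ ((α₀ + β₀ + γ₀ - ξ) 𝒯.grad)).prod
    (finite_cone β₀ ((α₀ + β₀ + γ₀ - ξ) 𝒯.grad))).subset ?_
  rintro ⟨η, ζ⟩ ⟨h1, h2, h3⟩
  obtain ⟨β, h1⟩ := ha _ h1
  obtain ⟨β', h2⟩ := hb _ h2
  obtain ⟨β'', h3⟩ := hc _ h3
  dsimp only at h1 h2 h3
  have key : 𝒯.res (posLattice R β) + 𝒯.res (posLattice R β') + 𝒯.res (posLattice R β'') =
      α₀ + β₀ + γ₀ - ξ := by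
    rw [h1, h2] at h3
    rw [eq_sub_iff_add_eq] at h3 ⊢
    rw [← h3]
    abel
  have key' := congrArg (fun φ : Dual ℂ 𝒯.l => φ 𝒯.grad) key
  simp only [LinearMap.add_apply, 𝒯.res_posLattice_grad] at key'
  refine ⟨⟨β, β' + β'', h1, ?_⟩, ⟨β', β + β'', h2, ?_⟩⟩
  · simp only [LinearMap.sub_apply, LinearMap.add_apply] at key' ⊢
    rw [← key']
    simp only [Pi.add_apply, Finset.sum_add_distrib]
    push_cast
    ring
  · simp only [LinearMap.sub_apply, LinearMap.add_apply] at key' ⊢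
    rw [← key']
    simp only [Pi.add_apply, Finset.sum_add_distrib]
    push_cast
    ring

end Finite

variable {U V W X Y Z : Type*} [AddCommGroup U] [AddCommGroup V] [AddCommGroup W]
  [AddCommGroup X] [AddCommGroup Y] [AddCommGroup Z] [Module ℂ U] [Module ℂ V] [Module ℂ W]
  [Module ℂ X] [Module ℂ Y] [Module ℂ Z]

theorem ne_zero_of_pairing {p : U →ₗ[ℂ] V →ₗ[ℂ] W} {u : U} {v : V} (h : p u v ≠ 0) :
    u ≠ 0 ∧ v ≠ 0 := by
  constructor
  · rintro rfl; simp at h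
  · rintro rfl; simp at h

theorem Series.Bdd.finite_support {a : Series 𝒯 U} {b : Series 𝒯 V} (ha : a.Bdd) (hb : b.Bdd)
    (p : U →ₗ[ℂ] V →ₗ[ℂ] W) (ξ : Dual ℂ 𝒯.l) :
    (Function.support fun η => p (a η) (b (ξ - η))).Finite :=
  (ha.finite hb ξ).subset fun _ h => ne_zero_of_pairing h

theorem Series.Bdd.mul {a : Series 𝒯 U} {b : Series 𝒯 V} (ha : a.Bdd) (hb : b.Bdd)
    (p : U →ₗ[ℂ] V →ₗ[ℂ] W) : (Series.mul p a b).Bdd := by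
  obtain ⟨α₀, ha⟩ := ha
  obtain ⟨β₀, hb⟩ := hb
  refine ⟨α₀ + β₀, fun ξ hξ => ?_⟩
  obtain ⟨η, hη⟩ : ∃ η, p (a η) (b (ξ - η)) ≠ 0 := by
    by_contra! h
    exact hξ (by rw [Series.mul, finsum_congr h, finsum_zero])
  obtain ⟨h1, h2⟩ := ne_zero_of_pairing hη
  obtain ⟨β, h1⟩ := ha _ h1
  obtain ⟨β', h2⟩ := hb _ h2
  refine ⟨β + β', ?_⟩
  rw [𝒯.res_posLattice_add, sub_eq_iff_eq_add.1 h2, h1]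
  abel

theorem Series.Bdd.deriv {a : Series 𝒯 V} (ha : a.Bdd) (z : 𝒯.l) : (Series.deriv z a).Bdd := by
  obtain ⟨α₀, ha⟩ := ha
  refine ⟨α₀, fun ξ hξ => ha ξ fun h => hξ ?_⟩
  rw [Series.deriv, h, smul_zero]

theorem Series.mul_add {a : Series 𝒯 U} {b b' : Series 𝒯 V} (ha : a.Bdd) (hb : b.Bdd)
    (hb' : b'.Bdd) (p : U →ₗ[ℂ] V →ₗ[ℂ] W) :
    Series.mul p a (b + b') = Series.mul p a b + Series.mul p a b' := by
  ext ξ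
  rw [Pi.add_apply, Series.mul, Series.mul, Series.mul,
    ← finsum_add_distrib (ha.finite_support hb p ξ) (ha.finite_support hb' p ξ)]
  simp only [Pi.add_apply, map_add]

theorem Series.add_mul {a a' : Series 𝒯 U} {b : Series 𝒯 V} (ha : a.Bdd) (ha' : a'.Bdd)
    (hb : b.Bdd) (p : U →ₗ[ℂ] V →ₗ[ℂ] W) :
    Series.mul p (a + a') b = Series.mul p a b + Series.mul p a' b := by
  ext ξ
  rw [Pi.add_apply, Series.mul, Series.mul, Series.mul,
    ← finsum_add_distrib (ha.finite_support hb p ξ) (ha'.finite_support hb p ξ)]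
  simp only [Pi.add_apply, map_add, LinearMap.add_apply]

theorem Series.mul_smul (a : Series 𝒯 U) (b : Series 𝒯 V) (p : U →ₗ[ℂ] V →ₗ[ℂ] W) (c : ℂ) :
    Series.mul p a (c • b) = c • Series.mul p a b := by
  ext ξ
  rw [Pi.smul_apply, Series.mul, Series.mul, smul_finsum]
  simp only [Pi.smul_apply, map_smul]

theorem Series.smul_mul (a : Series 𝒯 U) (b : Series 𝒯 V) (p : U →ₗ[ℂ] V →ₗ[ℂ] W) (c : ℂ) :
    Series.mul p (c • a) b = c • Series.mul p a b := by
  ext ξ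
  rw [Pi.smul_apply, Series.mul, Series.mul, smul_finsum]
  simp only [Pi.smul_apply, map_smul, LinearMap.smul_apply]

theorem Series.mul_sum_pairing {a : Series 𝒯 U} {b : Series 𝒯 V} (ha : a.Bdd) (hb : b.Bdd)
    {ι : Type*} (s : Finset ι) (p : ι → U →ₗ[ℂ] V →ₗ[ℂ] W) :
    ∑ i ∈ s, Series.mul (p i) a b = Series.mul (∑ i ∈ s, p i) a b := by
  ext ξ
  rw [Finset.sum_apply]
  simp only [Series.mul, LinearMap.sum_apply]
  rw [finsum_sum_comm _ _ fun i _ => ha.finite_support hb (p i) ξ]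

theorem Series.mul_mul_apply {a : Series 𝒯 U} {b : Series 𝒯 V} {c : Series 𝒯 W} (ha : a.Bdd)
    (hb : b.Bdd) (hc : c.Bdd) (p : U →ₗ[ℂ] X →ₗ[ℂ] Y) (q : V →ₗ[ℂ] W →ₗ[ℂ] X)
    (ξ : Dual ℂ 𝒯.l) : Series.mul p a (Series.mul q b c) ξ =
      ∑ᶠ z : Dual ℂ 𝒯.l × Dual ℂ 𝒯.l, p (a z.1) (q (b z.2) (c (ξ - z.1 - z.2))) := by
  rw [finsum_curry _ ((ha.finite₃ hb hc ξ).subset fun z hz => ?_), Series.mul]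
  · refine finsum_congr fun η => ?_
    rw [Series.mul]
    exact map_finsum (p (a η)) (hb.finite_support hc q (ξ - η))
  · exact ⟨(ne_zero_of_pairing hz).1, ne_zero_of_pairing (ne_zero_of_pairing hz).2⟩

theorem Series.mul_mul_apply' {a : Series 𝒯 U} {b : Series 𝒯 V} {c : Series 𝒯 W} (ha : a.Bdd)
    (hb : b.Bdd) (hc : c.Bdd) (p : X →ₗ[ℂ] W →ₗ[ℂ] Y) (q : U →ₗ[ℂ] V →ₗ[ℂ] X)
    (ξ : Dual ℂ 𝒯.l) : Series.mul p (Series.mul q a b) c ξ =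
      ∑ᶠ z : Dual ℂ 𝒯.l × Dual ℂ 𝒯.l, p (q (a z.1) (b z.2)) (c (ξ - z.1 - z.2)) := by
  -- Reindexing by the exponent of the inner product and that of its first factor.
  let e : Dual ℂ 𝒯.l × Dual ℂ 𝒯.l ≃ Dual ℂ 𝒯.l × Dual ℂ 𝒯.l :=
    { toFun := fun z => (z.1 + z.2, z.1)
      invFun := fun z => (z.2, z.1 - z.2)
      left_inv := fun z => by simp
      right_inv := fun z => by simp }
  have h1 : ∀ z : Dual ℂ 𝒯.l × Dual ℂ 𝒯.l, p (q (a z.1) (b z.2)) (c (ξ - z.1 - z.2)) =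
      (fun z : Dual ℂ 𝒯.l × Dual ℂ 𝒯.l => p (q (a z.2) (b (z.1 - z.2))) (c (ξ - z.1))) (e z) := by
    intro z
    simp [e, sub_sub]
  rw [finsum_congr h1, finsum_comp_equiv e (f := fun z : Dual ℂ 𝒯.l × Dual ℂ 𝒯.l =>
    p (q (a z.2) (b (z.1 - z.2))) (c (ξ - z.1))), finsum_curry, Series.mul]
  · refine finsum_congr fun θ => ?_
    rw [Series.mul]
    exact map_finsum (p.flip (c (ξ - θ))) (ha.finite_support hb q θ)
  · refine ((ha.finite₃ hb hc ξ).image e).subset fun z hz => ⟨e.symm z, ?_, e.apply_symm_apply z⟩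
    have h2 := ne_zero_of_pairing hz
    have h3 := ne_zero_of_pairing h2.1
    refine ⟨h3.1, h3.2, ?_⟩
    have h4 : ξ - (e.symm z).1 - (e.symm z).2 = ξ - z.1 := by
      change ξ - z.2 - (z.1 - z.2) = ξ - z.1
      abel
    rw [h4]
    exact h2.2

theorem Series.mul_left_comm {a : Series 𝒯 U} {b : Series 𝒯 V} {c : Series 𝒯 W} (ha : a.Bdd)
    (hb : b.Bdd) (hc : c.Bdd) {p : U →ₗ[ℂ] X →ₗ[ℂ] Y} {q : V →ₗ[ℂ] W →ₗ[ℂ] X}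
    {p' : V →ₗ[ℂ] Z →ₗ[ℂ] Y} {q' : U →ₗ[ℂ] W →ₗ[ℂ] Z}
    (h : ∀ u v w, p u (q v w) = p' v (q' u w)) :
    Series.mul p a (Series.mul q b c) = Series.mul p' b (Series.mul q' a c) := by
  ext ξ
  rw [Series.mul_mul_apply ha hb hc, Series.mul_mul_apply hb ha hc,
    ← finsum_comp_equiv (Equiv.prodComm (Dual ℂ 𝒯.l) (Dual ℂ 𝒯.l))]
  refine finsum_congr fun z => ?_
  rw [h, sub_right_comm]
  rfl

theorem Series.mul_assoc {a : Series 𝒯 U} {b : Series 𝒯 V} {c : Series 𝒯 W} (ha : a.Bdd)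
    (hb : b.Bdd) (hc : c.Bdd) {p : U →ₗ[ℂ] X →ₗ[ℂ] Y} {q : V →ₗ[ℂ] W →ₗ[ℂ] X}
    {p' : Z →ₗ[ℂ] W →ₗ[ℂ] Y} {q' : U →ₗ[ℂ] V →ₗ[ℂ] Z}
    (h : ∀ u v w, p' (q' u v) w = p u (q v w)) :
    Series.mul p' (Series.mul q' a b) c = Series.mul p a (Series.mul q b c) := by
  ext ξ
  rw [Series.mul_mul_apply ha hb hc, Series.mul_mul_apply' ha hb hc]
  exact finsum_congr fun z => h _ _ _

theorem Series.deriv_mul {a : Series 𝒯 U} {b : Series 𝒯 V} (ha : a.Bdd) (hb : b.Bdd)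
    (p : U →ₗ[ℂ] V →ₗ[ℂ] W) (z : 𝒯.l) : Series.deriv z (Series.mul p a b) =
      Series.mul p (Series.deriv z a) b + Series.mul p a (Series.deriv z b) := by
  ext ξ
  rw [Pi.add_apply, Series.deriv, Series.mul, Series.mul, Series.mul,
    ← finsum_add_distrib ((ha.deriv z).finite_support hb p ξ)
      (ha.finite_support (hb.deriv z) p ξ), smul_finsum]
  refine finsum_congr fun η => ?_
  rw [Series.deriv, Series.deriv, map_smul, map_smul, LinearMap.smul_apply, ← add_smul]
  congr 1
  rw [LinearMap.sub_apply]
  ring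

open Classical in
/-- The series `v e^0`. -/
def Series.const (𝒯 : GBDTriple R κ) (v : V) : Series 𝒯 V := fun ξ => if ξ = 0 then v else 0

theorem Series.Bdd.const {V : Type*} [AddCommGroup V] (v : V) : (Series.const 𝒯 v).Bdd := by
  refine ⟨0, fun ξ hξ => ⟨0, ?_⟩⟩
  have h : ξ = 0 := by
    by_contra h
    exact hξ (if_neg h)
  rw [h, zero_sub, eq_comm, neg_eq_zero]
  ext z
  simp [GBDTriple.res, posLattice]

theorem Series.const_mul (u : U) (b : Series 𝒯 V) (p : U →ₗ[ℂ] V →ₗ[ℂ] W) (ξ : Dual ℂ 𝒯.l) :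
    Series.mul p (Series.const 𝒯 u) b ξ = p u (b ξ) := by
  rw [Series.mul, finsum_eq_single _ 0]
  · rw [Series.const, if_pos rfl, sub_zero]
  · intro η hη
    rw [Series.const, if_neg hη, map_zero, LinearMap.zero_apply]

theorem Series.deriv_const (v : V) (z : 𝒯.l) : Series.deriv z (Series.const 𝒯 v) = 0 := by
  ext ξ
  rw [Series.deriv, Series.const]
  split_ifs with h
  · rw [h, LinearMap.zero_apply, zero_smul]; rfl
  · rw [smul_zero]; rfl

theorem Series.mul_comm (a b : Series 𝒯 ℂ) :
    Series.mul (LinearMap.lsmul ℂ ℂ) a b = Series.mul (LinearMap.lsmul ℂ ℂ) b a := by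
  ext ξ
  rw [Series.mul, Series.mul, ← finsum_comp_equiv (Equiv.subLeft ξ)]
  refine finsum_congr fun η => ?_
  simp [_root_.mul_comm]

end FormalSeries

/-! ### The differential equation for unnormalized traces -/

section DifferentialEquation

variable {n : ℕ} {A : Matrix (Fin n) (Fin n) ℤ} {H : Type*} [AddCommGroup H] [Module ℂ H]
  {R : Realization A H} {κ : LinearMap.BilinForm ℂ (KM R)} {𝒯 : GBDTriple R κ}

section Family

variable {ι U V W : Type*} [AddCommGroup U] [AddCommGroup V] [AddCommGroup W]

/-- The series `∑_p c_p e^{(λ, pos p)}`. -/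
def Series.ofFamily (pos : ι → Dual ℂ 𝒯.l) (c : ι → U) : Series 𝒯 U :=
  fun ξ => ∑ᶠ (p) (_ : ξ = pos p), c p

-- Different indices may share an exponent. Where the second factor does not vanish, only indices in
-- `P` can contribute, so the coefficient of the family is a finite sum there.
open Classical in
theorem Series.ofFamily_mul [Module ℂ U] [Module ℂ V] [Module ℂ W] (β : U →ₗ[ℂ] V →ₗ[ℂ] W) {pos : ι → Dual ℂ 𝒯.l} {c : ι → U}
    {b : Series 𝒯 V} {ξ : Dual ℂ 𝒯.l} {P : Finset ι} (hP : ∀ p ∉ P, b (ξ - pos p) = 0) :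
    Series.mul β (Series.ofFamily pos c) b ξ = ∑ p ∈ P, β (c p) (b (ξ - pos p)) := by
  have h1 : ∀ η, β (Series.ofFamily pos c η) (b (ξ - η)) =
      ∑ p ∈ P, if η = pos p then β (c p) (b (ξ - pos p)) else 0 := by
    intro η
    by_cases hb : b (ξ - η) = 0
    · rw [hb, map_zero, Finset.sum_eq_zero]
      intro p _
      split_ifs with h
      · rw [← h, hb, map_zero]
      · rfl
    · have h2 : Series.ofFamily pos c η = ∑ p ∈ P, if η = pos p then c p else 0 := by
        rw [Series.ofFamily]
        simp only [finsum_eq_if]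
        refine finsum_eq_sum_of_support_subset _ fun p hp => ?_
        by_contra hpP
        refine hp (if_neg ?_)
        rintro rfl
        exact hb (hP p hpP)
      rw [h2, map_sum, LinearMap.sum_apply]
      refine Finset.sum_congr rfl fun p _ => ?_
      split_ifs with h
      · rw [h]
      · rw [map_zero, LinearMap.zero_apply]
  rw [Series.mul, finsum_congr h1, finsum_sum_comm]
  · refine Finset.sum_congr rfl fun p _ => ?_
    rw [finsum_eq_single _ (pos p) fun η h => if_neg h, if_pos rfl]
  · intro p _
    refine (Set.finite_singleton (pos p)).subset fun η h => ?_
    by_contra h'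
    exact h (if_neg h')

/-- The exponents of the series lie in `-∑ ℕ α_i`. -/
def Series.IsCone (a : Series 𝒯 U) : Prop :=
  ∀ ξ, a ξ ≠ 0 → ∃ β : Fin n → ℕ, ξ = -𝒯.res (posLattice R β)

theorem Series.IsCone.bdd {a : Series 𝒯 U} (ha : a.IsCone) : a.Bdd :=
  ⟨0, fun ξ hξ => by simpa using ha ξ hξ⟩

theorem Series.IsCone.add {a b : Series 𝒯 U} (ha : a.IsCone) (hb : b.IsCone) :
    (a + b).IsCone := by
  intro ξ hξ
  by_cases h : a ξ = 0
  · refine hb ξ fun h' => hξ ?_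
    rw [Pi.add_apply, h, h', add_zero]
  · exact ha ξ h

theorem Series.IsCone.smul [Module ℂ U] {a : Series 𝒯 U} (ha : a.IsCone) (c : ℂ) : (c • a).IsCone :=
  fun ξ hξ => ha ξ fun h => hξ (by rw [Pi.smul_apply, h, smul_zero])

theorem Series.IsCone.const (u : U) : (Series.const 𝒯 u).IsCone := by
  intro ξ hξ
  have h : ξ = 0 := by
    by_contra h
    exact hξ (if_neg h)
  refine ⟨0, ?_⟩
  rw [h, eq_comm, neg_eq_zero]
  ext z
  simp [GBDTriple.res, posLattice]

theorem Series.IsCone.ofFamily {pos : ι → Dual ℂ 𝒯.l} (c : ι → U)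
    (h : ∀ p, ∃ β : Fin n → ℕ, pos p = -𝒯.res (posLattice R β)) :
    (Series.ofFamily pos c).IsCone := by
  classical
  intro ξ hξ
  have h1 : ∃ p, ξ = pos p := by
    by_contra! h1
    refine hξ ?_
    rw [Series.ofFamily]
    exact (finsum_congr fun p => by rw [finsum_eq_if, if_neg (h1 p)]).trans finsum_zero
  obtain ⟨p, rfl⟩ := h1
  exact h p

end Family

theorem GBDTriple.nsmul_res_root (N : ℕ) (α : posRoots R) :
    ∃ β : Fin n → ℕ, -(N • 𝒯.res (α : Dual ℂ H)) = -𝒯.res (posLattice R β) := by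
  refine ⟨N • α.2.choose, ?_⟩
  conv_lhs => rw [root_eq_posLattice α]
  congr 1
  rw [posLattice, posLattice]
  ext z
  simp [GBDTriple.res, Finset.mul_sum, mul_assoc]

/-- The exponents of the first part of `S_T`. -/
def GBDTriple.posS (𝒯 : GBDTriple R κ) (p : posRoots R × ℕ × ℕ) : Dual ℂ 𝒯.l :=
  -((p.2.1 + (p.2.2 + 1)) • 𝒯.res (p.1 : Dual ℂ H))

/-- The coefficients of the first part of `S_T`. -/
def GBDTriple.coefS (𝒯 : GBDTriple R κ) (D : DualRootBases R κ) (p : posRoots R × ℕ × ℕ) :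
    KM R ⊗[ℂ] KM R :=
  ∑ t : Fin (D.mult p.1),
    (((𝒯.B^[p.2.1] (D.f p.1 t) : nMinus R) : KM R) ⊗ₜ[ℂ]
        ((𝒯.BInv^[p.2.2 + 1] (D.e p.1 t) : nPlus R) : KM R) +
      ((𝒯.BInv^[p.2.2 + 1] (D.e p.1 t) : nPlus R) : KM R) ⊗ₜ[ℂ]
        ((𝒯.B^[p.2.1] (D.f p.1 t) : nMinus R) : KM R))

theorem GBDTriple.finite_posS (ξ : Dual ℂ 𝒯.l) : {p | ξ = 𝒯.posS p}.Finite := by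
  by_cases h : ∃ N : ℕ, ξ 𝒯.grad = -N
  · obtain ⟨N, hN⟩ := h
    refine ((finite_ht_le (R := R) N).prod ((Set.finite_Iic N).prod (Set.finite_Iic N))).subset ?_
    rintro ⟨α, s, w⟩ rfl
    have h1 : (s + (w + 1)) * ht α = N := by
      have h2 : -(((s + (w + 1) : ℕ) : ℂ) * ht α) = -N := by
        rw [← hN, ← posRoots_gradElt α, GBDTriple.posS, LinearMap.neg_apply,
          LinearMap.smul_apply, nsmul_eq_mul]
        rfl
      exact_mod_cast neg_injective h2
    have h3 := ht_pos α
    refine ⟨?_, ?_, ?_⟩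
    · exact (Nat.le_mul_of_pos_left (ht α) (by lia)).trans h1.le
    · exact (by lia : s ≤ s + (w + 1)).trans ((Nat.le_mul_of_pos_right _ h3).trans h1.le)
    · exact (by lia : w ≤ s + (w + 1)).trans ((Nat.le_mul_of_pos_right _ h3).trans h1.le)
  · refine Set.finite_empty.subset ?_
    rintro ⟨α, s, w⟩ rfl
    refine h ⟨(s + (w + 1)) * ht α, ?_⟩
    rw [Nat.cast_mul, ← posRoots_gradElt α, GBDTriple.posS, LinearMap.neg_apply,
      LinearMap.smul_apply, nsmul_eq_mul]
    rfl

/-- Only finitely many triples `(α, s, w)` produce a given exponent, so the nested `finsum` in the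
definition of `S_T` is a single one over triples. -/
theorem GBDTriple.S_eq (D : DualRootBases R κ) {I₂ : Type*} [Fintype I₂] (y : I₂ → 𝒯.h₀) :
    𝒯.S D y = Series.ofFamily 𝒯.posS (𝒯.coefS D) +
      (-1 : ℂ) • Series.const 𝒯 (∑ j, 𝒯.halfCayley (y j) ⊗ₜ[ℂ] 𝒯.halfCayley (y j)) := by
  classical
  ext ξ
  rw [Pi.add_apply, Pi.smul_apply, neg_one_smul, ← sub_eq_add_neg, GBDTriple.S, Series.const,
    Series.ofFamily, finsum_curry₃]
  · rfl
  · refine (𝒯.finite_posS ξ).subset fun p hp => ?_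
    by_contra h
    refine hp ?_
    dsimp only
    rw [finsum_eq_if]
    exact if_neg h

theorem GBDTriple.isCone_S₁ (D : DualRootBases R κ) :
    (Series.ofFamily 𝒯.posS (𝒯.coefS D)).IsCone :=
  Series.IsCone.ofFamily _ fun _ => 𝒯.nsmul_res_root _ _

theorem GBDTriple.isCone_S (D : DualRootBases R κ) {I₂ : Type*} [Fintype I₂] (y : I₂ → 𝒯.h₀) :
    (𝒯.S D y).IsCone := by
  rw [𝒯.S_eq]
  exact (𝒯.isCone_S₁ D).add ((Series.IsCone.const _).smul _)

/-- The exponents of the logarithmic derivative of `δ_B`. -/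
def GBDTriple.posPhi (𝒯 : GBDTriple R κ) (p : posRoots R × ℕ) : Dual ℂ 𝒯.l :=
  -((p.2 + 1) • 𝒯.res (p.1 : Dual ℂ H))

/-- The coefficients of the logarithmic derivative of `δ_B`. -/
def GBDTriple.coefPhi (𝒯 : GBDTriple R κ) (D : DualRootBases R κ) (z : 𝒯.l)
    (p : posRoots R × ℕ) : ℂ :=
  ∑ t : Fin (D.mult p.1), κ ⁅(D.e p.1 t : KM R), ((𝒯.B^[p.2 + 1] (D.f p.1 t) : nMinus R) : KM R)⁆
    (cartan R z)

/-- The logarithmic derivative of `δ_B` in the direction of `z`. -/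
def GBDTriple.phi (𝒯 : GBDTriple R κ) (D : DualRootBases R κ) (ρ : Dual ℂ H) (z : 𝒯.l) :
    Series 𝒯 ℂ :=
  Series.const 𝒯 (ρ z) + Series.ofFamily 𝒯.posPhi (𝒯.coefPhi D z)

theorem GBDTriple.isCone_phi (D : DualRootBases R κ) (ρ : Dual ℂ H) (z : 𝒯.l) :
    (𝒯.phi D ρ z).IsCone :=
  (Series.IsCone.const _).add (Series.IsCone.ofFamily _ fun _ => 𝒯.nsmul_res_root _ _)

theorem sum_range_level {V : Type*} [AddCommMonoid V] (D : DualRootBases R κ) (K : ℕ)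
    (g : D.Idx → V) : ∑ k ∈ Finset.range K, ∑ i ∈ D.level (k + 1), g i =
      ∑ α ∈ (finite_ht_le (R := R) K).toFinset, ∑ t : Fin (D.mult α), g ⟨α, t⟩ := by
  rw [Finset.sum_sigma', Finset.sum_sigma']
  refine Finset.sum_bij (fun p _ => p.2) ?_ ?_ ?_ ?_
  · rintro ⟨k, i⟩ h
    simp only [Finset.mem_sigma, Finset.mem_range, D.mem_level] at h
    simp only [Finset.mem_sigma, Set.Finite.mem_toFinset, Set.mem_ofPred_eq, Finset.mem_univ,
      and_true]
    lia
  · rintro ⟨k, i⟩ h ⟨k', i'⟩ h' heq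
    simp only [Finset.mem_sigma, Finset.mem_range, D.mem_level] at h h' heq
    subst heq
    obtain rfl : k = k' := by lia
    rfl
  · rintro i h
    simp only [Finset.mem_sigma, Set.Finite.mem_toFinset, Set.mem_ofPred_eq, Finset.mem_univ,
      and_true] at h
    have := ht_pos i.1
    refine ⟨⟨ht i.1 - 1, i⟩, ?_, rfl⟩
    simp only [Finset.mem_sigma, Finset.mem_range, D.mem_level]
    lia
  · rintro ⟨k, i⟩ h
    rfl

variable {W : Type*} [AddCommGroup W] [Module ℂ W] [LieRingModule (KM R) W]
  [LieModule ℂ (KM R) W]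

/-- The action of `a ⊗ b` on `W` by `a b`. -/
def liePair (R : Realization A H) (W : Type*) [AddCommGroup W] [Module ℂ W]
    [LieRingModule (KM R) W] [LieModule ℂ (KM R) W] : KM R ⊗[ℂ] KM R →ₗ[ℂ] End ℂ W :=
  TensorProduct.lift ((LinearMap.mul ℂ (End ℂ W)).compl₁₂
    (LieModule.toEnd ℂ (KM R) W).toLinearMap (LieModule.toEnd ℂ (KM R) W).toLinearMap)

theorem liePair_apply (a b : KM R) (w : W) : liePair R W (a ⊗ₜ b) w = ⁅a, ⁅b, w⁆⁆ := by
  rw [liePair, TensorProduct.lift.tmul, LinearMap.compl₁₂_apply, LinearMap.mul_apply',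
    Module.End.mul_apply]
  rfl

variable {μ' μ : Dual ℂ H} {Θ : Verma R μ →ₗ⁅ℂ,KM R⁆ Verma R μ' ⊗[ℂ] W}

theorem far_root {V : Type*} [Zero V] {ξ : Dual ℂ 𝒯.l} {K : ℕ} {F : Series 𝒯 V}
    (hF : ∀ ζ : Dual ℂ 𝒯.l, (∀ d : ℕ, μ' (gradElt R) - d ≠ ζ 𝒯.grad) → F ζ = 0)
    (hK : ∀ k, K ≤ k → ∀ d : ℕ, μ' (gradElt R) - d ≠ ξ 𝒯.grad + k) {α : posRoots R} {N : ℕ}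
    (hN : 0 < N) (h : K ≤ N ∨ K < ht α) :
    F (ξ - -(N • 𝒯.res (α : Dual ℂ H))) = 0 := by
  refine hF _ fun d hd => hK (N * ht α) ?_ d ?_
  · rcases h with h | h
    · exact h.trans (Nat.le_mul_of_pos_right N (ht_pos α))
    · exact h.le.trans (Nat.le_mul_of_pos_left _ hN)
  · rw [hd, sub_neg_eq_add, LinearMap.add_apply, LinearMap.smul_apply, nsmul_eq_mul, Nat.cast_mul,
      ← posRoots_gradElt α]
    rfl

theorem exists_wordWt (w : List (Fin n)) : ∃ β : Fin n → ℕ, wordWt R w = posLattice R β := by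
  induction w with
  | nil => exact ⟨0, by simp [wordWt, posLattice]⟩
  | cons j w ih =>
    obtain ⟨β, h⟩ := ih
    refine ⟨Pi.single j 1 + β, ?_⟩
    rw [posLattice_add, posLattice_single, ← h, wordWt, List.map_cons, List.sum_cons]
    rfl

theorem traceSeries_bdd {W : Type*} [AddCommGroup W] [Module ℂ W]
    (ψ : Verma R μ' →ₗ[ℂ] Verma R μ' ⊗[ℂ] W) : (traceSeries 𝒯 ψ).Bdd := by
  refine ⟨𝒯.res μ', fun ξ hξ => ?_⟩
  by_contra! h
  refine hξ (traceSeries_eq_zero 𝒯 fun w hw => ?_)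
  obtain ⟨β, hβ⟩ := exists_wordWt (R := R) w
  refine h β ?_
  rw [← hw, hβ]
  rfl

/-- Shifts by a root of height above `K`, or by at least `K` times a root, leave the support of `F`.
The product with the infinite series `φ` thus has exactly the truncated form in which it occurs in
the trace identity. -/
theorem GBDTriple.phi_mul (D : DualRootBases R κ) (ρ : Dual ℂ H) (z : 𝒯.l) {ξ : Dual ℂ 𝒯.l}
    {K : ℕ} {V : Type*} [AddCommGroup V] [Module ℂ V] {F : Series 𝒯 V} (hb : F.Bdd)
    (hF : ∀ ζ : Dual ℂ 𝒯.l, (∀ d : ℕ, μ' (gradElt R) - d ≠ ζ 𝒯.grad) → F ζ = 0)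
    (hK : ∀ k, K ≤ k → ∀ d : ℕ, μ' (gradElt R) - d ≠ ξ 𝒯.grad + k) :
    Series.mul (LinearMap.lsmul ℂ V) (𝒯.phi D ρ z) F ξ = ρ z • F ξ +
      ∑ k ∈ Finset.range K, ∑ i ∈ D.level (k + 1), ∑ s ∈ Finset.range K,
        κ ⁅(D.bE i : KM R), ((𝒯.B^[s + 1] (D.bF i) : nMinus R) : KM R)⁆ (cartan R z) •
          F (ξ + (s + 1) • 𝒯.lroot i) := by
  rw [GBDTriple.phi, Series.add_mul (Series.Bdd.const _)
    (Series.IsCone.ofFamily (pos := 𝒯.posPhi) (𝒯.coefPhi D z) fun _ =>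
      𝒯.nsmul_res_root _ _).bdd hb, Pi.add_apply, Series.const_mul, LinearMap.lsmul_apply, Series.ofFamily_mul
    (P := (finite_ht_le (R := R) K).toFinset ×ˢ Finset.range K), sum_range_level,
    Finset.sum_product]
  · congr 1
    refine Finset.sum_congr rfl fun α _ => ?_
    rw [Finset.sum_comm]
    refine Finset.sum_congr rfl fun s _ => ?_
    rw [LinearMap.lsmul_apply, GBDTriple.coefPhi, Finset.sum_smul, GBDTriple.posPhi,
      sub_neg_eq_add]
    rfl
  · rintro ⟨α, s⟩ h
    simp only [Finset.mem_product, Set.Finite.mem_toFinset, Set.mem_ofPred_eq,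
      Finset.mem_range] at h
    exact far_root hF hK (Nat.succ_pos s) (by lia)

theorem GBDTriple.S_mul (D : DualRootBases R κ) {I₂ : Type*} [Fintype I₂] (y : I₂ → 𝒯.h₀)
    {ξ : Dual ℂ 𝒯.l} {K : ℕ} {F : Series 𝒯 W} (hb : F.Bdd)
    (hF : ∀ ζ : Dual ℂ 𝒯.l, (∀ d : ℕ, μ' (gradElt R) - d ≠ ζ 𝒯.grad) → F ζ = 0)
    (hK : ∀ k, K ≤ k → ∀ d : ℕ, μ' (gradElt R) - d ≠ ξ 𝒯.grad + k) :
    Series.mul (liePair R W) (𝒯.S D y) F ξ =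
      ∑ k ∈ Finset.range K, ∑ i ∈ D.level (k + 1), ∑ s ∈ Finset.range K, ∑ w ∈ Finset.range K,
        (⁅((𝒯.B^[s] (D.bF i) : nMinus R) : KM R),
          ⁅((𝒯.BInv^[w + 1] (D.bE i) : nPlus R) : KM R), F (ξ + (s + (w + 1)) • 𝒯.lroot i)⁆⁆ +
          ⁅((𝒯.BInv^[w + 1] (D.bE i) : nPlus R) : KM R),
            ⁅((𝒯.B^[s] (D.bF i) : nMinus R) : KM R), F (ξ + (s + (w + 1)) • 𝒯.lroot i)⁆⁆) -
      ∑ j, ⁅𝒯.halfCayley (y j), ⁅𝒯.halfCayley (y j), F ξ⁆⁆ := by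
  rw [𝒯.S_eq, Series.add_mul (𝒯.isCone_S₁ D).bdd ((Series.IsCone.const _).smul _).bdd hb,
    Pi.add_apply, Series.smul_mul, Pi.smul_apply, Series.const_mul, neg_one_smul,
    ← sub_eq_add_neg, Series.ofFamily_mul
    (P := (finite_ht_le (R := R) K).toFinset ×ˢ Finset.range K ×ˢ Finset.range K),
    sum_range_level, Finset.sum_product]
  · congr 1
    · refine Finset.sum_congr rfl fun α _ => ?_
      rw [Finset.sum_product, Finset.sum_comm (s := Finset.univ)]
      refine Finset.sum_congr rfl fun s _ => ?_
      rw [Finset.sum_comm (s := Finset.univ)]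
      refine Finset.sum_congr rfl fun w _ => ?_
      rw [GBDTriple.coefS, map_sum, LinearMap.sum_apply, GBDTriple.posS, sub_neg_eq_add]
      refine Finset.sum_congr rfl fun t _ => ?_
      rw [map_add, LinearMap.add_apply, liePair_apply, liePair_apply]
      rfl
    · rw [map_sum]
      exact (LinearMap.sum_apply _ _ _).trans
        (Finset.sum_congr rfl fun j _ => liePair_apply _ _ _)
  · rintro ⟨α, s, w⟩ h
    simp only [Finset.mem_product, Set.Finite.mem_toFinset, Set.mem_ofPred_eq,
      Finset.mem_range] at h
    exact far_root hF hK (by lia) (by lia)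

/-- This is the trace identity coefficient by coefficient: the truncated sums are the products of
the trace with `S_T` and of its derivatives with the `φ_j`, whose constant terms `ρ(x_j)` come from
`ρ^♯` in the Casimir operator. -/
theorem GBDTriple.Compat.series_identity {I₁ I₂ : Type*} [Fintype I₁] [Fintype I₂] {x : I₁ → 𝒯.l}
    {y : I₂ → 𝒯.h₀} (hc : 𝒯.Compat μ' μ) (hxy : 𝒯.IsOrthonormal x y)
    (D : DualRootBases R κ) (hA : IsSymmetrizableGCM A) (hκ : IsInvariantForm R κ)
    (h𝒯 : 𝒯.IsNondegenerate) {ρ : Dual ℂ H} (hρ : ∀ i, ρ (R.coroot i) = 1) :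
    (dualForm R κ μ μ + 2 * dualForm R κ μ ρ) • 𝒯.twTrace Θ (𝒯.vermaB μ' μ) =
      ∑ j, Series.deriv (x j) (Series.deriv (x j) (𝒯.twTrace Θ (𝒯.vermaB μ' μ))) +
      (2 : ℂ) • ∑ j, Series.mul (LinearMap.lsmul ℂ W) (𝒯.phi D ρ (x j))
        (Series.deriv (x j) (𝒯.twTrace Θ (𝒯.vermaB μ' μ))) -
      Series.mul (liePair R W) (𝒯.S D y) (𝒯.twTrace Θ (𝒯.vermaB μ' μ)) := by
  ext ξ
  obtain ⟨K, hK, hK'⟩ := 𝒯.exists_twTrace_bound μ' ξ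
  have hF : ∀ ζ : Dual ℂ 𝒯.l, (∀ d : ℕ, μ' (gradElt R) - d ≠ ζ 𝒯.grad) →
      𝒯.twTrace Θ (𝒯.vermaB μ' μ) ζ = 0 := fun ζ h => 𝒯.twTrace_eq_zero h
  have hF' : ∀ j, ∀ ζ : Dual ℂ 𝒯.l, (∀ d : ℕ, μ' (gradElt R) - d ≠ ζ 𝒯.grad) →
      Series.deriv (x j) (𝒯.twTrace Θ (𝒯.vermaB μ' μ)) ζ = 0 := fun j ζ h => by
    rw [Series.deriv, hF ζ h, smul_zero]
  have hb : (𝒯.twTrace Θ (𝒯.vermaB μ' μ)).Bdd := traceSeries_bdd _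
  have h1 := hc.trace_identity (Θ := Θ) hxy D hA hκ h𝒯 hρ hK hK'
  have h2 : ∑ j, Series.mul (LinearMap.lsmul ℂ W) (𝒯.phi D ρ (x j))
      (Series.deriv (x j) (𝒯.twTrace Θ (𝒯.vermaB μ' μ))) ξ =
      ∑ j, ρ (x j) • ξ (x j) • 𝒯.twTrace Θ (𝒯.vermaB μ' μ) ξ +
      ∑ k ∈ Finset.range K, ∑ i ∈ D.level (k + 1), ∑ s ∈ Finset.range K,
        ∑ j, κ ⁅(D.bE i : KM R), ((𝒯.B^[s + 1] (D.bF i) : nMinus R) : KM R)⁆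
          (cartan R (x j)) • (ξ + (s + 1) • 𝒯.lroot i) (x j) •
          𝒯.twTrace Θ (𝒯.vermaB μ' μ) (ξ + (s + 1) • 𝒯.lroot i) := by
    simp only [𝒯.phi_mul D ρ _ (hb.deriv _) (hF' _) hK', Finset.sum_add_distrib]
    congr 1
    rw [Finset.sum_comm]
    refine Finset.sum_congr rfl fun k _ => ?_
    rw [Finset.sum_comm]
    refine Finset.sum_congr rfl fun i _ => ?_
    rw [Finset.sum_comm]
    rfl
  rw [Pi.sub_apply, Pi.add_apply, Pi.smul_apply, Pi.smul_apply, Finset.sum_apply,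
    Finset.sum_apply, h2, 𝒯.S_mul D y hb hF hK', h1, smul_add]
  simp only [Series.deriv]
  abel

end DifferentialEquation

/-! ### The character of `B` -/

section Character

variable {n : ℕ} {A : Matrix (Fin n) (Fin n) ℤ} {H : Type*} [AddCommGroup H] [Module ℂ H]
  {R : Realization A H} {κ : LinearMap.BilinForm ℂ (KM R)} {𝒯 : GBDTriple R κ}

/-- The trivial action of `𝔤` on `ℂ`. -/
abbrev trivialLieRingModule (R : Realization A H) : LieRingModule (KM R) ℂ where
  bracket _ _ := 0
  add_lie _ _ _ := (add_zero 0).symm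
  lie_add _ _ _ := (add_zero 0).symm
  leibniz_lie _ _ _ := (add_zero 0).symm

attribute [local instance] trivialLieRingModule

theorem trivialLieModule (R : Realization A H) : LieModule ℂ (KM R) ℂ where
  smul_lie _ _ _ := (smul_zero _).symm
  lie_smul _ _ _ := (smul_zero _).symm

attribute [local instance] trivialLieModule

theorem trivial_lie (x : KM R) (c : ℂ) : ⁅x, c⁆ = 0 := rfl

/-- The isomorphism `M_χ → M_χ ⊗ ℂ`. -/
def vermaRid (R : Realization A H) (χ : Dual ℂ H) :
    Verma R χ →ₗ⁅ℂ,KM R⁆ Verma R χ ⊗[ℂ] ℂ where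
  toLinearMap := (TensorProduct.rid ℂ (Verma R χ)).symm.toLinearMap
  map_lie' {x m} := by
    change (TensorProduct.rid ℂ (Verma R χ)).symm ⁅x, m⁆ =
      ⁅x, (TensorProduct.rid ℂ (Verma R χ)).symm m⁆
    rw [TensorProduct.rid_symm_apply, TensorProduct.rid_symm_apply,
      TensorProduct.LieModule.lie_tmul_right, trivial_lie, TensorProduct.tmul_zero, add_zero]

/-- The trace of `B e^λ` on `M_χ`. -/
def GBDTriple.charSeries (𝒯 : GBDTriple R κ) (χ : Dual ℂ H) : Series 𝒯 ℂ :=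
  traceSeries 𝒯 ((TensorProduct.rid ℂ (Verma R χ)).symm.toLinearMap ∘ₗ 𝒯.vermaB χ χ)

theorem GBDTriple.charSeries_eq (χ : Dual ℂ H) :
    𝒯.charSeries χ = 𝒯.twTrace (vermaRid R χ) (𝒯.vermaB χ χ) := rfl

/-- The isomorphism of `U(𝔫_-)`-modules between two Verma modules. -/
def vermaShift (hA : IsSymmetrizableGCM A) (χ χ' : Dual ℂ H) : Verma R χ ≃ₗ[ℂ] Verma R χ' :=
  (vermaEquiv hA χ).symm.trans (vermaEquiv hA χ')

theorem vermaShift_smul (hA : IsSymmetrizableGCM A) (χ χ' : Dual ℂ H)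
    (a : UniversalEnvelopingAlgebra ℂ (nMinus R)) :
    vermaShift hA χ χ' (uIncl R a • hwv R χ) = uIncl R a • hwv R χ' := by
  rw [vermaShift, LinearEquiv.trans_apply, ← vermaEquiv_apply hA, LinearEquiv.symm_apply_apply,
    vermaEquiv_apply]

theorem vermaShift_mem (hA : IsSymmetrizableGCM A) {χ χ' γ γ' : Dual ℂ H}
    (h : γ' - γ = χ' - χ) {m : Verma R χ} (hm : m ∈ wtSpace R (Verma R χ) γ) :
    vermaShift hA χ χ' m ∈ wtSpace R (Verma R χ') γ' := by
  have h1 : Submodule.span ℂ ((fun w => vermaWord R χ (word w)) '' {w | χ - wordWt R w = γ}) ≤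
      (wtSpace R (Verma R χ') γ').comap (vermaShift hA χ χ').toLinearMap := by
    rw [Submodule.span_le]
    rintro _ ⟨w, hw, rfl⟩
    have h2 : χ' - wordWt R w = γ' := by
      have hw' : χ - wordWt R w = γ := hw
      rw [eq_add_of_sub_eq h, ← hw']
      abel
    have h3 := vermaWord_mem_wtSpace (R := R) χ' w
    rw [h2, vermaWord_apply] at h3
    rw [SetLike.mem_coe, Submodule.mem_comap, LinearEquiv.coe_coe]
    dsimp only
    rw [vermaWord_apply, vermaShift_smul]
    exact h3
  exact h1 (mem_span_vermaWord_of_wt hm)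

theorem GBDTriple.vermaShift_vermaB (hA : IsSymmetrizableGCM A) (χ χ' : Dual ℂ H)
    (m : Verma R χ) :
    vermaShift hA χ χ' (𝒯.vermaB χ χ m) = 𝒯.vermaB χ' χ' (vermaShift hA χ χ' m) := by
  obtain ⟨a, rfl⟩ := (vermaEquiv hA χ).surjective m
  rw [vermaEquiv_apply, 𝒯.isVermaB hA χ χ, vermaShift_smul, vermaShift_smul,
    𝒯.isVermaB hA χ' χ']

/-- The restriction of `vermaShift` to a weight space. -/
def wtShift (hA : IsSymmetrizableGCM A) {χ χ' γ γ' : Dual ℂ H}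
    (h : γ' - γ = χ' - χ) : wtSpace R (Verma R χ) γ ≃ₗ[ℂ] wtSpace R (Verma R χ') γ' :=
  LinearEquiv.ofLinearMap
    ((vermaShift hA χ χ').toLinearMap.restrict fun _ hm => vermaShift_mem hA h hm)
    ((vermaShift hA χ' χ).toLinearMap.restrict fun _ hm => vermaShift_mem hA
      (by rw [← neg_sub, h, neg_sub]) hm)
    (by
      refine LinearMap.ext fun m => Subtype.ext ?_
      exact ((vermaShift hA χ χ').apply_symm_apply (m : Verma R χ')))
    (by
      refine LinearMap.ext fun m => Subtype.ext ?_
      exact ((vermaShift hA χ χ').symm_apply_apply (m : Verma R χ)))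

theorem wtProj_vermaShift (hA : IsSymmetrizableGCM A) {χ χ' γ γ' : Dual ℂ H}
    (h : γ' - γ = χ' - χ) (m : Verma R χ) :
    wtProj R (Verma R χ') γ' (vermaShift hA χ χ' m) = wtShift hA h (wtProj R (Verma R χ) γ m) := by
  have hm : m ∈ ⨆ η : Dual ℂ H, wtSpace R (Verma R χ) η := by
    rw [iSup_wtSpace_verma]; trivial
  induction hm using Submodule.iSup_induction' with
  | zero => simp
  | add m m' _ _ ih ih' => simp only [map_add, ih, ih']
  | mem η m hm =>
    by_cases hη : η = γ
    · subst hη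
      rw [wtProj_of_mem (iSup_wtSpace_verma χ') (vermaShift_mem hA h hm),
        wtProj_of_mem (iSup_wtSpace_verma χ) hm]
      rfl
    · rw [wtProj_of_mem_ne (iSup_wtSpace_verma χ) hη hm, map_zero]
      refine wtProj_of_mem_ne (iSup_wtSpace_verma χ') (χ' := η + (χ' - χ)) ?_
        (vermaShift_mem hA (by abel) hm)
      rw [← h]
      intro h'
      exact hη (sub_eq_zero.1 (by rw [← sub_eq_zero.2 h']; abel))

theorem GBDTriple.wtTrace_vermaB (χ γ : Dual ℂ H) :
    wtTrace R ((TensorProduct.rid ℂ (Verma R χ)).symm.toLinearMap ∘ₗ 𝒯.vermaB χ χ) γ =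
      LinearMap.trace ℂ (wtSpace R (Verma R χ) γ)
        (wtProj R (Verma R χ) γ ∘ₗ 𝒯.vermaB χ χ ∘ₗ (wtSpace R (Verma R χ) γ).subtype) := by
  rw [← LinearMap.id_apply (R := ℂ) (wtTrace R _ _), dual_wtTrace]
  congr 1
  ext m
  simp

theorem GBDTriple.wtTrace_shift (hA : IsSymmetrizableGCM A) {χ χ' γ γ' : Dual ℂ H}
    (h : γ' - γ = χ' - χ) :
    wtTrace R ((TensorProduct.rid ℂ (Verma R χ')).symm.toLinearMap ∘ₗ 𝒯.vermaB χ' χ') γ' =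
      wtTrace R ((TensorProduct.rid ℂ (Verma R χ)).symm.toLinearMap ∘ₗ 𝒯.vermaB χ χ) γ := by
  rw [𝒯.wtTrace_vermaB, 𝒯.wtTrace_vermaB, ← LinearMap.trace_conj' _ (wtShift hA h)]
  congr 1
  refine LinearMap.ext fun m => ?_
  rw [LinearEquiv.conj_apply_apply, LinearMap.comp_apply, LinearMap.comp_apply,
    LinearMap.comp_apply, LinearMap.comp_apply, ← wtProj_vermaShift, 𝒯.vermaShift_vermaB]
  congr 2
  exact (congrArg Subtype.val ((wtShift hA h).apply_symm_apply m)).symm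

/-- Every Verma module is `U(𝔫_-)` as an `𝔫_-`-module, with the same operator `B`; only the weights
are translated. -/
theorem GBDTriple.charSeries_shift (hA : IsSymmetrizableGCM A) (χ θ : Dual ℂ H)
    (ξ : Dual ℂ 𝒯.l) : 𝒯.charSeries (χ + θ) (ξ + 𝒯.res θ) = 𝒯.charSeries χ ξ := by
  rw [GBDTriple.charSeries, GBDTriple.charSeries, traceSeries, traceSeries,
    ← finsum_comp_equiv (Equiv.addRight θ)]
  refine finsum_congr fun γ => ?_
  rw [Equiv.coe_addRight, 𝒯.wtTrace_shift hA (χ := χ) (γ := γ)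
    (by rw [add_sub_cancel_left, add_sub_cancel_left])]
  refine finsum_congr_Prop (propext ?_) fun _ => rfl
  change 𝒯.res γ + 𝒯.res θ = _ ↔ _
  rw [add_left_inj]

variable {I₁ I₂ : Type*} [Fintype I₁] [Fintype I₂] {x : I₁ → 𝒯.l} {y : I₂ → 𝒯.h₀}

/-- Pairing with `z ∈ 𝔩` gives `α` and `T α` the same value, and so does pairing with `ρ`, by
equality of root lengths. This supplies a family of weights along which the identity for the trivial
module can be varied. -/
theorem GBDTriple.compat_neg_rho_add (hA : IsSymmetrizableGCM A) (hκ : IsInvariantForm R κ)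
    (D : DualRootBases R κ) {ρ : Dual ℂ H} (hρ : ∀ i, ρ (R.coroot i) = 1) {z : H}
    (hz : z ∈ 𝒯.l) : 𝒯.Compat (-ρ + hForm R κ z) (-ρ + hForm R κ z) := by
  refine ⟨fun i => ?_, fun _ _ => rfl⟩
  have h1 : hForm R κ z (sharp R κ (R.root i)) = hForm R κ z (sharp R κ (R.root (𝒯.T i))) := by
    rw [hForm_comm hκ, hForm_sharp hA hκ D, hForm_comm hκ, hForm_sharp hA hκ D]
    exact (𝒯.mem_l.1 hz i).symm
  have h2 : ρ (sharp R κ (R.root i)) = ρ (sharp R κ (R.root (𝒯.T i))) := by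
    have h3 := chevForm_mul_dualForm hA hκ D ρ i
    rw [hρ, ← hρ (𝒯.T i), ← chevForm_mul_dualForm hA hκ D, 𝒯.chevForm_T hA hκ D] at h3
    have h4 := mul_left_cancel₀ (chevForm_ne_zero hA hκ D i) h3
    rwa [dualForm_eq hA hκ D, dualForm_eq hA hκ D] at h4
  rw [dualForm_eq hA hκ D, dualForm_eq hA hκ D, LinearMap.add_apply, LinearMap.add_apply,
    LinearMap.neg_apply, LinearMap.neg_apply, h1, h2]

theorem liePair_trivial : liePair R ℂ = 0 := by
  refine TensorProduct.ext' fun a b => LinearMap.ext fun c => ?_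
  rw [liePair_apply, trivial_lie]
  rfl

theorem sharp_hForm (hA : IsSymmetrizableGCM A) (hκ : IsInvariantForm R κ)
    (D : DualRootBases R κ) (z : H) : sharp R κ (hForm R κ z) = z :=
  (eq_sharp hA hκ D fun _ => rfl).symm

theorem dualForm_neg_rho_add (hA : IsSymmetrizableGCM A) (hκ : IsInvariantForm R κ)
    (D : DualRootBases R κ) (ρ : Dual ℂ H) (z : H) :
    dualForm R κ (-ρ + hForm R κ z) (-ρ + hForm R κ z) +
      2 * dualForm R κ (-ρ + hForm R κ z) ρ = hForm R κ z z - dualForm R κ ρ ρ := by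
  have h1 := hForm_sharp hA hκ D ρ z
  rw [hForm_comm hκ] at h1
  simp only [dualForm_eq hA hκ D, map_add, map_neg, LinearMap.add_apply, LinearMap.neg_apply,
    sharp_hForm hA hκ D, h1]
  ring

theorem GBDTriple.charSeries_bdd (χ : Dual ℂ H) : (𝒯.charSeries χ).Bdd := traceSeries_bdd _

theorem GBDTriple.mul_deriv_charSeries (hA : IsSymmetrizableGCM A) {a : Series 𝒯 ℂ}
    (ha : a.Bdd) (z : 𝒯.l) (χ θ : Dual ℂ H) (ξ : Dual ℂ 𝒯.l) :
    Series.mul (LinearMap.lsmul ℂ ℂ) a (Series.deriv z (𝒯.charSeries (χ + θ))) (ξ + 𝒯.res θ) =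
      Series.mul (LinearMap.lsmul ℂ ℂ) a (Series.deriv z (𝒯.charSeries χ)) ξ +
        θ z * Series.mul (LinearMap.lsmul ℂ ℂ) a (𝒯.charSeries χ) ξ := by
  rw [← smul_eq_mul (θ z), Series.mul, Series.mul, Series.mul, smul_finsum,
    ← finsum_add_distrib (ha.finite_support ((𝒯.charSeries_bdd χ).deriv z)
      (LinearMap.lsmul ℂ ℂ) ξ)]
  · refine finsum_congr fun η => ?_
    rw [add_sub_right_comm, Series.deriv, Series.deriv, 𝒯.charSeries_shift hA,
      LinearMap.add_apply]
    simp only [LinearMap.lsmul_apply, smul_eq_mul]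
    change a η * (((ξ - η) z + θ z) * _) = _
    ring
  · refine (ha.finite_support (𝒯.charSeries_bdd χ) (LinearMap.lsmul ℂ ℂ) ξ).subset
      fun η h h' => h ?_
    exact (congrArg (θ z • ·) h').trans (smul_zero _)

/-- For the trivial module the `S_T`-term disappears. Translating the character at `-ρ + z` back to
`-ρ` turns the identity into one for a single series, with `z` as a free parameter. -/
theorem GBDTriple.IsOrthonormal.charSeries_identity (hxy : 𝒯.IsOrthonormal x y)
    (D : DualRootBases R κ) (hA : IsSymmetrizableGCM A) (hκ : IsInvariantForm R κ)
    (h𝒯 : 𝒯.IsNondegenerate) {ρ : Dual ℂ H} (hρ : ∀ i, ρ (R.coroot i) = 1) {z : H}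
    (hz : z ∈ 𝒯.l) (ξ : Dual ℂ 𝒯.l) :
    (hForm R κ z z - dualForm R κ ρ ρ) * 𝒯.charSeries (-ρ) ξ =
      ∑ j, (ξ (x j) + hForm R κ z (x j)) * ((ξ (x j) + hForm R κ z (x j)) *
        𝒯.charSeries (-ρ) ξ) +
      2 * ∑ j, (Series.mul (LinearMap.lsmul ℂ ℂ) (𝒯.phi D ρ (x j))
        (Series.deriv (x j) (𝒯.charSeries (-ρ))) ξ + hForm R κ z (x j) *
          Series.mul (LinearMap.lsmul ℂ ℂ) (𝒯.phi D ρ (x j)) (𝒯.charSeries (-ρ)) ξ) := by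
  have h1 := congrFun ((𝒯.compat_neg_rho_add hA hκ D hρ hz).series_identity
    (Θ := vermaRid R (-ρ + hForm R κ z)) hxy D hA hκ h𝒯 hρ) (ξ + 𝒯.res (hForm R κ z))
  rw [← 𝒯.charSeries_eq, dualForm_neg_rho_add hA hκ D, liePair_trivial, Pi.sub_apply,
    Pi.add_apply, Pi.smul_apply, Pi.smul_apply, Finset.sum_apply, Finset.sum_apply,
    𝒯.charSeries_shift hA] at h1
  simp only [𝒯.mul_deriv_charSeries hA (𝒯.isCone_phi D ρ _).bdd] at h1
  simp only [Series.deriv, 𝒯.charSeries_shift hA, LinearMap.add_apply, smul_eq_mul] at h1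
  have h2 : Series.mul (0 : KM R ⊗[ℂ] KM R →ₗ[ℂ] ℂ →ₗ[ℂ] ℂ) (𝒯.S D y)
      (𝒯.charSeries (-ρ + hForm R κ z)) (ξ + 𝒯.res (hForm R κ z)) = 0 := by
    rw [Series.mul]
    simp
  rw [h1, sub_eq_self.2]
  · rfl
  · exact h2

/-- Subtracting the case `z = 0` from the case `z = x_k` cancels everything quadratic and leaves `2
∂_k Tr + 2 φ_k Tr = 0`; the constant `(x_k, x_k) = 1` drops out on both sides. -/
theorem GBDTriple.IsOrthonormal.deriv_charB [DecidableEq I₁] (hxy : 𝒯.IsOrthonormal x y)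
    (hx : ∀ i j, hForm R κ (x i) (x j) = if i = j then 1 else 0)
    (D : DualRootBases R κ) (hA : IsSymmetrizableGCM A) (hκ : IsInvariantForm R κ)
    (h𝒯 : 𝒯.IsNondegenerate) {ρ : Dual ℂ H} (hρ : ∀ i, ρ (R.coroot i) = 1) (k : I₁) :
    Series.deriv (x k) (𝒯.charB ρ) =
      -Series.mul (LinearMap.lsmul ℂ ℂ) (𝒯.phi D ρ (x k)) (𝒯.charB ρ) := by
  ext ξ
  have h0 := hxy.charSeries_identity D hA hκ h𝒯 hρ 𝒯.l.zero_mem ξ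
  have h1 := hxy.charSeries_identity D hA hκ h𝒯 hρ (x k).2 ξ
  have h00 : ∀ u, hForm R κ 0 u = 0 := fun u => by rw [map_zero, LinearMap.zero_apply]
  have h2 : ∀ (a : I₁ → ℂ) (c : ℂ), ∑ j, (a j + if k = j then 1 else 0) *
      ((a j + if k = j then 1 else 0) * c) = ∑ j, a j * (a j * c) + (2 * a k + 1) * c := by
    intro a c
    have h3 : ∀ j, (a j + if k = j then 1 else 0) * ((a j + if k = j then 1 else 0) * c) =
        a j * (a j * c) + if k = j then (2 * a j + 1) * c else 0 := by
      intro j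
      split_ifs <;> ring
    simp only [h3, Finset.sum_add_distrib, Finset.sum_ite_eq, Finset.mem_univ, if_true]
  simp only [hx, h2, if_true, ite_mul, one_mul, zero_mul, Finset.sum_add_distrib,
    Finset.sum_ite_eq, Finset.mem_univ] at h1
  simp only [h00, add_zero, zero_mul, zero_sub] at h0
  change ξ (x k) * 𝒯.charSeries (-ρ) ξ = -Series.mul (LinearMap.lsmul ℂ ℂ)
    (𝒯.phi D ρ (x k)) (𝒯.charSeries (-ρ)) ξ
  linear_combination (h0 - h1) / 2

theorem GBDTriple.IsOrthonormal.laplacian_charB (hxy : 𝒯.IsOrthonormal x y)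
    (D : DualRootBases R κ) (hA : IsSymmetrizableGCM A) (hκ : IsInvariantForm R κ)
    (h𝒯 : 𝒯.IsNondegenerate) {ρ : Dual ℂ H} (hρ : ∀ i, ρ (R.coroot i) = 1) :
    ∑ j, Series.deriv (x j) (Series.deriv (x j) (𝒯.charB ρ)) +
      (2 : ℂ) • ∑ j, Series.mul (LinearMap.lsmul ℂ ℂ) (𝒯.phi D ρ (x j))
        (Series.deriv (x j) (𝒯.charB ρ)) = -dualForm R κ ρ ρ • 𝒯.charB ρ := by
  ext ξ
  have h0 := hxy.charSeries_identity D hA hκ h𝒯 hρ 𝒯.l.zero_mem ξ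
  have h00 : ∀ u, hForm R κ 0 u = 0 := fun u => by rw [map_zero, LinearMap.zero_apply]
  simp only [h00, add_zero, zero_mul, zero_sub] at h0
  rw [Pi.add_apply, Pi.smul_apply, Finset.sum_apply, Finset.sum_apply, Pi.smul_apply]
  exact h0.symm

end Character

/-! ### Existence of `δ_B` -/

section Delta

variable {n : ℕ} {A : Matrix (Fin n) (Fin n) ℤ} {H : Type*} [AddCommGroup H] [Module ℂ H]
  {R : Realization A H} {κ : LinearMap.BilinForm ℂ (KM R)} {𝒯 : GBDTriple R κ}

/-- The exponents of the series lie in `-∑ ℕ α_i` and have height at least `k`. -/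
def Series.IsDeep {V : Type*} [Zero V] (k : ℕ) (a : Series 𝒯 V) : Prop :=
  ∀ ξ, a ξ ≠ 0 → ∃ β : Fin n → ℕ, ξ = -𝒯.res (posLattice R β) ∧ k ≤ ∑ i, β i

theorem Series.IsDeep.isCone {V : Type*} [AddCommGroup V] {k : ℕ} {a : Series 𝒯 V}
    (ha : a.IsDeep k) : a.IsCone := fun ξ hξ => (ha ξ hξ).imp fun _ h => h.1

theorem Series.IsDeep.mul {k l : ℕ} {a b : Series 𝒯 ℂ} (ha : a.IsDeep k) (hb : b.IsDeep l) :
    (Series.mul (LinearMap.mul ℂ ℂ) a b).IsDeep (k + l) := by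
  intro ξ hξ
  obtain ⟨η, hη⟩ : ∃ η, LinearMap.mul ℂ ℂ (a η) (b (ξ - η)) ≠ 0 := by
    by_contra! h
    exact hξ (by rw [Series.mul, finsum_congr h, finsum_zero])
  obtain ⟨h1, h2⟩ := ne_zero_of_pairing hη
  obtain ⟨β, h1, hk⟩ := ha _ h1
  obtain ⟨β', h2, hl⟩ := hb _ h2
  refine ⟨β + β', ?_, ?_⟩
  · rw [𝒯.res_posLattice_add, sub_eq_iff_eq_add.1 h2, h1]
    abel
  · simp only [Pi.add_apply, Finset.sum_add_distrib]
    lia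

/-- The powers of a series. -/
def Series.pow (a : Series 𝒯 ℂ) : ℕ → Series 𝒯 ℂ
  | 0 => Series.const 𝒯 1
  | k + 1 => Series.mul (LinearMap.mul ℂ ℂ) a (Series.pow a k)

theorem Series.IsDeep.const (c : ℂ) : (Series.const 𝒯 c).IsDeep 0 := fun ξ hξ =>
  (Series.IsCone.const c ξ hξ).imp fun _ h => ⟨h, Nat.zero_le _⟩

theorem Series.IsDeep.pow {a : Series 𝒯 ℂ} (ha : a.IsDeep 1) (k : ℕ) : (a.pow k).IsDeep k := by
  induction k with
  | zero => exact Series.IsDeep.const 1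
  | succ k ih =>
    have h := ha.mul ih
    rwa [add_comm 1 k] at h

/-- The sum of the geometric series. -/
def Series.geom (a : Series 𝒯 ℂ) : Series 𝒯 ℂ := fun ξ => ∑ᶠ k, a.pow k ξ

theorem Series.IsDeep.geom_isCone {a : Series 𝒯 ℂ} (ha : a.IsDeep 1) : a.geom.IsCone := by
  intro ξ hξ
  obtain ⟨k, hk⟩ : ∃ k, a.pow k ξ ≠ 0 := by
    by_contra! h
    exact hξ (by rw [Series.geom, finsum_congr h, finsum_zero])
  exact (ha.pow k).isCone ξ hk

theorem Series.IsDeep.geom_eq {a : Series 𝒯 ℂ} (ha : a.IsDeep 1) {ξ : Dual ℂ 𝒯.l} {K : ℕ}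
    (hK : ∀ d : ℕ, ξ 𝒯.grad = -d → d < K) : a.geom ξ = ∑ k ∈ Finset.range K, a.pow k ξ := by
  refine finsum_eq_sum_of_support_subset _ fun k hk => ?_
  obtain ⟨β, rfl, h⟩ := ha.pow k ξ hk
  have h1 := hK (∑ i, β i) (by rw [LinearMap.neg_apply, 𝒯.res_posLattice_grad])
  simp only [Finset.coe_range, Set.mem_Iio]
  lia

theorem Series.IsDeep.mul_geom {a : Series 𝒯 ℂ} (ha : a.IsDeep 1) :
    a.geom = Series.const 𝒯 1 + Series.mul (LinearMap.mul ℂ ℂ) a a.geom := by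
  ext ξ
  obtain ⟨K, hK⟩ : ∃ K : ℕ, ∀ d : ℕ, ξ 𝒯.grad = -d → d < K := by
    by_cases h : ∃ d : ℕ, ξ 𝒯.grad = -d
    · obtain ⟨d, hd⟩ := h
      refine ⟨d + 1, fun d' hd' => ?_⟩
      rw [hd] at hd'
      have : d = d' := Nat.cast_injective (neg_injective hd')
      lia
    · push Not at h
      exact ⟨0, fun d hd => absurd hd (h d)⟩
  have h1 : Series.mul (LinearMap.mul ℂ ℂ) a a.geom ξ =
      ∑ k ∈ Finset.range K, a.pow (k + 1) ξ := by
    have h2 : ∀ η, LinearMap.mul ℂ ℂ (a η) (a.geom (ξ - η)) =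
        ∑ k ∈ Finset.range K, LinearMap.mul ℂ ℂ (a η) (a.pow k (ξ - η)) := by
      intro η
      by_cases hη : a η = 0
      · simp [hη]
      -- Where `a η ≠ 0` the exponent `η` lies in `-∑ ℕ α_i`, so `ξ - η` is no deeper than `ξ` and
      -- the same truncation `K` is valid.
      · rw [← map_sum, ha.geom_eq fun d hd => ?_]
        obtain ⟨β, rfl, h⟩ := ha η hη
        have h3 := hK (d + ∑ i, β i) (by
          rw [sub_neg_eq_add, LinearMap.add_apply, 𝒯.res_posLattice_grad] at hd
          push_cast at hd ⊢
          linear_combination hd)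
        lia
    rw [Series.mul, finsum_congr h2, finsum_sum_comm]
    · rfl
    · exact fun k _ => ha.isCone.bdd.finite_support (ha.pow k).isCone.bdd _ ξ
  rw [Pi.add_apply, h1, ha.geom_eq (K := K + 1) fun d hd => (hK d hd).trans (Nat.lt_succ_self K),
    Finset.sum_range_succ', add_comm]
  rfl

theorem GBDTriple.charB_ne_zero {ρ : Dual ℂ H} {ξ : Dual ℂ 𝒯.l} (h : 𝒯.charB ρ ξ ≠ 0) :
    ∃ β : Fin n → ℕ, ξ = -𝒯.res ρ - 𝒯.res (posLattice R β) := by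
  by_contra! h'
  refine h (traceSeries_eq_zero 𝒯 fun w hw => ?_)
  obtain ⟨β, hβ⟩ := exists_wordWt (R := R) w
  refine h' β ?_
  rw [← hw, hβ]
  rfl

theorem hwv_mem_wtSpace (χ : Dual ℂ H) : hwv R χ ∈ wtSpace R (Verma R χ) χ :=
  fun x => cartan_lie_hwv χ x

theorem wtSpace_verma_self (χ : Dual ℂ H) :
    wtSpace R (Verma R χ) χ = Submodule.span ℂ {hwv R χ} := by
  refine le_antisymm (fun m hm => ?_) ?_
  · refine Submodule.span_mono ?_ (mem_span_vermaWord_of_wt hm)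
    rintro _ ⟨w, hw, rfl⟩
    have h1 : wordWt R w (gradElt R) = 0 := by
      have hw' : χ - wordWt R w = χ := hw
      rw [sub_eq_self.1 hw', LinearMap.zero_apply]
    rw [wordWt_gradElt, Nat.cast_eq_zero, List.length_eq_zero_iff] at h1
    subst h1
    exact vermaWord_nil χ
  · rw [Submodule.span_singleton_le_iff_mem]
    exact hwv_mem_wtSpace χ

/-- Only the highest weight space has this exponent, because every other weight is strictly lower on
the grading element. It is spanned by the highest weight vector, which `B` fixes. -/
theorem GBDTriple.charB_leading (hA : IsSymmetrizableGCM A) (ρ : Dual ℂ H) :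
    𝒯.charB ρ (-𝒯.res ρ) = 1 := by
  have h1 : wtTrace R ((TensorProduct.rid ℂ (Verma R (-ρ))).symm.toLinearMap ∘ₗ
      𝒯.vermaB (-ρ) (-ρ)) (-ρ) = 1 := by
    rw [𝒯.wtTrace_vermaB]
    have h2 : wtProj R (Verma R (-ρ)) (-ρ) ∘ₗ 𝒯.vermaB (-ρ) (-ρ) ∘ₗ
        (wtSpace R (Verma R (-ρ)) (-ρ)).subtype = LinearMap.id := by
      refine LinearMap.ext fun m => ?_
      obtain ⟨c, hc⟩ := Submodule.mem_span_singleton.1 ((wtSpace_verma_self (-ρ)).le m.2)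
      have h3 : 𝒯.vermaB (-ρ) (-ρ) m = m := by
        rw [← hc, map_smul, 𝒯.vermaB_hwv hA]
      rw [LinearMap.comp_apply, LinearMap.comp_apply, Submodule.subtype_apply, h3,
        wtProj_of_mem (iSup_wtSpace_verma _) m.2]
      rfl
    rw [h2, LinearMap.trace_id, wtSpace_verma_self, finrank_span_singleton (hwv_ne_zero hA _)]
    simp
  rw [GBDTriple.charB, traceSeries_eq_sum, Finset.sum_eq_single (-ρ), h1]
  · intro χ hχ hne
    obtain ⟨h2, w, rfl⟩ := (Set.Finite.mem_toFinset _).1 hχ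
    refine absurd ?_ hne
    have h3 := LinearMap.congr_fun h2 𝒯.grad
    have h4 : -ρ (gradElt R) - wordWt R w (gradElt R) = -ρ (gradElt R) := h3
    rw [sub_eq_self, wordWt_gradElt, Nat.cast_eq_zero, List.length_eq_zero_iff] at h4
    rw [h4, wordWt]
    simp
  · intro h
    refine absurd ?_ h
    rw [Set.Finite.mem_toFinset]
    exact ⟨rfl, [], by simp [wordWt]⟩

theorem Series.mul_shift {U V W : Type*} [AddCommGroup U] [AddCommGroup V] [AddCommGroup W]
    [Module ℂ U] [Module ℂ V] [Module ℂ W] (p : U →ₗ[ℂ] V →ₗ[ℂ] W) (a : Series 𝒯 U)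
    (b : Series 𝒯 V) (τ ξ : Dual ℂ 𝒯.l) :
    Series.mul p a (fun ξ => b (ξ - τ)) ξ = Series.mul p (fun ξ => a (ξ - τ)) b ξ := by
  rw [Series.mul, Series.mul, ← finsum_comp_equiv (Equiv.addRight τ)
    (f := fun η => p (a (η - τ)) (b (ξ - η)))]
  refine finsum_congr fun η => ?_
  rw [Equiv.coe_addRight, add_sub_cancel_right, sub_add_eq_sub_sub, sub_right_comm]

/-- Translated by `ρ`, the character has leading coefficient `1` and so is `1 - a` with `a` of
positive height; the geometric series in `a` inverts it. -/
theorem GBDTriple.exists_isDelta (hA : IsSymmetrizableGCM A) (ρ : Dual ℂ H) :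
    ∃ δ, 𝒯.IsDelta ρ δ := by
  set a : Series 𝒯 ℂ := Series.const 𝒯 1 + (-1 : ℂ) • fun ξ => 𝒯.charB ρ (ξ - 𝒯.res ρ) with ha
  have ha1 : ∀ ξ, 𝒯.charB ρ (ξ - 𝒯.res ρ) = Series.const 𝒯 1 ξ - a ξ := by
    intro ξ
    rw [ha, Pi.add_apply, Pi.smul_apply, smul_eq_mul]
    ring
  have h1 : a.IsDeep 1 := by
    intro ξ hξ
    by_cases h0 : ξ = 0
    · refine absurd ?_ hξ
      rw [← sub_eq_zero, sub_zero, ← sub_sub_cancel (Series.const 𝒯 1 ξ) (a ξ), ← ha1, h0,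
        zero_sub, 𝒯.charB_leading hA, Series.const, if_pos rfl, sub_self]
    · have h2 : 𝒯.charB ρ (ξ - 𝒯.res ρ) ≠ 0 := by
        rw [ha1, Series.const, if_neg h0, zero_sub]
        exact neg_ne_zero.2 hξ
      obtain ⟨β, hβ⟩ := 𝒯.charB_ne_zero h2
      have h3 : ξ = -𝒯.res (posLattice R β) := by
        rw [sub_eq_iff_eq_add.1 hβ]; abel
      refine ⟨β, h3, ?_⟩
      by_contra h4
      have h5 : β = 0 := by
        have h6 : ∑ i, β i = 0 := by lia
        funext i
        exact Finset.sum_eq_zero_iff.1 h6 i (Finset.mem_univ i)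
      refine h0 (h3.trans ?_)
      rw [h5, neg_eq_zero]
      ext z
      simp [GBDTriple.res, posLattice]
  refine ⟨fun ξ => a.geom (ξ - 𝒯.res ρ), fun ξ hξ => ?_, ?_⟩
  · obtain ⟨β, hβ⟩ := h1.geom_isCone _ hξ
    refine ⟨β, ?_⟩
    rw [sub_eq_iff_eq_add.1 hβ, add_comm, ← sub_eq_add_neg]
    rfl
  · ext ξ
    have h2 := congrFun h1.mul_geom ξ
    have h3 : (fun ξ => 𝒯.charB ρ (ξ - 𝒯.res ρ)) = Series.const 𝒯 1 + (-1 : ℂ) • a := by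
      ext ξ
      rw [ha1, Pi.add_apply, Pi.smul_apply, neg_one_smul, sub_eq_add_neg]
    rw [Series.mul_shift, h3, Series.add_mul (Series.Bdd.const _) (h1.isCone.smul _).bdd
      h1.geom_isCone.bdd, Pi.add_apply, Series.const_mul, Series.smul_mul, Pi.smul_apply, h2,
      Pi.add_apply, map_add, LinearMap.mul_apply', LinearMap.mul_apply', one_mul, one_mul,
      neg_one_smul, add_neg_cancel_right]
    rfl

end Delta

/-! ### The differential equation for normalized traces -/

section Normalized

variable {n : ℕ} {A : Matrix (Fin n) (Fin n) ℤ} {H : Type*} [AddCommGroup H] [Module ℂ H]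
  {R : Realization A H} {κ : LinearMap.BilinForm ℂ (KM R)} {𝒯 : GBDTriple R κ}

variable {V : Type*} [AddCommGroup V] [Module ℂ V]

/-- The product of a scalar series and a vector series. -/
def Series.act (a : Series 𝒯 ℂ) (b : Series 𝒯 V) : Series 𝒯 V :=
  Series.mul (LinearMap.lsmul ℂ V) a b

/-- The exponents of the series lie in `ξ₀ - ∑ ℕ α_i`. -/
def Series.BddBy {V : Type*} [Zero V] (ξ₀ : Dual ℂ 𝒯.l) (a : Series 𝒯 V) : Prop :=
  ∀ ξ, a ξ ≠ 0 → ∃ β : Fin n → ℕ, ξ = ξ₀ - 𝒯.res (posLattice R β)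

section BddBy

variable {ξ₀ : Dual ℂ 𝒯.l} {a b : Series 𝒯 V}

theorem Series.BddBy.bdd {V : Type*} [Zero V] {a : Series 𝒯 V} (ha : a.BddBy ξ₀) : a.Bdd := ⟨ξ₀, ha⟩

theorem Series.BddBy.add {V : Type*} [AddCommGroup V] {a b : Series 𝒯 V} (ha : a.BddBy ξ₀) (hb : b.BddBy ξ₀) : (a + b).BddBy ξ₀ := by
  intro ξ hξ
  by_cases h : a ξ = 0
  · refine hb ξ fun h' => hξ ?_
    rw [Pi.add_apply, h, h', add_zero]
  · exact ha ξ h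

theorem Series.BddBy.smul (ha : a.BddBy ξ₀) (r : ℂ) : (r • a).BddBy ξ₀ :=
  fun ξ hξ => ha ξ fun h => hξ (by rw [Pi.smul_apply, h, smul_zero])

theorem Series.BddBy.deriv (ha : a.BddBy ξ₀) (z : 𝒯.l) : (Series.deriv z a).BddBy ξ₀ :=
  fun ξ hξ => ha ξ fun h => hξ (by rw [Series.deriv, h, smul_zero])

theorem Series.BddBy.sum {V ι : Type*} [AddCommGroup V] (s : Finset ι) {f : ι → Series 𝒯 V}
    (hf : ∀ i ∈ s, (f i).BddBy ξ₀) : (∑ i ∈ s, f i).BddBy ξ₀ :=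
  Finset.sum_induction f (fun a => a.BddBy ξ₀) (fun _ _ => Series.BddBy.add)
    (fun _ h => absurd rfl h) hf

theorem Series.IsCone.deriv (ha : a.IsCone) (z : 𝒯.l) : (Series.deriv z a).IsCone :=
  fun ξ hξ => ha ξ fun h => hξ (by rw [Series.deriv, h, smul_zero])

theorem Series.IsCone.act_bddBy {c : Series 𝒯 ℂ} (hc : c.IsCone) (ha : a.BddBy ξ₀) :
    (c.act a).BddBy ξ₀ := by
  intro ξ hξ
  obtain ⟨η, hη⟩ : ∃ η, LinearMap.lsmul ℂ V (c η) (a (ξ - η)) ≠ 0 := by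
    by_contra! h
    exact hξ (by rw [Series.act, Series.mul, finsum_congr h, finsum_zero])
  obtain ⟨h1, h2⟩ := ne_zero_of_pairing hη
  obtain ⟨β, h1⟩ := hc _ h1
  obtain ⟨β', h2⟩ := ha _ h2
  refine ⟨β + β', ?_⟩
  rw [𝒯.res_posLattice_add, sub_eq_iff_eq_add.1 h2, h1]
  abel

end BddBy

section Act

variable {a b : Series 𝒯 ℂ} {c c' : Series 𝒯 V}

theorem Series.Bdd.act (ha : a.Bdd) (hc : c.Bdd) : (a.act c).Bdd := ha.mul hc _

theorem Series.act_assoc (ha : a.Bdd) (hb : b.Bdd) (hc : c.Bdd) :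
    (a.act b).act c = a.act (b.act c) :=
  Series.mul_assoc ha hb hc fun u v w => SemigroupAction.mul_smul u v w

theorem Series.act_left_comm (ha : a.Bdd) (hb : b.Bdd) (hc : c.Bdd) :
    a.act (b.act c) = b.act (a.act c) :=
  Series.mul_left_comm ha hb hc fun u v w => by simp [smul_comm u v w]

theorem Series.act_comm (a b : Series 𝒯 ℂ) : a.act b = b.act a := Series.mul_comm a b

theorem Series.const_act (r : ℂ) (c : Series 𝒯 V) : (Series.const 𝒯 r).act c = r • c :=
  funext fun ξ => Series.const_mul r c _ ξ

theorem Series.act_add (ha : a.Bdd) (hc : c.Bdd) (hc' : c'.Bdd) :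
    a.act (c + c') = a.act c + a.act c' := Series.mul_add ha hc hc' _

theorem Series.act_smul (a : Series 𝒯 ℂ) (c : Series 𝒯 V) (r : ℂ) : a.act (r • c) = r • a.act c :=
  Series.mul_smul a c _ r

theorem Series.smul_act (a : Series 𝒯 ℂ) (c : Series 𝒯 V) (r : ℂ) : (r • a).act c = r • a.act c :=
  Series.smul_mul a c _ r

theorem Series.deriv_act (ha : a.Bdd) (hc : c.Bdd) (z : 𝒯.l) :
    Series.deriv z (a.act c) = (Series.deriv z a).act c + a.act (Series.deriv z c) :=
  Series.deriv_mul ha hc _ z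

theorem Series.deriv_smul (r : ℂ) (c : Series 𝒯 V) (z : 𝒯.l) :
    Series.deriv z (r • c) = r • Series.deriv z c :=
  funext fun ξ => smul_comm (ξ z) r (c ξ)

theorem Series.deriv_add (c c' : Series 𝒯 V) (z : 𝒯.l) :
    Series.deriv z (c + c') = Series.deriv z c + Series.deriv z c' :=
  funext fun ξ => smul_add (ξ z) (c ξ) (c' ξ)

theorem Series.act_sum {ι : Type*} (s : Finset ι) {f : ι → Series 𝒯 V} (ha : a.Bdd)
    (hf : ∀ i, (f i).Bdd) : a.act (∑ i ∈ s, f i) = ∑ i ∈ s, a.act (f i) := by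
  ext ξ
  rw [Finset.sum_apply, Series.act, Series.mul]
  simp only [Finset.sum_apply, map_sum]
  exact finsum_sum_comm _ _ fun i _ => ha.finite_support (hf i) _ ξ

theorem Series.sum_act {ι : Type*} (s : Finset ι) {f : ι → Series 𝒯 ℂ} (hf : ∀ i, (f i).Bdd)
    (hc : c.Bdd) : (∑ i ∈ s, f i).act c = ∑ i ∈ s, (f i).act c := by
  ext ξ
  rw [Finset.sum_apply, Series.act, Series.mul]
  simp only [Finset.sum_apply, map_sum, LinearMap.sum_apply]
  exact finsum_sum_comm _ _ fun i _ => (hf i).finite_support hc _ ξ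

end Act

theorem GBDTriple.IsDelta.bdd {ρ : Dual ℂ H} {δ : Series 𝒯 ℂ} (hδ : 𝒯.IsDelta ρ δ) : δ.Bdd :=
  ⟨𝒯.res ρ, hδ.1⟩

theorem GBDTriple.charB_bdd (ρ : Dual ℂ H) : (𝒯.charB ρ).Bdd := traceSeries_bdd _

theorem GBDTriple.IsDelta.charB_act {ρ : Dual ℂ H} {δ : Series 𝒯 ℂ} (hδ : 𝒯.IsDelta ρ δ) :
    (𝒯.charB ρ).act δ = Series.const 𝒯 1 :=
  Eq.trans (by rw [Series.act]; rfl) hδ.2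

theorem GBDTriple.isDelta_delta (hA : IsSymmetrizableGCM A) (ρ : Dual ℂ H) :
    𝒯.IsDelta ρ (𝒯.delta ρ) := by
  rw [GBDTriple.delta, dif_pos (𝒯.exists_isDelta hA ρ)]
  exact (𝒯.exists_isDelta hA ρ).choose_spec

variable {I₁ I₂ : Type*} [Fintype I₁] [Fintype I₂] {x : I₁ → 𝒯.l} {y : I₂ → 𝒯.h₀}
  [DecidableEq I₁]

/-- Differentiate `Tr · δ = 1` and use `∂_k Tr = -φ_k Tr`. -/
theorem GBDTriple.IsOrthonormal.deriv_delta (hxy : 𝒯.IsOrthonormal x y)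
    (hx : ∀ i j, hForm R κ (x i) (x j) = if i = j then 1 else 0)
    (D : DualRootBases R κ) (hA : IsSymmetrizableGCM A) (hκ : IsInvariantForm R κ)
    (h𝒯 : 𝒯.IsNondegenerate) {ρ : Dual ℂ H} (hρ : ∀ i, ρ (R.coroot i) = 1) (k : I₁)
    {δ : Series 𝒯 ℂ} (hδ : 𝒯.IsDelta ρ δ) :
    Series.deriv (x k) δ = (𝒯.phi D ρ (x k)).act δ := by
  have hφ := (𝒯.isCone_phi D ρ (x k)).bdd
  have hχ := 𝒯.charB_bdd ρ
  have h1 := Series.deriv_act hχ hδ.bdd (x k)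
  have h2 : Series.deriv (x k) (𝒯.charB ρ) = (-1 : ℂ) • (𝒯.phi D ρ (x k)).act (𝒯.charB ρ) := by
    rw [neg_one_smul]
    exact hxy.deriv_charB hx D hA hκ h𝒯 hρ k
  rw [hδ.charB_act, Series.deriv_const, h2, Series.smul_act, Series.act_assoc hφ hχ hδ.bdd,
    hδ.charB_act, Series.act_comm _ (Series.const 𝒯 1), Series.const_act, one_smul,
    neg_one_smul, eq_comm, neg_add_eq_zero] at h1
  rw [h1, Series.act_comm, ← Series.act_assoc hδ.bdd hχ (hδ.bdd.deriv _), Series.act_comm δ,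
    hδ.charB_act, Series.const_act, one_smul]

/-- The equation for the character says that `∑ (∂_j φ_j + φ_j²)` acts on it by `(ρ, ρ)`, and the
same expression gives `∑ ∂_j² δ` when applied to `δ`. -/
theorem GBDTriple.IsOrthonormal.laplacian_delta (hxy : 𝒯.IsOrthonormal x y)
    (hx : ∀ i j, hForm R κ (x i) (x j) = if i = j then 1 else 0)
    (D : DualRootBases R κ) (hA : IsSymmetrizableGCM A) (hκ : IsInvariantForm R κ)
    (h𝒯 : 𝒯.IsNondegenerate) {ρ : Dual ℂ H} (hρ : ∀ i, ρ (R.coroot i) = 1)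
    {δ : Series 𝒯 ℂ} (hδ : 𝒯.IsDelta ρ δ) :
    ∑ j, Series.deriv (x j) (Series.deriv (x j) δ) = dualForm R κ ρ ρ • δ := by
  have hφ := fun j => (𝒯.isCone_phi D ρ (x j)).bdd
  have hχ := 𝒯.charB_bdd ρ
  have hδ' := hδ.bdd
  have h1 : ∀ j, Series.deriv (x j) (𝒯.charB ρ) =
      (-1 : ℂ) • (𝒯.phi D ρ (x j)).act (𝒯.charB ρ) := fun j => by
    rw [neg_one_smul]
    exact hxy.deriv_charB hx D hA hκ h𝒯 hρ j
  have h2 : ∑ j, ((Series.deriv (x j) (𝒯.phi D ρ (x j))).act (𝒯.charB ρ) +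
      (𝒯.phi D ρ (x j)).act ((𝒯.phi D ρ (x j)).act (𝒯.charB ρ))) =
      dualForm R κ ρ ρ • 𝒯.charB ρ := by
    have h3 := hxy.laplacian_charB D hA hκ h𝒯 hρ
    rw [neg_smul, ← neg_eq_iff_eq_neg] at h3
    rw [← h3, Finset.smul_sum, ← Finset.sum_add_distrib, ← Finset.sum_neg_distrib]
    refine Finset.sum_congr rfl fun j _ => ?_
    rw [h1, Series.deriv_smul, Series.deriv_act (hφ j) hχ, h1]
    change _ = -((-1 : ℂ) • (_ + (𝒯.phi D ρ (x j)).act _) +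
      (2 : ℂ) • (𝒯.phi D ρ (x j)).act ((-1 : ℂ) • _))
    rw [Series.act_smul]
    module
  -- Multiplication by `δ²` converts an equation for the character into one for its inverse.
  have h3 : ∀ {c : Series 𝒯 ℂ}, c.Bdd → (δ.act δ).act (c.act (𝒯.charB ρ)) = c.act δ := by
    intro c hc
    rw [Series.act_left_comm (hδ'.act hδ') hc hχ, Series.act_assoc hδ' hδ' hχ,
      Series.act_comm δ (𝒯.charB ρ), hδ.charB_act, Series.act_comm δ (Series.const 𝒯 1),
    Series.const_act, one_smul]
  have h4 := congrArg (δ.act δ).act h2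
  rw [Series.act_sum _ (hδ'.act hδ'), Series.act_smul, Series.act_assoc hδ' hδ' hχ,
    Series.act_comm δ (𝒯.charB ρ), hδ.charB_act, Series.act_comm δ (Series.const 𝒯 1),
    Series.const_act, one_smul]
    at h4
  · rw [← h4]
    refine Finset.sum_congr rfl fun j _ => ?_
    rw [hxy.deriv_delta hx D hA hκ h𝒯 hρ j hδ, Series.deriv_act (hφ j) hδ',
      hxy.deriv_delta hx D hA hκ h𝒯 hρ j hδ, Series.act_add (hδ'.act hδ')
        (((hφ j).deriv _).act hχ) ((hφ j).act ((hφ j).act hχ)),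
      h3 ((hφ j).deriv _), ← Series.act_assoc (hφ j) (hφ j) hχ, h3 ((hφ j).act (hφ j)),
      Series.act_assoc (hφ j) (hφ j) hδ']
  · intro j
    obtain ⟨ξ₀, h⟩ : ∃ ξ₀, (𝒯.charB ρ).BddBy ξ₀ := hχ
    exact ((((𝒯.isCone_phi D ρ (x j)).deriv (x j)).act_bddBy h).add
      ((𝒯.isCone_phi D ρ (x j)).act_bddBy ((𝒯.isCone_phi D ρ (x j)).act_bddBy h))).bdd

/-- By the Leibniz rule the cross terms `2 ∂_j δ ∂_j F = 2 φ_j δ ∂_j F` are the first order terms of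
the equation for `F`, and `∑ ∂_j² δ` adds the missing `(ρ, ρ)` to `(μ, μ + 2ρ)`. -/
theorem GBDTriple.Compat.normalized_identity {W : Type*} [AddCommGroup W] [Module ℂ W]
    [LieRingModule (KM R) W] [LieModule ℂ (KM R) W] {μ' μ : Dual ℂ H}
    {Θ : Verma R μ →ₗ⁅ℂ,KM R⁆ Verma R μ' ⊗[ℂ] W}
    (hc : 𝒯.Compat μ' μ) (hxy : 𝒯.IsOrthonormal x y)
    (hx : ∀ i j, hForm R κ (x i) (x j) = if i = j then 1 else 0)
    (D : DualRootBases R κ) (hA : IsSymmetrizableGCM A) (hκ : IsInvariantForm R κ)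
    (h𝒯 : 𝒯.IsNondegenerate) {ρ : Dual ℂ H} (hρ : ∀ i, ρ (R.coroot i) = 1)
    {δ : Series 𝒯 ℂ} (hδ : 𝒯.IsDelta ρ δ) :
    ∑ j, Series.deriv (x j) (Series.deriv (x j) (δ.act (𝒯.twTrace Θ (𝒯.vermaB μ' μ)))) -
      Series.mul (liePair R W) (𝒯.S D y) (δ.act (𝒯.twTrace Θ (𝒯.vermaB μ' μ))) =
      dualForm R κ (μ + ρ) (μ + ρ) • δ.act (𝒯.twTrace Θ (𝒯.vermaB μ' μ)) := by
  have hφ := fun j => (𝒯.isCone_phi D ρ (x j)).bdd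
  have hS := (𝒯.isCone_S D y).bdd
  have hδ' := hδ.bdd
  set F := 𝒯.twTrace Θ (𝒯.vermaB μ' μ) with hF
  obtain ⟨ξ₀, hF₀⟩ : ∃ ξ₀, F.BddBy ξ₀ := traceSeries_bdd _
  have hF' := hF₀.bdd
  have h1 : Series.mul (liePair R W) (𝒯.S D y) F = (∑ j, Series.deriv (x j) (Series.deriv (x j) F) +
      (2 : ℂ) • ∑ j, (𝒯.phi D ρ (x j)).act (Series.deriv (x j) F)) +
      (-(dualForm R κ μ μ + 2 * dualForm R κ μ ρ)) • F := by
    have h2 := hc.series_identity (Θ := Θ) hxy D hA hκ h𝒯 hρ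
    rw [neg_smul, h2, ← sub_eq_add_neg]
    exact (sub_sub_cancel _ _).symm
  have h2 : Series.mul (liePair R W) (𝒯.S D y) (δ.act F) =
      ∑ j, δ.act (Series.deriv (x j) (Series.deriv (x j) F)) +
        (2 : ℂ) • ∑ j, (𝒯.phi D ρ (x j)).act (δ.act (Series.deriv (x j) F)) +
        (-(dualForm R κ μ μ + 2 * dualForm R κ μ ρ)) • δ.act F := by
    have h3 : Series.mul (liePair R W) (𝒯.S D y) (δ.act F) =
        δ.act (Series.mul (liePair R W) (𝒯.S D y) F) :=
      Series.mul_left_comm hS hδ' hF' fun u v w => map_smul (liePair R W u) v w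
    have hb1 : ∀ j, (Series.deriv (x j) (Series.deriv (x j) F)).BddBy ξ₀ :=
      fun j => (hF₀.deriv _).deriv _
    have hb2 : ∀ j, ((𝒯.phi D ρ (x j)).act (Series.deriv (x j) F)).BddBy ξ₀ :=
      fun j => (𝒯.isCone_phi D ρ (x j)).act_bddBy (hF₀.deriv _)
    have hb3 := Series.BddBy.sum Finset.univ fun j _ => hb1 j
    have hb4 := (Series.BddBy.sum Finset.univ fun j _ => hb2 j).smul 2
    rw [h3, h1, Series.act_add hδ' (hb3.add hb4).bdd (hF₀.smul _).bdd,
      Series.act_add hδ' hb3.bdd hb4.bdd, Series.act_smul, Series.act_smul,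
      Series.act_sum _ hδ' fun j => (hb1 j).bdd, Series.act_sum _ hδ' fun j => (hb2 j).bdd]
    simp only [Series.act_left_comm hδ' (hφ _) (hF'.deriv _)]
  have h3 : ∑ j, Series.deriv (x j) (Series.deriv (x j) (δ.act F)) =
      dualForm R κ ρ ρ • δ.act F +
        (2 : ℂ) • ∑ j, (𝒯.phi D ρ (x j)).act (δ.act (Series.deriv (x j) F)) +
        ∑ j, δ.act (Series.deriv (x j) (Series.deriv (x j) F)) := by
    rw [← Series.smul_act, ← hxy.laplacian_delta hx D hA hκ h𝒯 hρ hδ,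
      Series.sum_act _ (fun j => (hδ'.deriv (x j)).deriv (x j)) hF', Finset.smul_sum,
      ← Finset.sum_add_distrib, ← Finset.sum_add_distrib]
    refine Finset.sum_congr rfl fun j _ => ?_
    rw [Series.deriv_act hδ' hF', Series.deriv_add, Series.deriv_act (hδ'.deriv _) hF',
      Series.deriv_act hδ' (hF'.deriv _), ← Series.act_assoc (hφ j) hδ' (hF'.deriv _),
      ← hxy.deriv_delta hx D hA hκ h𝒯 hρ j hδ]
    module
  have h4 : dualForm R κ (μ + ρ) (μ + ρ) =
      dualForm R κ μ μ + 2 * dualForm R κ μ ρ + dualForm R κ ρ ρ := by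
    have h5 := dualForm_comm hκ ρ μ
    simp only [dualForm_eq hA hκ D, map_add, LinearMap.add_apply] at h5 ⊢
    rw [h5]
    ring
  rw [h2, h3, h4]
  module

end Normalized

/-! ### Tensor products of modules -/

section TensorAction

variable {n : ℕ} {A : Matrix (Fin n) (Fin n) ℤ} {H : Type*} [AddCommGroup H] [Module ℂ H]
  {R : Realization A H}

section PiAction

variable {r : ℕ} (R) (V : Fin r → Type*) [∀ i, AddCommGroup (V i)] [∀ i, Module ℂ (V i)]
  [∀ i, LieRingModule (KM R) (V i)] [∀ i, LieModule ℂ (KM R) (V i)]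

theorem actAt_tprod (i : Fin r) (x : KM R) (v : ∀ i, V i) :
    actAt R V i x (PiTensorProduct.tprod ℂ v) =
      PiTensorProduct.tprod ℂ (Function.update v i ⁅x, v i⁆) := by
  rw [actAt, LinearMap.comp_apply, MultilinearMap.toLinearMap_apply]
  refine (PiTensorProduct.map_tprod _ _).trans ?_
  congr 1
  funext j
  by_cases h : j = i
  · subst h
    simp
  · simp [h]

theorem actAt_comm {i j : Fin r} (h : i ≠ j) (x y : KM R) :
    actAt R V i x * actAt R V j y = actAt R V j y * actAt R V i x := by
  refine PiTensorProduct.ext (MultilinearMap.ext fun v => ?_)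
  simp only [LinearMap.compMultilinearMap_apply, Module.End.mul_apply, actAt_tprod]
  rw [Function.update_of_ne h, Function.update_of_ne h.symm, Function.update_comm h]

theorem actAt_lie (i : Fin r) (x y : KM R) :
    actAt R V i ⁅x, y⁆ = actAt R V i x * actAt R V i y - actAt R V i y * actAt R V i x := by
  refine PiTensorProduct.ext (MultilinearMap.ext fun v => ?_)
  simp only [LinearMap.compMultilinearMap_apply, Module.End.mul_apply, LinearMap.sub_apply,
    actAt_tprod, Function.update_self, Function.update_idem]
  rw [← MultilinearMap.map_update_sub, lie_lie]

/-- The action of `𝔤` on `V_1 ⊗ ... ⊗ V_r`. -/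
def piAct : KM R →ₗ[ℂ] End ℂ (⨂[ℂ] i, V i) := ∑ i, actAt R V i

theorem piAct_apply (x : KM R) : piAct R V x = ∑ i, actAt R V i x := LinearMap.sum_apply _ _ _

theorem piAct_lie (x y : KM R) :
    piAct R V ⁅x, y⁆ = piAct R V x * piAct R V y - piAct R V y * piAct R V x := by
  rw [piAct_apply, piAct_apply, piAct_apply, Finset.sum_mul_sum, Finset.sum_mul_sum,
    Finset.sum_comm (f := fun i j => actAt R V i y * actAt R V j x), ← Finset.sum_sub_distrib]
  refine Finset.sum_congr rfl fun i _ => ?_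
  rw [← Finset.sum_sub_distrib, Finset.sum_eq_single i, actAt_lie]
  · intro j _ h
    rw [actAt_comm R V h.symm, sub_self]
  · intro h
    exact absurd (Finset.mem_univ i) h

/-- The `𝔤`-module `V_1 ⊗ ... ⊗ V_r`. -/
abbrev piLieRingModule : LieRingModule (KM R) (⨂[ℂ] i, V i) where
  bracket x t := piAct R V x t
  add_lie x y t := by rw [map_add, LinearMap.add_apply]
  lie_add x t t' := map_add _ _ _
  leibniz_lie x y t := by
    rw [piAct_lie, LinearMap.sub_apply, Module.End.mul_apply, Module.End.mul_apply,
      sub_add_cancel]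

attribute [local instance] piLieRingModule

theorem pi_lie_def (x : KM R) (t : ⨂[ℂ] i, V i) : ⁅x, t⁆ = piAct R V x t := rfl

theorem piLieModule : LieModule ℂ (KM R) (⨂[ℂ] i, V i) where
  smul_lie c x t := by rw [pi_lie_def, map_smul]; rfl
  lie_smul c x t := by rw [pi_lie_def, map_smul]; rfl

attribute [local instance] piLieModule

/-- On a tensor product of modules `𝔤` acts by the sum of its actions on the factors, so the double
sum over pairs of factors is the product of two such sums. This reduces several modules to the
single module `V_1 ⊗ ... ⊗ V_r`. -/
theorem sum_actPair : ∑ l, ∑ k, actPair R V l k = liePair R (⨂[ℂ] i, V i) := by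
  refine TensorProduct.ext' fun a b => LinearMap.ext fun t => ?_
  rw [liePair_apply, pi_lie_def, pi_lie_def, piAct_apply, piAct_apply, ← Module.End.mul_apply,
    Finset.sum_mul_sum]
  simp only [LinearMap.sum_apply]
  refine Finset.sum_congr rfl fun l _ => Finset.sum_congr rfl fun k _ => ?_
  rw [actPair, TensorProduct.lift.tmul, LinearMap.compl₁₂_apply, LinearMap.mul_apply']

end PiAction

attribute [local instance] piLieRingModule piLieModule

theorem tensorCons_tmul_tprod {r : ℕ} (V : Fin (r + 1) → Type*) [∀ i, AddCommGroup (V i)]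
    [∀ i, Module ℂ (V i)] (v : V 0) (u : ∀ i : Fin r, V i.succ) :
    tensorCons V (v ⊗ₜ PiTensorProduct.tprod ℂ u) =
      PiTensorProduct.tprod ℂ (Fin.cons v u : ∀ i, V i) := by
  rw [tensorCons, TensorProduct.lift.tmul, LinearMap.comp_apply]
  exact PiTensorProduct.lift.tprod _

theorem tensorCons_lie {r : ℕ} (V : Fin (r + 1) → Type*) [∀ i, AddCommGroup (V i)]
    [∀ i, Module ℂ (V i)] [∀ i, LieRingModule (KM R) (V i)] [∀ i, LieModule ℂ (KM R) (V i)]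
    (x : KM R) (t : V 0 ⊗[ℂ] (⨂[ℂ] i : Fin r, V i.succ)) :
    tensorCons V ⁅x, t⁆ = ⁅x, tensorCons V t⁆ := by
  induction t with
  | zero => simp
  | add t t' h h' => rw [lie_add, map_add, map_add, lie_add, h, h']
  | tmul v t =>
    induction t using PiTensorProduct.induction_on with
    | add t t' h h' => rw [TensorProduct.tmul_add, lie_add, map_add, map_add, lie_add, h, h']
    | smul_tprod c u =>
      rw [TensorProduct.tmul_smul, lie_smul, map_smul, map_smul, lie_smul,
        TensorProduct.LieModule.lie_tmul_right, pi_lie_def, pi_lie_def, piAct_apply, piAct_apply,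
        LinearMap.sum_apply, map_add, tensorCons_tmul_tprod, tensorCons_tmul_tprod,
        LinearMap.sum_apply, Fin.sum_univ_succ, TensorProduct.tmul_sum, map_sum]
      congr 2
      · rw [actAt_tprod, Fin.cons_zero, Fin.update_cons_zero]
      · refine Finset.sum_congr rfl fun i _ => ?_
        rw [actAt_tprod, actAt_tprod, Fin.cons_succ, tensorCons_tmul_tprod, Fin.cons_update]

section Equivariance

variable {P Q S : Type*} [AddCommGroup P] [Module ℂ P] [LieRingModule (KM R) P]
  [LieModule ℂ (KM R) P] [AddCommGroup Q] [Module ℂ Q] [LieRingModule (KM R) Q]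
  [LieModule ℂ (KM R) Q] [AddCommGroup S] [Module ℂ S] [LieRingModule (KM R) S]
  [LieModule ℂ (KM R) S]

theorem rTensor_lie {g : P →ₗ[ℂ] Q} (x : KM R) (hg : ∀ a, g ⁅x, a⁆ = ⁅x, g a⁆) (t : P ⊗[ℂ] S) :
    g.rTensor S ⁅x, t⁆ = ⁅x, g.rTensor S t⁆ := by
  induction t with
  | zero => simp
  | add t t' h h' => rw [lie_add, map_add, map_add, lie_add, h, h']
  | tmul a b =>
    rw [TensorProduct.LieModule.lie_tmul_right, map_add, LinearMap.rTensor_tmul,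
      LinearMap.rTensor_tmul, LinearMap.rTensor_tmul, TensorProduct.LieModule.lie_tmul_right, hg]

theorem lTensor_lie {g : P →ₗ[ℂ] Q} (x : KM R) (hg : ∀ a, g ⁅x, a⁆ = ⁅x, g a⁆) (t : S ⊗[ℂ] P) :
    g.lTensor S ⁅x, t⁆ = ⁅x, g.lTensor S t⁆ := by
  induction t with
  | zero => simp
  | add t t' h h' => rw [lie_add, map_add, map_add, lie_add, h, h']
  | tmul a b =>
    rw [TensorProduct.LieModule.lie_tmul_right, map_add, LinearMap.lTensor_tmul,
      LinearMap.lTensor_tmul, LinearMap.lTensor_tmul, TensorProduct.LieModule.lie_tmul_right, hg]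

theorem assoc_lie (x : KM R) (t : (P ⊗[ℂ] Q) ⊗[ℂ] S) :
    TensorProduct.assoc ℂ P Q S ⁅x, t⁆ = ⁅x, TensorProduct.assoc ℂ P Q S t⁆ := by
  induction t with
  | zero => simp
  | add t t' h h' => rw [lie_add, map_add, map_add, lie_add, h, h']
  | tmul a b =>
    induction a with
    | zero => simp
    | add t t' h h' => rw [TensorProduct.add_tmul, lie_add, map_add, map_add, lie_add, h, h']
    | tmul a c =>
      rw [TensorProduct.LieModule.lie_tmul_right, TensorProduct.LieModule.lie_tmul_right,
        TensorProduct.add_tmul, map_add, map_add, TensorProduct.assoc_tmul,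
        TensorProduct.assoc_tmul, TensorProduct.assoc_tmul, TensorProduct.assoc_tmul,
        TensorProduct.LieModule.lie_tmul_right, TensorProduct.LieModule.lie_tmul_right,
        TensorProduct.tmul_add, add_assoc]

end Equivariance

theorem cons_lie {r : ℕ} (V : Fin (r + 1) → Type*) [∀ i, AddCommGroup (V i)]
    [∀ i, Module ℂ (V i)] [∀ i, LieRingModule (KM R) (V i)] [∀ i, LieModule ℂ (KM R) (V i)]
    {P Q : Type*} [AddCommGroup P] [Module ℂ P] [LieRingModule (KM R) P]
    [LieModule ℂ (KM R) P] [AddCommGroup Q] [Module ℂ Q] [LieRingModule (KM R) Q]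
    [LieModule ℂ (KM R) Q] {g : P →ₗ[ℂ] Q ⊗[ℂ] V 0} (x : KM R)
    (hg : ∀ a, g ⁅x, a⁆ = ⁅x, g a⁆) {t t' : P ⊗[ℂ] (⨂[ℂ] i : Fin r, V i.succ)}
    (ht : t' = ⁅x, t⁆) :
    (tensorCons V).lTensor Q (TensorProduct.assoc ℂ Q (V 0) _ (g.rTensor _ t')) =
      ⁅x, (tensorCons V).lTensor Q (TensorProduct.assoc ℂ Q (V 0) _ (g.rTensor _ t))⁆ := by
  rw [ht, rTensor_lie x hg, assoc_lie, lTensor_lie x fun t => tensorCons_lie V x t]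

/-- Every map in the recursion for `compAll` is `𝔤`-equivariant, including the reassociation of
tensor factors. Thus the composition of the `Φ_i` can serve as the one intertwiner `Θ`. -/
theorem compAll_lie : ∀ {r : ℕ} (M : Fin (r + 1) → Type*) (V : Fin r → Type*)
    [∀ i, AddCommGroup (M i)] [∀ i, Module ℂ (M i)] [∀ i, LieRingModule (KM R) (M i)]
    [∀ i, LieModule ℂ (KM R) (M i)]
    [∀ i, AddCommGroup (V i)] [∀ i, Module ℂ (V i)] [∀ i, LieRingModule (KM R) (V i)]
    [∀ i, LieModule ℂ (KM R) (V i)]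
    (Φ : ∀ i : Fin r, M i.succ →ₗ⁅ℂ,KM R⁆ M i.castSucc ⊗[ℂ] V i) (x : KM R)
    (m : M (Fin.last r)),
    compAll M V (fun i => (Φ i : _ →ₗ[ℂ] _)) ⁅x, m⁆ =
      ⁅x, compAll M V (fun i => (Φ i : _ →ₗ[ℂ] _)) m⁆
  | 0, M, V, _, _, _, _, _, _, _, _, Φ, x, m => by
      rw [compAll]
      change ⁅x, m⁆ ⊗ₜ[ℂ] _ = ⁅x, m ⊗ₜ[ℂ] _⁆
      rw [TensorProduct.LieModule.lie_tmul_right, pi_lie_def, piAct_apply, Finset.univ_eq_empty,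
        Finset.sum_empty, LinearMap.zero_apply, TensorProduct.tmul_zero, add_zero]
  | r + 1, M, V, _, _, _, _, _, _, _, _, Φ, x, m => by
      have ih := compAll_lie (r := r) (fun i => M i.succ) (fun i => V i.succ)
        (fun i => Φ i.succ) x m
      exact cons_lie V x (fun a => LieModuleHom.map_lie (Φ 0) x a) ih

end TensorAction

/-! ### Passage from one intertwiner to a composition of `r` intertwiners. -/

section Main

variable {n : ℕ} {A : Matrix (Fin n) (Fin n) ℤ} {H : Type*} [AddCommGroup H] [Module ℂ H]
  {R : Realization A H} {κ : LinearMap.BilinForm ℂ (KM R)} {𝒯 : GBDTriple R κ}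

attribute [local instance] piLieRingModule piLieModule

theorem partialWt_last {r : ℕ} (ν : Fin r → Dual ℂ H) (μ : Dual ℂ H) :
    partialWt ν μ (Fin.last r) = μ := by
  rw [partialWt, Finset.filter_false_of_mem, Finset.sum_empty, sub_zero]
  intro j _
  exact not_le.2 (Fin.castSucc_lt_last j)

theorem partialWt_zero {r : ℕ} (ν : Fin r → Dual ℂ H) (μ : Dual ℂ H) :
    partialWt ν μ 0 = μ - ∑ j, ν j := by
  rw [partialWt, Finset.filter_true_of_mem]
  intro j _
  exact Fin.zero_le _

theorem GBDTriple.IsOrthonormal.normTrace_identity {I₁ I₂ : Type*} [Fintype I₁] [Fintype I₂] [DecidableEq I₁]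
    {x : I₁ → 𝒯.l} {y : I₂ → 𝒯.h₀} (hxy : 𝒯.IsOrthonormal x y)
    (hx : ∀ i j, hForm R κ (x i) (x j) = if i = j then 1 else 0)
    (D : DualRootBases R κ) (hA : IsSymmetrizableGCM A) (hκ : IsInvariantForm R κ)
    (h𝒯 : 𝒯.IsNondegenerate) {ρ : Dual ℂ H} (hρ : ∀ i, ρ (R.coroot i) = 1)
    {r : ℕ} (V : Fin r → Type*) [∀ i, AddCommGroup (V i)] [∀ i, Module ℂ (V i)]
    [∀ i, LieRingModule (KM R) (V i)] [∀ i, LieModule ℂ (KM R) (V i)]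
    {m : Fin (r + 1) → Dual ℂ H} (hc : 𝒯.Compat (m 0) (m (Fin.last r)))
    (Φ : ∀ i : Fin r, Verma R (m i.succ) →ₗ⁅ℂ,KM R⁆ Verma R (m i.castSucc) ⊗[ℂ] V i) :
    ∑ j, Series.deriv (x j) (Series.deriv (x j) (𝒯.normTrace ρ m Φ)) -
      ∑ l, ∑ k, Series.mul (actPair R V l k) (𝒯.S D y) (𝒯.normTrace ρ m Φ) =
    dualForm R κ (m (Fin.last r) + ρ) (m (Fin.last r) + ρ) • 𝒯.normTrace ρ m Φ := by
  let Θ : Verma R (m (Fin.last r)) →ₗ⁅ℂ,KM R⁆ Verma R (m 0) ⊗[ℂ] (⨂[ℂ] i, V i) :=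
    { toLinearMap := compAll (fun i => Verma R (m i)) V (fun i => (Φ i : _ →ₗ[ℂ] _))
      map_lie' := fun {a b} => compAll_lie (fun i => Verma R (m i)) V Φ a b }
  have hδ := 𝒯.isDelta_delta hA ρ
  have hF : (𝒯.twTrace Θ (𝒯.vermaB (m 0) (m (Fin.last r)))).Bdd := traceSeries_bdd _
  have h1 : 𝒯.normTrace ρ m Φ =
      (𝒯.delta ρ).act (𝒯.twTrace Θ (𝒯.vermaB (m 0) (m (Fin.last r)))) := rfl
  have h2 : ∑ l, ∑ k, Series.mul (actPair R V l k) (𝒯.S D y) (𝒯.normTrace ρ m Φ) =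
      Series.mul (liePair R (⨂[ℂ] i, V i)) (𝒯.S D y) (𝒯.normTrace ρ m Φ) := by
    have hS := (𝒯.isCone_S D y).bdd
    have hb : (𝒯.normTrace ρ m Φ).Bdd := hδ.bdd.act hF
    rw [← sum_actPair, ← Series.mul_sum_pairing hS hb]
    exact Finset.sum_congr rfl fun l _ => Series.mul_sum_pairing hS hb _ _
  rw [h2, h1]
  exact hc.normalized_identity hxy hx D hA hκ h𝒯 hρ hδ

end Main

end TwistedTrace

end

open TwistedTrace in
theorem theorem3p2 {n : ℕ} {A : Matrix (Fin n) (Fin n) ℤ} (hA : IsSymmetrizableGCM A)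
    {H : Type*} [AddCommGroup H] [Module ℂ H] (R : Realization A H)
    (κ : LinearMap.BilinForm ℂ (KM R)) (hκ : IsInvariantForm R κ)
    (ρ : Dual ℂ H) (hρ : ∀ i, ρ (R.coroot i) = 1)
    (D : DualRootBases R κ)
    (𝒯 : GBDTriple R κ) (h𝒯 : 𝒯.IsNondegenerate)
    {I₁ I₂ : Type*} [Fintype I₁] [Fintype I₂] [DecidableEq I₁] [DecidableEq I₂]
    (x : Basis I₁ ℂ 𝒯.l) (y : Basis I₂ ℂ 𝒯.h₀)
    (hx : ∀ i j, hForm R κ (x i) (x j) = if i = j then 1 else 0)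
    (hy : ∀ i j, hForm R κ (y i) (y j) = if i = j then 1 else 0)
    {r : ℕ} (V : Fin r → Type*) [∀ i, AddCommGroup (V i)] [∀ i, Module ℂ (V i)]
    [∀ i, LieRingModule (KM R) (V i)] [∀ i, LieModule ℂ (KM R) (V i)]
    (hV : ∀ i, IsCategoryO R (V i))
    (ν : Fin r → Dual ℂ H) (v : ∀ i, V i) (hv : ∀ i, v i ∈ wtSpace R (V i) (ν i))
    (hν : ∀ z ∈ 𝒯.l, (∑ i, ν i) z = 0)
    (μ : Dual ℂ H)
    (hμ : ∀ i : 𝒯.Γ₁, dualForm R κ (μ - ∑ i, ν i) (R.root i) =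
      dualForm R κ μ (R.root (𝒯.T i)))
    (Φ : ∀ i : Fin r, Verma R (partialWt ν μ i.succ) →ₗ⁅ℂ,KM R⁆
      Verma R (partialWt ν μ i.castSucc) ⊗[ℂ] V i)
    (hΦ : ∀ i, IsLeading R (Φ i) (v i)) :
    ∑ j, Series.deriv (x j) (Series.deriv (x j) (𝒯.normTrace ρ (partialWt ν μ) Φ)) -
      ∑ l, ∑ k, Series.mul (actPair R V l k) (𝒯.S D y) (𝒯.normTrace ρ (partialWt ν μ) Φ) =
    dualForm R κ (μ + ρ) (μ + ρ) • 𝒯.normTrace ρ (partialWt ν μ) Φ := by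
  have hxy : 𝒯.IsOrthonormal x y := ⟨𝒯.eq_sum_bases hκ h𝒯 x y hx hy⟩
  -- The extreme weights are `μ' = μ - ν` and `μ`. The hypothesis on inner products is one half of
  -- compatibility, and the vanishing of `ν` on `𝔩` is the other.
  have hc : 𝒯.Compat (partialWt ν μ 0) (partialWt ν μ (Fin.last r)) := by
    rw [partialWt_zero, partialWt_last]
    exact ⟨hμ, fun z hz => by rw [LinearMap.sub_apply, hν z hz, sub_zero]⟩
  exact (hxy.normTrace_identity hx D hA hκ h𝒯 hρ V hc Φ).trans
    (congrArg (fun θ => dualForm R κ (θ + ρ) (θ + ρ) • 𝒯.normTrace ρ (partialWt ν μ) Φ)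
      (partialWt_last ν μ))
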